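/- Let $q\in L_2(0,\pi)$ be real valued and let $h,H\in\mathbb R$. For $\rho\in\mathbb C$ let $c(\rho,\cdot)$ be the solution on $[0,\pi]$ of $$-y''+q(x)y=\rho^2y,\qquad y(0)=1,\quad y'(0)=h,$$ (that is, $y,y'$ are absolutely continuous and the equation holds almost everywhere). Let $\lambda_0<\lambda_1<\lambda_2<\dots$ be all the eigenvalues of the problem $$-y''+q(x)y=\lambda y,\qquad y'(0)-hy(0)=y'(\pi)+Hy(\pi)=0,$$ and put $\rho_n=\sqrt{\lambda_n}\in\mathbb C$, $\alpha_n=\int_0^\pi c(\rho_n,x)^2\,dx$, $\alpha^0_0=\pi$, and $\alpha^0_n=\pi/2$ for $n\ge 1$. Let $$T[u](x)=u(x)+\int_0^xG(x,s)u(s)\,ds$$ be the transmutation operator with kernel $G$ continuous on $0\le t\le x\le\pi$: for every $u\in C^2[0,\pi]$ with $u'(0)=0$ the function $v=Tu$ satisfies $v''-qv=T[u'']$ almost everywhere on $[0,\pi]$ and $v'(0)-hv(0)=0$. Let $H(x,t)$ be the kernel, continuous on $0\le t\le x\le\pi$, of the inverse operator $T^{-1}[u](x)=u(x)+\int_0^xH(x,s)u(s)\,ds$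 on $C[0,\pi]$. All these objects exist, the series $$F(x,t)=\sum_{n=0}^\infty\left(\frac{\cos\rho_nx\cos\rho_nt}{\alpha_n}-\frac{\cos nx\cos nt}{\alpha_n^0}\right)$$ converges for all $x,t\in[0,\pi]$, and the kernels admit the representations $$G(x,t)=\sum_{n=0}^\infty\left(\frac{c(n,x)\cos nt}{\alpha_n^0}-\frac{c(\rho_n,x)\cos\rho_nt}{\alpha_n}\right),\qquad H(x,t)=\sum_{n=0}^\infty\left(\frac{\cos\rho_nx\;c(\rho_n,t)}{\alpha_n}-\frac{\cos nx\;c(n,t)}{\alpha_n^0}\right)$$ in the following distributional sense. Extend $G(x,t)$ and $H(x,t)$ by zero for $t>x$ (so that for $x\ne t$ at most one of $G(x,t)$, $H(t,x)$ is nonzero), and let $I_N(x,t)$ and $J_N(x,t)$ be the sums of the terms with $0\le n\le N$ of the first and of the second series; thus $J_N(t,x)=-I_N(x,t)$. Then for every absolutely continuous $f:[0,\pi]\to\mathbb C$, uniformly with respect to $x\in[0,\pi]$, $$\lim_{N\to\infty}\int_0^\pi f(t)I_N(x,t)\,dt=-\lim_{N\to\infty}\int_0^\pi f(t)J_N(t,x)\,dt=\int_0^\pi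 f(t)\bigl(G(x,t)-H(t,x)\bigr)\,dt,$$ and, for every $x\in[0,\pi]$, $$\int_0^\pi f(t)\bigl(G(x,t)-H(t,x)\bigr)\,dt=-\int_0^\pi f(t)\left(F(x,t)+\int_0^xG(x,s)F(s,t)\,ds\right)dt.$$ -/

import Mathlib

open MeasureTheory Filter Set Topology

noncomputable section

namespace SturmLiouville

/-- `y` is continuously differentiable on `[0, π]` with derivative `y'` (one-sided at the end
points), `y'` is absolutely continuous on `[0, π]`, and `y'' = w` almost everywhere. -/
structure HasSecondDeriv (y y' w : ℝ → ℂ) : Prop where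
  deriv : ∀ x ∈ Icc 0 Real.pi, HasDerivWithinAt y (y' x) (Icc 0 Real.pi) x
  absCont : AbsolutelyContinuousOnInterval y' 0 Real.pi
  deriv_ae : ∀ᵐ x ∂volume.restrict (Icc 0 Real.pi), HasDerivAt y' (w x) x

/-- `y = c(ρ, ·)` on `[0, π]`: `-y'' + q y = ρ² y`, `y(0) = 1`, `y'(0) = h`. -/
def IsCauchySolution (q : ℝ → ℝ) (h : ℝ) (ρ : ℂ) (y : ℝ → ℂ) : Prop :=
  ∃ y' : ℝ → ℂ, HasSecondDeriv y y' (fun x => (q x : ℂ) * y x - ρ ^ 2 * y x) ∧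
    y 0 = 1 ∧ y' 0 = (h : ℂ)

/-- `μ` is an eigenvalue of `-y'' + q y = μ y`, `y'(0) - h y(0) = 0 = y'(π) + H y(π)`. -/
def IsEigenvalue (q : ℝ → ℝ) (h H : ℝ) (μ : ℂ) : Prop :=
  ∃ y y' : ℝ → ℂ, HasSecondDeriv y y' (fun x => (q x : ℂ) * y x - μ * y x) ∧
    (∃ x ∈ Icc 0 Real.pi, y x ≠ 0) ∧
    y' 0 - (h : ℂ) * y 0 = 0 ∧ y' Real.pi + (H : ℂ) * y Real.pi = 0

/-- `lam` lists all the (complex) eigenvalues, which are thereby real, in increasing order. -/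
def IsEigenvalueSequence (q : ℝ → ℝ) (h H : ℝ) (lam : ℕ → ℝ) : Prop :=
  StrictMono lam ∧ ∀ μ : ℂ, IsEigenvalue q h H μ ↔ ∃ n, (lam n : ℂ) = μ

/-- `ρₙ`, the principal complex square root of `λₙ` (purely imaginary if `λₙ < 0`). -/
def rho (lam : ℕ → ℝ) (n : ℕ) : ℂ := Complex.sqrt (lam n)

/-- The weight numbers `αₙ = ∫₀^π c(ρₙ, x)² dx`. -/
def weight (c : ℂ → ℝ → ℂ) (lam : ℕ → ℝ) (n : ℕ) : ℂ :=
  ∫ x in (0 : ℝ)..Real.pi, c (rho lam n) x ^ 2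

/-- The weight numbers `αₙ⁰` of the problem with `q = 0`, `h = H = 0`. -/
def weight₀ (n : ℕ) : ℂ := if n = 0 then (Real.pi : ℂ) else (Real.pi : ℂ) / 2

/-- The Volterra operator `u ↦ u(x) + ∫₀ˣ k(x, s) u(s) ds`. -/
def volterra (k : ℝ → ℝ → ℝ) (u : ℝ → ℂ) (x : ℝ) : ℂ :=
  u x + ∫ s in (0 : ℝ)..x, (k x s : ℂ) * u s

/-- The triangle `0 ≤ t ≤ x ≤ π`, for points `(x, t)`. -/
def triangle : Set (ℝ × ℝ) := {p | 0 ≤ p.2 ∧ p.2 ≤ p.1 ∧ p.1 ≤ Real.pi}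

/-- `G` is the (continuous) kernel of the transmutation operator `T = volterra G`: for every
`u ∈ C²[0, π]` with `u'(0) = 0`, the function `v = T u` satisfies
`v'' - q v = T u''` and `v'(0) - h v(0) = 0`. -/
def IsTransmutationKernel (q : ℝ → ℝ) (h : ℝ) (G : ℝ → ℝ → ℝ) : Prop :=
  ContinuousOn (Function.uncurry G) triangle ∧
  ∀ u : ℝ → ℂ, ContDiffOn ℝ 2 u (Icc 0 Real.pi) → derivWithin u (Icc 0 Real.pi) 0 = 0 →
    ∃ v' : ℝ → ℂ,
      HasSecondDeriv (volterra G u) v' (fun x => (q x : ℂ) * volterra G u x +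
        volterra G (iteratedDerivWithin 2 u (Icc 0 Real.pi)) x) ∧
      v' 0 - (h : ℂ) * volterra G u 0 = 0

/-- `K` is the (continuous) kernel of the operator inverse to `volterra G` on `C[0, π]`. -/
def IsInverseKernel (G K : ℝ → ℝ → ℝ) : Prop :=
  ContinuousOn (Function.uncurry K) triangle ∧
  ∀ u : ℝ → ℂ, ContinuousOn u (Icc 0 Real.pi) → ∀ x ∈ Icc 0 Real.pi,
    volterra K (volterra G u) x = u x ∧ volterra G (volterra K u) x = u x

/-- Extension of a kernel by zero to `t > x`. -/
def extendZero (k : ℝ → ℝ → ℝ) (x t : ℝ) : ℝ := if t ≤ x then k x t else 0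

/-- Partial sums of the series for the kernel of the transmutation operator. -/
def partialSumG (c : ℂ → ℝ → ℂ) (lam : ℕ → ℝ) (N : ℕ) (x t : ℝ) : ℂ :=
  ∑ n ∈ Finset.range (N + 1),
    (c n x * Complex.cos (n * t) / weight₀ n
      - c (rho lam n) x * Complex.cos (rho lam n * t) / weight c lam n)

/-- Partial sums of the series for the kernel of the inverse operator. -/
def partialSumH (c : ℂ → ℝ → ℂ) (lam : ℕ → ℝ) (N : ℕ) (x t : ℝ) : ℂ :=
  ∑ n ∈ Finset.range (N + 1),
    (Complex.cos (rho lam n * x) * c (rho lam n) t / weight c lam n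
      - Complex.cos (n * x) * c n t / weight₀ n)

/-- Partial sums of the series for the function `F` of the Gel'fand-Levitan equation. -/
def partialSumF (c : ℂ → ℝ → ℂ) (lam : ℕ → ℝ) (N : ℕ) (x t : ℝ) : ℂ :=
  ∑ n ∈ Finset.range (N + 1),
    (Complex.cos (rho lam n * x) * Complex.cos (rho lam n * t) / weight c lam n
      - Complex.cos (n * x) * Complex.cos (n * t) / weight₀ n)

end SturmLiouville

end

open scoped Real BoundedContinuousFunction Polynomial InnerProductSpace

noncomputable section

section

/-! ### Absolutely continuous complex-valued functions -/

section AbsolutelyContinuous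

variable {a b : ℝ}

/-! Write T = I + G. Everything rests on c(ρ, ·) = T[cos ρ·], equivalently cos ρ· = T⁻¹[c(ρ, ·)].
Put a(ρ) = ∫ f(t) cos ρt dt. Integrating f against the first series gives the terms c(n, x) a(n) /
αₙ⁰ - c(ρₙ, x) a(ρₙ) / αₙ. For absolutely continuous f one has a(ρ) = O(1/ρ). Together with ρₙ - n =
O(1/n) and the summability of 1/αₙ - 1/αₙ⁰, this bounds the terms, uniformly in x, by a summable
sequence (`exists_summable_bound_seriesTerm`).

The limit is found by pairing with a continuous w (`tsum_seriesTerm`). Moving T to its transpose T*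
gives ∫ w c(ρ, ·) = ∫ (T*w) cos ρ·, and moving T⁻¹ gives a(ρ) = ∫ c(ρ, ·) (T⁻¹)*f. Parseval's
identity for the cosines sums the first halves of the terms to ∫ (T*w) f = ∫ w Tf; Parseval's
identity for the eigenfunctions sums the second halves to ∫ w (T⁻¹)*f. So the limit is Tf - (T⁻¹)*f.
The identity parts cancel, and the integral of f against G(x, t) - H(t, x) remains.

For the formula with F, apply T in the first variable to the partial sums of F: the result is
exactly minus the partial sum for G (`volterra_partialSumF`). Dominated convergence then suffices,
provided that the series for F converges boundedly. This holds because F(x, t) is the mean of a(x +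
t) and a(x - t) for a one-variable series a(z) whose terms differ by a summable amount from a
multiple of z sin(nz)/n, and the partial sums of ∑ sin(nz)/n are bounded and convergent
(`exists_bound_tendsto_partialSumF`).

Three inputs have to be supplied. The kernel G comes from the integrated Goursat problem, solved by
a Neumann series; the intertwining relation is verified on cosines and extended by density
(`exists_isTransmutationKernel`). Completeness of the eigenfunctions comes from the spectral theorem
for the compact symmetric Green operator at a spectral parameter -τ² below all eigenvalues
(`eq_zero_of_orthogonal`). The asymptotics come from the equation for ρ sin ρπ. That equation only
places each ρₙ near some integer; that this integer is n for large n follows by comparing the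
orthonormal bases of eigenfunctions and of cosines, which are square summably close
(`HilbertBasis.eventually_eq_of_close`). Bessel's inequality for the Fourier coefficients of q,
which is only square integrable, gives the summability of the corrections to ρₙ and αₙ. -/

theorem LipschitzWith.comp_absolutelyContinuousOnInterval {X Y : Type*} [PseudoMetricSpace X]
    [PseudoMetricSpace Y] {f : ℝ → X} {φ : X → Y} {k : NNReal} (hφ : LipschitzWith k φ)
    (hf : AbsolutelyContinuousOnInterval f a b) :
    AbsolutelyContinuousOnInterval (fun x => φ (f x)) a b := by
  refine squeeze_zero (fun t => Finset.sum_nonneg fun i _ => dist_nonneg) (fun t => ?_)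
    (by simpa using Tendsto.const_mul (k : ℝ) hf)
  rw [Finset.mul_sum]
  exact Finset.sum_le_sum fun i _ => hφ.dist_le_mul _ _

theorem AbsolutelyContinuousOnInterval.congr {X : Type*} [PseudoMetricSpace X] {f g : ℝ → X}
    (hf : AbsolutelyContinuousOnInterval f a b) (hfg : ∀ x ∈ uIcc a b, f x = g x) :
    AbsolutelyContinuousOnInterval g a b := by
  rw [absolutelyContinuousOnInterval_iff] at hf ⊢
  intro ε hε
  obtain ⟨δ, hδ, h⟩ := hf ε hε
  refine ⟨δ, hδ, fun E hE hE' => ?_⟩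
  rw [Finset.sum_congr rfl fun i hi => by
    rw [← hfg _ (hE.1 i hi).1, ← hfg _ (hE.1 i hi).2]]
  exact h E hE hE'

theorem AbsolutelyContinuousOnInterval.cmul {f g : ℝ → ℂ}
    (hf : AbsolutelyContinuousOnInterval f a b) (hg : AbsolutelyContinuousOnInterval g a b) :
    AbsolutelyContinuousOnInterval (fun x => f x * g x) a b :=
  hf.smul hg

/-- Reduction to the real statement: the primitive is the primitive of the real part plus
`Complex.I` times that of the imaginary part. -/
theorem IntervalIntegrable.absolutelyContinuousOnInterval_complex {w : ℝ → ℂ}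
    (hw : IntervalIntegrable w volume a b) :
    AbsolutelyContinuousOnInterval (fun x => ∫ t in a..x, w t) a b := by
  have hre : IntervalIntegrable (fun t => (w t).re) volume a b :=
    ⟨hw.1.re, hw.2.re⟩
  have him : IntervalIntegrable (fun t => (w t).im) volume a b :=
    ⟨hw.1.im, hw.2.im⟩
  have h1 := Complex.isometry_ofReal.lipschitz.comp_absolutelyContinuousOnInterval
    (hre.absolutelyContinuousOnInterval_intervalIntegral left_mem_uIcc)
  have h2 := Complex.isometry_ofReal.lipschitz.comp_absolutelyContinuousOnInterval
    (him.absolutelyContinuousOnInterval_intervalIntegral left_mem_uIcc)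
  refine (h1.add (h2.const_smul Complex.I)).congr fun x hx => ?_
  have hsub : uIcc a x ⊆ uIcc a b := uIcc_subset_uIcc left_mem_uIcc hx
  have e : ∀ t, w t = ((w t).re : ℂ) + Complex.I * ((w t).im : ℂ) := fun t => by
    rw [mul_comm]; exact (Complex.re_add_im _).symm
  have hr' : IntervalIntegrable (fun t => ((w t).re : ℂ)) volume a x :=
    ⟨(hre.mono_set hsub).1.ofReal, (hre.mono_set hsub).2.ofReal⟩
  have hi' : IntervalIntegrable (fun t => ((w t).im : ℂ)) volume a x :=
    ⟨(him.mono_set hsub).1.ofReal, (him.mono_set hsub).2.ofReal⟩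
  conv_rhs => rw [intervalIntegral.integral_congr fun t _ => e t]
  rw [intervalIntegral.integral_add hr' (hi'.const_mul _), intervalIntegral.integral_const_mul,
    intervalIntegral.integral_ofReal, intervalIntegral.integral_ofReal]
  rfl

theorem AbsolutelyContinuousOnInterval.intervalIntegrable_of_ae_hasDerivAt {f g : ℝ → ℂ}
    (hf : AbsolutelyContinuousOnInterval f a b)
    (hd : ∀ᵐ x, x ∈ uIcc a b → HasDerivAt f (g x) x) : IntervalIntegrable g volume a b := by
  have hre := (Complex.reCLM.lipschitz.comp_absolutelyContinuousOnInterval hf).intervalIntegrable_deriv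
  have him := (Complex.imCLM.lipschitz.comp_absolutelyContinuousOnInterval hf).intervalIntegrable_deriv
  have hr' : IntervalIntegrable (fun t => ((deriv (fun x => Complex.reCLM (f x)) t : ℝ) : ℂ))
    volume a b := ⟨hre.1.ofReal, hre.2.ofReal⟩
  have hi' : IntervalIntegrable (fun t => ((deriv (fun x => Complex.imCLM (f x)) t : ℝ) : ℂ))
    volume a b := ⟨him.1.ofReal, him.2.ofReal⟩
  refine (hr'.add (hi'.const_mul Complex.I)).congr_ae ?_
  rw [EventuallyEq, ae_restrict_iff' measurableSet_uIoc]
  filter_upwards [hd] with x hx hxm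
  have h := hx (uIoc_subset_uIcc hxm)
  have h1 : deriv (fun x => Complex.reCLM (f x)) x = Complex.reCLM (g x) :=
    (Complex.reCLM.hasFDerivAt.comp_hasDerivAt x h).deriv
  have h2 : deriv (fun x => Complex.imCLM (f x)) x = Complex.imCLM (g x) :=
    (Complex.imCLM.hasFDerivAt.comp_hasDerivAt x h).deriv
  rw [h1, h2, mul_comm]; exact Complex.re_add_im _

/-- Subtracting the primitive of g from f leaves an absolutely continuous function with zero
derivative almost everywhere, hence a constant. This is the form of the fundamental theorem behind
every integration by parts with complex functions below. -/
theorem AbsolutelyContinuousOnInterval.integral_eq_sub_of_ae_hasDerivAt {f g : ℝ → ℂ}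
    (hf : AbsolutelyContinuousOnInterval f a b)
    (hd : ∀ᵐ x, x ∈ uIcc a b → HasDerivAt f (g x) x) : ∫ x in a..b, g x = f b - f a := by
  have hg := hf.intervalIntegrable_of_ae_hasDerivAt hd
  have hG := hg.absolutelyContinuousOnInterval_complex
  obtain ⟨C, hC⟩ := (hf.sub hG).const_of_ae_hasDerivAt_zero (by
    filter_upwards [hd, hg.ae_hasDerivAt_integral] with x h1 h2 hx
    simpa using (h1 hx).sub (h2 hx a left_mem_uIcc))
  have e1 := hC a left_mem_uIcc
  have e2 := hC b right_mem_uIcc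
  simp only [Pi.sub_apply, intervalIntegral.integral_same, sub_zero] at e1 e2
  rw [e1, ← e2]; ring

end AbsolutelyContinuous

/-! ### Calculus of functions with an absolutely continuous derivative. -/

namespace SturmLiouville

theorem ae_restrict_Icc_iff {p : ℝ → Prop} :
    (∀ᵐ x ∂volume.restrict (Icc 0 π), p x) ↔ ∀ᵐ x, x ∈ uIcc 0 π → p x := by
  rw [ae_restrict_iff' measurableSet_Icc, uIcc_of_le Real.pi_nonneg]

theorem uIcc_zero_pi : uIcc 0 π = Icc 0 π := uIcc_of_le Real.pi_nonneg

theorem uIcc_subset_of_mem {x : ℝ} (hx : x ∈ Icc 0 π) : uIcc 0 x ⊆ uIcc 0 π :=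
  uIcc_subset_uIcc left_mem_uIcc (by rwa [uIcc_zero_pi])

theorem zero_mem_Icc_pi : (0 : ℝ) ∈ Icc 0 π := ⟨le_rfl, Real.pi_nonneg⟩

theorem pi_mem_Icc_pi : π ∈ Icc 0 π := ⟨Real.pi_nonneg, le_rfl⟩

theorem intervalIntegrable_mono_pi {E : Type*} [NormedAddCommGroup E] {w : ℝ → E}
    (hw : IntervalIntegrable w volume 0 π) {x : ℝ} (hx : x ∈ Icc 0 π) :
    IntervalIntegrable w volume 0 x :=
  hw.mono_set (uIcc_subset_of_mem hx)

theorem intervalIntegrable_of_continuousOn {E : Type*} [NormedAddCommGroup E] {w : ℝ → E}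
    (hw : ContinuousOn w (Icc 0 π)) : IntervalIntegrable w volume 0 π :=
  ContinuousOn.intervalIntegrable (by rwa [uIcc_zero_pi])

namespace HasSecondDeriv

variable {y y' w z z' v : ℝ → ℂ}

/-- The integrated form is the one in which solutions are produced; the almost everywhere derivative
comes from Lebesgue differentiation, and the end points are discarded as null. -/
theorem of_integral (hw : IntervalIntegrable w volume 0 π)
    (h' : ∀ x ∈ Icc 0 π, y' x = y' 0 + ∫ t in (0 : ℝ)..x, w t)
    (h : ∀ x ∈ Icc 0 π, y x = y 0 + ∫ t in (0 : ℝ)..x, y' t) : HasSecondDeriv y y' w := by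
  have hac : AbsolutelyContinuousOnInterval y' 0 π := by
    have h0 : AbsolutelyContinuousOnInterval (fun _ : ℝ => y' 0) 0 π :=
      (contDiff_const (n := 1)).contDiffOn.absolutelyContinuousOnInterval
    refine (h0.add hw.absolutelyContinuousOnInterval_complex).congr fun x hx => ?_
    rw [uIcc_zero_pi] at hx
    exact (h' x hx).symm
  have hcont : ContinuousOn y' (Icc 0 π) := by simpa [uIcc_zero_pi] using hac.continuousOn
  refine ⟨fun x hx => ?_, hac, ?_⟩
  · have : Fact (x ∈ Icc 0 π) := ⟨hx⟩
    have hi := intervalIntegrable_mono_pi (intervalIntegrable_of_continuousOn hcont) hx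
    have := (intervalIntegral.integral_hasDerivWithinAt_right (s := Icc 0 π) (t := Icc 0 π) hi
      (hcont.stronglyMeasurableAtFilter_nhdsWithin measurableSet_Icc x) (hcont x hx)).const_add (y 0)
    exact this.congr (fun u hu => h u hu) (h x hx)
  · have hend : ∀ᵐ x : ℝ, x ≠ 0 ∧ x ≠ π := by
      filter_upwards [volume.ae_ne 0, volume.ae_ne π] with x h1 h2 using ⟨h1, h2⟩
    rw [ae_restrict_Icc_iff]
    filter_upwards [hw.ae_hasDerivAt_integral, hend] with x hx h0 hxm
    have hx1 := (hx hxm 0 left_mem_uIcc).const_add (y' 0)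
    rw [uIcc_zero_pi] at hxm
    refine hx1.congr_of_eventuallyEq ?_
    filter_upwards [Ioo_mem_nhds (lt_of_le_of_ne hxm.1 h0.1.symm) (lt_of_le_of_ne hxm.2 h0.2)]
      with u hu using h' u (Ioo_subset_Icc_self hu)


theorem ae_hasDerivAt (hy : HasSecondDeriv y y' w) : ∀ᵐ x, x ∈ uIcc 0 π → HasDerivAt y' (w x) x :=
  ae_restrict_Icc_iff.1 hy.deriv_ae

theorem intervalIntegrable (hy : HasSecondDeriv y y' w) : IntervalIntegrable w volume 0 π :=
  hy.absCont.intervalIntegrable_of_ae_hasDerivAt hy.ae_hasDerivAt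

theorem continuousOn_deriv (hy : HasSecondDeriv y y' w) : ContinuousOn y' (Icc 0 π) := by
  simpa [uIcc_zero_pi] using hy.absCont.continuousOn

theorem continuousOn (hy : HasSecondDeriv y y' w) : ContinuousOn y (Icc 0 π) :=
  fun x hx => (hy.deriv x hx).continuousWithinAt

theorem deriv_eq (hy : HasSecondDeriv y y' w) {x : ℝ} (hx : x ∈ Icc 0 π) : y' x = y' 0 + ∫ t in (0 : ℝ)..x, w t := by
  rw [(hy.absCont.mono (uIcc_subset_of_mem hx)).integral_eq_sub_of_ae_hasDerivAt
    (hy.ae_hasDerivAt.mono fun t ht htm => ht (uIcc_subset_of_mem hx htm))]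
  ring

theorem hasDerivAt (hy : HasSecondDeriv y y' w) {x : ℝ} (hx : x ∈ Ioo 0 π) : HasDerivAt y (y' x) x :=
  (hy.deriv x (Ioo_subset_Icc_self hx)).hasDerivAt (Icc_mem_nhds hx.1 hx.2)

theorem eq_integral (hy : HasSecondDeriv y y' w) {x : ℝ} (hx : x ∈ Icc 0 π) : y x = y 0 + ∫ t in (0 : ℝ)..x, y' t := by
  have hsub : Icc 0 x ⊆ Icc 0 π := Icc_subset_Icc_right hx.2
  rw [intervalIntegral.integral_eq_sub_of_hasDerivAt_of_le hx.1 (hy.continuousOn.mono hsub)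
    (fun t ht => hy.hasDerivAt ⟨ht.1, ht.2.trans_le hx.2⟩)
    (intervalIntegrable_mono_pi (intervalIntegrable_of_continuousOn hy.continuousOn_deriv) hx)]
  ring

theorem absCont_self (hy : HasSecondDeriv y y' w) : AbsolutelyContinuousOnInterval y 0 π := by
  have h0 : AbsolutelyContinuousOnInterval (fun _ : ℝ => y 0) 0 π :=
    (contDiff_const (n := 1)).contDiffOn.absolutelyContinuousOnInterval
  refine (h0.add (intervalIntegrable_of_continuousOn
    hy.continuousOn_deriv).absolutelyContinuousOnInterval_complex).congr fun x hx => ?_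
  rw [uIcc_zero_pi] at hx
  exact (hy.eq_integral hx).symm

theorem ae_hasDerivAt_self (hy : HasSecondDeriv y y' w) : ∀ᵐ x, x ∈ uIcc 0 π → HasDerivAt y (y' x) x := by
  filter_upwards [volume.ae_ne 0, volume.ae_ne π] with x h1 h2 hx
  rw [uIcc_zero_pi] at hx
  exact hy.hasDerivAt ⟨lt_of_le_of_ne hx.1 h1.symm, lt_of_le_of_ne hx.2 h2⟩

/-- Lagrange's identity. -/
theorem lagrange (hy : HasSecondDeriv y y' w) (hz : HasSecondDeriv z z' v) {x : ℝ} (hx : x ∈ Icc 0 π) :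
    ∫ t in (0 : ℝ)..x, (y t * v t - w t * z t) =
      (y x * z' x - y' x * z x) - (y 0 * z' 0 - y' 0 * z 0) := by
  have hsub := uIcc_subset_of_mem hx
  have hac := ((hy.absCont_self.cmul hz.absCont).sub (hy.absCont.cmul hz.absCont_self)).mono hsub
  refine hac.integral_eq_sub_of_ae_hasDerivAt ?_
  filter_upwards [hy.ae_hasDerivAt, hz.ae_hasDerivAt, hy.ae_hasDerivAt_self,
    hz.ae_hasDerivAt_self] with t h1 h2 h3 h4 ht
  have ht := hsub ht
  refine (((h3 ht).mul (h2 ht)).sub ((h1 ht).mul (h4 ht))).congr_deriv ?_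
  ring

theorem congr_right (hy : HasSecondDeriv y y' w) {w₁ : ℝ → ℂ} (h : ∀ᵐ x ∂volume.restrict (Icc 0 π), w x = w₁ x) :
    HasSecondDeriv y y' w₁ :=
  ⟨hy.deriv, hy.absCont, by filter_upwards [hy.deriv_ae, h] with x h1 h2 using h2 ▸ h1⟩

theorem congr_left (hy : HasSecondDeriv y y' w) {y₁ : ℝ → ℂ} (h : ∀ x ∈ Icc 0 π, y₁ x = y x) : HasSecondDeriv y₁ y' w :=
  ⟨fun x hx => (hy.deriv x hx).congr h (h x hx), hy.absCont, hy.deriv_ae⟩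

theorem sub (hy : HasSecondDeriv y y' w) (hz : HasSecondDeriv z z' v) :
    HasSecondDeriv (fun x => y x - z x) (fun x => y' x - z' x) (fun x => w x - v x) :=
  ⟨fun x hx => (hy.deriv x hx).sub (hz.deriv x hx), hy.absCont.sub hz.absCont, by
    filter_upwards [hy.deriv_ae, hz.deriv_ae] with x h1 h2 using h1.sub h2⟩

theorem const_mul (hy : HasSecondDeriv y y' w) (k : ℂ) :
    HasSecondDeriv (fun x => k * y x) (fun x => k * y' x) (fun x => k * w x) :=
  ⟨fun x hx => (hy.deriv x hx).const_mul k, hy.absCont.const_smul k, by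
    filter_upwards [hy.deriv_ae] with x h1 using h1.const_mul k⟩

theorem conj (hy : HasSecondDeriv y y' w) : HasSecondDeriv (fun x => starRingEnd ℂ (y x)) (fun x => starRingEnd ℂ (y' x))
    (fun x => starRingEnd ℂ (w x)) := by
  refine ⟨fun x hx => ?_, ?_, ?_⟩
  · exact (Complex.conjCLE.toContinuousLinearMap.hasFDerivAt.comp_hasDerivWithinAt x
      (hy.deriv x hx))
  · exact Complex.isometry_conj.lipschitz.comp_absolutelyContinuousOnInterval hy.absCont
  · filter_upwards [hy.deriv_ae] with x h1
    exact (Complex.conjCLE.toContinuousLinearMap.hasFDerivAt.comp_hasDerivAt x h1)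

/-- Only almost everywhere differentiability of y is asked for, which is what products with Lebesgue
primitives provide; differentiability everywhere is recovered from the continuity of y'. -/
theorem of_ae (hac : AbsolutelyContinuousOnInterval y 0 π)
    (hac' : AbsolutelyContinuousOnInterval y' 0 π)
    (hd : ∀ᵐ x, x ∈ uIcc 0 π → HasDerivAt y (y' x) x)
    (hd' : ∀ᵐ x, x ∈ uIcc 0 π → HasDerivAt y' (w x) x) : HasSecondDeriv y y' w := by
  refine of_integral (hac'.intervalIntegrable_of_ae_hasDerivAt hd') (fun x hx => ?_)
    (fun x hx => ?_)
  · rw [(hac'.mono (uIcc_subset_of_mem hx)).integral_eq_sub_of_ae_hasDerivAt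
      (hd'.mono fun t ht htm => ht (uIcc_subset_of_mem hx htm))]
    ring
  · rw [(hac.mono (uIcc_subset_of_mem hx)).integral_eq_sub_of_ae_hasDerivAt
      (hd.mono fun t ht htm => ht (uIcc_subset_of_mem hx htm))]
    ring

theorem of_hasDerivAt (hd : ∀ x, HasDerivAt y (y' x) x) (hd' : ∀ x, HasDerivAt y' (w x) x)
    (hw : Continuous w) : HasSecondDeriv y y' w := by
  have hi := hw.intervalIntegrable (μ := volume)
  have hc' : Continuous y' := continuous_iff_continuousAt.2 fun x => (hd' x).continuousAt
  refine of_integral (hi 0 π) (fun x hx => ?_) (fun x hx => ?_)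
  · rw [intervalIntegral.integral_eq_sub_of_hasDerivAt (fun t _ => hd' t) (hi 0 x)]; ring
  · rw [intervalIntegral.integral_eq_sub_of_hasDerivAt (fun t _ => hd t)
      (hc'.intervalIntegrable 0 x)]; ring

end HasSecondDeriv

end SturmLiouville

end

section

namespace SturmLiouville

/-! ### Volterra equations with square integrable majorants -/

theorem intervalIntegrable_of_memLp {E : Type*} [NormedAddCommGroup E] {m : ℝ → E}
    (hm : MemLp m 2 (volume.restrict (Ioc 0 π))) : IntervalIntegrable m volume 0 π := by
  rw [intervalIntegrable_iff_integrableOn_Ioc_of_le Real.pi_nonneg]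
  exact hm.integrable (by norm_num)

theorem intervalIntegrable_mul_continuousOn {m : ℝ → ℝ} {f : ℝ → ℝ}
    (hm : MemLp m 2 (volume.restrict (Ioc 0 π))) (hf : ContinuousOn f (Icc 0 π)) :
    IntervalIntegrable (fun s => |m s| * f s) volume 0 π :=
  (intervalIntegrable_of_memLp hm).abs.mul_continuousOn (by rwa [uIcc_zero_pi])

/-- In the sup norm weighted by exp(-Lx), a Volterra operator with majorant |m| becomes a
contraction with factor 1/2. Square integrability of m enters through a weighted
arithmetic-geometric inequality, which yields an explicit L. -/
theorem exists_exp_weight {m : ℝ → ℝ} (hm : MemLp m 2 (volume.restrict (Ioc 0 π))) :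
    ∃ L : ℝ, 0 < L ∧ ∀ x ∈ Icc 0 π,
      ∫ s in (0 : ℝ)..x, |m s| * Real.exp (L * s) ≤ Real.exp (L * x) / 2 := by
  have hsq : IntervalIntegrable (fun s => m s ^ 2) volume 0 π := by
    rw [intervalIntegrable_iff_integrableOn_Ioc_of_le Real.pi_nonneg]
    exact hm.integrable_sq
  set B := ∫ s in (0 : ℝ)..π, m s ^ 2 with hB
  have hB0 : 0 ≤ B := intervalIntegral.integral_nonneg Real.pi_nonneg fun s _ => sq_nonneg _
  -- With this L the part with m² contributes at most exp(Lx)/4, since B/(B + 1) ≤ 1, and the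
  -- exponential part (B + 1)/(2L) = 1/4 times exp(Lx).
  refine ⟨2 * (B + 1), by positivity, fun x hx => ?_⟩
  set L := 2 * (B + 1) with hL
  have hLpos : 0 < L := by positivity
  have hexp : ∀ u : ℝ, u ∈ Icc 0 π → ∫ s in (0 : ℝ)..u, Real.exp (2 * L * s) ≤
      Real.exp (2 * L * u) / (2 * L) := by
    intro u _
    have : ∀ s ∈ uIcc 0 u, HasDerivAt (fun s => Real.exp (2 * L * s) / (2 * L))
        (Real.exp (2 * L * s)) s := fun s _ => by
      have := (((hasDerivAt_id s).const_mul (2 * L)).exp).div_const (2 * L)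
      refine this.congr_deriv ?_
      simp only [id]; field_simp
    rw [intervalIntegral.integral_eq_sub_of_hasDerivAt this
      (Continuous.intervalIntegrable (by fun_prop) _ _)]
    have : 0 ≤ Real.exp (2 * L * 0) / (2 * L) := by positivity
    linarith
  have hI1 : IntervalIntegrable (fun s => |m s| * Real.exp (L * s)) volume 0 x :=
    intervalIntegrable_mono_pi (intervalIntegrable_mul_continuousOn hm (by fun_prop)) hx
  have hI2 : IntervalIntegrable (fun s => Real.exp (L * x) / (4 * (B + 1)) * m s ^ 2)
      volume 0 x := (intervalIntegrable_mono_pi hsq hx).const_mul _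
  have hI3 : IntervalIntegrable (fun s => Real.exp (-(L * x)) * (B + 1) *
      Real.exp (2 * L * s)) volume 0 x := Continuous.intervalIntegrable (by fun_prop) _ _
  calc ∫ s in (0 : ℝ)..x, |m s| * Real.exp (L * s)
      ≤ ∫ s in (0 : ℝ)..x, (Real.exp (L * x) / (4 * (B + 1)) * m s ^ 2 +
          Real.exp (-(L * x)) * (B + 1) * Real.exp (2 * L * s)) := by
        refine intervalIntegral.integral_mono_on hx.1 hI1 (hI2.add hI3) fun s _ => ?_
        have e1 : Real.exp (2 * L * s) = Real.exp (L * s) ^ 2 := by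
          rw [← Real.exp_nat_mul]; congr 1; push_cast; ring
        have e2 : Real.exp (-(L * x)) = (Real.exp (L * x))⁻¹ := Real.exp_neg _
        rw [e1, e2, ← sq_abs (m s)]
        have hE := Real.exp_pos (L * x)
        have key := sq_nonneg (Real.exp (L * x) * |m s| - 2 * (B + 1) * Real.exp (L * s))
        have hB1 : 0 < B + 1 := by positivity
        rw [← sub_nonneg]
        have : Real.exp (L * x) / (4 * (B + 1)) * |m s| ^ 2 +
            (Real.exp (L * x))⁻¹ * (B + 1) * Real.exp (L * s) ^ 2 - |m s| * Real.exp (L * s) =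
            (Real.exp (L * x) * |m s| - 2 * (B + 1) * Real.exp (L * s)) ^ 2 /
              (4 * (B + 1) * Real.exp (L * x)) := by
          field_simp; ring
        rw [this]; positivity
    _ = Real.exp (L * x) / (4 * (B + 1)) * (∫ s in (0 : ℝ)..x, m s ^ 2) +
          Real.exp (-(L * x)) * (B + 1) * ∫ s in (0 : ℝ)..x, Real.exp (2 * L * s) := by
        rw [intervalIntegral.integral_add hI2 hI3, intervalIntegral.integral_const_mul,
          intervalIntegral.integral_const_mul]
    _ ≤ Real.exp (L * x) / (4 * (B + 1)) * B +
          Real.exp (-(L * x)) * (B + 1) * (Real.exp (2 * L * x) / (2 * L)) := by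
        gcongr
        · exact intervalIntegral.integral_mono_interval le_rfl hx.1 hx.2
            (Eventually.of_forall fun s => sq_nonneg _) hsq
        · exact hexp x hx
    _ = Real.exp (L * x) * (B / (4 * (B + 1)) + 1 / 4) := by
        have e1 : Real.exp (2 * L * x) = Real.exp (L * x) * Real.exp (L * x) := by
          rw [← Real.exp_add]; congr 1; ring
        have e2 : Real.exp (-(L * x)) = (Real.exp (L * x))⁻¹ := Real.exp_neg _
        have hE := Real.exp_pos (L * x)
        have hB1 : 0 < B + 1 := by positivity
        rw [e1, e2, hL]
        field_simp; ring
    _ ≤ Real.exp (L * x) * (1 / 4 + 1 / 4) := by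
        refine mul_le_mul_of_nonneg_left (add_le_add_left ?_ _) (Real.exp_pos _).le
        rw [div_le_div_iff₀ (by positivity) (by norm_num)]; linarith
    _ = Real.exp (L * x) / 2 := by ring

/-- Grönwall's lemma in integral form. -/
theorem eq_zero_of_norm_le_integral {m : ℝ → ℝ} (hm : MemLp m 2 (volume.restrict (Ioc 0 π)))
    {d : ℝ → ℂ} (hd : ContinuousOn d (Icc 0 π))
    (h : ∀ x ∈ Icc 0 π, ‖d x‖ ≤ ∫ s in (0 : ℝ)..x, |m s| * ‖d s‖) :
    ∀ x ∈ Icc 0 π, d x = 0 := by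
  obtain ⟨L, hL, hw⟩ := exists_exp_weight hm
  have hc : ContinuousOn (fun x => Real.exp (-(L * x)) * ‖d x‖) (Icc 0 π) := by
    have := hd.norm
    fun_prop
  -- At a maximum point of the weighted norm the hypothesis gives M ≤ M/2 for the maximum M.
  obtain ⟨x₀, hx₀, hmax⟩ := isCompact_Icc.exists_isMaxOn ⟨0, zero_mem_Icc_pi⟩ hc
  set M := Real.exp (-(L * x₀)) * ‖d x₀‖ with hM
  have hle : ∀ s ∈ Icc 0 π, ‖d s‖ ≤ M * Real.exp (L * s) := fun s hs => by
    have h1 : Real.exp (-(L * s)) * ‖d s‖ ≤ M := hmax hs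
    have h2 := mul_le_mul_of_nonneg_right h1 (Real.exp_pos (L * s)).le
    rwa [mul_right_comm, ← Real.exp_add, neg_add_cancel, Real.exp_zero, one_mul] at h2
  have hM0 : 0 ≤ M := by positivity
  have h1 : ‖d x₀‖ ≤ M * (Real.exp (L * x₀) / 2) := by
    refine (h x₀ hx₀).trans ?_
    refine le_trans ?_ (mul_le_mul_of_nonneg_left (hw x₀ hx₀) hM0)
    rw [← intervalIntegral.integral_const_mul]
    refine intervalIntegral.integral_mono_on hx₀.1
      (intervalIntegrable_mono_pi (intervalIntegrable_mul_continuousOn hm hd.norm) hx₀)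
      ((intervalIntegrable_mono_pi (intervalIntegrable_mul_continuousOn hm (by fun_prop))
        hx₀).const_mul _) fun s hs => ?_
    have := mul_le_mul_of_nonneg_left (hle s ⟨hs.1, hs.2.trans hx₀.2⟩) (abs_nonneg (m s))
    linarith
  have h2 : M ≤ M / 2 := by
    have := mul_le_mul_of_nonneg_left h1 (Real.exp_pos (-(L * x₀))).le
    have e : Real.exp (-(L * x₀)) * (M * (Real.exp (L * x₀) / 2)) = M / 2 := by
      rw [show Real.exp (-(L * x₀)) * (M * (Real.exp (L * x₀) / 2)) =
        M / 2 * (Real.exp (-(L * x₀)) * Real.exp (L * x₀)) by ring, ← Real.exp_add,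
        neg_add_cancel, Real.exp_zero, mul_one]
    rwa [e] at this
  have hM' : M = 0 := by linarith
  intro x hx
  have := hle x hx
  rw [hM', zero_mul] at this
  exact norm_le_zero_iff.1 this

/-- The nearest point of `[0, π]`. -/
def clamp (x : ℝ) : ℝ := max 0 (min π x)

theorem clamp_mem (x : ℝ) : clamp x ∈ Icc 0 π :=
  ⟨le_max_left _ _, max_le Real.pi_nonneg (min_le_left _ _)⟩

theorem clamp_of_mem {x : ℝ} (hx : x ∈ Icc 0 π) : clamp x = x := by
  rw [clamp, min_eq_right hx.2, max_eq_right hx.1]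

theorem continuous_clamp : Continuous clamp := by unfold clamp; fun_prop

/-- Solvability of Volterra equations in two variables. -/
theorem exists_fixedPoint_of_volterra {m : ℝ → ℝ} (hm : MemLp m 2 (volume.restrict (Ioc 0 π)))
    (A : (ℝ × ℝ →ᵇ ℝ) →L[ℝ] (ℝ × ℝ →ᵇ ℝ))
    (hA : ∀ g : ℝ × ℝ →ᵇ ℝ, ∀ M L : ℝ, 0 ≤ M →
      (∀ p, |g p| ≤ M * Real.exp (L * clamp p.1)) →
      ∀ p, |A g p| ≤ M * ∫ s in (0 : ℝ)..clamp p.1, |m s| * Real.exp (L * s))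
    (b : ℝ × ℝ →ᵇ ℝ) : ∃ g : ℝ × ℝ →ᵇ ℝ, g = b + A g := by
  obtain ⟨L, hL, hw⟩ := exists_exp_weight hm
  -- Each application of A halves the constant in the exponential bound, so the Neumann series ∑ Aᵏ
  -- b converges geometrically in the unweighted norm.
  have hb : ∀ k : ℕ, ∀ p, |(A ^ k) b p| ≤ ‖b‖ * (1 / 2) ^ k * Real.exp (L * clamp p.1) := by
    intro k
    induction k with
    | zero =>
      intro p
      have h1 : |b p| ≤ ‖b‖ := b.norm_coe_le_norm p
      have h2 : 1 ≤ Real.exp (L * clamp p.1) :=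
        Real.one_le_exp (mul_nonneg hL.le (clamp_mem _).1)
      simpa using h1.trans (le_mul_of_one_le_right (norm_nonneg b) h2)
    | succ k ih =>
      intro p
      have h1 := hA _ _ L (by positivity) ih p
      rw [pow_succ' A]
      refine h1.trans ?_
      have h2 := mul_le_mul_of_nonneg_left (hw _ (clamp_mem p.1))
        (by positivity : 0 ≤ ‖b‖ * (1 / 2) ^ k)
      refine h2.trans (le_of_eq ?_)
      rw [pow_succ]; ring
  have hnorm : ∀ k : ℕ, ‖(A ^ k) b‖ ≤ ‖b‖ * Real.exp (L * π) * (1 / 2) ^ k := by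
    intro k
    refine (BoundedContinuousFunction.norm_le (by positivity)).2 fun p => ?_
    refine (hb k p).trans ?_
    have : Real.exp (L * clamp p.1) ≤ Real.exp (L * π) :=
      Real.exp_le_exp.2 (mul_le_mul_of_nonneg_left (clamp_mem _).2 hL.le)
    calc _ ≤ ‖b‖ * (1 / 2) ^ k * Real.exp (L * π) := by gcongr
      _ = _ := by ring
  have hs : Summable fun k => (A ^ k) b :=
    Summable.of_norm_bounded
      ((summable_geometric_of_lt_one (by norm_num) (by norm_num)).mul_left _) hnorm
  refine ⟨∑' k, (A ^ k) b, ?_⟩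
  rw [A.map_tsum hs, hs.tsum_eq_zero_add]
  simp only [pow_zero, pow_succ']
  rfl

end SturmLiouville

end

section

namespace SturmLiouville

/-! ### The Goursat problem for the transmutation kernel -/

/-- The integral of `g(s, |r|)` over `|r| ≤ s`, `|r - t| ≤ x - s`. -/
def goursatInner (g : ℝ × ℝ → ℝ) (x t s : ℝ) : ℝ :=
  ∫ r in (-π)..π, if |r| ≤ s ∧ |r - t| ≤ x - s then g (s, |r|) else 0

theorem measurable_goursatIntegrand {g : ℝ × ℝ → ℝ} (hg : Continuous g) :
    Measurable fun p : (ℝ × ℝ × ℝ) × ℝ =>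
      if |p.2| ≤ p.1.2.2 ∧ |p.2 - p.1.2.1| ≤ p.1.1 - p.1.2.2 then g (p.1.2.2, |p.2|) else 0 := by
  have h1 : MeasurableSet {p : (ℝ × ℝ × ℝ) × ℝ | |p.2| ≤ p.1.2.2} :=
    (isClosed_le (by fun_prop) (by fun_prop)).measurableSet
  have h2 : MeasurableSet {p : (ℝ × ℝ × ℝ) × ℝ | |p.2 - p.1.2.1| ≤ p.1.1 - p.1.2.2} :=
    (isClosed_le (by fun_prop) (by fun_prop)).measurableSet
  exact Measurable.ite (h1.inter h2)
    (hg.comp (by fun_prop : Continuous fun p : (ℝ × ℝ × ℝ) × ℝ => (p.1.2.2, |p.2|))).measurable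
    measurable_const

theorem measurable_goursatIntegrand_right {g : ℝ × ℝ → ℝ} (hg : Continuous g) (x t s : ℝ) :
    Measurable fun r : ℝ => if |r| ≤ s ∧ |r - t| ≤ x - s then g (s, |r|) else 0 :=
  (measurable_goursatIntegrand hg).comp
    (by fun_prop : Measurable fun r : ℝ => (((x, t, s), r) : (ℝ × ℝ × ℝ) × ℝ))

theorem stronglyMeasurable_goursatInner {g : ℝ × ℝ → ℝ} (hg : Continuous g) :
    StronglyMeasurable fun p : ℝ × ℝ × ℝ => goursatInner g p.1 p.2.1 p.2.2 := by
  have := (measurable_goursatIntegrand hg).stronglyMeasurable.integral_prod_right'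
    (ν := volume.restrict (Ioc (-π) π))
  simpa only [goursatInner, intervalIntegral.integral_of_le (neg_le_self Real.pi_nonneg)]
    using this

theorem measurable_goursatInner {g : ℝ × ℝ → ℝ} (hg : Continuous g) (x t : ℝ) :
    Measurable fun s => goursatInner g x t s :=
  (stronglyMeasurable_goursatInner hg).measurable.comp
    (by fun_prop : Measurable fun s : ℝ => ((x, t, s) : ℝ × ℝ × ℝ))

theorem norm_goursatIntegrand_le {g : ℝ × ℝ → ℝ} {M : ℝ} {x t s : ℝ} (hM : 0 ≤ M)
    (hg : ∀ r, |g (s, r)| ≤ M) (r : ℝ) :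
    ‖if |r| ≤ s ∧ |r - t| ≤ x - s then g (s, |r|) else 0‖ ≤ M := by
  split_ifs
  · exact hg _
  · simpa using hM

theorem abs_goursatInner_le {g : ℝ × ℝ → ℝ} {M : ℝ} {x t s : ℝ}
    (hg : ∀ r, |g (s, r)| ≤ M) : |goursatInner g x t s| ≤ 2 * π * M := by
  have hM : 0 ≤ M := (abs_nonneg _).trans (hg 0)
  have := intervalIntegral.norm_integral_le_of_norm_le_const (a := -π) (b := π)
    fun r _ => norm_goursatIntegrand_le (x := x) (t := t) hM hg r
  rw [sub_neg_eq_add, abs_of_nonneg (by positivity)] at this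
  calc _ ≤ _ := this
    _ = _ := by ring

theorem goursatInner_eq_zero {g : ℝ × ℝ → ℝ} {x t s : ℝ} (h : x < s) :
    goursatInner g x t s = 0 := by
  have : ∀ r : ℝ, ¬ (|r| ≤ s ∧ |r - t| ≤ x - s) := fun r hr => by
    have := abs_nonneg (r - t)
    linarith [hr.2]
  simp [goursatInner, this]

theorem goursatInner_add {g₁ g₂ : ℝ × ℝ →ᵇ ℝ} (x t s : ℝ) :
    goursatInner (⇑(g₁ + g₂)) x t s = goursatInner g₁ x t s + goursatInner g₂ x t s := by
  have hi : ∀ g : ℝ × ℝ →ᵇ ℝ, IntervalIntegrable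
      (fun r : ℝ => if |r| ≤ s ∧ |r - t| ≤ x - s then g (s, |r|) else 0) volume (-π) π := by
    intro g
    refine (intervalIntegrable_const (c := ‖g‖)).mono_fun
      (measurable_goursatIntegrand_right g.continuous x t s).aestronglyMeasurable
      (Eventually.of_forall fun r => ?_)
    refine (norm_goursatIntegrand_le (norm_nonneg g)
      (fun r => g.norm_coe_le_norm _) r).trans (le_abs_self _)
  rw [goursatInner, goursatInner, goursatInner, ← intervalIntegral.integral_add (hi g₁) (hi g₂)]
  refine intervalIntegral.integral_congr fun r _ => ?_
  simp only [BoundedContinuousFunction.coe_add, Pi.add_apply]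
  split_ifs <;> simp

theorem goursatInner_smul {g : ℝ × ℝ →ᵇ ℝ} (k x t s : ℝ) :
    goursatInner (⇑(k • g)) x t s = k * goursatInner g x t s := by
  rw [goursatInner, goursatInner, ← intervalIntegral.integral_const_mul]
  refine intervalIntegral.integral_congr fun r _ => ?_
  simp

/-- When s is fixed and the point moves, the integrand can jump only where |r - t| = x - s, that is,
at no more than two values of r; elsewhere it is locally constant in (x, t), so dominated
convergence applies. -/
theorem continuous_goursatInner (g : ℝ × ℝ →ᵇ ℝ) (s : ℝ) :
    Continuous fun p : ℝ × ℝ => goursatInner g p.1 p.2 s := by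
  refine continuous_iff_continuousAt.2 fun p => ?_
  refine intervalIntegral.continuousAt_of_dominated_interval (bound := fun _ => ‖g‖)
    (Eventually.of_forall fun p =>
      (measurable_goursatIntegrand_right g.continuous p.1 p.2 s).aestronglyMeasurable)
    (Eventually.of_forall fun p => Eventually.of_forall fun r _ =>
      norm_goursatIntegrand_le (norm_nonneg g) (fun r => g.norm_coe_le_norm _) r)
    intervalIntegrable_const ?_
  filter_upwards [volume.ae_ne (p.2 + (p.1 - s)), volume.ae_ne (p.2 - (p.1 - s))] with r h1 h2 _
  have hne : |r - p.2| ≠ p.1 - s := by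
    intro h
    rcases abs_choice (r - p.2) with h' | h'
    · exact h1 (by linarith)
    · exact h2 (by linarith)
  have hcont : Continuous fun p : ℝ × ℝ => p.1 - s - |r - p.2| := by fun_prop
  rcases lt_or_gt_of_ne hne with hlt | hgt
  · have : ∀ᶠ p' : ℝ × ℝ in 𝓝 p, 0 < p'.1 - s - |r - p'.2| :=
      hcont.continuousAt.eventually (lt_mem_nhds (by linarith))
    refine (continuousAt_const (y := if |r| ≤ s then g (s, |r|) else 0)).congr ?_
    filter_upwards [this] with p' hp'
    have : |r - p'.2| ≤ p'.1 - s := by linarith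
    simp [this]
  · have : ∀ᶠ p' : ℝ × ℝ in 𝓝 p, p'.1 - s - |r - p'.2| < 0 :=
      hcont.continuousAt.eventually (gt_mem_nhds (by linarith))
    refine (continuousAt_const (y := (0 : ℝ))).congr ?_
    filter_upwards [this] with p' hp'
    have : ¬ |r - p'.2| ≤ p'.1 - s := by linarith
    simp [this]

variable {q : ℝ → ℝ}

theorem intervalIntegrable_mul_goursatInner (hq : MemLp q 2 (volume.restrict (Ioc 0 π)))
    (g : ℝ × ℝ →ᵇ ℝ) (x t : ℝ) :
    IntervalIntegrable (fun s => q s * goursatInner g x t s) volume 0 π := by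
  have hq1 := intervalIntegrable_of_memLp hq
  refine (hq1.norm.mul_const (2 * π * ‖g‖)).mono_fun ?_ (Eventually.of_forall fun s => ?_)
  · rw [uIoc_of_le Real.pi_nonneg]
    exact hq.1.mul (measurable_goursatInner g.continuous x t).aestronglyMeasurable
  · beta_reduce
    rw [norm_mul, norm_mul, norm_norm, Real.norm_of_nonneg (by positivity : 0 ≤ 2 * π * ‖g‖)]
    exact mul_le_mul_of_nonneg_left (abs_goursatInner_le fun r => g.norm_coe_le_norm _)
      (norm_nonneg _)

/-- The region of integration is empty for s > x, which gives the Volterra character. The inner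
interval has length at most 2π, and with the factor 1/2 this makes π|q| the majorant. -/
theorem abs_integral_goursat_le (hq : MemLp q 2 (volume.restrict (Ioc 0 π)))
    {g : ℝ × ℝ →ᵇ ℝ} {M L : ℝ} (hg : ∀ p, |g p| ≤ M * Real.exp (L * clamp p.1))
    (p : ℝ × ℝ) :
    |2⁻¹ * ∫ s in (0 : ℝ)..π, q s * goursatInner g (clamp p.1) p.2 s| ≤
      M * ∫ s in (0 : ℝ)..clamp p.1, |π * q s| * Real.exp (L * s) := by
  have hx := clamp_mem p.1
  set x := clamp p.1
  have hi := intervalIntegrable_mul_goursatInner hq g x p.2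
  have hm : MemLp (fun s => π * q s) 2 (volume.restrict (Ioc 0 π)) := hq.const_mul π
  have h0 : ∫ s in x..π, q s * goursatInner g x p.2 s = 0 := by
    refine intervalIntegral.integral_zero_ae (Eventually.of_forall fun s hs => ?_)
    rw [uIoc_of_le hx.2] at hs
    rw [goursatInner_eq_zero hs.1, mul_zero]
  have hx' : x ∈ uIcc 0 π := by rwa [uIcc_zero_pi]
  rw [← intervalIntegral.integral_add_adjacent_intervals
    (hi.mono_set (uIcc_subset_uIcc left_mem_uIcc hx'))
    (hi.mono_set (uIcc_subset_uIcc hx' right_mem_uIcc)), h0, add_zero,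
    ← intervalIntegral.integral_const_mul, ← intervalIntegral.integral_const_mul]
  refine (intervalIntegral.abs_integral_le_integral_abs hx.1).trans ?_
  refine intervalIntegral.integral_mono_on hx.1
    ((intervalIntegrable_mono_pi hi hx).const_mul _).abs
    ((intervalIntegrable_mono_pi (intervalIntegrable_mul_continuousOn hm (by fun_prop))
      hx).const_mul _) fun s hs => ?_
  have hs' : s ∈ Icc 0 π := ⟨hs.1, hs.2.trans hx.2⟩
  have h1 : |goursatInner g x p.2 s| ≤ 2 * π * (M * Real.exp (L * s)) :=
    abs_goursatInner_le fun r => by simpa [clamp_of_mem hs'] using hg (s, r)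
  rw [abs_mul, abs_mul, abs_mul, abs_of_pos Real.pi_pos, abs_of_pos (by norm_num : (0:ℝ) < 2⁻¹)]
  calc 2⁻¹ * (|q s| * |goursatInner g x p.2 s|)
      ≤ 2⁻¹ * (|q s| * (2 * π * (M * Real.exp (L * s)))) := by gcongr
    _ = _ := by ring

theorem norm_integral_goursat_le (hq : MemLp q 2 (volume.restrict (Ioc 0 π)))
    (g : ℝ × ℝ →ᵇ ℝ) (p : ℝ × ℝ) :
    ‖2⁻¹ * ∫ s in (0 : ℝ)..π, q s * goursatInner g (clamp p.1) p.2 s‖ ≤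
      ‖g‖ * ∫ s in (0 : ℝ)..π, |π * q s| := by
  have h := abs_integral_goursat_le hq (g := g) (M := ‖g‖) (L := 0)
    (fun p => by simpa using g.norm_coe_le_norm p) p
  refine h.trans (mul_le_mul_of_nonneg_left ?_ (norm_nonneg _))
  simp only [zero_mul, Real.exp_zero, mul_one]
  exact intervalIntegral.integral_mono_interval le_rfl (clamp_mem _).1 (clamp_mem _).2
    (Eventually.of_forall fun s => abs_nonneg _)
    ((intervalIntegrable_of_memLp hq).const_mul π).abs

/-- The Volterra operator of the Goursat problem. -/
def goursatOperator (hq : MemLp q 2 (volume.restrict (Ioc 0 π))) :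
    (ℝ × ℝ →ᵇ ℝ) →L[ℝ] (ℝ × ℝ →ᵇ ℝ) :=
  LinearMap.mkContinuous
    { toFun := fun g => BoundedContinuousFunction.ofNormedAddCommGroup
        (fun p => 2⁻¹ * ∫ s in (0 : ℝ)..π, q s * goursatInner g (clamp p.1) p.2 s)
        (by
          refine continuous_const.mul (continuous_iff_continuousAt.2 fun p => ?_)
          refine intervalIntegral.continuousAt_of_dominated_interval
            (bound := fun s => ‖q s‖ * (2 * π * ‖g‖))
            (Eventually.of_forall fun p => ?_)
            (Eventually.of_forall fun p => Eventually.of_forall fun s _ => ?_)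
            ((intervalIntegrable_of_memLp hq).norm.mul_const _)
            (Eventually.of_forall fun s _ => ?_)
          · rw [uIoc_of_le Real.pi_nonneg]
            exact hq.1.mul (measurable_goursatInner g.continuous _ _).aestronglyMeasurable
          · rw [norm_mul]
            exact mul_le_mul_of_nonneg_left (abs_goursatInner_le fun r => g.norm_coe_le_norm _)
              (norm_nonneg _)
          · exact (continuous_const.mul ((continuous_goursatInner g s).comp
              ((continuous_clamp.comp continuous_fst).prodMk continuous_snd))).continuousAt)
        (‖g‖ * ∫ s in (0 : ℝ)..π, |π * q s|)
        (norm_integral_goursat_le hq g)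
      map_add' := fun g₁ g₂ => by
        ext p
        simp only [BoundedContinuousFunction.coe_ofNormedAddCommGroup,
          BoundedContinuousFunction.coe_add, Pi.add_apply]
        rw [← mul_add, ← intervalIntegral.integral_add
          (intervalIntegrable_mul_goursatInner hq g₁ _ _)
          (intervalIntegrable_mul_goursatInner hq g₂ _ _)]
        congr 1
        refine intervalIntegral.integral_congr fun s _ => ?_
        rw [← mul_add, ← goursatInner_add]
        rfl
      map_smul' := fun k g => by
        ext p
        simp only [BoundedContinuousFunction.coe_ofNormedAddCommGroup,
          BoundedContinuousFunction.coe_smul, smul_eq_mul, RingHom.id_apply]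
        rw [mul_left_comm, ← intervalIntegral.integral_const_mul k]
        congr 1
        refine intervalIntegral.integral_congr fun s _ => ?_
        rw [mul_left_comm, ← goursatInner_smul]
        rfl }
    (∫ s in (0 : ℝ)..π, |π * q s|)
    (fun g => by
      refine (BoundedContinuousFunction.norm_ofNormedAddCommGroup_le _
        (mul_nonneg (norm_nonneg _)
          (intervalIntegral.integral_nonneg Real.pi_nonneg fun s _ => abs_nonneg _))
        (norm_integral_goursat_le hq g)).trans
        (mul_comm _ _).le)

theorem goursatOperator_apply (hq : MemLp q 2 (volume.restrict (Ioc 0 π))) (g : ℝ × ℝ →ᵇ ℝ)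
    (p : ℝ × ℝ) : goursatOperator hq g p =
      2⁻¹ * ∫ s in (0 : ℝ)..π, q s * goursatInner g (clamp p.1) p.2 s := rfl

theorem continuous_primitive_clamp {E : Type*} [NormedAddCommGroup E] [NormedSpace ℝ E]
    {w : ℝ → E} (hw : IntervalIntegrable w volume 0 π) :
    Continuous fun y => ∫ s in (0 : ℝ)..clamp y, w s := by
  have h := intervalIntegral.continuousOn_primitive_interval' hw left_mem_uIcc
  rw [uIcc_zero_pi] at h
  exact h.comp_continuous continuous_clamp clamp_mem

/-- This is the integrated form of g_xx - q g = g_tt with g(x, x) = h + ½ ∫₀ˣ q and g_t(x, 0) = 0.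
The condition at t = 0 is built in by extending g evenly in t, whence |r| in `goursatInner`. The
equation is solved on the whole plane with clamped arguments, where data are bounded and continuous,
and read off on the triangle. -/
theorem exists_goursat_solution (hq : MemLp q 2 (volume.restrict (Ioc 0 π))) (h : ℝ) :
    ∃ g : ℝ × ℝ →ᵇ ℝ, ∀ x ∈ Icc 0 π, ∀ t ∈ Icc 0 x,
      g (x, t) = h + 2⁻¹ * ((∫ s in (0 : ℝ)..(x + t) / 2, q s) + ∫ s in (0 : ℝ)..(x - t) / 2, q s)
        + 2⁻¹ * ∫ s in (0 : ℝ)..π, q s * goursatInner g x t s := by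
  have hq1 := intervalIntegrable_of_memLp hq
  have hQ := continuous_primitive_clamp hq1
  have hQb : ∀ y, |∫ s in (0 : ℝ)..clamp y, q s| ≤ ∫ s in (0 : ℝ)..π, |q s| := fun y =>
    (intervalIntegral.abs_integral_le_integral_abs (clamp_mem y).1).trans
      (intervalIntegral.integral_mono_interval le_rfl (clamp_mem _).1 (clamp_mem _).2
            (Eventually.of_forall fun s => abs_nonneg _) hq1.abs)
  let b : ℝ × ℝ →ᵇ ℝ := BoundedContinuousFunction.ofNormedAddCommGroup
    (fun p => h + 2⁻¹ * ((∫ s in (0 : ℝ)..clamp ((p.1 + p.2) / 2), q s) +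
      ∫ s in (0 : ℝ)..clamp ((p.1 - p.2) / 2), q s))
    (continuous_const.add (continuous_const.mul ((hQ.comp (by fun_prop)).add
      (hQ.comp (by fun_prop)))))
    (|h| + ∫ s in (0 : ℝ)..π, |q s|) (fun p => by
      have h1 := hQb ((p.1 + p.2) / 2)
      have h2 := hQb ((p.1 - p.2) / 2)
      rw [Real.norm_eq_abs]
      refine (abs_add_le _ _).trans (add_le_add_right ?_ _)
      rw [abs_mul, abs_of_pos (by norm_num : (0:ℝ) < 2⁻¹)]
      have h3 := (abs_add_le _ _).trans (add_le_add h1 h2)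
      linarith)
  obtain ⟨g, hg⟩ := exists_fixedPoint_of_volterra (hq.const_mul π) (goursatOperator hq)
    (fun g M L _ hg p => abs_integral_goursat_le hq hg p) b
  refine ⟨g, fun x hx t ht => ?_⟩
  have h1 : g (x, t) = b (x, t) + goursatOperator hq g (x, t) := DFunLike.congr_fun hg (x, t)
  rw [h1, goursatOperator_apply]
  simp only [b, BoundedContinuousFunction.coe_ofNormedAddCommGroup]
  have m1 : (x + t) / 2 ∈ Icc 0 π := ⟨by linarith [hx.1, ht.1], by linarith [hx.2, ht.2]⟩
  have m2 : (x - t) / 2 ∈ Icc 0 π := ⟨by linarith [ht.2], by linarith [hx.2, ht.1, hx.1]⟩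
  rw [clamp_of_mem hx, clamp_of_mem m1, clamp_of_mem m2]

end SturmLiouville

end

/-! ### The transmuted cosine as a solution of the Cauchy integral equation. -/

section

namespace SturmLiouville

theorem integral_ite_mem_Icc {a b c d : ℝ} (hac : a ≤ c) (hcd : c ≤ d) (hdb : d ≤ b)
    (f : ℝ → ℝ) : ∫ t in a..b, (if c ≤ t ∧ t ≤ d then f t else 0) = ∫ t in c..d, f t := by
  rw [intervalIntegral.integral_of_le (hac.trans (hcd.trans hdb)),
    intervalIntegral.integral_of_le hcd, ← integral_Icc_eq_integral_Ioc,
    ← integral_Icc_eq_integral_Ioc]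
  have : (fun t => if c ≤ t ∧ t ≤ d then f t else 0) = (Icc c d).indicator f := by
    ext t; simp [indicator_apply]
  rw [this, setIntegral_indicator measurableSet_Icc, inter_eq_right.2 (Icc_subset_Icc hac hdb)]

theorem integral_symm_of_even {f : ℝ → ℝ} (hf : ∀ t, f (-t) = f t) {x : ℝ}
    (hi : IntervalIntegrable f volume 0 x) :
    ∫ t in (-x)..x, f t = 2 * ∫ t in (0 : ℝ)..x, f t := by
  have h1 : ∫ t in (-x)..0, f t = ∫ t in (0 : ℝ)..x, f t := by
    have := intervalIntegral.integral_comp_neg (a := 0) (b := x) f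
    rw [neg_zero] at this
    rw [← this]
    exact intervalIntegral.integral_congr fun t _ => hf t
  have hi' : IntervalIntegrable f volume (-x) 0 := by
    rw [IntervalIntegrable.iff_comp_neg]
    simpa [hf] using hi.symm
  rw [← intervalIntegral.integral_add_adjacent_intervals hi' hi, h1]; ring

theorem goursatInner_neg (g : ℝ × ℝ → ℝ) (x t s : ℝ) :
    goursatInner g x (-t) s = goursatInner g x t s := by
  rw [goursatInner, goursatInner]
  have := intervalIntegral.integral_comp_neg (a := -π) (b := π)
    (fun r => if |r| ≤ s ∧ |r - -t| ≤ x - s then g (s, |r|) else 0)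
  rw [neg_neg] at this
  rw [← this]
  refine intervalIntegral.integral_congr fun r _ => ?_
  have e : |-r - -t| = |r - t| := by rw [← abs_neg]; congr 1; ring
  simp only [abs_neg, e]

/-- Evenness in t doubles the range to [-x, x]. After Fubini, for fixed r with |r| ≤ s the variable
t runs over the full interval of radius x - s about r, which lies in [-x, x]; there the integral of
cos ρt is 2 sin(ρ(x - s))/ρ · cos ρr. Evenness in r then halves the range again. -/
theorem integral_cos_mul_goursatInner (g : ℝ × ℝ →ᵇ ℝ) {ρ : ℝ} (hρ : ρ ≠ 0) {x s : ℝ}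
    (hs : 0 ≤ s) (hsx : s ≤ x) (hx : x ≤ π) :
    ∫ t in (0 : ℝ)..x, Real.cos (ρ * t) * goursatInner g x t s =
      2 * (Real.sin (ρ * (x - s)) / ρ) * ∫ r in (0 : ℝ)..s, g (s, r) * Real.cos (ρ * r) := by
  have hx0 : 0 ≤ x := hs.trans hsx
  have hcont : Continuous fun t => Real.cos (ρ * t) * goursatInner g x t s :=
    (by fun_prop : Continuous fun t => Real.cos (ρ * t)).mul
      ((continuous_goursatInner g s).comp (by fun_prop : Continuous fun t : ℝ => (x, t)))
  have h1 := integral_symm_of_even (f := fun t => Real.cos (ρ * t) * goursatInner g x t s)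
    (fun t => by rw [goursatInner_neg, mul_neg, Real.cos_neg]) (hcont.intervalIntegrable 0 x)
  have h2 : ∫ t in (-x)..x, Real.cos (ρ * t) * goursatInner g x t s =
      ∫ r in (-π)..π, ∫ t in (-x)..x, Real.cos (ρ * t) *
        (if |r| ≤ s ∧ |r - t| ≤ x - s then g (s, |r|) else 0) := by
    simp only [goursatInner, ← intervalIntegral.integral_const_mul]
    rw [intervalIntegral.integral_of_le (by linarith : -x ≤ x),
      intervalIntegral.integral_of_le (neg_le_self Real.pi_nonneg)]
    simp only [intervalIntegral.integral_of_le (by linarith : -x ≤ x),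
      intervalIntegral.integral_of_le (neg_le_self Real.pi_nonneg)]
    refine integral_integral_swap (Integrable.of_bound (C := ‖g‖) ?_
      (Eventually.of_forall fun p => ?_))
    · refine Measurable.aestronglyMeasurable (Measurable.mul (by fun_prop) ?_)
      exact (measurable_goursatIntegrand g.continuous).comp
        (by fun_prop : Measurable fun p : ℝ × ℝ => (((x, p.1, s), p.2) : (ℝ × ℝ × ℝ) × ℝ))
    · rw [Function.uncurry, norm_mul]
      exact (mul_le_mul (Real.abs_cos_le_one _) (norm_goursatIntegrand_le (norm_nonneg g)
        (fun r => g.norm_coe_le_norm _) _) (norm_nonneg _) zero_le_one).trans (one_mul _).le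
  have h3 : ∀ r : ℝ, ∫ t in (-x)..x, Real.cos (ρ * t) *
        (if |r| ≤ s ∧ |r - t| ≤ x - s then g (s, |r|) else 0) =
      if -s ≤ r ∧ r ≤ s then 2 * (Real.sin (ρ * (x - s)) / ρ) *
        (g (s, |r|) * Real.cos (ρ * r)) else 0 := by
    intro r
    simp only [← abs_le]
    split_ifs with hr
    · have hr' := abs_le.1 hr
      have e : ∀ t, Real.cos (ρ * t) * (if |r| ≤ s ∧ |r - t| ≤ x - s then g (s, |r|) else 0) =
          if r - (x - s) ≤ t ∧ t ≤ r + (x - s) then Real.cos (ρ * t) * g (s, |r|) else 0 := by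
        intro t
        have : |r - t| ≤ x - s ↔ (r - (x - s) ≤ t ∧ t ≤ r + (x - s)) := by
          rw [abs_le]; constructor <;> rintro ⟨_, _⟩ <;> constructor <;> linarith
        simp [hr, this]
      simp only [e]
      rw [integral_ite_mem_Icc (by linarith [hr'.1]) (by linarith) (by linarith [hr'.2]),
        intervalIntegral.integral_mul_const, intervalIntegral.integral_comp_mul_left _ hρ,
        integral_cos, mul_add, mul_sub ρ r, Real.sin_add, Real.sin_sub (ρ * r), smul_eq_mul]
      field_simp; ring
    · simp [hr]
  have h4 : ∫ r in (-π)..π, (if -s ≤ r ∧ r ≤ s then 2 * (Real.sin (ρ * (x - s)) / ρ) *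
        (g (s, |r|) * Real.cos (ρ * r)) else 0) =
      2 * (2 * (Real.sin (ρ * (x - s)) / ρ) * ∫ r in (0 : ℝ)..s, g (s, r) * Real.cos (ρ * r)) := by
    rw [integral_ite_mem_Icc (by linarith) (by linarith) (by linarith),
      integral_symm_of_even (fun t => by rw [abs_neg, mul_neg, Real.cos_neg])
        (Continuous.intervalIntegrable (by fun_prop) _ _),
      intervalIntegral.integral_const_mul]
    congr 2
    refine intervalIntegral.integral_congr fun r hr => ?_
    rw [uIcc_of_le hs] at hr
    simp only [abs_of_nonneg hr.1]
  rw [h2] at h1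
  simp only [h3] at h1
  rw [h4] at h1
  linarith

variable {q : ℝ → ℝ}

/-- The double integral in the Goursat equation thus turns into the Duhamel term of the integral
equation for c(ρ, ·). -/
theorem integral_cos_mul_integral_goursatInner (hq : MemLp q 2 (volume.restrict (Ioc 0 π)))
    (g : ℝ × ℝ →ᵇ ℝ) {ρ : ℝ} (hρ : ρ ≠ 0) {x : ℝ} (hx : x ∈ Icc 0 π) :
    ∫ t in (0 : ℝ)..x, Real.cos (ρ * t) * (2⁻¹ * ∫ s in (0 : ℝ)..π, q s * goursatInner g x t s) =
      ∫ s in (0 : ℝ)..x, Real.sin (ρ * (x - s)) / ρ *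
        (q s * ∫ r in (0 : ℝ)..s, g (s, r) * Real.cos (ρ * r)) := by
  have hx' : x ∈ uIcc 0 π := by rwa [uIcc_zero_pi]
  have hint : Integrable (Function.uncurry fun t s => Real.cos (ρ * t) *
      (q s * goursatInner g x t s))
      ((volume.restrict (Ioc 0 x)).prod (volume.restrict (Ioc 0 π))) := by
    have hqi : Integrable q (volume.restrict (Ioc 0 π)) := hq.integrable (by norm_num)
    have hb := (integrable_const (μ := volume.restrict (Ioc 0 x)) (1 : ℝ)).mul_prod
      (hqi.norm.mul_const (2 * π * ‖g‖))
    refine hb.mono' ?_ (Eventually.of_forall fun p => ?_)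
    · have hm : AEStronglyMeasurable (fun p : ℝ × ℝ => q p.2)
          ((volume.restrict (Ioc 0 x)).prod (volume.restrict (Ioc 0 π))) := hq.1.comp_snd
      have hm2 : Measurable fun p : ℝ × ℝ => goursatInner g x p.1 p.2 :=
        (stronglyMeasurable_goursatInner g.continuous).measurable.comp
          (by fun_prop : Measurable fun p : ℝ × ℝ => ((x, p.1, p.2) : ℝ × ℝ × ℝ))
      exact (by fun_prop : Measurable fun p : ℝ × ℝ =>
        Real.cos (ρ * p.1)).aestronglyMeasurable.mul (hm.mul hm2.aestronglyMeasurable)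
    · rw [Function.uncurry, norm_mul, norm_mul]
      exact mul_le_mul (Real.abs_cos_le_one _) (mul_le_mul_of_nonneg_left
        (abs_goursatInner_le fun r => g.norm_coe_le_norm _) (norm_nonneg _)) (by positivity)
        zero_le_one
  have h1 : ∫ t in (0 : ℝ)..x, Real.cos (ρ * t) *
        (2⁻¹ * ∫ s in (0 : ℝ)..π, q s * goursatInner g x t s) =
      2⁻¹ * ∫ s in (0 : ℝ)..π, ∫ t in (0 : ℝ)..x, Real.cos (ρ * t) *
        (q s * goursatInner g x t s) := by
    have e : ∀ t, Real.cos (ρ * t) * (2⁻¹ * ∫ s in (0 : ℝ)..π, q s * goursatInner g x t s) =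
        2⁻¹ * ∫ s in (0 : ℝ)..π, Real.cos (ρ * t) * (q s * goursatInner g x t s) := fun t => by
      rw [intervalIntegral.integral_const_mul]; ring
    simp only [e]
    rw [intervalIntegral.integral_const_mul]
    simp only [intervalIntegral.integral_of_le hx.1, intervalIntegral.integral_of_le Real.pi_nonneg]
    rw [integral_integral_swap hint]
  have h2 : ∀ s, ∫ t in (0 : ℝ)..x, Real.cos (ρ * t) * (q s * goursatInner g x t s) =
      q s * ∫ t in (0 : ℝ)..x, Real.cos (ρ * t) * goursatInner g x t s := fun s => by
    rw [← intervalIntegral.integral_const_mul]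
    refine intervalIntegral.integral_congr fun t _ => ?_
    ring
  have hI : IntervalIntegrable (fun s => q s * ∫ t in (0 : ℝ)..x, Real.cos (ρ * t) *
      goursatInner g x t s) volume 0 π := by
    have := hint.swap.integral_prod_left
    rw [intervalIntegrable_iff_integrableOn_Ioc_of_le Real.pi_nonneg]
    refine this.congr (Eventually.of_forall fun s => ?_)
    beta_reduce
    rw [← h2, intervalIntegral.integral_of_le hx.1]
    rfl
  have h3 : ∫ s in x..π, q s * ∫ t in (0 : ℝ)..x, Real.cos (ρ * t) * goursatInner g x t s = 0 := by
    refine intervalIntegral.integral_zero_ae (Eventually.of_forall fun s hs => ?_)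
    rw [uIoc_of_le hx.2] at hs
    simp [goursatInner_eq_zero hs.1]
  rw [h1]
  simp only [h2]
  rw [← intervalIntegral.integral_add_adjacent_intervals
    (hI.mono_set (uIcc_subset_uIcc left_mem_uIcc hx'))
    (hI.mono_set (uIcc_subset_uIcc hx' right_mem_uIcc)), h3, add_zero,
    ← intervalIntegral.integral_const_mul]
  refine intervalIntegral.integral_congr fun s hs => ?_
  rw [uIcc_of_le hx.1] at hs
  rw [integral_cos_mul_goursatInner g hρ hs.1 hs.2 hx.2]; ring

/-- The reflection t ↦ -t joins the two primitives into one integral over [-x, x]. The substitution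
s = (x + t)/2 and integration by parts against the primitive of q leave sin ρx - sin ρ(2s - x),
which factors as 2 sin ρ(x - s) cos ρs. -/
theorem integral_cos_mul_primitive (hq : IntervalIntegrable q volume 0 π) {ρ : ℝ} (hρ : ρ ≠ 0)
    {x : ℝ} (hx : x ∈ Icc 0 π) :
    ∫ t in (0 : ℝ)..x, Real.cos (ρ * t) * (2⁻¹ * ((∫ s in (0 : ℝ)..(x + t) / 2, q s) +
        ∫ s in (0 : ℝ)..(x - t) / 2, q s)) =
      ∫ s in (0 : ℝ)..x, Real.sin (ρ * (x - s)) / ρ * (q s * Real.cos (ρ * s)) := by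
  have hq' := intervalIntegrable_mono_pi hq hx
  set Q : ℝ → ℝ := fun y => ∫ s in (0 : ℝ)..clamp y, q s with hQdef
  have hQ : Continuous Q := continuous_primitive_clamp hq
  have hQe : ∀ y ∈ Icc 0 π, ∫ s in (0 : ℝ)..y, q s = Q y := fun y hy => by
    rw [hQdef]; simp only [clamp_of_mem hy]
  have h1 : ∫ t in (0 : ℝ)..x, Real.cos (ρ * t) * (2⁻¹ * ((∫ s in (0 : ℝ)..(x + t) / 2, q s) +
        ∫ s in (0 : ℝ)..(x - t) / 2, q s)) =
      2⁻¹ * ((∫ t in (0 : ℝ)..x, Real.cos (ρ * t) * Q ((x + t) / 2)) +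
        ∫ t in (0 : ℝ)..x, Real.cos (ρ * t) * Q ((x - t) / 2)) := by
    rw [← intervalIntegral.integral_add (Continuous.intervalIntegrable (by fun_prop) _ _)
      (Continuous.intervalIntegrable (by fun_prop) _ _), ← intervalIntegral.integral_const_mul]
    refine intervalIntegral.integral_congr fun t ht => ?_
    rw [uIcc_of_le hx.1] at ht
    rw [hQe ((x + t) / 2) ⟨by linarith [hx.1, ht.1], by linarith [hx.2, ht.2]⟩,
      hQe ((x - t) / 2) ⟨by linarith [ht.2], by linarith [hx.2, ht.1, hx.1]⟩]
    ring
  have h2 : ∫ t in (0 : ℝ)..x, Real.cos (ρ * t) * Q ((x - t) / 2) =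
      ∫ t in (-x)..0, Real.cos (ρ * t) * Q ((x + t) / 2) := by
    have := intervalIntegral.integral_comp_neg (a := 0) (b := x)
      (fun t => Real.cos (ρ * t) * Q ((x + t) / 2))
    rw [neg_zero] at this
    rw [← this]
    refine intervalIntegral.integral_congr fun t _ => ?_
    simp only [mul_neg, Real.cos_neg, sub_eq_add_neg]
  have hcont : Continuous fun t => Real.cos (ρ * t) * Q ((x + t) / 2) := by fun_prop
  have h3 : ∫ t in (-x)..x, Real.cos (ρ * t) * Q ((x + t) / 2) =
      2 * ∫ s in (0 : ℝ)..x, Real.cos (ρ * (2 * s - x)) * Q s := by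
    have := intervalIntegral.mul_integral_comp_mul_add (a := 0) (b := x)
      (f := fun t => Real.cos (ρ * t) * Q ((x + t) / 2)) 2 (-x)
    rw [show 2 * 0 + -x = -x by ring, show 2 * x + -x = x by ring] at this
    rw [← this]
    congr 1
    refine intervalIntegral.integral_congr fun s _ => ?_
    rw [show (x + (2 * s + -x)) / 2 = s by ring, sub_eq_add_neg]
  have hac : AbsolutelyContinuousOnInterval
      (fun s => (∫ r in (0 : ℝ)..s, q r) * (Real.sin (ρ * (2 * s - x)) / (2 * ρ))) 0 x :=
    (hq'.absolutelyContinuousOnInterval_intervalIntegral left_mem_uIcc).mul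
      (ContDiffOn.absolutelyContinuousOnInterval (ContDiff.contDiffOn (by fun_prop)))
  have hd : ∀ᵐ s, s ∈ uIcc 0 x → HasDerivAt
      (fun s => (∫ r in (0 : ℝ)..s, q r) * (Real.sin (ρ * (2 * s - x)) / (2 * ρ)))
      (q s * (Real.sin (ρ * (2 * s - x)) / (2 * ρ)) +
        (∫ r in (0 : ℝ)..s, q r) * Real.cos (ρ * (2 * s - x))) s := by
    filter_upwards [hq'.ae_hasDerivAt_integral] with s hs hsm
    have e : HasDerivAt (fun s => Real.sin (ρ * (2 * s - x)) / (2 * ρ))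
        (Real.cos (ρ * (2 * s - x))) s := by
      have := (((((hasDerivAt_id s).const_mul 2).sub_const x).const_mul ρ).sin).div_const (2 * ρ)
      refine this.congr_deriv ?_
      simp only [id]; field_simp
    exact (hs hsm 0 left_mem_uIcc).mul e
  have h4 : ∫ s in (0 : ℝ)..x, (q s * (Real.sin (ρ * (2 * s - x)) / (2 * ρ)) +
      Real.cos (ρ * (2 * s - x)) * Q s) = Q x * (Real.sin (ρ * x) / (2 * ρ)) := by
    have h5 := hac.integral_deriv_eq_sub
    rw [intervalIntegral.integral_same, zero_mul, sub_zero, show 2 * x - x = x by ring,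
      hQe x hx] at h5
    rw [← h5]
    refine intervalIntegral.integral_congr_ae ?_
    filter_upwards [hd] with s hs hsm
    have hsm' := uIoc_subset_uIcc hsm
    rw [(hs hsm').deriv]
    rw [uIcc_of_le hx.1] at hsm'
    rw [hQe s ⟨hsm'.1, hsm'.2.trans hx.2⟩, mul_comm (Q s)]
  have hi1 : IntervalIntegrable (fun s => q s * (Real.sin (ρ * (2 * s - x)) / (2 * ρ)))
      volume 0 x := hq'.mul_continuousOn (by fun_prop)
  rw [intervalIntegral.integral_add hi1 (Continuous.intervalIntegrable (by fun_prop) _ _)] at h4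
  rw [h1, h2, add_comm, intervalIntegral.integral_add_adjacent_intervals
    (hcont.intervalIntegrable _ _) (hcont.intervalIntegrable _ _), h3]
  have h6 : Q x * (Real.sin (ρ * x) / (2 * ρ)) =
      ∫ s in (0 : ℝ)..x, q s * (Real.sin (ρ * x) / (2 * ρ)) := by
    rw [intervalIntegral.integral_mul_const, hQe x hx]
  have h7 : ∫ s in (0 : ℝ)..x, Real.sin (ρ * (x - s)) / ρ * (q s * Real.cos (ρ * s)) =
      (∫ s in (0 : ℝ)..x, q s * (Real.sin (ρ * x) / (2 * ρ))) -
        ∫ s in (0 : ℝ)..x, q s * (Real.sin (ρ * (2 * s - x)) / (2 * ρ)) := by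
    rw [← intervalIntegral.integral_sub (hq'.mul_const _) hi1]
    refine intervalIntegral.integral_congr fun s _ => ?_
    have e1 : Real.sin (ρ * x) = Real.sin (ρ * (x - s)) * Real.cos (ρ * s) +
        Real.cos (ρ * (x - s)) * Real.sin (ρ * s) := by rw [← Real.sin_add]; congr 1; ring
    have e2 : Real.sin (ρ * (2 * s - x)) = Real.sin (ρ * s) * Real.cos (ρ * (x - s)) -
        Real.cos (ρ * s) * Real.sin (ρ * (x - s)) := by rw [← Real.sin_sub]; congr 1; ring
    rw [e1, e2]
    field_simp; ring
  rw [h7, ← h6, ← h4]; ring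

/-- The transmuted cosine solves the integral equation of the Cauchy problem. -/
theorem volterra_equation_of_goursat (hq : MemLp q 2 (volume.restrict (Ioc 0 π))) {h : ℝ}
    {g : ℝ × ℝ →ᵇ ℝ} (hg : ∀ x ∈ Icc 0 π, ∀ t ∈ Icc 0 x,
      g (x, t) = h + 2⁻¹ * ((∫ s in (0 : ℝ)..(x + t) / 2, q s) + ∫ s in (0 : ℝ)..(x - t) / 2, q s)
        + 2⁻¹ * ∫ s in (0 : ℝ)..π, q s * goursatInner g x t s)
    {ρ : ℝ} (hρ : ρ ≠ 0) {x : ℝ} (hx : x ∈ Icc 0 π) :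
    ∫ t in (0 : ℝ)..x, g (x, t) * Real.cos (ρ * t) =
      h * (Real.sin (ρ * x) / ρ) + ∫ s in (0 : ℝ)..x, Real.sin (ρ * (x - s)) / ρ *
        (q s * (Real.cos (ρ * s) + ∫ t in (0 : ℝ)..s, g (s, t) * Real.cos (ρ * t))) := by
  have hq1 := intervalIntegrable_of_memLp hq
  have hq' := intervalIntegrable_mono_pi hq1 hx
  have hc1 : ContinuousOn (fun t => Real.cos (ρ * t) * (2⁻¹ * ((∫ s in (0 : ℝ)..(x + t) / 2, q s) +
        ∫ s in (0 : ℝ)..(x - t) / 2, q s))) (Icc 0 x) := by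
    have hQ := continuous_primitive_clamp hq1
    have : Continuous fun t => Real.cos (ρ * t) * (2⁻¹ *
        ((∫ s in (0 : ℝ)..clamp ((x + t) / 2), q s) +
        ∫ s in (0 : ℝ)..clamp ((x - t) / 2), q s)) :=
      (by fun_prop : Continuous fun t => Real.cos (ρ * t)).mul (continuous_const.mul
        ((hQ.comp (by fun_prop : Continuous fun t => (x + t) / 2)).add
          (hQ.comp (by fun_prop : Continuous fun t => (x - t) / 2))))
    refine this.continuousOn.congr fun t ht => ?_
    beta_reduce
    rw [clamp_of_mem (x := (x + t) / 2) ⟨by linarith [hx.1, ht.1], by linarith [hx.2, ht.2]⟩,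
      clamp_of_mem (x := (x - t) / 2) ⟨by linarith [ht.2], by linarith [hx.2, ht.1, hx.1]⟩]
  have hc2 : Continuous fun t => Real.cos (ρ * t) *
      (2⁻¹ * ∫ s in (0 : ℝ)..π, q s * goursatInner g x t s) := by
    have h1 : Continuous fun t => goursatOperator hq g (x, t) :=
      (goursatOperator hq g).continuous.comp (by fun_prop)
    simp only [goursatOperator_apply, clamp_of_mem hx] at h1
    exact (by fun_prop : Continuous fun t => Real.cos (ρ * t)).mul h1
  have hi1 : IntervalIntegrable (fun t => Real.cos (ρ * t) *
      (2⁻¹ * ((∫ s in (0 : ℝ)..(x + t) / 2, q s) + ∫ s in (0 : ℝ)..(x - t) / 2, q s)))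
      volume 0 x := ContinuousOn.intervalIntegrable (by rwa [uIcc_of_le hx.1])
  have h1 : ∫ t in (0 : ℝ)..x, g (x, t) * Real.cos (ρ * t) =
      ∫ t in (0 : ℝ)..x, ((h * Real.cos (ρ * t) + Real.cos (ρ * t) *
        (2⁻¹ * ((∫ s in (0 : ℝ)..(x + t) / 2, q s) + ∫ s in (0 : ℝ)..(x - t) / 2, q s))) +
        Real.cos (ρ * t) * (2⁻¹ * ∫ s in (0 : ℝ)..π, q s * goursatInner g x t s)) := by
    refine intervalIntegral.integral_congr fun t ht => ?_
    rw [uIcc_of_le hx.1] at ht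
    rw [hg x hx t ht]; ring
  have hi0 : IntervalIntegrable (fun t => h * Real.cos (ρ * t)) volume 0 x :=
    Continuous.intervalIntegrable (by fun_prop) _ _
  rw [h1, intervalIntegral.integral_add (hi0.add hi1) (hc2.intervalIntegrable _ _),
    intervalIntegral.integral_add hi0 hi1, integral_cos_mul_primitive hq1 hρ hx,
    integral_cos_mul_integral_goursatInner hq g hρ hx, intervalIntegral.integral_const_mul,
    intervalIntegral.integral_comp_mul_left _ hρ, integral_cos]
  have hG : Continuous fun s => ∫ r in (0 : ℝ)..s, g (s, r) * Real.cos (ρ * r) :=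
    intervalIntegral.continuous_parametric_intervalIntegral_of_continuous
      (by fun_prop) continuous_id
  have hk : Continuous fun s => Real.sin (ρ * (x - s)) / ρ := by fun_prop
  rw [add_assoc, ← intervalIntegral.integral_add]
  · congr 1
    · simp only [mul_zero, Real.sin_zero, sub_zero, smul_eq_mul]; ring
    · refine intervalIntegral.integral_congr fun s _ => ?_
      ring
  · exact (hq'.mul_continuousOn (by fun_prop)).continuousOn_mul hk.continuousOn
  · exact (hq'.mul_continuousOn hG.continuousOn).continuousOn_mul hk.continuousOn

end SturmLiouville

end

section

namespace SturmLiouville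

/-! ### Volterra operators with continuous kernels -/

/-- The triangle is a retract of the plane, so composing with the retraction extends the kernel.
Continuity and Fubini statements can then be taken from kernels continuous everywhere. -/
theorem exists_extension_of_continuousOn_triangle {G : ℝ → ℝ → ℝ}
    (hG : ContinuousOn (Function.uncurry G) triangle) :
    ∃ g : ℝ × ℝ →ᵇ ℝ, ∀ x ∈ Icc 0 π, ∀ t ∈ Icc 0 x, g (x, t) = G x t := by
  let pr : ℝ × ℝ → ℝ × ℝ := fun p => (clamp p.1, min (clamp p.2) (clamp p.1))
  have hpr : Continuous pr := (continuous_clamp.comp continuous_fst).prodMk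
    ((continuous_clamp.comp continuous_snd).min (continuous_clamp.comp continuous_fst))
  have hmem : ∀ p, pr p ∈ triangle := fun p =>
    ⟨le_min (clamp_mem _).1 (clamp_mem _).1, min_le_right _ _, (clamp_mem _).2⟩
  have hcompact : IsCompact triangle := by
    refine (isCompact_Icc.prod isCompact_Icc : IsCompact (Icc 0 π ×ˢ Icc 0 π)).of_isClosed_subset
      ?_ fun p hp => ⟨⟨hp.1.trans hp.2.1, hp.2.2⟩, hp.1, hp.2.1.trans hp.2.2⟩
    exact (isClosed_le continuous_const continuous_snd).inter
      ((isClosed_le continuous_snd continuous_fst).inter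
        (isClosed_le continuous_fst continuous_const))
  obtain ⟨C, hC⟩ := hcompact.exists_bound_of_continuousOn hG
  refine ⟨BoundedContinuousFunction.ofNormedAddCommGroup (fun p => Function.uncurry G (pr p))
    (hG.comp_continuous hpr hmem) C fun p => hC _ (hmem p), fun x hx t ht => ?_⟩
  simp only [BoundedContinuousFunction.coe_ofNormedAddCommGroup, pr]
  rw [clamp_of_mem hx, clamp_of_mem ⟨ht.1, ht.2.trans hx.2⟩, min_eq_left ht.2]
  rfl

theorem continuousOn_triangle (g : ℝ × ℝ →ᵇ ℝ) :
    ContinuousOn (Function.uncurry fun x t => g (x, t)) triangle :=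
  g.continuous.continuousOn

section Volterra

variable {G : ℝ → ℝ → ℝ} {u u₁ u₂ : ℝ → ℂ}

theorem continuousOn_kernel_right (hG : ContinuousOn (Function.uncurry G) triangle) {x : ℝ}
    (hx : x ∈ Icc 0 π) : ContinuousOn (fun t => (G x t : ℂ)) (Icc 0 x) := by
  obtain ⟨g, hg⟩ := exists_extension_of_continuousOn_triangle hG
  have : Continuous fun t => (g (x, t) : ℂ) := by fun_prop
  exact this.continuousOn.congr fun t ht => by
    beta_reduce; rw [hg x hx t ht]

theorem intervalIntegrable_kernel_mul (hG : ContinuousOn (Function.uncurry G) triangle)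
    (hu : ContinuousOn u (Icc 0 π)) {x : ℝ} (hx : x ∈ Icc 0 π) :
    IntervalIntegrable (fun s => (G x s : ℂ) * u s) volume 0 x := by
  refine ContinuousOn.intervalIntegrable ?_
  rw [uIcc_of_le hx.1]
  exact (continuousOn_kernel_right hG hx).mul (hu.mono (Icc_subset_Icc_right hx.2))

theorem continuousOn_volterra (hG : ContinuousOn (Function.uncurry G) triangle)
    (hu : ContinuousOn u (Icc 0 π)) : ContinuousOn (volterra G u) (Icc 0 π) := by
  obtain ⟨g, hg⟩ := exists_extension_of_continuousOn_triangle hG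
  have hc : Continuous fun s => u (clamp s) := hu.comp_continuous continuous_clamp clamp_mem
  have h1 : Continuous fun x => u (clamp x) + ∫ s in (0 : ℝ)..x, (g (x, s) : ℂ) * u (clamp s) :=
    hc.add (intervalIntegral.continuous_parametric_intervalIntegral_of_continuous
      (((Complex.continuous_ofReal.comp g.continuous)).mul (hc.comp continuous_snd))
      continuous_id)
  refine h1.continuousOn.congr fun x hx => ?_
  beta_reduce
  rw [volterra, clamp_of_mem hx]
  congr 1
  refine intervalIntegral.integral_congr fun s hs => ?_
  rw [uIcc_of_le hx.1] at hs
  rw [hg x hx s hs, clamp_of_mem ⟨hs.1, hs.2.trans hx.2⟩]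

theorem volterra_congr (h : ∀ x ∈ Icc 0 π, u₁ x = u₂ x) {x : ℝ} (hx : x ∈ Icc 0 π) :
    volterra G u₁ x = volterra G u₂ x := by
  rw [volterra, volterra, h x hx]
  congr 1
  refine intervalIntegral.integral_congr fun s hs => ?_
  rw [uIcc_of_le hx.1] at hs
  rw [h s ⟨hs.1, hs.2.trans hx.2⟩]

/-- Linearity is packed into the single combination u₁ - k u₂; sums, multiples and differences are
all read off from it. -/
theorem volterra_sub_mul (hG : ContinuousOn (Function.uncurry G) triangle)
    (hu₁ : ContinuousOn u₁ (Icc 0 π)) (hu₂ : ContinuousOn u₂ (Icc 0 π)) (k : ℂ) {x : ℝ}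
    (hx : x ∈ Icc 0 π) :
    volterra G (fun s => u₁ s - k * u₂ s) x = volterra G u₁ x - k * volterra G u₂ x := by
  have e : ∀ s, (G x s : ℂ) * (u₁ s - k * u₂ s) = G x s * u₁ s - k * (G x s * u₂ s) :=
    fun s => by ring
  simp only [volterra, e]
  rw [intervalIntegral.integral_sub (intervalIntegrable_kernel_mul hG hu₁ hx)
    ((intervalIntegrable_kernel_mul hG hu₂ hx).const_mul k), intervalIntegral.integral_const_mul]
  ring

theorem volterra_const_mul (k : ℂ) (x : ℝ) :
    volterra G (fun s => k * u s) x = k * volterra G u x := by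
  have e : ∀ s, (G x s : ℂ) * (k * u s) = k * (G x s * u s) := fun s => by ring
  simp only [volterra, e]
  rw [intervalIntegral.integral_const_mul]
  ring

theorem volterra_at_zero : volterra G u 0 = u 0 := by simp [volterra]

theorem exists_volterra_bound (hG : ContinuousOn (Function.uncurry G) triangle) :
    ∃ C : ℝ, 0 < C ∧ ∀ u : ℝ → ℂ, ∀ M : ℝ, (∀ x ∈ Icc 0 π, ‖u x‖ ≤ M) →
      ∀ x ∈ Icc 0 π, ‖volterra G u x‖ ≤ C * M := by
  obtain ⟨g, hg⟩ := exists_extension_of_continuousOn_triangle hG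
  refine ⟨1 + ‖g‖ * π, by positivity, fun u M hM x hx => ?_⟩
  have h0 : 0 ≤ M := (norm_nonneg _).trans (hM x hx)
  have h1 : ‖∫ s in (0 : ℝ)..x, (G x s : ℂ) * u s‖ ≤ ‖g‖ * M * |x - 0| := by
    refine intervalIntegral.norm_integral_le_of_norm_le_const fun s hs => ?_
    rw [uIoc_of_le hx.1] at hs
    have hs' : s ∈ Icc 0 x := ⟨hs.1.le, hs.2⟩
    rw [norm_mul, ← hg x hx s hs', Complex.norm_real]
    exact mul_le_mul (g.norm_coe_le_norm _) (hM s ⟨hs'.1, hs'.2.trans hx.2⟩) (norm_nonneg _)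
      (norm_nonneg _)
  rw [sub_zero, abs_of_nonneg hx.1] at h1
  have h2 : ‖g‖ * M * x ≤ ‖g‖ * M * π := mul_le_mul_of_nonneg_left hx.2 (by positivity)
  calc ‖volterra G u x‖ ≤ ‖u x‖ + ‖∫ s in (0 : ℝ)..x, (G x s : ℂ) * u s‖ := norm_add_le _ _
    _ ≤ M + ‖g‖ * M * π := add_le_add (hM x hx) (h1.trans h2)
    _ = _ := by ring

end Volterra

/-! ### The intertwining relation -/

section Defect

variable {q : ℝ → ℝ} {h : ℝ} {G : ℝ → ℝ → ℝ} {u u₁ u₂ w w₁ w₂ : ℝ → ℂ}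

/-- The integrand of the twice integrated intertwining relation. -/
def transmutedSource (q : ℝ → ℝ) (G : ℝ → ℝ → ℝ) (u w : ℝ → ℂ) (r : ℝ) : ℂ :=
  (q r : ℂ) * volterra G u r + volterra G w r

/-- The defect in the twice integrated intertwining relation `(Tu)'' - q Tu = T w`. -/
def defect (q : ℝ → ℝ) (h : ℝ) (G : ℝ → ℝ → ℝ) (u w : ℝ → ℂ) (x : ℝ) : ℂ :=
  volterra G u x - (u 0 + h * u 0 * x +
    ∫ s in (0 : ℝ)..x, ∫ r in (0 : ℝ)..s, transmutedSource q G u w r)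

theorem intervalIntegrable_transmutedSource (hq : MemLp q 2 (volume.restrict (Ioc 0 π)))
    (hG : ContinuousOn (Function.uncurry G) triangle)
    (hu : ContinuousOn u (Icc 0 π)) (hw : ContinuousOn w (Icc 0 π)) :
    IntervalIntegrable (transmutedSource q G u w) volume 0 π := by
  have hq1 : IntervalIntegrable (fun r => (q r : ℂ)) volume 0 π :=
    ⟨(intervalIntegrable_of_memLp hq).1.ofReal, (intervalIntegrable_of_memLp hq).2.ofReal⟩
  refine (hq1.mul_continuousOn ?_).add (intervalIntegrable_of_continuousOn
    (continuousOn_volterra hG hw))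
  rw [uIcc_zero_pi]
  exact continuousOn_volterra hG hu

theorem continuousOn_primitive {E : Type*} [NormedAddCommGroup E] [NormedSpace ℝ E] {v : ℝ → E}
    (hv : IntervalIntegrable v volume 0 π) :
    ContinuousOn (fun s => ∫ r in (0 : ℝ)..s, v r) (Icc 0 π) := by
  have := intervalIntegral.continuousOn_primitive_interval' hv left_mem_uIcc
  rwa [uIcc_zero_pi] at this

theorem defect_sub_mul (hq : MemLp q 2 (volume.restrict (Ioc 0 π)))
    (hG : ContinuousOn (Function.uncurry G) triangle)
    (hu₁ : ContinuousOn u₁ (Icc 0 π)) (hw₁ : ContinuousOn w₁ (Icc 0 π))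
    (hu₂ : ContinuousOn u₂ (Icc 0 π)) (hw₂ : ContinuousOn w₂ (Icc 0 π)) (k : ℂ) {x : ℝ}
    (hx : x ∈ Icc 0 π) :
    defect q h G (fun s => u₁ s - k * u₂ s) (fun s => w₁ s - k * w₂ s) x =
      defect q h G u₁ w₁ x - k * defect q h G u₂ w₂ x := by
  have i1 := intervalIntegrable_transmutedSource hq hG hu₁ hw₁
  have i2 := intervalIntegrable_transmutedSource hq hG hu₂ hw₂
  have e : ∫ s in (0 : ℝ)..x, ∫ r in (0 : ℝ)..s, transmutedSource q G
      (fun s => u₁ s - k * u₂ s) (fun s => w₁ s - k * w₂ s) r =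
      (∫ s in (0 : ℝ)..x, ∫ r in (0 : ℝ)..s, transmutedSource q G u₁ w₁ r) -
        k * ∫ s in (0 : ℝ)..x, ∫ r in (0 : ℝ)..s, transmutedSource q G u₂ w₂ r := by
    rw [← intervalIntegral.integral_const_mul, ← intervalIntegral.integral_sub
      (intervalIntegrable_mono_pi (intervalIntegrable_of_continuousOn
        (continuousOn_primitive i1)) hx)
      ((intervalIntegrable_mono_pi (intervalIntegrable_of_continuousOn
        (continuousOn_primitive i2)) hx).const_mul k)]
    refine intervalIntegral.integral_congr fun s hs => ?_
    rw [uIcc_of_le hx.1] at hs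
    have hs' : s ∈ Icc 0 π := ⟨hs.1, hs.2.trans hx.2⟩
    rw [← intervalIntegral.integral_const_mul, ← intervalIntegral.integral_sub
      (intervalIntegrable_mono_pi i1 hs') ((intervalIntegrable_mono_pi i2 hs').const_mul k)]
    refine intervalIntegral.integral_congr fun r hr => ?_
    rw [uIcc_of_le hs.1] at hr
    have hr' : r ∈ Icc 0 π := ⟨hr.1, hr.2.trans hs'.2⟩
    simp only [transmutedSource]
    rw [volterra_sub_mul hG hu₁ hu₂ k hr', volterra_sub_mul hG hw₁ hw₂ k hr']
    ring
  rw [defect, defect, defect, e, volterra_sub_mul hG hu₁ hu₂ k hx]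
  ring

/-- The bound involves only the sup norms of u and w because the relation has been integrated twice.
This is what allows the intertwining relation to pass to uniform limits. -/
theorem exists_defect_bound (hq : MemLp q 2 (volume.restrict (Ioc 0 π))) (h : ℝ)
    (hG : ContinuousOn (Function.uncurry G) triangle) :
    ∃ C : ℝ, 0 < C ∧ ∀ u w : ℝ → ℂ, ContinuousOn u (Icc 0 π) → ContinuousOn w (Icc 0 π) →
      ∀ M : ℝ, (∀ x ∈ Icc 0 π, ‖u x‖ ≤ M) → (∀ x ∈ Icc 0 π, ‖w x‖ ≤ M) →
      ∀ x ∈ Icc 0 π, ‖defect q h G u w x‖ ≤ C * M := by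
  obtain ⟨C, hC, hb⟩ := exists_volterra_bound hG
  have hq1 := (intervalIntegrable_of_memLp hq).abs
  set B := ∫ r in (0 : ℝ)..π, (|q r| + 1) with hB
  have hB0 : 0 ≤ B := intervalIntegral.integral_nonneg Real.pi_nonneg fun s _ => by positivity
  refine ⟨C + (1 + |h| * π + B * C * π), by positivity, fun u w hu hw M hM hM' x hx => ?_⟩
  have h0 : 0 ≤ M := (norm_nonneg _).trans (hM x hx)
  have i1 := intervalIntegrable_transmutedSource hq hG hu hw
  have h1 : ∀ s ∈ Icc 0 π, ‖∫ r in (0 : ℝ)..s, transmutedSource q G u w r‖ ≤ B * (C * M) := by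
    intro s hs
    refine (intervalIntegral.norm_integral_le_integral_norm hs.1).trans ?_
    have : ∫ r in (0 : ℝ)..s, ‖transmutedSource q G u w r‖ ≤
        ∫ r in (0 : ℝ)..s, (|q r| + 1) * (C * M) := by
      refine intervalIntegral.integral_mono_on hs.1 (intervalIntegrable_mono_pi i1 hs).norm
        (intervalIntegrable_mono_pi ((hq1.add intervalIntegrable_const).mul_const _) hs)
        fun r hr => ?_
      have hr' : r ∈ Icc 0 π := ⟨hr.1, hr.2.trans hs.2⟩
      refine (norm_add_le _ _).trans ?_
      rw [norm_mul, Complex.norm_real, Real.norm_eq_abs, add_mul, one_mul]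
      exact add_le_add (mul_le_mul_of_nonneg_left (hb u M hM r hr') (abs_nonneg _))
        (hb w M hM' r hr')
    refine this.trans ?_
    rw [intervalIntegral.integral_mul_const]
    exact mul_le_mul_of_nonneg_right (intervalIntegral.integral_mono_interval le_rfl hs.1 hs.2
      (Eventually.of_forall fun r => by simp only [Pi.zero_apply]; positivity)
      (hq1.add intervalIntegrable_const)) (by positivity)
  have h2 : ‖∫ s in (0 : ℝ)..x, ∫ r in (0 : ℝ)..s, transmutedSource q G u w r‖ ≤
      B * (C * M) * |x - 0| := by
    refine intervalIntegral.norm_integral_le_of_norm_le_const fun s hs => ?_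
    rw [uIoc_of_le hx.1] at hs
    exact h1 s ⟨hs.1.le, hs.2.trans hx.2⟩
  rw [sub_zero, abs_of_nonneg hx.1] at h2
  have h3 : ‖(h : ℂ) * u 0 * x‖ ≤ |h| * M * π := by
    rw [norm_mul, norm_mul, Complex.norm_real, Complex.norm_real, Real.norm_eq_abs,
      Real.norm_eq_abs, abs_of_nonneg hx.1]
    exact mul_le_mul (mul_le_mul_of_nonneg_left (hM 0 zero_mem_Icc_pi) (abs_nonneg _)) hx.2 hx.1
      (by positivity)
  have h4 : B * (C * M) * x ≤ B * (C * M) * π := mul_le_mul_of_nonneg_left hx.2 (by positivity)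
  calc ‖defect q h G u w x‖ ≤ ‖volterra G u x‖ + (‖u 0‖ + ‖(h : ℂ) * u 0 * x‖ +
        ‖∫ s in (0 : ℝ)..x, ∫ r in (0 : ℝ)..s, transmutedSource q G u w r‖) :=
        (norm_sub_le _ _).trans (add_le_add_right (norm_add₃_le) _)
    _ ≤ C * M + (M + |h| * M * π + B * (C * M) * π) :=
        add_le_add (hb u M hM x hx) (add_le_add (add_le_add (hM 0 zero_mem_Icc_pi) h3)
          (h2.trans h4))
    _ = _ := by ring

theorem hasSecondDeriv_of_defect (hq : MemLp q 2 (volume.restrict (Ioc 0 π)))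
    (hG : ContinuousOn (Function.uncurry G) triangle)
    (hu : ContinuousOn u (Icc 0 π)) (hw : ContinuousOn w (Icc 0 π))
    (hD : ∀ x ∈ Icc 0 π, defect q h G u w x = 0) :
    HasSecondDeriv (volterra G u)
      (fun x => h * u 0 + ∫ r in (0 : ℝ)..x, transmutedSource q G u w r)
      (transmutedSource q G u w) := by
  have i1 := intervalIntegrable_transmutedSource hq hG hu hw
  refine HasSecondDeriv.of_integral i1 (fun x hx => by simp) fun x hx => ?_
  have := hD x hx
  rw [defect, sub_eq_zero] at this
  rw [this, volterra_at_zero, intervalIntegral.integral_add intervalIntegrable_const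
    (intervalIntegrable_mono_pi (intervalIntegrable_of_continuousOn
      (continuousOn_primitive i1)) hx)]
  simp; ring

end Defect

end SturmLiouville

end

/-! ### Variation of constants, and the intertwining relation on cosines. -/

section

namespace SturmLiouville

theorem hasDerivAt_cos_mul (ρ : ℂ) (x : ℝ) :
    HasDerivAt (fun x : ℝ => Complex.cos (ρ * x)) (-(ρ * Complex.sin (ρ * x))) x := by
  have h1 : HasDerivAt (fun z : ℂ => Complex.cos (ρ * z)) (-(ρ * Complex.sin (ρ * x))) (x : ℂ) :=
    (((hasDerivAt_id (x : ℂ)).const_mul ρ).ccos).congr_deriv (by simp only [id]; ring)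
  exact h1.comp_ofReal

theorem hasDerivAt_sin_mul (ρ : ℂ) (x : ℝ) :
    HasDerivAt (fun x : ℝ => Complex.sin (ρ * x)) (ρ * Complex.cos (ρ * x)) x := by
  have h1 : HasDerivAt (fun z : ℂ => Complex.sin (ρ * z)) (ρ * Complex.cos (ρ * x)) (x : ℂ) :=
    (((hasDerivAt_id (x : ℂ)).const_mul ρ).csin).congr_deriv (by simp only [id]; ring)
  exact h1.comp_ofReal

theorem contDiff_cos_mul (ρ : ℂ) {n : WithTop ℕ∞} :
    ContDiff ℝ n fun x : ℝ => Complex.cos (ρ * x) :=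
  (Complex.contDiff_cos.comp (contDiff_const.mul contDiff_id)).restrict_scalars ℝ |>.comp
    Complex.ofRealCLM.contDiff

theorem contDiff_sin_mul (ρ : ℂ) {n : WithTop ℕ∞} :
    ContDiff ℝ n fun x : ℝ => Complex.sin (ρ * x) :=
  (Complex.contDiff_sin.comp (contDiff_const.mul contDiff_id)).restrict_scalars ℝ |>.comp
    Complex.ofRealCLM.contDiff

theorem absCont_cos_mul (ρ : ℂ) :
    AbsolutelyContinuousOnInterval (fun x : ℝ => Complex.cos (ρ * x)) 0 π :=
  (contDiff_cos_mul ρ).contDiffOn.absolutelyContinuousOnInterval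

theorem absCont_sin_mul (ρ : ℂ) :
    AbsolutelyContinuousOnInterval (fun x : ℝ => Complex.sin (ρ * x)) 0 π :=
  (contDiff_sin_mul ρ).contDiffOn.absolutelyContinuousOnInterval

theorem HasSecondDeriv.add {y y' w z z' v : ℝ → ℂ} (hy : HasSecondDeriv y y' w)
    (hz : HasSecondDeriv z z' v) :
    HasSecondDeriv (fun x => y x + z x) (fun x => y' x + z' x) (fun x => w x + v x) :=
  ⟨fun x hx => (hy.deriv x hx).add (hz.deriv x hx), hy.absCont.add hz.absCont, by
    filter_upwards [hy.deriv_ae, hz.deriv_ae] with x h1 h2 using h1.add h2⟩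

theorem hasSecondDeriv_cos (ρ : ℂ) : HasSecondDeriv (fun x : ℝ => Complex.cos (ρ * x))
    (fun x : ℝ => -(ρ * Complex.sin (ρ * x))) (fun x : ℝ => -(ρ ^ 2 * Complex.cos (ρ * x))) :=
  .of_hasDerivAt (hasDerivAt_cos_mul ρ)
    (fun x => (((hasDerivAt_sin_mul ρ x).const_mul ρ).neg).congr_deriv (by ring))
    (continuous_const.mul (contDiff_cos_mul ρ (n := 0)).continuous).neg

theorem hasSecondDeriv_sin (ρ : ℂ) : HasSecondDeriv (fun x : ℝ => Complex.sin (ρ * x))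
    (fun x : ℝ => ρ * Complex.cos (ρ * x)) (fun x : ℝ => -(ρ ^ 2 * Complex.sin (ρ * x))) :=
  .of_hasDerivAt (hasDerivAt_sin_mul ρ)
    (fun x => ((hasDerivAt_cos_mul ρ x).const_mul ρ).congr_deriv (by ring))
    (continuous_const.mul (contDiff_sin_mul ρ (n := 0)).continuous).neg

/-- Variation of constants for `y'' + ρ² y = w`. -/
theorem exists_hasSecondDeriv_variation {w : ℝ → ℂ} (hw : IntervalIntegrable w volume 0 π)
    {ρ : ℂ} (hρ : ρ ≠ 0) {S : ℝ → ℂ}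
    (hS : ∀ x ∈ Icc 0 π, S x = ∫ s in (0 : ℝ)..x, Complex.sin (ρ * (x - s)) / ρ * w s) :
    ∃ S' : ℝ → ℂ, HasSecondDeriv S S' (fun x => w x - ρ ^ 2 * S x) ∧ S' 0 = 0 := by
  have hA : IntervalIntegrable (fun s : ℝ => Complex.cos (ρ * s) * w s) volume 0 π :=
    hw.continuousOn_mul (contDiff_cos_mul ρ (n := 0)).continuous.continuousOn
  have hB : IntervalIntegrable (fun s : ℝ => Complex.sin (ρ * s) * w s) volume 0 π :=
    hw.continuousOn_mul (contDiff_sin_mul ρ (n := 0)).continuous.continuousOn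
  set A : ℝ → ℂ := fun x => ∫ s in (0 : ℝ)..x, Complex.cos (ρ * s) * w s with hAdef
  set B : ℝ → ℂ := fun x => ∫ s in (0 : ℝ)..x, Complex.sin (ρ * s) * w s with hBdef
  have hSe : ∀ x ∈ Icc 0 π,
      S x = ρ⁻¹ * (Complex.sin (ρ * x) * A x - Complex.cos (ρ * x) * B x) := by
    intro x hx
    rw [hS x hx, hAdef, hBdef]
    simp only
    rw [← intervalIntegral.integral_const_mul, ← intervalIntegral.integral_const_mul,
      ← intervalIntegral.integral_sub ((intervalIntegrable_mono_pi hA hx).const_mul _)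
        ((intervalIntegrable_mono_pi hB hx).const_mul _), ← intervalIntegral.integral_const_mul]
    refine intervalIntegral.integral_congr fun s _ => ?_
    rw [mul_sub, Complex.sin_sub]
    ring
  have hAac := hA.absolutelyContinuousOnInterval_complex
  have hBac := hB.absolutelyContinuousOnInterval_complex
  -- The derivative is guessed from the separated form: differentiating the primitives A and B
  -- contributes sin·cos - cos·sin = 0.
  refine ⟨fun x => Complex.cos (ρ * x) * A x + Complex.sin (ρ * x) * B x, ?_, by simp [A, B]⟩
  have key : HasSecondDeriv
      (fun x => ρ⁻¹ * (Complex.sin (ρ * x) * A x - Complex.cos (ρ * x) * B x))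
      (fun x => Complex.cos (ρ * x) * A x + Complex.sin (ρ * x) * B x)
      (fun x => w x - ρ ^ 2 * (ρ⁻¹ *
        (Complex.sin (ρ * x) * A x - Complex.cos (ρ * x) * B x))) := by
    refine .of_ae ((((absCont_sin_mul ρ).cmul hAac).sub
      ((absCont_cos_mul ρ).cmul hBac)).const_smul ρ⁻¹)
      (((absCont_cos_mul ρ).cmul hAac).add ((absCont_sin_mul ρ).cmul hBac)) ?_ ?_
    · filter_upwards [hA.ae_hasDerivAt_integral, hB.ae_hasDerivAt_integral] with x h1 h2 hx
      refine ((((hasDerivAt_sin_mul ρ x).mul (h1 hx 0 left_mem_uIcc)).sub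
        ((hasDerivAt_cos_mul ρ x).mul (h2 hx 0 left_mem_uIcc))).const_mul ρ⁻¹).congr_deriv ?_
      field_simp; ring
    · filter_upwards [hA.ae_hasDerivAt_integral, hB.ae_hasDerivAt_integral] with x h1 h2 hx
      refine (((hasDerivAt_cos_mul ρ x).mul (h1 hx 0 left_mem_uIcc)).add
        ((hasDerivAt_sin_mul ρ x).mul (h2 hx 0 left_mem_uIcc))).congr_deriv ?_
      have e := Complex.sin_sq_add_cos_sq (ρ * x)
      field_simp
      linear_combination w x * e
  refine (key.congr_left hSe).congr_right ?_
  filter_upwards [ae_restrict_mem measurableSet_Icc] with x hx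
  rw [hSe x hx]

section Transmutation

variable {q : ℝ → ℝ} {h : ℝ} {g : ℝ × ℝ →ᵇ ℝ}

theorem intervalIntegrable_ofReal {f : ℝ → ℝ} {a b : ℝ} (hf : IntervalIntegrable f volume a b) :
    IntervalIntegrable (fun x => (f x : ℂ)) volume a b :=
  ⟨hf.1.ofReal, hf.2.ofReal⟩

/-- By `volterra_equation_of_goursat`, Y = T[cos ρ·] differs from cos ρx + (h/ρ) sin ρx by the
Duhamel integral of qY. Hence Y'' = qY - ρ²Y with Y'(0) = h, and -ρ²Y = T[(cos ρ·)'']; integrating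
twice gives the claim. -/
theorem defect_cos_eq_zero (hq : MemLp q 2 (volume.restrict (Ioc 0 π)))
    (hg : ∀ x ∈ Icc 0 π, ∀ t ∈ Icc 0 x,
      g (x, t) = h + 2⁻¹ * ((∫ s in (0 : ℝ)..(x + t) / 2, q s) + ∫ s in (0 : ℝ)..(x - t) / 2, q s)
        + 2⁻¹ * ∫ s in (0 : ℝ)..π, q s * goursatInner g x t s)
    {ρ : ℝ} (hρ : ρ ≠ 0) {x : ℝ} (hx : x ∈ Icc 0 π) :
    defect q h (fun x t => g (x, t)) (fun x : ℝ => Complex.cos (ρ * x))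
      (fun x : ℝ => -((ρ : ℂ) ^ 2 * Complex.cos (ρ * x))) x = 0 := by
  have hρ' : (ρ : ℂ) ≠ 0 := by exact_mod_cast hρ
  set G : ℝ → ℝ → ℝ := fun x t => g (x, t)
  have hG : ContinuousOn (Function.uncurry G) triangle := continuousOn_triangle g
  set Y := volterra G fun x : ℝ => Complex.cos (ρ * x) with hY
  have hcc : Continuous fun x : ℝ => Complex.cos ((ρ : ℂ) * x) :=
    (contDiff_cos_mul ρ (n := 0)).continuous
  have hYc : ContinuousOn Y (Icc 0 π) := continuousOn_volterra hG hcc.continuousOn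
  have hYr : ∀ x, Y x = ((Real.cos (ρ * x) + ∫ t in (0 : ℝ)..x, g (x, t) * Real.cos (ρ * t) : ℝ) : ℂ) := by
    intro x
    rw [hY, volterra]
    push_cast [← intervalIntegral.integral_ofReal]
    rfl
  have hqY : IntervalIntegrable (fun s => (q s : ℂ) * Y s) volume 0 π :=
    (intervalIntegrable_ofReal (intervalIntegrable_of_memLp hq)).mul_continuousOn
      (by rwa [uIcc_zero_pi])
  set S : ℝ → ℂ := fun x => Y x - (Complex.cos (ρ * x) + (h / ρ : ℂ) * Complex.sin (ρ * x))
    with hSdef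
  have hS : ∀ x ∈ Icc 0 π, S x = ∫ s in (0 : ℝ)..x,
      Complex.sin ((ρ : ℂ) * (x - s)) / ρ * ((q s : ℂ) * Y s) := by
    intro x hx
    have h1 := volterra_equation_of_goursat hq hg hρ hx
    have h2 : ∫ s in (0 : ℝ)..x, Complex.sin ((ρ : ℂ) * (x - s)) / ρ * ((q s : ℂ) * Y s) =
        ((∫ s in (0 : ℝ)..x, Real.sin (ρ * (x - s)) / ρ *
        (q s * (Real.cos (ρ * s) + ∫ t in (0 : ℝ)..s, g (s, t) * Real.cos (ρ * t))) : ℝ) : ℂ) := by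
      rw [← intervalIntegral.integral_ofReal]
      refine intervalIntegral.integral_congr fun s _ => ?_
      rw [hYr]
      simp only [Complex.ofReal_mul, Complex.ofReal_div, Complex.ofReal_sin, Complex.ofReal_sub]
    rw [hSdef]
    simp only
    rw [h2, hYr, h1]
    push_cast
    ring
  obtain ⟨S', hS', hS0⟩ := exists_hasSecondDeriv_variation hqY hρ' hS
  have hY2 := ((hasSecondDeriv_cos ρ).add ((hasSecondDeriv_sin ρ).const_mul (h / ρ))).add hS'
  have hY3 := (hY2.congr_left (y₁ := Y) fun x _ => by simp [S]).congr_right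
    (w₁ := transmutedSource q G (fun x : ℝ => Complex.cos (ρ * x))
      (fun x : ℝ => -((ρ : ℂ) ^ 2 * Complex.cos (ρ * x)))) (Eventually.of_forall fun x => by
        have := volterra_const_mul (G := G) (u := fun x : ℝ => Complex.cos (ρ * x))
          (-(ρ : ℂ) ^ 2) x
        simp only [neg_mul] at this
        rw [transmutedSource, this, ← hY]
        simp only [S]; ring)
  rw [defect, sub_eq_zero, ← hY, hY3.eq_integral hx]
  have e1 : ∫ s in (0 : ℝ)..x, (-((ρ : ℂ) * Complex.sin (ρ * s)) +
      h / ρ * (ρ * Complex.cos (ρ * s)) + S' s) = ∫ s in (0 : ℝ)..x, ((h : ℂ) +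
        ∫ r in (0 : ℝ)..s, transmutedSource q G (fun x : ℝ => Complex.cos (ρ * x))
      (fun x : ℝ => -((ρ : ℂ) ^ 2 * Complex.cos (ρ * x))) r) := by
    refine intervalIntegral.integral_congr fun s hs => ?_
    rw [uIcc_of_le hx.1] at hs
    have := hY3.deriv_eq ⟨hs.1, hs.2.trans hx.2⟩
    rw [this]
    congr 1
    simp [hS0, hρ']
  rw [e1, intervalIntegral.integral_add intervalIntegrable_const
    (intervalIntegrable_mono_pi (intervalIntegrable_of_continuousOn
      (continuousOn_primitive hY3.intervalIntegrable)) hx), hY, volterra_at_zero]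
  simp
  ring

end Transmutation

end SturmLiouville

end

/-! ### Extension of the intertwining relation by density. -/

section

namespace SturmLiouville

section Density

variable {q : ℝ → ℝ} {h : ℝ} {G : ℝ → ℝ → ℝ}

/-- The double primitive vanishing to second order at `0`. -/
def doublePrimitive (p : ℝ → ℂ) (x : ℝ) : ℂ := ∫ s in (0 : ℝ)..x, ∫ r in (0 : ℝ)..s, p r

theorem continuousOn_doublePrimitive {p : ℝ → ℂ} (hp : ContinuousOn p (Icc 0 π)) :
    ContinuousOn (doublePrimitive p) (Icc 0 π) :=
  continuousOn_primitive (intervalIntegrable_of_continuousOn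
    (continuousOn_primitive (intervalIntegrable_of_continuousOn hp)))

theorem doublePrimitive_sub_mul {p₁ p₂ : ℝ → ℂ} (h₁ : ContinuousOn p₁ (Icc 0 π))
    (h₂ : ContinuousOn p₂ (Icc 0 π)) (k : ℂ) {x : ℝ} (hx : x ∈ Icc 0 π) :
    doublePrimitive (fun x => p₁ x - k * p₂ x) x =
      doublePrimitive p₁ x - k * doublePrimitive p₂ x := by
  have i1 := intervalIntegrable_of_continuousOn h₁
  have i2 := intervalIntegrable_of_continuousOn h₂
  simp only [doublePrimitive]
  rw [← intervalIntegral.integral_const_mul, ← intervalIntegral.integral_sub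
    (intervalIntegrable_mono_pi (intervalIntegrable_of_continuousOn (continuousOn_primitive i1)) hx)
    ((intervalIntegrable_mono_pi (intervalIntegrable_of_continuousOn
      (continuousOn_primitive i2)) hx).const_mul k)]
  refine intervalIntegral.integral_congr fun s hs => ?_
  rw [uIcc_of_le hx.1] at hs
  have hs' : s ∈ Icc 0 π := ⟨hs.1, hs.2.trans hx.2⟩
  rw [intervalIntegral.integral_sub (intervalIntegrable_mono_pi i1 hs')
    ((intervalIntegrable_mono_pi i2 hs').const_mul k), intervalIntegral.integral_const_mul]

theorem norm_doublePrimitive_le {p : ℝ → ℂ} {M : ℝ} (hM : ∀ x ∈ Icc 0 π, ‖p x‖ ≤ M) {x : ℝ}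
    (hx : x ∈ Icc 0 π) : ‖doublePrimitive p x‖ ≤ M * π * π := by
  have h0 : 0 ≤ M := (norm_nonneg _).trans (hM x hx)
  have h1 : ∀ s ∈ Icc 0 π, ‖∫ r in (0 : ℝ)..s, p r‖ ≤ M * π := fun s hs => by
    have := intervalIntegral.norm_integral_le_of_norm_le_const (a := 0) (b := s) (f := p) (C := M)
      fun r hr => by
        rw [uIoc_of_le hs.1] at hr
        exact hM r ⟨hr.1.le, hr.2.trans hs.2⟩
    rw [sub_zero, abs_of_nonneg hs.1] at this
    exact this.trans (mul_le_mul_of_nonneg_left hs.2 h0)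
  have := intervalIntegral.norm_integral_le_of_norm_le_const (a := 0) (b := x)
    (f := fun s => ∫ r in (0 : ℝ)..s, p r) (C := M * π)
    fun r hr => by
      rw [uIoc_of_le hx.1] at hr
      exact h1 r ⟨hr.1.le, hr.2.trans hx.2⟩
  rw [sub_zero, abs_of_nonneg hx.1] at this
  exact this.trans (mul_le_mul_of_nonneg_left hx.2 (by positivity))

/-- The frequency ρ = 0 is reached as a limit: both 1 - cos ρx and ρ² cos ρx are O(ρ²) uniformly on
[0, π], and the defect is bounded by sup norms. -/
theorem defect_one_eq_zero (hq : MemLp q 2 (volume.restrict (Ioc 0 π)))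
    (hG : ContinuousOn (Function.uncurry G) triangle)
    (hcos : ∀ ρ : ℝ, ρ ≠ 0 → ∀ x ∈ Icc 0 π, defect q h G (fun x : ℝ => Complex.cos (ρ * x))
      (fun x : ℝ => -((ρ : ℂ) ^ 2 * Complex.cos (ρ * x))) x = 0) {x : ℝ} (hx : x ∈ Icc 0 π) :
    defect q h G (fun _ => 1) (fun _ => 0) x = 0 := by
  obtain ⟨C, hC, hb⟩ := exists_defect_bound hq h hG
  have key : ∀ ρ : ℝ, ρ ≠ 0 →
      ‖defect q h G (fun _ => 1) (fun _ => 0) x‖ ≤ C * (ρ ^ 2 * (π ^ 2 + 1)) := by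
    intro ρ hρ
    have hc : Continuous fun x : ℝ => Complex.cos ((ρ : ℂ) * x) :=
      (contDiff_cos_mul ρ (n := 0)).continuous
    have hc2 : Continuous fun x : ℝ => -((ρ : ℂ) ^ 2 * Complex.cos (ρ * x)) :=
      (continuous_const.mul hc).neg
    have h1 := defect_sub_mul (h := h) hq hG (continuousOn_const (c := (1 : ℂ)))
      (continuousOn_const (c := (0 : ℂ))) hc.continuousOn hc2.continuousOn 1 hx
    rw [hcos ρ hρ x hx, mul_zero, sub_zero] at h1
    rw [← h1]
    have hcosr : ∀ s : ℝ, Complex.cos ((ρ : ℂ) * s) = (Real.cos (ρ * s) : ℂ) := fun s => by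
      push_cast; rfl
    refine hb _ _ (by fun_prop) (by fun_prop) _ (fun s hs => ?_) (fun s hs => ?_) x hx
    · rw [hcosr, one_mul, ← Complex.ofReal_one, ← Complex.ofReal_sub, Complex.norm_real,
        Real.norm_eq_abs, abs_of_nonneg (by linarith [Real.cos_le_one (ρ * s)])]
      have h2 := Real.one_sub_sq_div_two_le_cos (x := ρ * s)
      have h3 : s ^ 2 ≤ π ^ 2 := pow_le_pow_left₀ hs.1 hs.2 2
      nlinarith [sq_nonneg ρ, sq_nonneg s, mul_le_mul_of_nonneg_left h3 (sq_nonneg ρ)]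
    · rw [hcosr, one_mul, zero_sub, neg_neg, norm_mul, norm_pow, Complex.norm_real,
        Complex.norm_real, Real.norm_eq_abs, Real.norm_eq_abs, sq_abs]
      have h2 := Real.abs_cos_le_one (ρ * s)
      nlinarith [sq_nonneg ρ, sq_nonneg π, mul_nonneg (sq_nonneg ρ) (sq_nonneg π),
        mul_le_mul_of_nonneg_left h2 (sq_nonneg ρ)]
  have hlim : Tendsto (fun ρ : ℝ => C * (ρ ^ 2 * (π ^ 2 + 1))) (𝓝[≠] 0) (𝓝 0) := by
    have : Continuous fun ρ : ℝ => C * (ρ ^ 2 * (π ^ 2 + 1)) := by fun_prop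
    have h0 := this.tendsto 0
    simp only [ne_eq, OfNat.ofNat_ne_zero, not_false_eq_true, zero_pow, zero_mul, mul_zero] at h0
    exact h0.mono_left nhdsWithin_le_nhds
  exact norm_le_zero_iff.1 (ge_of_tendsto hlim
    (eventually_nhdsWithin_of_forall fun ρ hρ => key ρ hρ))

variable (q h G) in
/-- The intertwining relation holds for the double primitive of `p`. -/
def IntertwinesPrimitive (p : ℝ → ℂ) : Prop :=
  ContinuousOn p (Icc 0 π) ∧ ∀ x ∈ Icc 0 π, defect q h G (doublePrimitive p) p x = 0

theorem defect_congr {u₁ u₂ w₁ w₂ : ℝ → ℂ} (hu : ∀ x ∈ Icc 0 π, u₁ x = u₂ x)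
    (hw : ∀ x ∈ Icc 0 π, w₁ x = w₂ x) {x : ℝ} (hx : x ∈ Icc 0 π) :
    defect q h G u₁ w₁ x = defect q h G u₂ w₂ x := by
  rw [defect, defect, volterra_congr hu hx, hu 0 zero_mem_Icc_pi]
  congr 2
  refine intervalIntegral.integral_congr fun s hs => intervalIntegral.integral_congr fun r hr => ?_
  rw [uIcc_of_le hx.1] at hs
  rw [uIcc_of_le hs.1] at hr
  have hr' : r ∈ Icc 0 π := ⟨hr.1, hr.2.trans (hs.2.trans hx.2)⟩
  simp only [transmutedSource]
  rw [volterra_congr hu hr', volterra_congr hw hr']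

namespace IntertwinesPrimitive

theorem sub_mul (hq : MemLp q 2 (volume.restrict (Ioc 0 π)))
    (hG : ContinuousOn (Function.uncurry G) triangle) {p₁ p₂ : ℝ → ℂ}
    (h₁ : IntertwinesPrimitive q h G p₁) (h₂ : IntertwinesPrimitive q h G p₂) (k : ℂ) :
    IntertwinesPrimitive q h G fun x => p₁ x - k * p₂ x := by
  refine ⟨h₁.1.sub (continuousOn_const.mul h₂.1), fun x hx => ?_⟩
  rw [defect_congr (fun s hs => doublePrimitive_sub_mul h₁.1 h₂.1 k hs) (fun _ _ => rfl) hx,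
    defect_sub_mul hq hG (continuousOn_doublePrimitive h₁.1) h₁.1
      (continuousOn_doublePrimitive h₂.1) h₂.1 k hx, h₁.2 x hx, h₂.2 x hx]
  simp

theorem zero : IntertwinesPrimitive q h G fun _ => 0 := by
  refine ⟨continuousOn_const, fun x _ => ?_⟩
  have h0 : doublePrimitive (fun _ => 0) = fun _ => 0 := by ext; simp [doublePrimitive]
  rw [h0]
  simp [defect, transmutedSource, volterra]

theorem const_mul (hq : MemLp q 2 (volume.restrict (Ioc 0 π)))
    (hG : ContinuousOn (Function.uncurry G) triangle) {p : ℝ → ℂ}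
    (hp : IntertwinesPrimitive q h G p) (k : ℂ) :
    IntertwinesPrimitive q h G fun x => k * p x := by
  have := sub_mul hq hG zero hp (-k)
  simpa using this

theorem add (hq : MemLp q 2 (volume.restrict (Ioc 0 π)))
    (hG : ContinuousOn (Function.uncurry G) triangle) {p₁ p₂ : ℝ → ℂ}
    (h₁ : IntertwinesPrimitive q h G p₁) (h₂ : IntertwinesPrimitive q h G p₂) :
    IntertwinesPrimitive q h G fun x => p₁ x + p₂ x := by
  have := sub_mul hq hG h₁ h₂ (-1)
  simpa using this

/-- The double primitive of cos ρx is (1 - cos ρx)/ρ², a combination of two functions whose defects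
are known to vanish. -/
theorem cos (hq : MemLp q 2 (volume.restrict (Ioc 0 π)))
    (hG : ContinuousOn (Function.uncurry G) triangle)
    (hcos : ∀ ρ : ℝ, ρ ≠ 0 → ∀ x ∈ Icc 0 π, defect q h G (fun x : ℝ => Complex.cos (ρ * x))
      (fun x : ℝ => -((ρ : ℂ) ^ 2 * Complex.cos (ρ * x))) x = 0) {ρ : ℝ} (hρ : ρ ≠ 0) :
    IntertwinesPrimitive q h G fun x : ℝ => Complex.cos (ρ * x) := by
  have hρ' : (ρ : ℂ) ≠ 0 := by exact_mod_cast hρ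
  have hc : Continuous fun x : ℝ => Complex.cos ((ρ : ℂ) * x) :=
    (contDiff_cos_mul ρ (n := 0)).continuous
  have hc2 : Continuous fun x : ℝ => -((ρ : ℂ) ^ 2 * Complex.cos (ρ * x)) :=
    (continuous_const.mul hc).neg
  refine ⟨hc.continuousOn, fun x hx => ?_⟩
  have e : ∀ x ∈ Icc 0 π, doublePrimitive (fun x : ℝ => Complex.cos (ρ * x)) x =
      0 - (-((ρ : ℂ) ^ 2)⁻¹) * (1 - 1 * Complex.cos (ρ * x)) := by
    intro x hx
    have h1 := hasSecondDeriv_cos (ρ : ℂ)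
    have h2 := h1.eq_integral hx
    have h3 : ∫ s in (0 : ℝ)..x, -((ρ : ℂ) * Complex.sin (ρ * s)) =
        -((ρ : ℂ) ^ 2) * doublePrimitive (fun x : ℝ => Complex.cos (ρ * x)) x := by
      rw [doublePrimitive, ← intervalIntegral.integral_const_mul]
      refine intervalIntegral.integral_congr fun s hs => ?_
      rw [uIcc_of_le hx.1] at hs
      have h4 := h1.deriv_eq ⟨hs.1, hs.2.trans hx.2⟩
      rw [h4, ← intervalIntegral.integral_const_mul]
      simp
    rw [h3] at h2
    simp only [Complex.ofReal_zero, mul_zero, Complex.cos_zero] at h2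
    rw [h2]
    field_simp; ring
  have hdiff : defect q h G (fun x : ℝ => 1 - 1 * Complex.cos (ρ * x))
      (fun x : ℝ => 0 - 1 * -((ρ : ℂ) ^ 2 * Complex.cos (ρ * x))) x = 0 := by
    rw [defect_sub_mul hq hG continuousOn_const continuousOn_const hc.continuousOn
      hc2.continuousOn 1 hx, hcos ρ hρ x hx, defect_one_eq_zero hq hG hcos hx]
    simp
  rw [defect_congr (w₂ := fun x : ℝ => 0 - (-((ρ : ℂ) ^ 2)⁻¹) *
    (0 - 1 * -((ρ : ℂ) ^ 2 * Complex.cos (ρ * x)))) e (fun s _ => by field_simp; ring) hx,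
    defect_sub_mul hq hG (u₁ := fun _ => 0) (w₁ := fun _ => 0) continuousOn_const
      continuousOn_const (by fun_prop) (by fun_prop) _ hx, hdiff]
  simp [defect, transmutedSource, volterra]

/-- Multiplication by cos(x/2) shifts the frequency by ±1/2, that is, k by ±1. The odd multiples of
1/4 are stable under these shifts and never zero, so only admissible frequencies occur. -/
theorem cos_mul_pow (hq : MemLp q 2 (volume.restrict (Ioc 0 π)))
    (hG : ContinuousOn (Function.uncurry G) triangle)
    (hcos : ∀ ρ : ℝ, ρ ≠ 0 → ∀ x ∈ Icc 0 π, defect q h G (fun x : ℝ => Complex.cos (ρ * x))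
      (fun x : ℝ => -((ρ : ℂ) ^ 2 * Complex.cos (ρ * x))) x = 0) (n : ℕ) (k : ℤ) :
    IntertwinesPrimitive q h G fun x : ℝ =>
      ((Real.cos ((2 * k + 1) / 4 * x) * Real.cos (x / 2) ^ n : ℝ) : ℂ) := by
  induction n generalizing k with
  | zero =>
    have hk : (((2 * k + 1) / 4 : ℝ)) ≠ 0 := by
      have : (2 * k + 1 : ℤ) ≠ 0 := by omega
      have : ((2 * k + 1 : ℤ) : ℝ) ≠ 0 := by exact_mod_cast this
      push_cast at this
      positivity
    simpa using cos hq hG hcos hk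
  | succ n ih =>
    have := const_mul hq hG (add hq hG (ih (k + 1)) (ih (k - 1))) (1 / 2)
    convert this using 2 with x
    have e0 : (1 / 2 : ℂ) = ((1 / 2 : ℝ) : ℂ) := by push_cast; rfl
    rw [e0, ← Complex.ofReal_add, ← Complex.ofReal_mul]
    congr 1
    have e1 : (2 * ((k + 1 : ℤ) : ℝ) + 1) / 4 * x = (2 * k + 1) / 4 * x + x / 2 := by
      push_cast; ring
    have e2 : (2 * ((k - 1 : ℤ) : ℝ) + 1) / 4 * x = (2 * k + 1) / 4 * x - x / 2 := by
      push_cast; ring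
    rw [e1, e2, Real.cos_add, Real.cos_sub]
    ring

theorem cos_mul_polynomial (hq : MemLp q 2 (volume.restrict (Ioc 0 π)))
    (hG : ContinuousOn (Function.uncurry G) triangle)
    (hcos : ∀ ρ : ℝ, ρ ≠ 0 → ∀ x ∈ Icc 0 π, defect q h G (fun x : ℝ => Complex.cos (ρ * x))
      (fun x : ℝ => -((ρ : ℂ) ^ 2 * Complex.cos (ρ * x))) x = 0) (P : ℝ[X]) :
    IntertwinesPrimitive q h G fun x : ℝ =>
      ((Real.cos (x / 4) * P.eval (Real.cos (x / 2)) : ℝ) : ℂ) := by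
  induction P using Polynomial.induction_on' with
  | add P₁ P₂ h₁ h₂ =>
    have := add hq hG h₁ h₂
    convert this using 2 with x
    rw [Polynomial.eval_add]; push_cast; ring
  | monomial n a =>
    have := const_mul hq hG (cos_mul_pow hq hG hcos n 0) a
    convert this using 2 with x
    rw [Polynomial.eval_monomial, ← Complex.ofReal_mul]
    congr 1
    rw [show (2 * ((0 : ℤ) : ℝ) + 1) / 4 * x = x / 4 by push_cast; ring]
    ring

/-- The intertwining relation extends to all continuous functions by density. -/
theorem of_continuousOn (hq : MemLp q 2 (volume.restrict (Ioc 0 π)))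
    (hG : ContinuousOn (Function.uncurry G) triangle)
    (hcos : ∀ ρ : ℝ, ρ ≠ 0 → ∀ x ∈ Icc 0 π, defect q h G (fun x : ℝ => Complex.cos (ρ * x))
      (fun x : ℝ => -((ρ : ℂ) ^ 2 * Complex.cos (ρ * x))) x = 0) {w : ℝ → ℂ}
    (hw : ContinuousOn w (Icc 0 π)) : IntertwinesPrimitive q h G w := by
  refine ⟨hw, fun x hx => ?_⟩
  obtain ⟨C, hC, hb⟩ := exists_defect_bound hq h hG
  -- In the variable y = cos(x/2), a homeomorphism of [0, π] onto [0, 1], the factor cos(x/4) is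
  -- positive. It can be divided out, and Weierstrass' theorem approximates the quotient by
  -- polynomials in y.
  have hpos : ∀ y ∈ Icc (0 : ℝ) 1, 0 < Real.cos (Real.arccos y / 2) := fun y _ =>
    Real.cos_pos_of_mem_Ioo ⟨by linarith [Real.arccos_nonneg y, Real.pi_pos],
      by linarith [Real.arccos_le_pi y, Real.pi_pos, Real.arccos_le_pi_div_two.2 (‹y ∈ Icc (0 : ℝ) 1›).1]⟩
  have hmaps : MapsTo (fun y => 2 * Real.arccos y) (Icc (0 : ℝ) 1) (Icc 0 π) := fun y hy =>
    ⟨by linarith [Real.arccos_nonneg y], by linarith [Real.arccos_le_pi_div_two.2 hy.1]⟩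
  have hwc : ContinuousOn (fun y => w (2 * Real.arccos y)) (Icc 0 1) :=
    hw.comp (continuous_const.mul Real.continuous_arccos).continuousOn hmaps
  have hdc : ContinuousOn (fun y => Real.cos (Real.arccos y / 2)) (Icc (0 : ℝ) 1) :=
    (Real.continuous_cos.comp (Real.continuous_arccos.div_const 2)).continuousOn
  -- The factor 2 comes from treating real and imaginary parts separately; π² bounds the double
  -- primitive, and the 1 leaves room for w itself.
  have key : ∀ ε > 0, ‖defect q h G (doublePrimitive w) w x‖ ≤ C * (2 * ε * (π * π + 1)) := by
    intro ε hε
    obtain ⟨P₁, hP₁⟩ := exists_polynomial_near_of_continuousOn 0 1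
      (fun y => (w (2 * Real.arccos y)).re / Real.cos (Real.arccos y / 2))
      ((Complex.continuous_re.comp_continuousOn hwc).div hdc fun y hy => (hpos y hy).ne') ε hε
    obtain ⟨P₂, hP₂⟩ := exists_polynomial_near_of_continuousOn 0 1
      (fun y => (w (2 * Real.arccos y)).im / Real.cos (Real.arccos y / 2))
      ((Complex.continuous_im.comp_continuousOn hwc).div hdc fun y hy => (hpos y hy).ne') ε hε
    have hp := add hq hG (cos_mul_polynomial hq hG hcos P₁)
      (const_mul hq hG (cos_mul_polynomial hq hG hcos P₂) Complex.I)
    set p : ℝ → ℂ := fun x => ((Real.cos (x / 4) * P₁.eval (Real.cos (x / 2)) : ℝ) : ℂ) +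
      Complex.I * ((Real.cos (x / 4) * P₂.eval (Real.cos (x / 2)) : ℝ) : ℂ) with hpdef
    have hclose : ∀ s ∈ Icc 0 π, ‖w s - 1 * p s‖ ≤ 2 * ε := by
      intro s hs
      have hy : Real.cos (s / 2) ∈ Icc (0 : ℝ) 1 :=
        ⟨Real.cos_nonneg_of_mem_Icc ⟨by linarith [hs.1, Real.pi_pos], by linarith [hs.2]⟩,
          Real.cos_le_one _⟩
      have harc : Real.arccos (Real.cos (s / 2)) = s / 2 :=
        Real.arccos_cos (by linarith [hs.1]) (by linarith [hs.2, Real.pi_pos])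
      have h1 := hP₁ _ hy
      have h2 := hP₂ _ hy
      have hc := hpos _ hy
      rw [harc, show 2 * (s / 2) = s by ring, show s / 2 / 2 = s / 4 by ring] at h1 h2
      rw [harc, show s / 2 / 2 = s / 4 by ring] at hc
      have key2 : ∀ a b : ℝ, |b - a / Real.cos (s / 4)| < ε →
          |a - Real.cos (s / 4) * b| ≤ ε := by
        intro a b hab
        have : a - Real.cos (s / 4) * b = -(Real.cos (s / 4) * (b - a / Real.cos (s / 4))) := by
          field_simp; ring
        rw [this, abs_neg, abs_mul, abs_of_pos hc]
        calc _ ≤ 1 * ε := mul_le_mul (Real.cos_le_one _) hab.le (abs_nonneg _) zero_le_one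
          _ = ε := one_mul _
      have h3 := key2 _ _ h1
      have h4 := key2 _ _ h2
      refine (Complex.norm_le_abs_re_add_abs_im _).trans ?_
      have er : (w s - 1 * p s).re = (w s).re - Real.cos (s / 4) * P₁.eval (Real.cos (s / 2)) := by
        rw [hpdef]
        simp only [one_mul, Complex.sub_re, Complex.add_re, Complex.ofReal_re, Complex.mul_re,
          Complex.I_re, Complex.I_im, Complex.ofReal_im]
        ring
      have ei : (w s - 1 * p s).im = (w s).im - Real.cos (s / 4) * P₂.eval (Real.cos (s / 2)) := by
        rw [hpdef]
        simp only [one_mul, Complex.sub_im, Complex.add_im, Complex.ofReal_re, Complex.mul_im,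
          Complex.I_re, Complex.I_im, Complex.ofReal_im]
        ring
      rw [er, ei]
      linarith
    have hd := defect_sub_mul (h := h) hq hG (continuousOn_doublePrimitive hw) hw
      (continuousOn_doublePrimitive hp.1) hp.1 1 hx
    rw [hp.2 x hx, mul_zero, sub_zero] at hd
    rw [← hd]
    have hcw : ContinuousOn (fun s => w s - 1 * p s) (Icc 0 π) :=
      hw.sub (continuousOn_const.mul hp.1)
    refine hb _ _ ((continuousOn_doublePrimitive hw).sub (continuousOn_const.mul
      (continuousOn_doublePrimitive hp.1))) hcw _ (fun s hs => ?_) (fun s hs => ?_) x hx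
    · change ‖doublePrimitive w s - 1 * doublePrimitive p s‖ ≤ _
      rw [← doublePrimitive_sub_mul hw hp.1 1 hs]
      refine (norm_doublePrimitive_le hclose hs).trans ?_
      nlinarith
    · refine (hclose s hs).trans ?_
      nlinarith [mul_pos Real.pi_pos Real.pi_pos]
  have hlim : Tendsto (fun ε : ℝ => C * (2 * ε * (π * π + 1))) (𝓝[>] 0) (𝓝 0) := by
    have : Continuous fun ε : ℝ => C * (2 * ε * (π * π + 1)) := by fun_prop
    have h0 := this.tendsto 0
    simp only [mul_zero, zero_mul] at h0
    exact h0.mono_left nhdsWithin_le_nhds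
  exact norm_le_zero_iff.1 (ge_of_tendsto hlim
    (eventually_nhdsWithin_of_forall fun ε hε => key ε hε))

end IntertwinesPrimitive

/-- As u'(0) = 0, one has u = u(0) + the double primitive of u'', so the cases of constants and of
double primitives suffice. -/
theorem isTransmutationKernel_of_defect (hq : MemLp q 2 (volume.restrict (Ioc 0 π)))
    (hG : ContinuousOn (Function.uncurry G) triangle)
    (hcos : ∀ ρ : ℝ, ρ ≠ 0 → ∀ x ∈ Icc 0 π, defect q h G (fun x : ℝ => Complex.cos (ρ * x))
      (fun x : ℝ => -((ρ : ℂ) ^ 2 * Complex.cos (ρ * x))) x = 0) :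
    IsTransmutationKernel q h G := by
  refine ⟨hG, fun u hu hu0 => ?_⟩
  have hud : UniqueDiffOn ℝ (Icc 0 π) := uniqueDiffOn_Icc Real.pi_pos
  set w := iteratedDerivWithin 2 u (Icc 0 π) with hwdef
  have hw : ContinuousOn w (Icc 0 π) := hu.continuousOn_iteratedDerivWithin le_rfl hud
  have hu' : ContDiffOn ℝ 1 (derivWithin u (Icc 0 π)) (Icc 0 π) :=
    hu.derivWithin hud (by norm_num)
  have hder : ∀ (f : ℝ → ℂ), ContDiffOn ℝ 1 f (Icc 0 π) → ∀ x ∈ Icc 0 π,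
      f x = f 0 + ∫ s in (0 : ℝ)..x, derivWithin f (Icc 0 π) s := by
    intro f hf x hx
    have hsub : Icc 0 x ⊆ Icc 0 π := Icc_subset_Icc_right hx.2
    rw [intervalIntegral.integral_eq_sub_of_hasDerivAt_of_le hx.1 (hf.continuousOn.mono hsub)
      (fun t ht => ((hf.differentiableOn (by norm_num)) t
        (hsub (Ioo_subset_Icc_self ht))).hasDerivWithinAt.hasDerivAt
          (Icc_mem_nhds ht.1 (ht.2.trans_le hx.2)))
      (intervalIntegrable_mono_pi (intervalIntegrable_of_continuousOn
        (hf.continuousOn_derivWithin hud le_rfl)) hx)]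
    ring
  have hw' : ∀ x ∈ Icc 0 π, derivWithin u (Icc 0 π) x = ∫ s in (0 : ℝ)..x, w s := by
    intro x hx
    rw [hder _ hu' x hx, hu0, zero_add]
    refine intervalIntegral.integral_congr fun s hs => ?_
    rw [hwdef, iteratedDerivWithin_succ, iteratedDerivWithin_one]
  have hue : ∀ x ∈ Icc 0 π, u x = doublePrimitive w x - (-u 0) * 1 := by
    intro x hx
    rw [hder u (hu.of_le (by norm_num)) x hx, doublePrimitive,
      intervalIntegral.integral_congr fun s hs => hw' s (by
        rw [uIcc_of_le hx.1] at hs; exact ⟨hs.1, hs.2.trans hx.2⟩)]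
    ring
  have hD : ∀ x ∈ Icc 0 π, defect q h G u w x = 0 := by
    intro x hx
    rw [defect_congr (w₂ := fun s => w s - (-u 0) * 0) hue (fun s _ => by simp) hx,
      defect_sub_mul hq hG (continuousOn_doublePrimitive hw) hw continuousOn_const
      continuousOn_const (-u 0) hx, defect_one_eq_zero hq hG hcos hx,
      (IntertwinesPrimitive.of_continuousOn hq hG hcos hw).2 x hx]
    simp
  refine ⟨_, hasSecondDeriv_of_defect hq hG hu.continuousOn hw hD, ?_⟩
  simp [volterra_at_zero]

theorem exists_isTransmutationKernel (hq : MemLp q 2 (volume.restrict (Ioc 0 π))) (h : ℝ) :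
    ∃ G, IsTransmutationKernel q h G := by
  obtain ⟨g, hg⟩ := exists_goursat_solution hq h
  exact ⟨fun x t => g (x, t), isTransmutationKernel_of_defect hq (continuousOn_triangle g)
    fun ρ hρ x hx => defect_cos_eq_zero hq hg hρ hx⟩

end Density

end SturmLiouville

end

section

namespace SturmLiouville

/-! ### Inversion of Volterra operators -/

theorem integral_triangle_swap {F : ℝ → ℝ → ℂ} {x : ℝ} (hx : 0 ≤ x)
    (hF : Integrable (Function.uncurry F)
      ((volume.restrict (Ioc 0 x)).prod (volume.restrict (Ioc 0 x)))) :
    ∫ s in (0 : ℝ)..x, ∫ t in (0 : ℝ)..s, F s t = ∫ t in (0 : ℝ)..x, ∫ s in t..x, F s t := by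
  have hm : MeasurableSet {p : ℝ × ℝ | p.2 ≤ p.1} :=
    (isClosed_le continuous_snd continuous_fst).measurableSet
  have h1 : ∫ s in (0 : ℝ)..x, ∫ t in (0 : ℝ)..s, F s t =
      ∫ s in Ioc 0 x, ∫ t in Ioc 0 x, {p : ℝ × ℝ | p.2 ≤ p.1}.indicator (Function.uncurry F) (s, t) := by
    rw [intervalIntegral.integral_of_le hx]
    refine setIntegral_congr_fun measurableSet_Ioc fun s hs => ?_
    rw [intervalIntegral.integral_of_le hs.1.le]
    have : (fun t => {p : ℝ × ℝ | p.2 ≤ p.1}.indicator (Function.uncurry F) (s, t)) =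
        (Iic s).indicator (F s) := by
      ext t; simp [indicator_apply, Function.uncurry]
    rw [this, setIntegral_indicator measurableSet_Iic]
    congr 2
    ext t
    simp only [mem_Ioc, mem_inter_iff, mem_Iic]
    exact ⟨fun h => ⟨⟨h.1, h.2.trans hs.2⟩, h.2⟩, fun h => ⟨h.1.1, h.2⟩⟩
  have h2 : ∫ t in (0 : ℝ)..x, ∫ s in t..x, F s t =
      ∫ t in Ioc 0 x, ∫ s in Ioc 0 x, {p : ℝ × ℝ | p.2 ≤ p.1}.indicator (Function.uncurry F) (s, t) := by
    rw [intervalIntegral.integral_of_le hx]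
    refine setIntegral_congr_fun measurableSet_Ioc fun t ht => ?_
    rw [intervalIntegral.integral_of_le ht.2, ← integral_Icc_eq_integral_Ioc]
    have : (fun s => {p : ℝ × ℝ | p.2 ≤ p.1}.indicator (Function.uncurry F) (s, t)) =
        (Ici t).indicator (fun s => F s t) := by
      ext s; simp [indicator_apply, Function.uncurry]
    rw [this, setIntegral_indicator measurableSet_Ici]
    congr 2
    ext s
    simp only [mem_Icc, mem_Ioc, mem_inter_iff, mem_Ici]
    exact ⟨fun h => ⟨⟨ht.1.trans_le h.1, h.2⟩, h.1⟩, fun h => ⟨h.2, h.1.2⟩⟩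
  rw [h1, h2]
  exact integral_integral_swap (f := fun s t => {p : ℝ × ℝ | p.2 ≤ p.1}.indicator
    (Function.uncurry F) (s, t)) (hF.indicator hm)

theorem integrable_of_continuous_prod {F : ℝ → ℝ → ℂ} (hF : Continuous (Function.uncurry F))
    (a b c d : ℝ) : Integrable (Function.uncurry F)
      ((volume.restrict (Ioc a b)).prod (volume.restrict (Ioc c d))) := by
  rw [Measure.prod_restrict]
  exact (hF.continuousOn.integrableOn_compact (isCompact_Icc.prod isCompact_Icc)).mono_set
    (prod_mono Ioc_subset_Icc_self Ioc_subset_Icc_self)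

theorem abs_integral_resolvent_le (g : ℝ × ℝ →ᵇ ℝ) {k : ℝ × ℝ →ᵇ ℝ} {M L : ℝ} (hM : 0 ≤ M)
    (hk : ∀ p, |k p| ≤ M * Real.exp (L * clamp p.1)) (p : ℝ × ℝ) :
    |-∫ s in min (clamp p.2) (clamp p.1)..clamp p.1, g (clamp p.1, s) * k (s, p.2)| ≤
      M * ∫ s in (0 : ℝ)..clamp p.1, |‖g‖| * Real.exp (L * s) := by
  have hx := clamp_mem p.1
  have ht := clamp_mem p.2
  set x := clamp p.1
  set t := min (clamp p.2) x
  have ht0 : 0 ≤ t := le_min ht.1 hx.1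
  have htx : t ≤ x := min_le_right _ _
  rw [abs_neg, ← intervalIntegral.integral_const_mul]
  refine (intervalIntegral.abs_integral_le_integral_abs htx).trans ?_
  have hc1 : Continuous fun s => |g (x, s) * k (s, p.2)| := by fun_prop
  have hc2 : Continuous fun s => M * (|‖g‖| * Real.exp (L * s)) := by fun_prop
  refine (intervalIntegral.integral_mono_on htx (hc1.intervalIntegrable _ _)
    (hc2.intervalIntegrable _ _) fun s hs => ?_).trans
    (intervalIntegral.integral_mono_interval ht0 htx le_rfl
      (Eventually.of_forall fun s => by simp only [Pi.zero_apply]; positivity)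
      (hc2.intervalIntegrable _ _))
  rw [abs_mul, abs_norm]
  have h1 : |k (s, p.2)| ≤ M * Real.exp (L * s) := by
    have := hk (s, p.2)
    rwa [clamp_of_mem ⟨ht0.trans hs.1, hs.2.trans hx.2⟩] at this
  calc |g (x, s)| * |k (s, p.2)| ≤ ‖g‖ * (M * Real.exp (L * s)) :=
        mul_le_mul (g.norm_coe_le_norm _) h1 (abs_nonneg _) (norm_nonneg _)
    _ = _ := by ring

theorem norm_integral_resolvent_le (g k : ℝ × ℝ →ᵇ ℝ) (p : ℝ × ℝ) :
    ‖-∫ s in min (clamp p.2) (clamp p.1)..clamp p.1, g (clamp p.1, s) * k (s, p.2)‖ ≤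
      ‖g‖ * π * ‖k‖ := by
  have h := abs_integral_resolvent_le g (k := k) (M := ‖k‖) (L := 0) (norm_nonneg _)
    (fun p => by simpa using k.norm_coe_le_norm p) p
  refine h.trans ?_
  simp only [zero_mul, Real.exp_zero, mul_one, abs_norm, intervalIntegral.integral_const, sub_zero,
    smul_eq_mul]
  calc ‖k‖ * (clamp p.1 * ‖g‖) ≤ ‖k‖ * (π * ‖g‖) := by
        gcongr; exact (clamp_mem _).2
    _ = _ := by ring

/-- The operator of the resolvent equation of a Volterra kernel. -/
def resolventOperator (g : ℝ × ℝ →ᵇ ℝ) : (ℝ × ℝ →ᵇ ℝ) →L[ℝ] (ℝ × ℝ →ᵇ ℝ) :=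
  LinearMap.mkContinuous
    { toFun := fun k => BoundedContinuousFunction.ofNormedAddCommGroup
        (fun p => -∫ s in min (clamp p.2) (clamp p.1)..clamp p.1, g (clamp p.1, s) * k (s, p.2))
        (by
          have h1 : Continuous fun p : ℝ × ℝ => clamp p.1 := continuous_clamp.comp continuous_fst
          have h2 : Continuous fun p : ℝ × ℝ => clamp p.2 := continuous_clamp.comp continuous_snd
          have hc : Continuous (Function.uncurry fun (p : ℝ × ℝ) (s : ℝ) =>
              g (clamp p.1, s) * k (s, p.2)) :=
            (g.continuous.comp ((h1.comp continuous_fst).prodMk continuous_snd)).mul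
              (k.continuous.comp (continuous_snd.prodMk (continuous_snd.comp continuous_fst)))
          have e : ∀ p : ℝ × ℝ,
              ∫ s in min (clamp p.2) (clamp p.1)..clamp p.1, g (clamp p.1, s) * k (s, p.2) =
              (∫ s in (0 : ℝ)..clamp p.1, g (clamp p.1, s) * k (s, p.2)) -
              ∫ s in (0 : ℝ)..min (clamp p.2) (clamp p.1), g (clamp p.1, s) * k (s, p.2) := by
            intro p
            have hcp : Continuous fun s => g (clamp p.1, s) * k (s, p.2) := by fun_prop
            rw [intervalIntegral.integral_interval_sub_left (hcp.intervalIntegrable _ _)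
              (hcp.intervalIntegrable _ _)]
          simp only [e]
          exact ((intervalIntegral.continuous_parametric_intervalIntegral_of_continuous hc h1).sub
            (intervalIntegral.continuous_parametric_intervalIntegral_of_continuous hc
              (h2.min h1))).neg)
        (‖g‖ * π * ‖k‖) (norm_integral_resolvent_le g k)
      map_add' := fun k₁ k₂ => by
        ext p
        have hc : ∀ k : ℝ × ℝ →ᵇ ℝ, Continuous fun s => g (clamp p.1, s) * k (s, p.2) :=
          fun k => by fun_prop
        simp only [BoundedContinuousFunction.coe_ofNormedAddCommGroup,
          BoundedContinuousFunction.coe_add, Pi.add_apply]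
        rw [← neg_add, ← intervalIntegral.integral_add ((hc k₁).intervalIntegrable _ _)
          ((hc k₂).intervalIntegrable _ _)]
        simp only [mul_add]
      map_smul' := fun c k => by
        ext p
        simp only [BoundedContinuousFunction.coe_ofNormedAddCommGroup,
          BoundedContinuousFunction.coe_smul, smul_eq_mul, RingHom.id_apply]
        rw [mul_neg, ← intervalIntegral.integral_const_mul c]
        simp only [mul_left_comm] }
    (‖g‖ * π)
    (fun k => BoundedContinuousFunction.norm_ofNormedAddCommGroup_le _ (by positivity)
      (norm_integral_resolvent_le g k))

/-- The equation expresses g + k + g∘k = 0 for the composition of kernels, i.e. (I + g)(I + k) = I;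
the constant ‖g‖ serves as majorant for the Neumann series. -/
theorem exists_resolvent (g : ℝ × ℝ →ᵇ ℝ) :
    ∃ k : ℝ × ℝ →ᵇ ℝ, ∀ x ∈ Icc 0 π, ∀ t ∈ Icc 0 x,
      k (x, t) = -g (x, t) - ∫ s in t..x, g (x, s) * k (s, t) := by
  obtain ⟨k, hk⟩ := exists_fixedPoint_of_volterra (m := fun _ => ‖g‖) (memLp_const _)
    (resolventOperator g) (fun k M L hM hk p => abs_integral_resolvent_le g hM hk p) (-g)
  refine ⟨k, fun x hx t ht => ?_⟩
  have h1 : k (x, t) = (-g) (x, t) + resolventOperator g k (x, t) := DFunLike.congr_fun hk (x, t)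
  have h2 : resolventOperator g k (x, t) = -∫ s in min (clamp t) (clamp x)..clamp x,
    g (clamp x, s) * k (s, t) := rfl
  rw [clamp_of_mem hx, clamp_of_mem ⟨ht.1, ht.2.trans hx.2⟩, min_eq_left ht.2] at h2
  rw [h1, h2]
  rfl

theorem exists_right_inverse_kernel {G : ℝ → ℝ → ℝ}
    (hG : ContinuousOn (Function.uncurry G) triangle) :
    ∃ K : ℝ → ℝ → ℝ, ContinuousOn (Function.uncurry K) triangle ∧
      ∀ u : ℝ → ℂ, ContinuousOn u (Icc 0 π) → ∀ x ∈ Icc 0 π,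
        volterra G (volterra K u) x = u x := by
  obtain ⟨g, hg⟩ := exists_extension_of_continuousOn_triangle hG
  obtain ⟨k, hk⟩ := exists_resolvent g
  refine ⟨fun x t => k (x, t), continuousOn_triangle k, fun u hu x hx => ?_⟩
  have hc : Continuous fun s => u (clamp s) := hu.comp_continuous continuous_clamp clamp_mem
  have hgc : Continuous fun p : ℝ × ℝ => (g p : ℂ) := Complex.continuous_ofReal.comp g.continuous
  have hkc : Continuous fun p : ℝ × ℝ => (k p : ℂ) := Complex.continuous_ofReal.comp k.continuous
  set v : ℝ → ℂ := fun s => u (clamp s) with hv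
  have hvu : ∀ s ∈ Icc 0 π, u s = v s := fun s hs => by rw [hv]; simp only [clamp_of_mem hs]
  have hinner : Continuous fun s => ∫ t in (0 : ℝ)..s, (k (s, t) : ℂ) * v t :=
    intervalIntegral.continuous_parametric_intervalIntegral_of_continuous
      (f := fun s t => (k (s, t) : ℂ) * v t)
      (hkc.mul (hc.comp continuous_snd)) continuous_id
  have hgx : Continuous fun s => (g (x, s) : ℂ) := by fun_prop
  have hkx : Continuous fun s => (k (x, s) : ℂ) := by fun_prop
  have hcF : Continuous (Function.uncurry fun s t : ℝ => (g (x, s) : ℂ) * ((k (s, t) : ℂ) * v t)) :=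
    (hgx.comp continuous_fst).mul (hkc.mul (hc.comp continuous_snd))
  have i1 : IntervalIntegrable (fun s => (g (x, s) : ℂ) * v s) volume 0 x :=
    (hgx.mul hc).intervalIntegrable _ _
  have i2 : IntervalIntegrable (fun s => (g (x, s) : ℂ) *
    ∫ t in (0 : ℝ)..s, (k (s, t) : ℂ) * v t) volume 0 x := (hgx.mul hinner).intervalIntegrable _ _
  have i3 : IntervalIntegrable (fun s => -((k (x, s) : ℂ) * v s)) volume 0 x :=
    (hkx.mul hc).neg.intervalIntegrable _ _
  have hfub := integral_triangle_swap hx.1 (integrable_of_continuous_prod hcF 0 x 0 x)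
  have e1 : volterra G (volterra (fun x t => k (x, t)) u) x =
      (v x + ∫ t in (0 : ℝ)..x, (k (x, t) : ℂ) * v t) +
      ((∫ s in (0 : ℝ)..x, (g (x, s) : ℂ) * v s) +
        ∫ s in (0 : ℝ)..x, ∫ t in (0 : ℝ)..s, (g (x, s) : ℂ) * ((k (s, t) : ℂ) * v t)) := by
    rw [volterra_congr (u₂ := fun s => v s + ∫ t in (0 : ℝ)..s, (k (s, t) : ℂ) * v t)
      (fun s hs => by rw [volterra_congr hvu hs]; rfl) hx, volterra]
    congr 1
    simp only [intervalIntegral.integral_const_mul]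
    rw [← intervalIntegral.integral_add i1 i2]
    refine intervalIntegral.integral_congr fun s hs => ?_
    rw [uIcc_of_le hx.1] at hs
    rw [hg x hx s hs]; ring
  have e2 : ∫ t in (0 : ℝ)..x, ∫ s in t..x, (g (x, s) : ℂ) * ((k (s, t) : ℂ) * v t) =
      -(∫ t in (0 : ℝ)..x, (k (x, t) : ℂ) * v t) - ∫ s in (0 : ℝ)..x, (g (x, s) : ℂ) * v s := by
    rw [← intervalIntegral.integral_neg, ← intervalIntegral.integral_sub i3 i1]
    refine intervalIntegral.integral_congr fun t ht => ?_
    rw [uIcc_of_le hx.1] at ht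
    have h1 := hk x hx t ht
    have h2 : ∫ s in t..x, (g (x, s) : ℂ) * ((k (s, t) : ℂ) * v t) =
        ((∫ s in t..x, g (x, s) * k (s, t) : ℝ) : ℂ) * v t := by
      rw [← intervalIntegral.integral_ofReal, ← intervalIntegral.integral_mul_const]
      refine intervalIntegral.integral_congr fun s _ => ?_
      push_cast; ring
    rw [h2, h1]
    push_cast; ring
  rw [e1, hfub, e2, hvu x hx]
  ring

/-- A right inverse K has a right inverse G' of its own, and G = G(KG') = (GK)G' = G' as operators.
So K is two-sided, and no separate left resolvent equation is needed. -/
theorem exists_isInverseKernel {G : ℝ → ℝ → ℝ}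
    (hG : ContinuousOn (Function.uncurry G) triangle) : ∃ K, IsInverseKernel G K := by
  obtain ⟨K, hK, h1⟩ := exists_right_inverse_kernel hG
  obtain ⟨G', hG', h2⟩ := exists_right_inverse_kernel hK
  refine ⟨K, hK, fun u hu x hx => ⟨?_, h1 u hu x hx⟩⟩
  have h3 : ∀ s ∈ Icc 0 π, volterra G u s = volterra G' u s := fun s hs => by
    rw [← h1 _ (continuousOn_volterra hG' hu) s hs]
    exact volterra_congr (fun r hr => (h2 u hu r hr).symm) hs
  rw [volterra_congr h3 hx, h2 u hu x hx]

end SturmLiouville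

end

section

namespace SturmLiouville

/-! ### Solutions of the Cauchy problem -/

variable {q : ℝ → ℝ} {h H : ℝ} {y y' z z' : ℝ → ℂ} {μ ν ρ : ℂ}

/-- Integrating the equation twice from zero data costs a factor x ≤ π and leaves |y(x)| ≤ π ∫₀ˣ
(|q| + |μ|)|y|, to which Grönwall's lemma applies. -/
theorem HasSecondDeriv.eq_zero_of_initial (hq : MemLp q 2 (volume.restrict (Ioc 0 π)))
    (hy : HasSecondDeriv y y' fun x => (q x : ℂ) * y x - μ * y x) (h0 : y 0 = 0)
    (h0' : y' 0 = 0) : ∀ x ∈ Icc 0 π, y x = 0 := by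
  have hm : MemLp (fun x => π * (|q x| + ‖μ‖)) 2 (volume.restrict (Ioc 0 π)) :=
    (hq.abs.add (memLp_const ‖μ‖)).const_mul π
  refine eq_zero_of_norm_le_integral hm hy.continuousOn fun x hx => ?_
  have hi : IntervalIntegrable (fun s => (|q s| + ‖μ‖) * ‖y s‖) volume 0 π :=
    ((intervalIntegrable_of_memLp hq).abs.add intervalIntegrable_const).mul_continuousOn
      (by rw [uIcc_zero_pi]; exact hy.continuousOn.norm)
  set J := ∫ s in (0 : ℝ)..x, (|q s| + ‖μ‖) * ‖y s‖ with hJ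
  have hJ0 : 0 ≤ J := intervalIntegral.integral_nonneg hx.1 fun s _ => by positivity
  have h1 : ∀ s ∈ Icc 0 x, ‖y' s‖ ≤ J := by
    intro s hs
    have hs' : s ∈ Icc 0 π := ⟨hs.1, hs.2.trans hx.2⟩
    rw [hy.deriv_eq hs', h0', zero_add]
    refine (intervalIntegral.norm_integral_le_integral_norm hs.1).trans ?_
    refine (intervalIntegral.integral_mono_on hs.1
      (intervalIntegrable_mono_pi hy.intervalIntegrable hs').norm
      (intervalIntegrable_mono_pi hi hs') fun r _ => ?_).trans
      (intervalIntegral.integral_mono_interval le_rfl hs.1 hs.2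
        (Eventually.of_forall fun r => by simp only [Pi.zero_apply]; positivity)
        (intervalIntegrable_mono_pi hi hx))
    refine (norm_sub_le _ _).trans ?_
    rw [norm_mul, norm_mul, Complex.norm_real, Real.norm_eq_abs, add_mul]
  have h2 : ‖y x‖ ≤ J * x := by
    rw [hy.eq_integral hx, h0, zero_add]
    have := intervalIntegral.norm_integral_le_of_norm_le_const (a := 0) (b := x) (f := y') (C := J)
      fun s hs => by
        rw [uIoc_of_le hx.1] at hs
        exact h1 s ⟨hs.1.le, hs.2⟩
    rwa [sub_zero, abs_of_nonneg hx.1] at this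
  have h3 : ∫ s in (0 : ℝ)..x, |π * (|q s| + ‖μ‖)| * ‖y s‖ = π * J := by
    rw [hJ, ← intervalIntegral.integral_const_mul]
    refine intervalIntegral.integral_congr fun s _ => ?_
    rw [abs_of_nonneg (by positivity), mul_assoc]
  rw [h3, mul_comm π]
  exact h2.trans (mul_le_mul_of_nonneg_left hx.2 hJ0)

theorem HasSecondDeriv.eq_of_initial (hq : MemLp q 2 (volume.restrict (Ioc 0 π)))
    (hy : HasSecondDeriv y y' fun x => (q x : ℂ) * y x - μ * y x)
    (hz : HasSecondDeriv z z' fun x => (q x : ℂ) * z x - μ * z x) (h0 : y 0 = z 0)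
    (h0' : y' 0 = z' 0) : ∀ x ∈ Icc 0 π, y x = z x := by
  intro x hx
  have := ((hy.sub hz).congr_right (w₁ := fun x => (q x : ℂ) * (y x - z x) - μ * (y x - z x))
    (Eventually.of_forall fun x => by ring)).eq_zero_of_initial hq (by rw [h0, sub_self])
    (by rw [h0', sub_self]) x hx
  exact sub_eq_zero.1 this

theorem IsCauchySolution.eqOn (hq : MemLp q 2 (volume.restrict (Ioc 0 π)))
    (hy : IsCauchySolution q h ρ y) (hz : IsCauchySolution q h ρ z) :
    ∀ x ∈ Icc 0 π, y x = z x := by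
  obtain ⟨y', h1, h2, h3⟩ := hy
  obtain ⟨z', h4, h5, h6⟩ := hz
  exact h1.eq_of_initial hq h4 (by rw [h2, h5]) (by rw [h3, h6])

theorem iteratedDerivWithin_two_cos (ρ : ℂ) {x : ℝ} (hx : x ∈ Icc 0 π) :
    iteratedDerivWithin 2 (fun x : ℝ => Complex.cos (ρ * x)) (Icc 0 π) x =
      -(ρ ^ 2 * Complex.cos (ρ * x)) := by
  have hud : UniqueDiffOn ℝ (Icc 0 π) := uniqueDiffOn_Icc Real.pi_pos
  rw [iteratedDerivWithin_succ, iteratedDerivWithin_one]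
  have h1 : EqOn (derivWithin (fun x : ℝ => Complex.cos (ρ * x)) (Icc 0 π))
      (fun x : ℝ => -(ρ * Complex.sin (ρ * x))) (Icc 0 π) := fun s hs =>
    (hasDerivAt_cos_mul ρ s).hasDerivWithinAt.derivWithin (hud s hs)
  rw [derivWithin_congr h1 (h1 hx)]
  exact ((((hasDerivAt_sin_mul ρ x).const_mul ρ).neg).congr_deriv (by ring)).hasDerivWithinAt.derivWithin
    (hud x hx)

end SturmLiouville

end

/-! ### Boundary conditions, orthogonality and integral equations for solutions. -/

section

namespace SturmLiouville

variable {q : ℝ → ℝ} {h H : ℝ} {G : ℝ → ℝ → ℝ} {y y' z z' : ℝ → ℂ} {μ ν ρ : ℂ}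

/-- The cosine is C² with vanishing derivative at 0, so the intertwining relation applies to it for
every complex ρ, even though the kernel was constructed from real frequencies. -/
theorem IsTransmutationKernel.isCauchySolution (hG : IsTransmutationKernel q h G) (ρ : ℂ) :
    IsCauchySolution q h ρ (volterra G fun x : ℝ => Complex.cos (ρ * x)) := by
  have hud : UniqueDiffOn ℝ (Icc 0 π) := uniqueDiffOn_Icc Real.pi_pos
  obtain ⟨v', h1, h2⟩ := hG.2 (fun x : ℝ => Complex.cos (ρ * x)) (contDiff_cos_mul ρ).contDiffOn
    (by rw [(hasDerivAt_cos_mul ρ 0).hasDerivWithinAt.derivWithin (hud 0 zero_mem_Icc_pi)]; simp)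
  rw [volterra_at_zero] at h2
  refine ⟨v', h1.congr_right ?_, by simp [volterra_at_zero], by simpa [sub_eq_zero] using h2⟩
  filter_upwards [ae_restrict_mem measurableSet_Icc] with x hx
  rw [volterra_congr
    (u₁ := iteratedDerivWithin 2 (fun x : ℝ => Complex.cos (ρ * x)) (Icc 0 π))
    (u₂ := fun x : ℝ => -ρ ^ 2 * Complex.cos (ρ * x))
    (fun s hs => by rw [iteratedDerivWithin_two_cos ρ hs]; ring) hx, volterra_const_mul]
  ring

theorem exists_isCauchySolution (hq : MemLp q 2 (volume.restrict (Ioc 0 π))) (h : ℝ) (ρ : ℂ) :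
    ∃ y, IsCauchySolution q h ρ y := by
  obtain ⟨G, hG⟩ := exists_isTransmutationKernel hq h
  exact ⟨_, hG.isCauchySolution ρ⟩

theorem IsCauchySolution.eq_volterra (hq : MemLp q 2 (volume.restrict (Ioc 0 π)))
    (hy : IsCauchySolution q h ρ y) (hG : IsTransmutationKernel q h G) :
    ∀ x ∈ Icc 0 π, y x = volterra G (fun x : ℝ => Complex.cos (ρ * x)) x :=
  hy.eqOn hq (hG.isCauchySolution ρ)

/-- Orthogonality of solutions of the boundary value problem. -/
theorem HasSecondDeriv.integral_mul_eq_zero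
    (hy : HasSecondDeriv y y' fun x => (q x : ℂ) * y x - μ * y x)
    (hz : HasSecondDeriv z z' fun x => (q x : ℂ) * z x - ν * z x)
    (hy0 : y' 0 - (h : ℂ) * y 0 = 0) (hyπ : y' π + (H : ℂ) * y π = 0)
    (hz0 : z' 0 - (h : ℂ) * z 0 = 0) (hzπ : z' π + (H : ℂ) * z π = 0) (hne : μ ≠ ν) :
    ∫ x in (0 : ℝ)..π, y x * z x = 0 := by
  have h1 := hy.lagrange hz pi_mem_Icc_pi
  have h2 : ∀ t, y t * ((q t : ℂ) * z t - ν * z t) - ((q t : ℂ) * y t - μ * y t) * z t =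
      (μ - ν) * (y t * z t) := fun t => by ring
  simp only [h2] at h1
  rw [intervalIntegral.integral_const_mul] at h1
  have h3 : (y π * z' π - y' π * z π) - (y 0 * z' 0 - y' 0 * z 0) = 0 := by
    rw [sub_eq_zero] at hy0 hz0
    rw [eq_neg_of_add_eq_zero_left hyπ, eq_neg_of_add_eq_zero_left hzπ, hy0, hz0]
    ring
  rw [h3] at h1
  exact (mul_eq_zero.1 h1).resolve_left (sub_ne_zero.2 hne)

theorem HasSecondDeriv.conj_equation
    (hy : HasSecondDeriv y y' fun x => (q x : ℂ) * y x - μ * y x) :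
    HasSecondDeriv (fun x => starRingEnd ℂ (y x)) (fun x => starRingEnd ℂ (y' x))
      fun x => (q x : ℂ) * starRingEnd ℂ (y x) - starRingEnd ℂ μ * starRingEnd ℂ (y x) :=
  hy.conj.congr_right (Eventually.of_forall fun x => by simp)

theorem integral_mul_conj_ne_zero (hy : ContinuousOn y (Icc 0 π))
    (hne : ∃ x ∈ Icc 0 π, y x ≠ 0) : ∫ x in (0 : ℝ)..π, y x * starRingEnd ℂ (y x) ≠ 0 := by
  have e : ∀ x, y x * starRingEnd ℂ (y x) = ((Complex.normSq (y x) : ℝ) : ℂ) :=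
    fun x => Complex.mul_conj _
  simp only [e]
  rw [intervalIntegral.integral_ofReal]
  have hpos : 0 < ∫ x in (0 : ℝ)..π, Complex.normSq (y x) := by
    obtain ⟨x, hx, hx0⟩ := hne
    exact intervalIntegral.integral_pos Real.pi_pos
      (Complex.continuous_normSq.comp_continuousOn hy) (fun x _ => Complex.normSq_nonneg _)
      ⟨x, hx, Complex.normSq_pos.2 hx0⟩
  exact_mod_cast hpos.ne'

/-- The conjugate of an eigenfunction belongs to the conjugate eigenvalue, the data being real. If
these eigenvalues differed, orthogonality would give ∫|y|² = 0. -/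
theorem IsEigenvalue.im_eq_zero (hμ : IsEigenvalue q h H μ) : μ.im = 0 := by
  obtain ⟨y, y', hy, hne, h0, hπ⟩ := hμ
  by_contra him
  have h0' := congrArg (starRingEnd ℂ) h0
  have hπ' := congrArg (starRingEnd ℂ) hπ
  simp only [map_sub, map_mul, Complex.conj_ofReal, map_zero, map_add] at h0' hπ'
  refine integral_mul_conj_ne_zero hy.continuousOn hne
    (hy.integral_mul_eq_zero hy.conj_equation h0 hπ h0' hπ' fun h => him ?_)
  exact Complex.conj_eq_iff_im.1 h.symm

theorem sqrt_sq (μ : ℂ) : Complex.sqrt μ ^ 2 = μ := by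
  simp [Complex.sqrt]

/-- Solutions satisfying the left boundary condition are multiples of the Cauchy solution. -/
theorem HasSecondDeriv.eq_mul_of_left (hq : MemLp q 2 (volume.restrict (Ioc 0 π)))
    (hy : HasSecondDeriv y y' fun x => (q x : ℂ) * y x - ρ ^ 2 * y x)
    (h0 : y 0 = 1) (h0' : y' 0 = h)
    (hz : HasSecondDeriv z z' fun x => (q x : ℂ) * z x - ρ ^ 2 * z x)
    (hz0 : z' 0 - (h : ℂ) * z 0 = 0) : ∀ x ∈ Icc 0 π, z x = z 0 * y x :=
  hz.eq_of_initial hq ((hy.const_mul (z 0)).congr_right (Eventually.of_forall fun x => by ring))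
    (by rw [h0, mul_one]) (by rw [h0', sub_eq_zero.1 hz0]; ring)

theorem HasSecondDeriv.deriv_unique {w w₁ : ℝ → ℂ} (hy : HasSecondDeriv y y' w)
    (hz : HasSecondDeriv z z' w₁) (hyz : ∀ x ∈ Icc 0 π, y x = z x) {x : ℝ} (hx : x ∈ Icc 0 π) :
    y' x = z' x :=
  (uniqueDiffOn_Icc Real.pi_pos x hx).eq_deriv _ (hy.deriv x hx)
    ((hz.deriv x hx).congr hyz (hyz x hx))

/-- By the left boundary condition an eigenfunction is a nonzero multiple of the Cauchy solution, so
eigenvalues are the zeros of the characteristic function y'(π) + H y(π). -/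
theorem isEigenvalue_iff (hq : MemLp q 2 (volume.restrict (Ioc 0 π)))
    (hy : HasSecondDeriv y y' fun x => (q x : ℂ) * y x - ρ ^ 2 * y x)
    (h0 : y 0 = 1) (h0' : y' 0 = h) :
    IsEigenvalue q h H (ρ ^ 2) ↔ y' π + (H : ℂ) * y π = 0 := by
  constructor
  · rintro ⟨z, z', hz, ⟨x, hx, hx0⟩, hz0, hzπ⟩
    have e := hy.eq_mul_of_left hq h0 h0' hz hz0
    have hz00 : z 0 ≠ 0 := fun h => hx0 (by rw [e x hx, h, zero_mul])
    have e' := hz.deriv_unique (hy.const_mul (z 0)) e pi_mem_Icc_pi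
    rw [e π pi_mem_Icc_pi, e'] at hzπ
    have : z 0 * (y' π + (H : ℂ) * y π) = 0 := by rw [← hzπ]; ring
    exact (mul_eq_zero.1 this).resolve_left hz00
  · intro hπ
    exact ⟨y, y', hy, ⟨0, zero_mem_Icc_pi, by rw [h0]; exact one_ne_zero⟩,
      by rw [h0, h0']; ring, hπ⟩

/-- Only ρ² enters the equation, so the solution is real valued for purely imaginary ρ as well, i.e.
for negative eigenvalues. -/
theorem IsCauchySolution.conj_eq (hq : MemLp q 2 (volume.restrict (Ioc 0 π)))
    (hy : IsCauchySolution q h ρ y) (hρ : (ρ ^ 2).im = 0) :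
    ∀ x ∈ Icc 0 π, starRingEnd ℂ (y x) = y x := by
  obtain ⟨y', h1, h2, h3⟩ := hy
  have h4 := h1.conj_equation
  rw [Complex.conj_eq_iff_im.2 hρ] at h4
  exact h4.eq_of_initial hq h1 (by rw [h2, map_one]) (by rw [h3, Complex.conj_ofReal])

theorem hasSecondDeriv_sin_sub (ρ : ℂ) (x : ℝ) :
    HasSecondDeriv (fun t : ℝ => Complex.sin (ρ * (x - t)))
      (fun t : ℝ => -(ρ * Complex.cos (ρ * (x - t))))
      (fun t : ℝ => -(ρ ^ 2 * Complex.sin (ρ * (x - t)))) := by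
  have h1 := ((hasSecondDeriv_cos ρ).const_mul (Complex.sin (ρ * x))).sub
    ((hasSecondDeriv_sin ρ).const_mul (Complex.cos (ρ * x)))
  refine ⟨fun t ht => ?_, ?_, ?_⟩
  · refine ((h1.deriv t ht).congr_of_eventuallyEq (Eventually.of_forall fun s => ?_) ?_).congr_deriv ?_
    · rw [mul_sub, Complex.sin_sub]
    · rw [mul_sub, Complex.sin_sub]
    · rw [mul_sub, Complex.cos_sub]; ring
  · refine h1.absCont.congr fun t _ => ?_
    rw [mul_sub, Complex.cos_sub]; ring
  · filter_upwards [h1.deriv_ae] with t ht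
    refine (ht.congr_of_eventuallyEq (Eventually.of_forall fun s => ?_)).congr_deriv ?_
    · beta_reduce
      rw [mul_sub, Complex.cos_sub]; ring
    · rw [mul_sub, Complex.sin_sub]; ring

theorem hasSecondDeriv_cos_sub (ρ : ℂ) (x : ℝ) :
    HasSecondDeriv (fun t : ℝ => Complex.cos (ρ * (x - t)))
      (fun t : ℝ => ρ * Complex.sin (ρ * (x - t)))
      (fun t : ℝ => -(ρ ^ 2 * Complex.cos (ρ * (x - t)))) := by
  have h1 := ((hasSecondDeriv_cos ρ).const_mul (Complex.cos (ρ * x))).add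
    ((hasSecondDeriv_sin ρ).const_mul (Complex.sin (ρ * x)))
  refine ⟨fun t ht => ?_, ?_, ?_⟩
  · refine ((h1.deriv t ht).congr_of_eventuallyEq (Eventually.of_forall fun s => ?_) ?_).congr_deriv ?_
    · rw [mul_sub, Complex.cos_sub]
    · rw [mul_sub, Complex.cos_sub]
    · rw [mul_sub, Complex.sin_sub]; ring
  · refine h1.absCont.congr fun t _ => ?_
    rw [mul_sub, Complex.sin_sub]; ring
  · filter_upwards [h1.deriv_ae] with t ht
    refine (ht.congr_of_eventuallyEq (Eventually.of_forall fun s => ?_)).congr_deriv ?_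
    · beta_reduce
      rw [mul_sub, Complex.sin_sub]; ring
    · rw [mul_sub, Complex.cos_sub]; ring

/-- Lagrange's identity against sin ρ(x - t), the free solution vanishing at t = x. The factor ρ is
kept on the left so that ρ = 0 needs no exception. Using cos ρ(x - t) instead gives the formula for
y'. -/
theorem HasSecondDeriv.mul_eq_integral
    (hy : HasSecondDeriv y y' fun x => (q x : ℂ) * y x - ρ ^ 2 * y x)
    (h0 : y 0 = 1) (h0' : y' 0 = h) {x : ℝ} (hx : x ∈ Icc 0 π) :
    ρ * y x = ρ * Complex.cos (ρ * x) + h * Complex.sin (ρ * x) +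
      ∫ t in (0 : ℝ)..x, Complex.sin (ρ * (x - t)) * ((q t : ℂ) * y t) := by
  have h1 := hy.lagrange (hasSecondDeriv_sin_sub ρ x) hx
  have e : ∀ t : ℝ, y t * -(ρ ^ 2 * Complex.sin (ρ * (x - t))) -
      ((q t : ℂ) * y t - ρ ^ 2 * y t) * Complex.sin (ρ * (x - t)) =
      -(Complex.sin (ρ * (x - t)) * ((q t : ℂ) * y t)) := fun t => by ring
  simp only [e, intervalIntegral.integral_neg, sub_self, mul_zero, Complex.sin_zero,
    Complex.cos_zero, Complex.ofReal_zero, sub_zero, h0, h0'] at h1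
  linear_combination h1

theorem HasSecondDeriv.deriv_eq_integral
    (hy : HasSecondDeriv y y' fun x => (q x : ℂ) * y x - ρ ^ 2 * y x)
    (h0 : y 0 = 1) (h0' : y' 0 = h) {x : ℝ} (hx : x ∈ Icc 0 π) :
    y' x = -(ρ * Complex.sin (ρ * x)) + h * Complex.cos (ρ * x) +
      ∫ t in (0 : ℝ)..x, Complex.cos (ρ * (x - t)) * ((q t : ℂ) * y t) := by
  have h1 := hy.lagrange (hasSecondDeriv_cos_sub ρ x) hx
  have e : ∀ t : ℝ, y t * -(ρ ^ 2 * Complex.cos (ρ * (x - t))) -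
      ((q t : ℂ) * y t - ρ ^ 2 * y t) * Complex.cos (ρ * (x - t)) =
      -(Complex.cos (ρ * (x - t)) * ((q t : ℂ) * y t)) := fun t => by ring
  simp only [e, intervalIntegral.integral_neg, sub_self, mul_zero, Complex.sin_zero,
    Complex.cos_zero, Complex.ofReal_zero, sub_zero, h0, h0'] at h1
  linear_combination h1

end SturmLiouville

end

/-! ### Growth estimates, location and discreteness of the eigenvalues. -/

section

namespace SturmLiouville

variable {q : ℝ → ℝ} {h H : ℝ} {G : ℝ → ℝ → ℝ} {y y' z z' : ℝ → ℂ} {μ ν ρ : ℂ}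

theorem intervalIntegrable_mul {u v : ℝ → ℂ} (hu : ContinuousOn u (Icc 0 π))
    (hv : ContinuousOn v (Icc 0 π)) : IntervalIntegrable (fun x => u x * v x) volume 0 π :=
  intervalIntegrable_of_continuousOn (hu.mul hv)

theorem norm_cos_le (z : ℂ) : ‖Complex.cos z‖ ≤ Real.exp |z.im| := by
  rw [Complex.cos, norm_div]
  have h1 : ‖Complex.exp (z * Complex.I)‖ ≤ Real.exp |z.im| := by
    rw [Complex.norm_exp]; exact Real.exp_le_exp.2 (by simpa using neg_le_abs z.im)
  have h2 : ‖Complex.exp (-z * Complex.I)‖ ≤ Real.exp |z.im| := by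
    rw [Complex.norm_exp]; exact Real.exp_le_exp.2 (by simpa using le_abs_self z.im)
  have h3 := norm_add_le (Complex.exp (z * Complex.I)) (Complex.exp (-z * Complex.I))
  rw [Complex.norm_ofNat, div_le_iff₀ two_pos]
  linarith

theorem norm_sin_le (z : ℂ) : ‖Complex.sin z‖ ≤ Real.exp |z.im| := by
  have := norm_cos_le (π / 2 - z)
  rw [Complex.cos_pi_div_two_sub] at this
  simpa [← Complex.ofReal_ofNat, ← Complex.ofReal_div] using this

theorem convex_abs_im_le (R : ℝ) : Convex ℝ {z : ℂ | |z.im| ≤ R} := by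
  have : {z : ℂ | |z.im| ≤ R} = Complex.imLm ⁻¹' Icc (-R) R := by
    ext z; simp [abs_le]
  rw [this]
  exact (convex_Icc _ _).linear_preimage _

theorem norm_cos_sub_cos_le {R : ℝ} {z w : ℂ} (hz : |z.im| ≤ R) (hw : |w.im| ≤ R) :
    ‖Complex.cos z - Complex.cos w‖ ≤ Real.exp R * ‖z - w‖ := by
  refine (convex_abs_im_le R).norm_image_sub_le_of_norm_hasDerivWithin_le (𝕜 := ℂ)
    (f' := fun z => -Complex.sin z) (fun z _ => (Complex.hasDerivAt_cos z).hasDerivWithinAt)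
    (fun z hz => ?_) hw hz
  rw [norm_neg]
  exact (norm_sin_le z).trans (Real.exp_le_exp.2 hz)

theorem norm_sin_sub_sin_le {R : ℝ} {z w : ℂ} (hz : |z.im| ≤ R) (hw : |w.im| ≤ R) :
    ‖Complex.sin z - Complex.sin w‖ ≤ Real.exp R * ‖z - w‖ := by
  refine (convex_abs_im_le R).norm_image_sub_le_of_norm_hasDerivWithin_le (𝕜 := ℂ)
    (f' := fun z => Complex.cos z) (fun z _ => (Complex.hasDerivAt_sin z).hasDerivWithinAt)
    (fun z hz => ?_) hw hz
  exact (norm_cos_le z).trans (Real.exp_le_exp.2 hz)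

theorem abs_im_mul_ofReal (ρ : ℂ) {x : ℝ} (hx : 0 ≤ x) : |(ρ * x).im| = |ρ.im| * x := by
  simp [Complex.mul_im, abs_mul, abs_of_nonneg hx]

theorem norm_cos_mul_le (ρ : ℂ) {x : ℝ} (hx : 0 ≤ x) :
    ‖Complex.cos (ρ * x)‖ ≤ Real.exp (|ρ.im| * x) := by
  rw [← abs_im_mul_ofReal ρ hx]; exact norm_cos_le _

theorem norm_sin_mul_le (ρ : ℂ) {x : ℝ} (hx : 0 ≤ x) :
    ‖Complex.sin (ρ * x)‖ ≤ Real.exp (|ρ.im| * x) := by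
  rw [← abs_im_mul_ofReal ρ hx]; exact norm_sin_le _

/-- Since c(ρ, ·) = T[cos ρ·] with one bounded kernel for all ρ, the growth of the cosine is
inherited with a constant independent of ρ, without iterating the integral equation. -/
theorem exists_norm_cauchySolution_le (hq : MemLp q 2 (volume.restrict (Ioc 0 π))) (h : ℝ) :
    ∃ C : ℝ, 0 < C ∧ ∀ ρ y, IsCauchySolution q h ρ y →
      ∀ x ∈ Icc 0 π, ‖y x‖ ≤ C * Real.exp (|ρ.im| * x) := by
  obtain ⟨G, hG⟩ := exists_isTransmutationKernel hq h
  obtain ⟨g, hg⟩ := exists_extension_of_continuousOn_triangle hG.1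
  refine ⟨1 + ‖g‖ * π, by positivity, fun ρ y hy x hx => ?_⟩
  rw [hy.eq_volterra hq hG x hx, volterra]
  have h1 : ‖∫ s in (0 : ℝ)..x, (G x s : ℂ) * Complex.cos (ρ * s)‖ ≤
      ‖g‖ * Real.exp (|ρ.im| * x) * |x - 0| := by
    refine intervalIntegral.norm_integral_le_of_norm_le_const fun s hs => ?_
    rw [uIoc_of_le hx.1] at hs
    have hs' : s ∈ Icc 0 x := ⟨hs.1.le, hs.2⟩
    rw [norm_mul, ← hg x hx s hs', Complex.norm_real]
    refine mul_le_mul (g.norm_coe_le_norm _) ((norm_cos_mul_le ρ hs'.1).trans ?_)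
      (norm_nonneg _) (norm_nonneg _)
    exact Real.exp_le_exp.2 (mul_le_mul_of_nonneg_left hs.2 (abs_nonneg _))
  rw [sub_zero, abs_of_nonneg hx.1] at h1
  have h2 : ‖g‖ * Real.exp (|ρ.im| * x) * x ≤ ‖g‖ * Real.exp (|ρ.im| * x) * π :=
    mul_le_mul_of_nonneg_left hx.2 (by positivity)
  have h3 := norm_add_le (Complex.cos (ρ * x)) (∫ s in (0 : ℝ)..x, (G x s : ℂ) * Complex.cos (ρ * s))
  have h4 := norm_cos_mul_le ρ hx.1
  nlinarith

/-- A Volterra integral with a trigonometric kernel, applied to `q y`. -/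
theorem exists_norm_integral_le (hq : MemLp q 2 (volume.restrict (Ioc 0 π))) (h : ℝ) :
    ∃ C : ℝ, 0 < C ∧ ∀ ρ y, IsCauchySolution q h ρ y → ∀ f : ℂ → ℂ,
      (∀ z, ‖f z‖ ≤ Real.exp |z.im|) → ∀ x ∈ Icc 0 π,
      ‖∫ t in (0 : ℝ)..x, f (ρ * (x - t)) * ((q t : ℂ) * y t)‖ ≤ C * Real.exp (|ρ.im| * x) := by
  obtain ⟨C, hC, hb⟩ := exists_norm_cauchySolution_le hq h
  have hqi := (intervalIntegrable_of_memLp hq).abs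
  set B := ∫ t in (0 : ℝ)..π, |q t| with hB
  have hB0 : 0 ≤ B := intervalIntegral.integral_nonneg Real.pi_nonneg fun s _ => abs_nonneg _
  refine ⟨C * (B + 1), by positivity, fun ρ y hy f hf x hx => ?_⟩
  have h1 : ‖∫ t in (0 : ℝ)..x, f (ρ * (x - t)) * ((q t : ℂ) * y t)‖ ≤
      ∫ t in (0 : ℝ)..x, (C * Real.exp (|ρ.im| * x)) * |q t| := by
    refine intervalIntegral.norm_integral_le_of_norm_le hx.1 (ae_of_all _ fun t ht => ?_)
      ((intervalIntegrable_mono_pi hqi hx).const_mul _)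
    have ht' : t ∈ Icc 0 π := ⟨ht.1.le, ht.2.trans hx.2⟩
    rw [norm_mul, norm_mul, Complex.norm_real, Real.norm_eq_abs]
    have e1 := hf (ρ * (x - t))
    rw [← Complex.ofReal_sub, abs_im_mul_ofReal _ (sub_nonneg.2 ht.2)] at e1
    rw [← Complex.ofReal_sub]
    have e2 := hb ρ y hy t ht'
    calc _ ≤ Real.exp (|ρ.im| * (x - t)) * (|q t| * (C * Real.exp (|ρ.im| * t))) := by gcongr
      _ = C * (Real.exp (|ρ.im| * (x - t)) * Real.exp (|ρ.im| * t)) * |q t| := by ring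
      _ = _ := by rw [← Real.exp_add]; ring_nf
  refine h1.trans ?_
  rw [intervalIntegral.integral_const_mul]
  have h2 : ∫ t in (0 : ℝ)..x, |q t| ≤ B :=
    intervalIntegral.integral_mono_interval le_rfl hx.1 hx.2
      (ae_of_all _ fun t => abs_nonneg _) hqi
  have h3 : 0 < C * Real.exp (|ρ.im| * x) := by positivity
  nlinarith

/-- Location of the eigenvalues. -/
theorem exists_norm_mul_sin_le (hq : MemLp q 2 (volume.restrict (Ioc 0 π))) (h H : ℝ) :
    ∃ C : ℝ, 0 < C ∧ ∀ ρ : ℂ, IsEigenvalue q h H (ρ ^ 2) →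
      ‖ρ * Complex.sin (ρ * π)‖ ≤ C * Real.exp (|ρ.im| * π) := by
  obtain ⟨C₁, hC₁, hb₁⟩ := exists_norm_cauchySolution_le hq h
  obtain ⟨C₂, hC₂, hb₂⟩ := exists_norm_integral_le hq h
  refine ⟨|h| + C₂ + |H| * C₁, by positivity, fun ρ hρ => ?_⟩
  obtain ⟨y, hy⟩ := exists_isCauchySolution hq h ρ
  have hy1 := hb₁ ρ y hy π pi_mem_Icc_pi
  have hy2 := hb₂ ρ y hy Complex.cos norm_cos_le π pi_mem_Icc_pi
  obtain ⟨y', h1, h2, h3⟩ := hy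
  have h4 := (isEigenvalue_iff hq h1 h2 h3).1 hρ
  have h5 := h1.deriv_eq_integral h2 h3 pi_mem_Icc_pi
  -- The right boundary condition eliminates y'(π) from its integral formula; every remaining term
  -- is O(exp(|Im ρ| π)).
  have h6 : ρ * Complex.sin (ρ * π) = h * Complex.cos (ρ * π) +
      (∫ t in (0 : ℝ)..π, Complex.cos (ρ * (π - t)) * ((q t : ℂ) * y t)) + H * y π := by
    linear_combination h5 - h4
  rw [h6]
  refine (norm_add₃_le).trans ?_
  rw [norm_mul, norm_mul, Complex.norm_real, Complex.norm_real, Real.norm_eq_abs, Real.norm_eq_abs]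
  have h7 := mul_le_mul_of_nonneg_left (norm_cos_mul_le ρ Real.pi_nonneg) (abs_nonneg h)
  have h8 := mul_le_mul_of_nonneg_left hy1 (abs_nonneg H)
  nlinarith

/-- At ρ = iτ the left side of the eigenvalue estimate has size τ sinh(τπ) ≥ τ exp(τπ)/4, which
exceeds C exp(τπ) once τ > 4C. This bounds the spectrum below and provides a real spectral parameter
for the Green operator. -/
theorem exists_not_isEigenvalue (hq : MemLp q 2 (volume.restrict (Ioc 0 π))) (h H : ℝ) :
    ∃ τ₀ : ℝ, 0 < τ₀ ∧ ∀ τ, τ₀ ≤ τ → ¬ IsEigenvalue q h H ((τ * Complex.I) ^ 2) := by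
  obtain ⟨C, hC, hb⟩ := exists_norm_mul_sin_le hq h H
  refine ⟨4 * C + 1, by positivity, fun τ hτ hμ => ?_⟩
  have hτ0 : 0 < τ := by linarith
  have h1 := hb _ hμ
  have e : (τ : ℂ) * Complex.I * π = ((τ * π : ℝ) : ℂ) * Complex.I := by push_cast; ring
  rw [e, Complex.sin_mul_I, norm_mul, norm_mul, norm_mul, Complex.norm_I, Complex.norm_real,
    ← Complex.ofReal_sinh, Complex.norm_real, mul_one, mul_one, Real.norm_of_nonneg hτ0.le,
    Real.norm_of_nonneg (Real.sinh_nonneg_iff.2 (by positivity))] at h1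
  simp only [Complex.mul_im, Complex.ofReal_re, Complex.I_im, mul_one, Complex.ofReal_im,
    Complex.I_re, mul_zero, add_zero, abs_of_pos hτ0] at h1
  have h3 : 1 ≤ τ * π := by nlinarith [Real.pi_gt_three]
  have h4 : Real.exp (-(τ * π)) ≤ 1 := Real.exp_le_one_iff.2 (by linarith)
  have h5 : 2 ≤ Real.exp (τ * π) := by linarith [Real.add_one_le_exp (τ * π)]
  rw [Real.sinh_eq] at h1
  nlinarith

theorem exists_lower_bound (hq : MemLp q 2 (volume.restrict (Ioc 0 π))) (h H : ℝ) :
    ∃ m : ℝ, ∀ μ : ℝ, IsEigenvalue q h H μ → m ≤ μ := by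
  obtain ⟨τ₀, h0, hτ⟩ := exists_not_isEigenvalue hq h H
  refine ⟨-τ₀ ^ 2, fun μ hμ => ?_⟩
  by_contra! hlt
  have h1 : τ₀ ≤ Real.sqrt (-μ) := Real.le_sqrt_of_sq_le (by linarith)
  refine hτ _ h1 ?_
  rwa [mul_pow, Complex.I_sq, ← Complex.ofReal_pow, Real.sq_sqrt (by nlinarith [sq_nonneg τ₀]),
    Complex.ofReal_neg, mul_neg_one, neg_neg]

/-- Lipschitz dependence on the spectral parameter. -/
theorem exists_norm_cauchySolution_sub_le (hq : MemLp q 2 (volume.restrict (Ioc 0 π))) (h R : ℝ) :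
    ∃ C : ℝ, 0 < C ∧ ∀ ρ₁ ρ₂ y₁ y₂, |ρ₁.im| ≤ R → |ρ₂.im| ≤ R → IsCauchySolution q h ρ₁ y₁ →
      IsCauchySolution q h ρ₂ y₂ → ∀ x ∈ Icc 0 π, ‖y₁ x - y₂ x‖ ≤ C * ‖ρ₁ - ρ₂‖ := by
  obtain ⟨G, hG⟩ := exists_isTransmutationKernel hq h
  obtain ⟨C, hC, hb⟩ := exists_volterra_bound hG.1
  refine ⟨C * (Real.exp (R * π) * π), by positivity, fun ρ₁ ρ₂ y₁ y₂ h1 h2 hy₁ hy₂ x hx => ?_⟩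
  have e : volterra G (fun x : ℝ => Complex.cos (ρ₁ * x)) x -
      volterra G (fun x : ℝ => Complex.cos (ρ₂ * x)) x =
      volterra G (fun x : ℝ => Complex.cos (ρ₁ * x) - Complex.cos (ρ₂ * x)) x := by
    have := volterra_sub_mul hG.1 (u₁ := fun x : ℝ => Complex.cos (ρ₁ * x))
      (u₂ := fun x : ℝ => Complex.cos (ρ₂ * x)) (by fun_prop) (by fun_prop) 1 hx
    simpa using this.symm
  rw [hy₁.eq_volterra hq hG x hx, hy₂.eq_volterra hq hG x hx, e, mul_assoc]
  refine hb _ _ (fun s hs => ?_) x hx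
  have hI : ∀ ρ : ℂ, |ρ.im| ≤ R → |(ρ * s).im| ≤ R * π := fun ρ hρ => by
    rw [abs_im_mul_ofReal ρ hs.1]
    exact mul_le_mul hρ hs.2 hs.1 ((abs_nonneg _).trans hρ)
  refine (norm_cos_sub_cos_le (hI _ h1) (hI _ h2)).trans ?_
  rw [← sub_mul, norm_mul, Complex.norm_real, Real.norm_of_nonneg hs.1, mul_assoc]
  refine mul_le_mul_of_nonneg_left ?_ (Real.exp_pos _).le
  rw [mul_comm]
  exact mul_le_mul_of_nonneg_right hs.2 (norm_nonneg _)

/-- The leading asymptotics of the solution for large real `ρ`. -/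
theorem exists_norm_cauchySolution_sub_cos_le (hq : MemLp q 2 (volume.restrict (Ioc 0 π)))
    (h : ℝ) : ∃ C : ℝ, 0 < C ∧ ∀ (r : ℝ) y, 0 < r → IsCauchySolution q h r y →
      ∀ x ∈ Icc 0 π, ‖y x - Complex.cos (r * x)‖ ≤ C / r := by
  obtain ⟨C, hC, hb⟩ := exists_norm_integral_le hq h
  refine ⟨|h| + C, by positivity, fun r y hr hy x hx => ?_⟩
  have h1 := hb r y hy Complex.sin norm_sin_le x hx
  have h0 := norm_sin_mul_le r hx.1
  obtain ⟨y', hy1, hy2, hy3⟩ := hy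
  have h2 := hy1.mul_eq_integral hy2 hy3 hx
  have h3 : (r : ℂ) * (y x - Complex.cos (r * x)) = h * Complex.sin (r * x) +
      ∫ t in (0 : ℝ)..x, Complex.sin (r * (x - t)) * ((q t : ℂ) * y t) := by
    linear_combination h2
  have h4 := congrArg norm h3
  rw [norm_mul, Complex.norm_real, Real.norm_of_nonneg hr.le] at h4
  rw [le_div_iff₀ hr, mul_comm, h4]
  refine (norm_add_le _ _).trans ?_
  rw [norm_mul, Complex.norm_real, Real.norm_eq_abs]
  simp only [Complex.ofReal_im, abs_zero, zero_mul, Real.exp_zero, mul_one] at h0 h1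
  nlinarith [abs_nonneg h]

theorem integral_sq_ne_zero (hq : MemLp q 2 (volume.restrict (Ioc 0 π)))
    (hy : IsCauchySolution q h ρ y) (hρ : (ρ ^ 2).im = 0) :
    ∫ x in (0 : ℝ)..π, y x * y x ≠ 0 := by
  have h1 := hy.conj_eq hq hρ
  have e : ∫ x in (0 : ℝ)..π, y x * y x = ∫ x in (0 : ℝ)..π, y x * starRingEnd ℂ (y x) :=
    intervalIntegral.integral_congr fun x hx => by
      rw [uIcc_zero_pi] at hx
      rw [h1 x hx]
  rw [e]
  obtain ⟨y', hy1, hy2, -⟩ := hy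
  exact integral_mul_conj_ne_zero hy1.continuousOn ⟨0, zero_mem_Icc_pi, by simp [hy2]⟩

theorem IsCauchySolution.continuousOn (hy : IsCauchySolution q h ρ y) :
    ContinuousOn y (Icc 0 π) := hy.choose_spec.1.continuousOn

theorem IsCauchySolution.integral_mul_eq_zero (hq : MemLp q 2 (volume.restrict (Ioc 0 π)))
    {ρ₁ ρ₂ : ℂ} (hy : IsCauchySolution q h ρ₁ y) (hz : IsCauchySolution q h ρ₂ z)
    (h1 : IsEigenvalue q h H (ρ₁ ^ 2)) (h2 : IsEigenvalue q h H (ρ₂ ^ 2))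
    (hne : ρ₁ ^ 2 ≠ ρ₂ ^ 2) : ∫ x in (0 : ℝ)..π, y x * z x = 0 := by
  obtain ⟨y', hy1, hy2, hy3⟩ := hy
  obtain ⟨z', hz1, hz2, hz3⟩ := hz
  exact hy1.integral_mul_eq_zero (h := h) hz1 (by rw [hy2, hy3, mul_one, sub_self])
    ((isEigenvalue_iff hq hy1 hy2 hy3).1 h1) (by rw [hz2, hz3, mul_one, sub_self])
    ((isEigenvalue_iff hq hz1 hz2 hz3).1 h2) hne

/-- The eigenvalues have no finite accumulation point. -/
theorem finite_isEigenvalue_le (hq : MemLp q 2 (volume.restrict (Ioc 0 π))) (h H M : ℝ) :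
    {μ : ℝ | IsEigenvalue q h H μ ∧ μ ≤ M}.Finite := by
  choose c hc using exists_isCauchySolution hq h
  obtain ⟨m, hm⟩ := exists_lower_bound hq h H
  set R : ℝ := |m| + |M| + 1 with hR
  set S : Set ℂ := {ρ : ℂ | IsEigenvalue q h H (ρ ^ 2)} ∩ Metric.closedBall 0 R with hS
  -- Square roots of eigenvalues in a ball cannot accumulate: solutions depend continuously on ρ,
  -- and those for distinct eigenvalues are orthogonal, so the solution at an accumulation point
  -- would be orthogonal to itself.
  have hfin : S.Finite := by
    by_contra hinf
    obtain ⟨ρ₀, hρ₀, hacc⟩ := Set.Infinite.exists_accPt_of_subset_isCompact hinf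
      (isCompact_closedBall (0 : ℂ) R) inter_subset_right
    have him : ∀ ρ ∈ Metric.closedBall (0 : ℂ) R, |ρ.im| ≤ R := fun ρ hρ =>
      (Complex.abs_im_le_norm ρ).trans (by simpa using hρ)
    obtain ⟨C, hC, hL⟩ := exists_norm_cauchySolution_sub_le hq h R
    set l : Filter ℂ := 𝓝[≠] ρ₀ ⊓ 𝓟 S with hl
    have : l.NeBot := hacc
    have hlS : ∀ᶠ ρ in l, ρ ∈ S := mem_inf_of_right (mem_principal_self S)
    have hlt : Tendsto id l (𝓝 ρ₀) := (inf_le_left.trans nhdsWithin_le_nhds : l ≤ 𝓝 ρ₀)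
    have hlne : ∀ᶠ ρ in l, ρ ≠ ρ₀ := mem_inf_of_left self_mem_nhdsWithin
    have hcont : ∀ σ : ℂ, Tendsto (fun ρ => ∫ x in (0 : ℝ)..π, c σ x * c ρ x) l
        (𝓝 (∫ x in (0 : ℝ)..π, c σ x * c ρ₀ x)) := by
      intro σ
      obtain ⟨B, hB⟩ := isCompact_Icc.exists_bound_of_continuousOn (hc σ).continuousOn
      rw [tendsto_iff_norm_sub_tendsto_zero]
      have hz : Tendsto (fun ρ => B * (C * ‖ρ - ρ₀‖) * |π - 0|) l (𝓝 0) := by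
        have h1 := (tendsto_iff_norm_sub_tendsto_zero.1 hlt)
        simpa using ((h1.const_mul C).const_mul B).mul_const |π - 0|
      refine squeeze_zero' (Eventually.of_forall fun _ => norm_nonneg _) ?_ hz
      filter_upwards [hlS] with ρ hρ
      rw [← intervalIntegral.integral_sub
        (intervalIntegrable_mul (hc σ).continuousOn (hc ρ).continuousOn)
        (intervalIntegrable_mul (hc σ).continuousOn (hc ρ₀).continuousOn)]
      refine intervalIntegral.norm_integral_le_of_norm_le_const fun x hx => ?_
      rw [uIoc_of_le Real.pi_nonneg] at hx
      have hx' : x ∈ Icc 0 π := ⟨hx.1.le, hx.2⟩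
      rw [← mul_sub, norm_mul]
      exact mul_le_mul (hB x hx') (hL _ _ _ _ (him _ hρ.2) (him _ hρ₀) (hc ρ) (hc ρ₀) x hx')
        (norm_nonneg _) ((norm_nonneg _).trans (hB x hx'))
    have hne2 : ∀ᶠ ρ in l, ρ ^ 2 ≠ ρ₀ ^ 2 := by
      by_cases h0 : ρ₀ = 0
      · filter_upwards [hlne] with ρ hρ
        rw [h0] at hρ ⊢
        simpa using hρ
      · have : ∀ᶠ ρ in l, ρ ≠ -ρ₀ := hlt.eventually_ne (fun h => h0 (by
          have : ρ₀ + ρ₀ = 0 := by nth_rewrite 1 [h]; ring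
          simpa [← two_mul] using this))
        filter_upwards [hlne, this] with ρ h1 h2 h3
        rcases sq_eq_sq_iff_eq_or_eq_neg.1 h3 with h | h
        exacts [h1 h, h2 h]
    have hsq : Tendsto (fun ρ : ℂ => ρ ^ 2) l (𝓝 (ρ₀ ^ 2)) := hlt.pow 2
    -- The limit is taken in two stages, first in ρ with σ fixed and then in σ, so that ρ₀² need not
    -- be known to be an eigenvalue.
    have horth : ∀ᶠ σ in l, ∫ x in (0 : ℝ)..π, c σ x * c ρ₀ x = 0 := by
      filter_upwards [hlS, hne2] with σ hσ hσ2
      refine tendsto_nhds_unique_of_eventuallyEq (hcont σ) tendsto_const_nhds ?_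
      filter_upwards [hlS, hsq.eventually_ne hσ2.symm] with ρ hρ hρ2
      exact (hc σ).integral_mul_eq_zero hq (hc ρ) hσ.1 hρ.1 hρ2.symm
    have hzero : ∫ x in (0 : ℝ)..π, c ρ₀ x * c ρ₀ x = 0 := by
      refine tendsto_nhds_unique_of_eventuallyEq (hcont ρ₀) tendsto_const_nhds ?_
      filter_upwards [horth] with σ hσ
      rw [← hσ]
      exact intervalIntegral.integral_congr fun x _ => mul_comm _ _
    -- Reality of ρ₀², as a limit of real eigenvalues, makes the solution at ρ₀ real, so the
    -- vanishing integral of its square is a contradiction.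
    refine integral_sq_ne_zero hq (hc ρ₀) ?_ hzero
    have h1 : Tendsto (fun ρ : ℂ => (ρ ^ 2).im) l (𝓝 ((ρ₀ ^ 2).im)) :=
      (Complex.continuous_im.tendsto _).comp hsq
    refine tendsto_nhds_unique_of_eventuallyEq h1 tendsto_const_nhds ?_
    filter_upwards [hlS] with ρ hρ using hρ.1.im_eq_zero
  refine Set.Finite.of_finite_image (f := fun μ : ℝ => Complex.sqrt μ) (hfin.subset ?_) ?_
  · rintro _ ⟨μ, ⟨h1, h2⟩, rfl⟩
    refine ⟨by simpa [sqrt_sq] using h1, ?_⟩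
    have h3 : ‖Complex.sqrt μ‖ ^ 2 = |μ| := by
      rw [← norm_pow, sqrt_sq, Complex.norm_real, Real.norm_eq_abs]
    have h4 := hm μ h1
    have h5 : |μ| ≤ |m| + |M| := by
      rw [abs_le]
      constructor
      · linarith [neg_abs_le m, abs_nonneg M]
      · linarith [le_abs_self M, abs_nonneg m]
    rw [mem_closedBall_zero_iff]
    nlinarith [norm_nonneg (Complex.sqrt μ), abs_nonneg m, abs_nonneg M]
  · intro a _ b _ hab
    have := congrArg (· ^ 2) hab
    simpa [sqrt_sq] using this

end SturmLiouville

end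

/-! ### Green's function of the boundary value problem. -/

section

namespace SturmLiouville

variable {q : ℝ → ℝ} {h H : ℝ} {y y' w : ℝ → ℂ} {ρ : ℂ}

theorem intervalIntegrable_reflect {w : ℝ → ℂ} (hw : IntervalIntegrable w volume 0 π) :
    IntervalIntegrable (fun x => w (π - x)) volume 0 π := by
  simpa using (hw.comp_sub_left π).symm

theorem HasSecondDeriv.reflect (hy : HasSecondDeriv y y' w) :
    HasSecondDeriv (fun x => y (π - x)) (fun x => -y' (π - x)) (fun x => w (π - x)) := by
  have hmem : ∀ {x}, x ∈ Icc 0 π → π - x ∈ Icc 0 π := fun hx =>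
    ⟨sub_nonneg.2 hx.2, sub_le_self _ hx.1⟩
  refine .of_integral (intervalIntegrable_reflect hy.intervalIntegrable) (fun x hx => ?_)
    (fun x hx => ?_)
  · rw [intervalIntegral.integral_comp_sub_left (fun t => w t), sub_zero,
      hy.deriv_eq (hmem hx), hy.deriv_eq pi_mem_Icc_pi,
      ← intervalIntegral.integral_add_adjacent_intervals (b := π - x) (c := π)
      (intervalIntegrable_mono_pi hy.intervalIntegrable (hmem hx))
      ((intervalIntegrable_mono_pi hy.intervalIntegrable (hmem hx)).symm.trans
        hy.intervalIntegrable)]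
    ring
  · have hi := intervalIntegrable_of_continuousOn hy.continuousOn_deriv
    rw [intervalIntegral.integral_neg, intervalIntegral.integral_comp_sub_left (fun t => y' t),
      sub_zero, hy.eq_integral (hmem hx), hy.eq_integral pi_mem_Icc_pi,
      ← intervalIntegral.integral_add_adjacent_intervals (b := π - x) (c := π)
      (intervalIntegrable_mono_pi hi (hmem hx))
      ((intervalIntegrable_mono_pi hi (hmem hx)).symm.trans hi)]
    ring

theorem memLp_reflect (hq : MemLp q 2 (volume.restrict (Ioc 0 π))) :
    MemLp (fun x => q (π - x)) 2 (volume.restrict (Ioc 0 π)) := by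
  have hmp : MeasurePreserving (fun x : ℝ => π - x) (volume.restrict (Ioc 0 π))
      (volume.restrict (Ioc 0 π)) := by
    have h1 := (Measure.measurePreserving_sub_left volume π).restrict_preimage
      (measurableSet_Ioc (a := (0 : ℝ)) (b := π))
    have h2 : (fun x : ℝ => π - x) ⁻¹' Ioc 0 π = Ico 0 π := by
      ext x; simp [and_comm]
    rw [h2] at h1
    rwa [Measure.restrict_congr_set (Ico_ae_eq_Ioc (a := (0 : ℝ)) (b := π)) (μ := volume)] at h1
  exact hq.comp_measurePreserving hmp

/-- A solution satisfying the right boundary condition. -/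
theorem exists_right_solution (hq : MemLp q 2 (volume.restrict (Ioc 0 π))) (H : ℝ) (ρ : ℂ) :
    ∃ y y' : ℝ → ℂ, HasSecondDeriv y y' (fun x => (q x : ℂ) * y x - ρ ^ 2 * y x) ∧
      y π = 1 ∧ y' π = -(H : ℂ) := by
  obtain ⟨y, y', h1, h2, h3⟩ := exists_isCauchySolution (memLp_reflect hq) H ρ
  refine ⟨_, _, h1.reflect.congr_right (Eventually.of_forall fun x => ?_), ?_, ?_⟩
  · beta_reduce; rw [sub_sub_cancel]
  · rw [sub_self, h2]
  · rw [sub_self, h3]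

/-- The solution `y` of `-y'' + q y - ρ² y = f` built from solutions `φ` and `ψ` of the homogeneous
equation with Wronskian `W`. -/
def green (φ ψ : ℝ → ℂ) (W : ℂ) (f : ℝ → ℂ) (x : ℝ) : ℂ :=
  -W⁻¹ * (ψ x * (∫ t in (0 : ℝ)..x, φ t * f t) + φ x * ∫ t in x..π, ψ t * f t)

variable {φ φ' ψ ψ' f : ℝ → ℂ} {W : ℂ}

theorem HasSecondDeriv.wronskian_eq
    (hφ : HasSecondDeriv φ φ' fun x => (q x : ℂ) * φ x - ρ ^ 2 * φ x)
    (hψ : HasSecondDeriv ψ ψ' fun x => (q x : ℂ) * ψ x - ρ ^ 2 * ψ x) {x : ℝ} (hx : x ∈ Icc 0 π) :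
    φ x * ψ' x - φ' x * ψ x = φ π * ψ' π - φ' π * ψ π := by
  have e : ∀ t : ℝ, φ t * ((q t : ℂ) * ψ t - ρ ^ 2 * ψ t) -
      ((q t : ℂ) * φ t - ρ ^ 2 * φ t) * ψ t = 0 := fun t => by ring
  have h1 := hφ.lagrange hψ hx
  have h2 := hφ.lagrange hψ pi_mem_Icc_pi
  simp only [e, intervalIntegral.integral_zero] at h1 h2
  linear_combination h2 - h1

theorem continuousOn_mul_intervalIntegrable (hφ : ContinuousOn φ (Icc 0 π))
    (hf : IntervalIntegrable f volume 0 π) :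
    IntervalIntegrable (fun t => φ t * f t) volume 0 π :=
  hf.continuousOn_mul (by rwa [uIcc_zero_pi])

/-- In the first derivative the contributions of the moving limits cancel; in the second they add up
to the Wronskian times f, which the prefactor -W⁻¹ turns into -f. -/
theorem hasSecondDeriv_green
    (hφ : HasSecondDeriv φ φ' fun x => (q x : ℂ) * φ x - ρ ^ 2 * φ x)
    (hψ : HasSecondDeriv ψ ψ' fun x => (q x : ℂ) * ψ x - ρ ^ 2 * ψ x)
    (hW : ∀ x ∈ Icc 0 π, φ x * ψ' x - φ' x * ψ x = W) (hW0 : W ≠ 0)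
    (hf : IntervalIntegrable f volume 0 π) :
    HasSecondDeriv (green φ ψ W f)
      (fun x => -W⁻¹ * (ψ' x * (∫ t in (0 : ℝ)..x, φ t * f t) + φ' x * ∫ t in x..π, ψ t * f t))
      (fun x => (q x : ℂ) * green φ ψ W f x - ρ ^ 2 * green φ ψ W f x - f x) := by
  have iA := continuousOn_mul_intervalIntegrable hφ.continuousOn hf
  have iB := continuousOn_mul_intervalIntegrable hψ.continuousOn hf
  have hB : ∀ x ∈ Icc 0 π, ∫ t in x..π, ψ t * f t =
      (∫ t in (0 : ℝ)..π, ψ t * f t) - ∫ t in (0 : ℝ)..x, ψ t * f t := fun x hx => by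
    rw [intervalIntegral.integral_interval_sub_left iB (intervalIntegrable_mono_pi iB hx)]
  have acA := iA.absolutelyContinuousOnInterval_complex
  have acB : AbsolutelyContinuousOnInterval (fun x => (∫ t in (0 : ℝ)..π, ψ t * f t) -
      ∫ t in (0 : ℝ)..x, ψ t * f t) 0 π :=
    ((contDiff_const (n := 1)).contDiffOn.absolutelyContinuousOnInterval).sub
      iB.absolutelyContinuousOnInterval_complex
  have acW : AbsolutelyContinuousOnInterval (fun _ : ℝ => -W⁻¹) 0 π :=
    (contDiff_const (n := 1)).contDiffOn.absolutelyContinuousOnInterval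
  refine HasSecondDeriv.of_ae ?_ ?_ ?_ ?_
  · refine (acW.cmul ((hψ.absCont_self.cmul acA).add (hφ.absCont_self.cmul acB))).congr
      fun x hx => ?_
    rw [uIcc_zero_pi] at hx
    rw [green, hB x hx]; rfl
  · refine (acW.cmul ((hψ.absCont.cmul acA).add (hφ.absCont.cmul acB))).congr fun x hx => ?_
    rw [uIcc_zero_pi] at hx
    rw [hB x hx]; rfl
  · filter_upwards [iA.ae_hasDerivAt_integral, iB.ae_hasDerivAt_integral, hφ.ae_hasDerivAt_self,
      hψ.ae_hasDerivAt_self, volume.ae_ne 0, volume.ae_ne π] with x h1 h2 h3 h4 h5 h6 hx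
    have hx' : x ∈ Icc 0 π := by rwa [uIcc_zero_pi] at hx
    have e1 := h1 hx 0 left_mem_uIcc
    have e2 := h2 hx 0 left_mem_uIcc
    have hnhds : Icc 0 π ∈ 𝓝 x :=
      Icc_mem_nhds (lt_of_le_of_ne hx'.1 h5.symm) (lt_of_le_of_ne hx'.2 h6)
    have e3 := ((((h4 hx).mul e1).add ((h3 hx).mul (e2.const_sub
      (∫ t in (0 : ℝ)..π, ψ t * f t)))).const_mul (-W⁻¹))
    refine (e3.congr_of_eventuallyEq ?_).congr_deriv ?_
    · filter_upwards [hnhds] with s hs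
      rw [green, hB s hs]; rfl
    · rw [hB x hx']; ring
  · filter_upwards [iA.ae_hasDerivAt_integral, iB.ae_hasDerivAt_integral, hφ.ae_hasDerivAt,
      hψ.ae_hasDerivAt, volume.ae_ne 0, volume.ae_ne π] with x h1 h2 h3 h4 h5 h6 hx
    have hx' : x ∈ Icc 0 π := by rwa [uIcc_zero_pi] at hx
    have e1 := h1 hx 0 left_mem_uIcc
    have e2 := h2 hx 0 left_mem_uIcc
    have hnhds : Icc 0 π ∈ 𝓝 x :=
      Icc_mem_nhds (lt_of_le_of_ne hx'.1 h5.symm) (lt_of_le_of_ne hx'.2 h6)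
    have e3 := ((((h4 hx).mul e1).add ((h3 hx).mul (e2.const_sub
      (∫ t in (0 : ℝ)..π, ψ t * f t)))).const_mul (-W⁻¹))
    refine (e3.congr_of_eventuallyEq ?_).congr_deriv ?_
    · filter_upwards [hnhds] with s hs
      rw [hB s hs]; rfl
    · have hw := hW x hx'
      have hinv : W⁻¹ * W = 1 := inv_mul_cancel₀ hW0
      rw [green, hB x hx']
      linear_combination (-f x * W⁻¹) * hw - f x * hinv

theorem green_left (hφ : φ' 0 = h * φ 0) :
    (-W⁻¹ * (ψ' 0 * (∫ t in (0 : ℝ)..0, φ t * f t) + φ' 0 * ∫ t in (0 : ℝ)..π, ψ t * f t)) -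
      h * green φ ψ W f 0 = 0 := by
  simp only [green, intervalIntegral.integral_same, hφ]; ring

theorem green_right (hψ : ψ' π = -(H : ℂ) * ψ π) :
    (-W⁻¹ * (ψ' π * (∫ t in (0 : ℝ)..π, φ t * f t) + φ' π * ∫ t in π..π, ψ t * f t)) +
      H * green φ ψ W f π = 0 := by
  simp only [green, intervalIntegral.integral_same, hψ]; ring

/-- Written with min and max the kernel is visibly continuous on the square, which is what
compactness needs. -/
theorem green_eq_integral (hφ : ContinuousOn φ (Icc 0 π)) (hψ : ContinuousOn ψ (Icc 0 π))
    (hf : IntervalIntegrable f volume 0 π) {x : ℝ} (hx : x ∈ Icc 0 π) :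
    green φ ψ W f x = ∫ t in (0 : ℝ)..π, -W⁻¹ * (φ (min x t) * ψ (max x t)) * f t := by
  have iA := continuousOn_mul_intervalIntegrable hφ hf
  have iB := continuousOn_mul_intervalIntegrable hψ hf
  have e1 : EqOn (fun t => -W⁻¹ * (φ (min x t) * ψ (max x t)) * f t)
      (fun t => (-W⁻¹ * ψ x) * (φ t * f t)) (uIcc 0 x) := fun t ht => by
    rw [uIcc_of_le hx.1] at ht
    beta_reduce
    rw [min_eq_right ht.2, max_eq_left ht.2]; ring
  have e2 : EqOn (fun t => -W⁻¹ * (φ (min x t) * ψ (max x t)) * f t)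
      (fun t => (-W⁻¹ * φ x) * (ψ t * f t)) (uIcc x π) := fun t ht => by
    rw [uIcc_of_le hx.2] at ht
    beta_reduce
    rw [min_eq_left ht.1, max_eq_right ht.1]; ring
  have iB' : IntervalIntegrable (fun t => ψ t * f t) volume x π :=
    (intervalIntegrable_mono_pi iB hx).symm.trans iB
  rw [← intervalIntegral.integral_add_adjacent_intervals (b := x)
    (((intervalIntegrable_mono_pi iA hx).const_mul (-W⁻¹ * ψ x)).congr fun t ht =>
      (e1 (uIoc_subset_uIcc ht)).symm)
    ((iB'.const_mul (-W⁻¹ * φ x)).congr fun t ht => (e2 (uIoc_subset_uIcc ht)).symm),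
    intervalIntegral.integral_congr e1, intervalIntegral.integral_congr e2,
    intervalIntegral.integral_const_mul, intervalIntegral.integral_const_mul, green]
  ring

end SturmLiouville

end

/-! ### The Hilbert space, the compact Green operator and completeness. -/

section

namespace SturmLiouville

/-- The measure on `[0, π]`. -/
abbrev piMeasure : Measure ℝ := volume.restrict (Ioc 0 π)

/-- The complex Hilbert space `L²(0, π)`. -/
abbrev L2 : Type := Lp ℂ 2 piMeasure

/-- An operator given by a continuous family of functionals is compact. -/
theorem isCompactOperator_of_inner {X E : Type*} [TopologicalSpace X] [CompactSpace X]
    [NormedAddCommGroup E] [InnerProductSpace ℂ E] (κ : X → E) (hκ : Continuous κ)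
    (T : E →L[ℂ] (X →ᵇ ℂ)) (hT : ∀ f x, T f x = ⟪κ x, f⟫_ℂ) : IsCompactOperator T := by
  refine ⟨closure (T '' Metric.ball 0 1), ?_, ?_⟩
  -- Equicontinuity of the image of the unit ball is the continuity of κ, by Cauchy-Schwarz.
  · refine BoundedContinuousFunction.arzela_ascoli (Metric.closedBall 0 ‖T‖)
      (isCompact_closedBall _ _) _ ?_ ?_
    · rintro _ x ⟨f, hf, rfl⟩
      rw [mem_closedBall_zero_iff]
      refine ((T f).norm_coe_le_norm x).trans ((T.le_opNorm f).trans ?_)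
      rw [mem_ball_zero_iff] at hf
      nlinarith [norm_nonneg T]
    · intro x₀
      rw [Metric.equicontinuousAt_iff_right]
      intro ε hε
      filter_upwards [Metric.continuousAt_iff'.1 hκ.continuousAt ε hε] with x hx
      rintro ⟨_, f, hf, rfl⟩
      rw [mem_ball_zero_iff] at hf
      rw [dist_eq_norm] at hx ⊢
      change ‖T f x₀ - T f x‖ < ε
      rw [hT, hT, ← inner_sub_left]
      refine (norm_inner_le_norm _ _).trans_lt ?_
      rw [norm_sub_rev]
      nlinarith [norm_nonneg (κ x - κ x₀), norm_nonneg f]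
  · filter_upwards [Metric.ball_mem_nhds (0 : E) one_pos] with f hf
    exact subset_closure ⟨f, hf, rfl⟩

theorem exists_compact_operator {X E : Type*} [TopologicalSpace X] [CompactSpace X]
    [NormedAddCommGroup E] [InnerProductSpace ℂ E] (κ : X → E) (hκ : Continuous κ) :
    ∃ T : E →L[ℂ] (X →ᵇ ℂ), (∀ f x, T f x = ⟪κ x, f⟫_ℂ) ∧ IsCompactOperator T := by
  obtain ⟨M, hM⟩ := (isCompact_range hκ).isBounded.exists_norm_le
  let L : E →ₗ[ℂ] (X →ᵇ ℂ) :=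
    { toFun := fun f => BoundedContinuousFunction.mkOfCompact
        ⟨fun x => ⟪κ x, f⟫_ℂ, hκ.inner continuous_const⟩
      map_add' := fun f g => by ext x; exact inner_add_right _ _ _
      map_smul' := fun a f => by ext x; exact inner_smul_right _ _ _ }
  have hL : ∀ f x, L f x = ⟪κ x, f⟫_ℂ := fun f x => rfl
  let T := L.mkContinuous |M| fun f => by
    refine (BoundedContinuousFunction.norm_le (by positivity)).2 fun x => ?_
    rw [hL]
    refine (norm_inner_le_norm _ _).trans (mul_le_mul_of_nonneg_right ?_ (norm_nonneg _))
    exact (hM _ ⟨x, rfl⟩).trans (le_abs_self M)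
  exact ⟨T, hL, isCompactOperator_of_inner κ hκ T hL⟩

/-- Continuous functions on `[0, π]` as elements of `L²`. -/
theorem exists_embedding : ∃ J : (Icc 0 π →ᵇ ℂ) →L[ℂ] L2,
    ∀ g, J g =ᵐ[piMeasure] fun x => g (projIcc 0 π Real.pi_nonneg x) := by
  have hm : ∀ g : Icc 0 π →ᵇ ℂ, Continuous fun x => g (projIcc 0 π Real.pi_nonneg x) :=
    fun g => g.continuous.comp continuous_projIcc
  have hLp : ∀ g : Icc 0 π →ᵇ ℂ, MemLp (fun x => g (projIcc 0 π Real.pi_nonneg x)) 2 piMeasure :=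
    fun g => MemLp.of_bound (hm g).aestronglyMeasurable ‖g‖
      (ae_of_all _ fun x => g.norm_coe_le_norm _)
  let L : (Icc 0 π →ᵇ ℂ) →ₗ[ℂ] L2 :=
    { toFun := fun g => (hLp g).toLp _
      map_add' := fun f g => MemLp.toLp_add (hLp f) (hLp g)
      map_smul' := fun a f => MemLp.toLp_const_smul a (hLp f) }
  let J := L.mkContinuous ((measureUnivNNReal piMeasure : ℝ) ^ ((2 : ENNReal).toReal)⁻¹) fun g => by
    refine Lp.norm_le_of_ae_bound (norm_nonneg g) ?_
    filter_upwards [MemLp.coeFn_toLp (hLp g)] with x hx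
    change ‖(hLp g).toLp _ x‖ ≤ _
    rw [hx]
    exact g.norm_coe_le_norm _
  exact ⟨J, fun g => MemLp.coeFn_toLp (hLp g)⟩

theorem intervalIntegrable_L2 (f : L2) : IntervalIntegrable f volume 0 π := by
  rw [intervalIntegrable_iff_integrableOn_Ioc_of_le Real.pi_nonneg]
  exact (Lp.memLp f).integrable (by norm_num)

theorem inner_L2 (f g : L2) : ⟪f, g⟫_ℂ = ∫ x in (0 : ℝ)..π, starRingEnd ℂ (f x) * g x := by
  rw [L2.inner_def, intervalIntegral.integral_of_le Real.pi_nonneg]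
  exact integral_congr_ae (ae_of_all _ fun x => mul_comm _ _)

theorem ae_piMeasure_iff {p : ℝ → Prop} :
    (∀ᵐ x ∂piMeasure, p x) ↔ ∀ᵐ x ∂volume.restrict (Icc 0 π), p x := by
  rw [piMeasure, Measure.restrict_congr_set Ioc_ae_eq_Icc]

theorem integral_congr_piMeasure {u v : ℝ → ℂ} (huv : u =ᵐ[piMeasure] v) :
    ∫ x in (0 : ℝ)..π, u x = ∫ x in (0 : ℝ)..π, v x := by
  rw [intervalIntegral.integral_of_le Real.pi_nonneg, intervalIntegral.integral_of_le Real.pi_nonneg]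
  exact integral_congr_ae huv

/-- The Green operator as a compact operator on `L²`. -/
theorem exists_green_operator {φ ψ : ℝ → ℂ} (W : ℂ) (hφ : ContinuousOn φ (Icc 0 π))
    (hψ : ContinuousOn ψ (Icc 0 π)) :
    ∃ R : L2 →L[ℂ] L2, IsCompactOperator R ∧ ∀ f : L2, R f =ᵐ[piMeasure] green φ ψ W f := by
  obtain ⟨J, hJ⟩ := exists_embedding
  -- The kernel is conjugated because it enters the inner product in the conjugate linear slot.
  let k : C(Icc (0 : ℝ) π × Icc (0 : ℝ) π, ℂ) :=
    ⟨fun p => starRingEnd ℂ (-W⁻¹ * (φ (min p.1 p.2 : Icc (0 : ℝ) π) *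
      ψ (max p.1 p.2 : Icc (0 : ℝ) π))), by
      have h1 := hφ.domRestrict
      have h2 := hψ.domRestrict
      refine Complex.continuous_conj.comp (continuous_const.mul (Continuous.mul ?_ ?_))
      · exact h1.comp (continuous_fst.min continuous_snd)
      · exact h2.comp (continuous_fst.max continuous_snd)⟩
  let κ : Icc (0 : ℝ) π → L2 := fun x => J (BoundedContinuousFunction.mkOfCompact (k.curry x))
  have hκ : Continuous κ := J.continuous.comp
    ((ContinuousMap.linearIsometryBoundedOfCompact (Icc (0 : ℝ) π) ℂ ℂ).continuous.comp
      k.curry.continuous)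
  obtain ⟨T, hT, hTc⟩ := exists_compact_operator κ hκ
  refine ⟨J.comp T, hTc.clm_comp J, fun f => ?_⟩
  refine (hJ (T f)).trans ?_
  filter_upwards [ae_restrict_mem measurableSet_Ioc] with x hx
  have hx' : x ∈ Icc 0 π := ⟨hx.1.le, hx.2⟩
  rw [projIcc_of_mem Real.pi_nonneg hx', hT, green_eq_integral hφ hψ (intervalIntegrable_L2 f) hx',
    inner_L2]
  refine integral_congr_piMeasure ?_
  filter_upwards [ae_restrict_mem measurableSet_Ioc,
    hJ (BoundedContinuousFunction.mkOfCompact (k.curry ⟨x, hx'⟩))] with t ht htJ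
  have ht' : t ∈ Icc 0 π := ⟨ht.1.le, ht.2⟩
  have e : κ ⟨x, hx'⟩ t = starRingEnd ℂ (-W⁻¹ * (φ (min x t) * ψ (max x t))) := by
    refine htJ.trans ?_
    rw [projIcc_of_mem Real.pi_nonneg ht']
    change starRingEnd ℂ (-W⁻¹ * (φ (min (⟨x, hx'⟩ : Icc (0 : ℝ) π) ⟨t, ht'⟩ : Icc (0 : ℝ) π) *
      ψ (max (⟨x, hx'⟩ : Icc (0 : ℝ) π) ⟨t, ht'⟩ : Icc (0 : ℝ) π))) = _
    rcases le_total x t with hxt | hxt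
    · have hxt' : (⟨x, hx'⟩ : Icc (0 : ℝ) π) ≤ ⟨t, ht'⟩ := hxt
      rw [min_eq_left hxt, max_eq_right hxt, min_eq_left hxt', max_eq_right hxt']
    · have hxt' : (⟨t, ht'⟩ : Icc (0 : ℝ) π) ≤ ⟨x, hx'⟩ := hxt
      rw [min_eq_right hxt, max_eq_left hxt, min_eq_right hxt', max_eq_left hxt']
  rw [e, Complex.conj_conj]

variable {q : ℝ → ℝ} {h H : ℝ} {y y' z z' : ℝ → ℂ} {ρ : ℂ}

/-- Solutions of the inhomogeneous problem are symmetric. -/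
theorem HasSecondDeriv.integral_conj_mul_eq {f g : ℝ → ℂ}
    (hy : HasSecondDeriv y y' fun x => (q x : ℂ) * y x - ρ ^ 2 * y x - f x)
    (hz : HasSecondDeriv z z' fun x => (q x : ℂ) * z x - ρ ^ 2 * z x - g x)
    (hy0 : y' 0 - (h : ℂ) * y 0 = 0) (hyπ : y' π + (H : ℂ) * y π = 0)
    (hz0 : z' 0 - (h : ℂ) * z 0 = 0) (hzπ : z' π + (H : ℂ) * z π = 0)
    (hρ : (ρ ^ 2).im = 0) (hf : IntervalIntegrable f volume 0 π)
    (hg : IntervalIntegrable g volume 0 π) :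
    ∫ x in (0 : ℝ)..π, starRingEnd ℂ (y x) * g x = ∫ x in (0 : ℝ)..π, starRingEnd ℂ (f x) * z x := by
  have h1 := hy.conj.lagrange hz pi_mem_Icc_pi
  have e : ∀ t, starRingEnd ℂ (y t) * ((q t : ℂ) * z t - ρ ^ 2 * z t - g t) -
      starRingEnd ℂ ((q t : ℂ) * y t - ρ ^ 2 * y t - f t) * z t =
      starRingEnd ℂ (f t) * z t - starRingEnd ℂ (y t) * g t := fun t => by
    have : starRingEnd ℂ (ρ ^ 2) = ρ ^ 2 := Complex.conj_eq_iff_im.2 hρ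
    rw [map_sub, map_sub, map_mul, map_mul, this, Complex.conj_ofReal]
    ring
  simp only [e] at h1
  have hcf : IntervalIntegrable (fun t => starRingEnd ℂ (f t)) volume 0 π := by
    rw [intervalIntegrable_iff] at hf ⊢
    exact Complex.conjCLE.toContinuousLinearMap.integrable_comp hf
  have i1 : IntervalIntegrable (fun t => starRingEnd ℂ (f t) * z t) volume 0 π :=
    hcf.mul_continuousOn (by rw [uIcc_zero_pi]; exact hz.continuousOn)
  have i2 : IntervalIntegrable (fun t => starRingEnd ℂ (y t) * g t) volume 0 π :=
    continuousOn_mul_intervalIntegrable hy.conj.continuousOn hg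
  rw [intervalIntegral.integral_sub i1 i2] at h1
  have h0' := congrArg (starRingEnd ℂ) hy0
  have hπ' := congrArg (starRingEnd ℂ) hyπ
  simp only [map_sub, map_mul, Complex.conj_ofReal, map_zero, map_add] at h0' hπ'
  rw [eq_neg_of_add_eq_zero_left hπ', eq_neg_of_add_eq_zero_left hzπ, sub_eq_zero.1 h0',
    sub_eq_zero.1 hz0] at h1
  linear_combination -h1

/-- Continuous functions that agree almost everywhere agree. -/
theorem eqOn_of_ae_eq {u v : ℝ → ℂ} (hu : ContinuousOn u (Icc 0 π)) (hv : ContinuousOn v (Icc 0 π))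
    (huv : u =ᵐ[piMeasure] v) : ∀ x ∈ Icc 0 π, u x = v x :=
  fun _ hx => Measure.eqOn_Icc_of_ae_eq volume Real.pi_pos.ne (ae_piMeasure_iff.1 huv) hu hv hx

/-- This serves to show that the Green operator is injective: if its value is the zero function, the
source term vanishes almost everywhere. -/
theorem HasSecondDeriv.right_ae_unique {w₁ w₂ : ℝ → ℂ} (h₁ : HasSecondDeriv y y' w₁)
    (h₂ : HasSecondDeriv z z' w₂) (hyz : ∀ x ∈ Icc 0 π, y x = z x) : w₁ =ᵐ[piMeasure] w₂ := by
  refine ae_piMeasure_iff.2 ?_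
  have h0 : ∀ᵐ x ∂volume.restrict (Icc (0 : ℝ) π), x ≠ 0 ∧ x ≠ π :=
    ae_restrict_of_ae ((volume.ae_ne 0).and (volume.ae_ne π))
  filter_upwards [h₁.deriv_ae, h₂.deriv_ae, ae_restrict_mem measurableSet_Icc, h0]
    with x e1 e2 hx hne
  have hnhds : Icc 0 π ∈ 𝓝 x :=
    Icc_mem_nhds (lt_of_le_of_ne hx.1 hne.1.symm) (lt_of_le_of_ne hx.2 hne.2)
  refine e1.unique (e2.congr_of_eventuallyEq ?_)
  filter_upwards [hnhds] with s hs using h₁.deriv_unique h₂ hyz hs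

/-- Completeness of the system of eigenfunctions. -/
theorem eq_zero_of_orthogonal (hq : MemLp q 2 piMeasure) {c : ℂ → ℝ → ℂ}
    (hc : ∀ ρ, IsCauchySolution q h ρ (c ρ)) (f : L2)
    (hf : ∀ μ, IsEigenvalue q h H μ →
      ∫ x in (0 : ℝ)..π, starRingEnd ℂ (c (Complex.sqrt μ) x) * f x = 0) : f = 0 := by
  -- At ρ = iτ the number ρ² is real, so the Green operator is symmetric, and not an eigenvalue, so
  -- the Wronskian is nonzero.
  obtain ⟨τ, hτ0, hτ⟩ := exists_not_isEigenvalue hq h H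
  set ρ : ℂ := τ * Complex.I with hρ
  have hρim : (ρ ^ 2).im = 0 := by
    rw [hρ, mul_pow, Complex.I_sq, ← Complex.ofReal_pow, mul_neg_one, Complex.neg_im, Complex.ofReal_im,
      neg_zero]
  obtain ⟨φ', hφ, hφ0, hφ0'⟩ := hc ρ
  obtain ⟨ψ, ψ', hψ, hψπ, hψπ'⟩ := exists_right_solution hq H ρ
  have hΔ : φ' π + H * c ρ π ≠ 0 := fun h =>
    hτ τ le_rfl ((isEigenvalue_iff hq hφ hφ0 hφ0').2 h)
  set W := c ρ π * ψ' π - φ' π * ψ π with hWdef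
  have hW0 : W ≠ 0 := by
    rw [hWdef, hψπ, hψπ']
    intro h; exact hΔ (by linear_combination -h)
  have hW : ∀ x ∈ Icc 0 π, c ρ x * ψ' x - φ' x * ψ x = W := fun x hx => hφ.wronskian_eq hψ hx
  obtain ⟨R, hRc, hR⟩ := exists_green_operator (φ := c ρ) (ψ := ψ) W hφ.continuousOn
    hψ.continuousOn
  have hg : ∀ g : L2, _ := fun g => hasSecondDeriv_green hφ hψ hW hW0 (intervalIntegrable_L2 g)
  have hl : ∀ g : L2, _ := fun g => green_left (φ := c ρ) (ψ := ψ) (ψ' := ψ') (W := W) (f := g)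
    (φ' := φ') (h := h) (by rw [hφ0, hφ0', mul_one])
  have hr : ∀ g : L2, _ := fun g => green_right (φ := c ρ) (ψ := ψ) (ψ' := ψ') (W := W) (f := g)
    (φ' := φ') (H := H) (by rw [hψπ, hψπ', mul_one])
  have hsymm : (R : L2 →ₗ[ℂ] L2).IsSymmetric := by
    intro u v
    change ⟪R u, v⟫_ℂ = ⟪u, R v⟫_ℂ
    have h1 := (hg u).integral_conj_mul_eq (hg v) (hl u) (hr u) (hl v) (hr v) hρim
      (intervalIntegrable_L2 u) (intervalIntegrable_L2 v)
    rw [inner_L2, inner_L2]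
    refine (integral_congr_piMeasure ?_).trans (h1.trans (integral_congr_piMeasure ?_))
    · filter_upwards [hR u] with x hx
      rw [hx]
    · filter_upwards [hR v] with x hx
      rw [hx]
  -- By the spectral theorem only f ⟂ every eigenvector v of R remains to be checked.
  have key := ContinuousLinearMap.orthogonalComplement_iSup_eigenspaces_eq_bot hRc hsymm
  have hmem : f ∈ (⨆ μ, Module.End.eigenspace (R : L2 →ₗ[ℂ] L2) μ)ᗮ := by
    rw [← Submodule.iInf_orthogonal, Submodule.mem_iInf]
    intro μ
    rw [Submodule.mem_orthogonal]
    intro v hv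
    have hv' : R v = μ • v := Module.End.mem_eigenspace_iff.1 hv
    have hRv : green (c ρ) ψ W v =ᵐ[piMeasure] fun x => μ * v x := by
      filter_upwards [hR v, Lp.coeFn_smul μ v] with x h1 h2
      rw [← h1, hv', h2]; rfl
    by_cases hμ : μ = 0
    · have h1 : ∀ x ∈ Icc 0 π, green (c ρ) ψ W v x = (fun _ : ℝ => (0 : ℂ)) x :=
        eqOn_of_ae_eq (hg v).continuousOn continuousOn_const (by
          filter_upwards [hRv] with x hx
          rw [hx, hμ, zero_mul])
      have h2 : HasSecondDeriv (fun _ => (0 : ℂ)) (fun _ => (0 : ℂ)) (fun _ => (0 : ℂ)) :=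
        .of_hasDerivAt (fun x => hasDerivAt_const x 0) (fun x => hasDerivAt_const x 0)
          continuous_const
      have h3 := (hg v).right_ae_unique h2 h1
      have h4 : v = 0 := by
        refine Lp.ext ?_
        filter_upwards [h3, Lp.coeFn_zero ℂ 2 piMeasure, ae_restrict_mem measurableSet_Ioc]
          with x h5 h6 hx
        have h7 : green (c ρ) ψ W v x = 0 := h1 x ⟨hx.1.le, hx.2⟩
        rw [h6]
        rw [h7] at h5
        simpa using h5
      rw [h4, inner_zero_left]
    · have hgv := hg v
      have hlv := hl v
      have hrv := hr v
      set y := green (c ρ) ψ W v with hy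
      -- From Rv = μv with μ ≠ 0 the function y = Rv has source v = y/μ, so it solves the
      -- homogeneous equation with spectral parameter ρ² + 1/μ and both boundary conditions. It is a
      -- multiple of c(σ, ·), and the multiple is zero unless σ² is an eigenvalue.
      set σ := Complex.sqrt (ρ ^ 2 + μ⁻¹) with hσ
      have hσ2 : σ ^ 2 = ρ ^ 2 + μ⁻¹ := sqrt_sq _
      have h1 := hgv.congr_right (w₁ := fun x => (q x : ℂ) * y x - σ ^ 2 * y x) (by
        refine ae_piMeasure_iff.1 ?_
        filter_upwards [hRv] with x hx
        rw [hσ2, hx]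
        field_simp
        ring)
      obtain ⟨c', hc1, hc2, hc3⟩ := hc σ
      have h2 := hc1.eq_mul_of_left hq hc2 hc3 h1 hlv
      rw [inner_L2]
      have h3 : ∫ x in (0 : ℝ)..π, starRingEnd ℂ (v x) * f x =
          starRingEnd ℂ (μ⁻¹ * y 0) * ∫ x in (0 : ℝ)..π, starRingEnd ℂ (c σ x) * f x := by
        rw [← intervalIntegral.integral_const_mul]
        refine integral_congr_piMeasure ?_
        filter_upwards [hRv, ae_restrict_mem measurableSet_Ioc] with x h4 h5
        have h6 : v x = μ⁻¹ * y 0 * c σ x := by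
          rw [mul_assoc, ← h2 x ⟨h5.1.le, h5.2⟩, h4, inv_mul_cancel_left₀ hμ]
        rw [h6, map_mul]; ring
      rw [h3]
      by_cases hE : IsEigenvalue q h H (ρ ^ 2 + μ⁻¹)
      · rw [hf _ hE, mul_zero]
      · have : y 0 = 0 := by
          by_contra h0
          refine hE ⟨y, fun x => -W⁻¹ * (ψ' x * (∫ t in (0 : ℝ)..x, c ρ t * v t) +
            φ' x * ∫ t in x..π, ψ t * v t), ?_, ⟨0, zero_mem_Icc_pi, h0⟩, hlv, hrv⟩
          rw [← hσ2]; exact h1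
        rw [this, mul_zero, map_zero, zero_mul]
  rw [key] at hmem
  exact (Submodule.mem_bot ℂ).1 hmem

end SturmLiouville

end

/-! ### Enumeration of the eigenvalues, orthonormal bases and Parseval's identity. -/

section

namespace SturmLiouville

/-- Finiteness below each bound makes S locally finite with a least element; being infinite, it has
no greatest one. Such a linear order is isomorphic to ℕ. -/
theorem exists_strictMono_range_eq {S : Set ℝ} (hinf : S.Infinite)
    (hfin : ∀ M, (S ∩ Iic M).Finite) : ∃ lam : ℕ → ℝ, StrictMono lam ∧ range lam = S := by
  have : Infinite S := hinf.to_subtype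
  let _ : LocallyFiniteOrder S := LocallyFiniteOrder.ofFiniteIcc fun a b =>
    Set.Finite.of_finite_image (f := ((↑) : S → ℝ)) ((hfin b).subset (by
      rintro _ ⟨x, hx, rfl⟩; exact ⟨x.2, hx.2⟩)) Subtype.val_injective.injOn
  obtain ⟨a, ha⟩ := hinf.nonempty
  obtain ⟨m, hm, hmin⟩ := (hfin a).exists_minimalFor id _ ⟨a, ha, mem_Iic.2 le_rfl⟩
  let _ : OrderBot S :=
    { bot := ⟨m, hm.1⟩
      bot_le := fun x => by
        rcases le_total (x : ℝ) a with h | h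
        · rcases le_total m (x : ℝ) with h' | h'
          · exact h'
          · exact hmin ⟨x.2, h⟩ h'
        · exact (show m ≤ (x : ℝ) from (mem_Iic.1 hm.2).trans h) }
  have : NoMaxOrder S := ⟨fun x => by
    by_contra! hx
    refine hinf ((hfin x).subset fun y hy => ⟨hy, ?_⟩)
    exact hx ⟨y, hy⟩⟩
  let _ : SuccOrder S := LinearLocallyFiniteOrder.succOrder S
  let _ : PredOrder S := LinearLocallyFiniteOrder.predOrder S
  let e : S ≃o ℕ := orderIsoNatOfLinearSuccPredArch
  refine ⟨fun n => e.symm n, fun i j hij => e.symm.strictMono hij, ?_⟩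
  ext x
  constructor
  · rintro ⟨n, rfl⟩; exact (e.symm n).2
  · intro hx; exact ⟨e ⟨x, hx⟩, by simp⟩

open Classical in
/-- The class in `L²(0, π)` of a function. -/
def toL2 (u : ℝ → ℂ) : L2 := if hu : MemLp u 2 piMeasure then hu.toLp u else 0

variable {u v : ℝ → ℂ}

theorem memLp_of_continuousOn (hu : ContinuousOn u (Icc 0 π)) : MemLp u 2 piMeasure := by
  obtain ⟨C, hC⟩ := isCompact_Icc.exists_bound_of_continuousOn hu
  refine MemLp.of_bound ((hu.mono Ioc_subset_Icc_self).aestronglyMeasurable measurableSet_Ioc) C ?_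
  filter_upwards [ae_restrict_mem measurableSet_Ioc] with x hx
  exact hC x ⟨hx.1.le, hx.2⟩

theorem coeFn_toL2 (hu : ContinuousOn u (Icc 0 π)) : toL2 u =ᵐ[piMeasure] u := by
  rw [toL2, dif_pos (memLp_of_continuousOn hu)]
  exact MemLp.coeFn_toLp _

theorem inner_toL2 (hu : ContinuousOn u (Icc 0 π)) (f : L2) :
    ⟪toL2 u, f⟫_ℂ = ∫ x in (0 : ℝ)..π, starRingEnd ℂ (u x) * f x := by
  rw [inner_L2]
  refine integral_congr_piMeasure ?_
  filter_upwards [coeFn_toL2 hu] with x hx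
  rw [hx]

theorem inner_toL2_toL2 (hu : ContinuousOn u (Icc 0 π)) (hv : ContinuousOn v (Icc 0 π)) :
    ⟪toL2 u, toL2 v⟫_ℂ = ∫ x in (0 : ℝ)..π, starRingEnd ℂ (u x) * v x := by
  rw [inner_toL2 hu]
  refine integral_congr_piMeasure ?_
  filter_upwards [coeFn_toL2 hv] with x hx
  rw [hx]

/-- The constant is √π ≤ 2. -/
theorem norm_toL2_sub_le (hu : ContinuousOn u (Icc 0 π)) (hv : ContinuousOn v (Icc 0 π)) {C : ℝ}
    (hC : ∀ x ∈ Icc 0 π, ‖u x - v x‖ ≤ C) : ‖toL2 u - toL2 v‖ ≤ 2 * C := by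
  have hC0 : 0 ≤ C := (norm_nonneg _).trans (hC 0 zero_mem_Icc_pi)
  have h1 : ‖toL2 u - toL2 v‖ ≤ (measureUnivNNReal piMeasure : ℝ) ^ ((2 : ENNReal).toReal)⁻¹ * C := by
    refine Lp.norm_le_of_ae_bound hC0 ?_
    filter_upwards [Lp.coeFn_sub (toL2 u) (toL2 v), coeFn_toL2 hu, coeFn_toL2 hv,
      ae_restrict_mem measurableSet_Ioc] with x h1 h2 h3 hx
    rw [h1, Pi.sub_apply, h2, h3]
    exact hC x ⟨hx.1.le, hx.2⟩
  refine h1.trans (mul_le_mul_of_nonneg_right ?_ hC0)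
  have h2 : (measureUnivNNReal piMeasure : ℝ) = π := by
    simp [measureUnivNNReal, ← ENNReal.toReal.eq_1, Real.pi_nonneg]
  have h3 : Real.sqrt π ≤ 2 := Real.sqrt_le_iff.2 ⟨two_pos.le, by nlinarith [Real.pi_le_four]⟩
  rw [h2]
  simpa [Real.sqrt_eq_rpow] using h3

variable {q : ℝ → ℝ} {h H : ℝ} {c : ℂ → ℝ → ℂ} {lam : ℕ → ℝ}

theorem rho_sq (lam : ℕ → ℝ) (n : ℕ) : rho lam n ^ 2 = lam n := sqrt_sq _

theorem rho_sq_im (lam : ℕ → ℝ) (n : ℕ) : (rho lam n ^ 2).im = 0 := by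
  rw [rho_sq, Complex.ofReal_im]

theorem IsEigenvalueSequence.isEigenvalue (hl : IsEigenvalueSequence q h H lam) (n : ℕ) :
    IsEigenvalue q h H (rho lam n ^ 2) := by
  rw [rho_sq]; exact (hl.2 _).2 ⟨n, rfl⟩

theorem inner_eigenfunction (hq : MemLp q 2 piMeasure) (hc : ∀ ρ, IsCauchySolution q h ρ (c ρ))
    (n : ℕ) {v : ℝ → ℂ} (hv : ContinuousOn v (Icc 0 π)) :
    ⟪toL2 (c (rho lam n)), toL2 v⟫_ℂ = ∫ x in (0 : ℝ)..π, c (rho lam n) x * v x := by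
  rw [inner_toL2_toL2 (hc _).continuousOn hv]
  refine intervalIntegral.integral_congr fun x hx => ?_
  rw [uIcc_zero_pi] at hx
  rw [(hc _).conj_eq hq (rho_sq_im lam n) x hx]

theorem weight_eq_norm_sq (hq : MemLp q 2 piMeasure) (hc : ∀ ρ, IsCauchySolution q h ρ (c ρ))
    (n : ℕ) :
    weight c lam n = ((‖toL2 (c (rho lam n))‖ ^ 2 : ℝ) : ℂ) := by
  have := inner_self_eq_norm_sq_to_K (𝕜 := ℂ) (toL2 (c (rho lam n)))
  rw [inner_eigenfunction hq hc n (hc _).continuousOn] at this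
  rw [weight, Complex.ofReal_pow]
  refine Eq.trans ?_ this
  exact intervalIntegral.integral_congr fun x _ => sq _

theorem weight_ne_zero (hq : MemLp q 2 piMeasure) (hc : ∀ ρ, IsCauchySolution q h ρ (c ρ))
    (n : ℕ) : weight c lam n ≠ 0 := by
  have := integral_sq_ne_zero hq (hc (rho lam n)) (rho_sq_im lam n)
  rw [weight]
  simpa only [sq] using this

theorem norm_eigenfunction_pos (hq : MemLp q 2 piMeasure) (hc : ∀ ρ, IsCauchySolution q h ρ (c ρ))
    (n : ℕ) : 0 < ‖toL2 (c (rho lam n))‖ := by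
  refine (norm_nonneg _).lt_of_ne fun h0 => weight_ne_zero hq hc (lam := lam) n ?_
  rw [weight_eq_norm_sq hq hc, ← h0]; simp

theorem inner_eigenfunction_eq_zero (hq : MemLp q 2 piMeasure) (hc : ∀ ρ, IsCauchySolution q h ρ (c ρ))
    (hl : IsEigenvalueSequence q h H lam) {m n : ℕ} (hmn : m ≠ n) :
    ⟪toL2 (c (rho lam m)), toL2 (c (rho lam n))⟫_ℂ = 0 := by
  rw [inner_eigenfunction hq hc m (hc _).continuousOn]
  refine (hc _).integral_mul_eq_zero hq (hc _) (hl.isEigenvalue m) (hl.isEigenvalue n) fun h0 => ?_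
  rw [rho_sq, rho_sq] at h0
  exact hmn (hl.1.injective (by exact_mod_cast h0))

/-- The normalized eigenfunctions form a Hilbert basis. -/
theorem exists_hilbertBasis (hq : MemLp q 2 piMeasure) (hc : ∀ ρ, IsCauchySolution q h ρ (c ρ))
    (hl : IsEigenvalueSequence q h H lam) : ∃ b : HilbertBasis ℕ ℂ L2,
    ∀ n, b n = ((‖toL2 (c (rho lam n))‖⁻¹ : ℝ) : ℂ) • toL2 (c (rho lam n)) := by
  set e : ℕ → L2 := fun n => ((‖toL2 (c (rho lam n))‖⁻¹ : ℝ) : ℂ) • toL2 (c (rho lam n)) with he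
  have hpos := norm_eigenfunction_pos hq hc (lam := lam)
  have ho : Orthonormal ℂ e := by
    refine ⟨fun n => ?_, fun m n hmn => ?_⟩
    · rw [he, norm_smul, Complex.norm_real, norm_inv, norm_norm, inv_mul_cancel₀ (hpos n).ne']
    · change ⟪_ • _, _ • _⟫_ℂ = 0
      rw [inner_smul_left, inner_smul_right,
        inner_eigenfunction_eq_zero hq hc hl hmn, mul_zero, mul_zero]
  have hb : (Submodule.span ℂ (range e))ᗮ = ⊥ := by
    rw [eq_bot_iff]
    intro f hf
    rw [Submodule.mem_bot]
    refine eq_zero_of_orthogonal (H := H) hq hc f fun μ hμ => ?_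
    obtain ⟨n, rfl⟩ := (hl.2 μ).1 hμ
    have h1 : ⟪e n, f⟫_ℂ = 0 :=
      (Submodule.mem_orthogonal _ _).1 hf _ (Submodule.subset_span ⟨n, rfl⟩)
    rw [he, inner_smul_left] at h1
    have h2 := (mul_eq_zero.1 h1).resolve_left (by
      rw [Complex.conj_ofReal]; exact_mod_cast (inv_pos.2 (hpos n)).ne')
    rwa [inner_toL2 (hc _).continuousOn] at h2
  exact ⟨HilbertBasis.mkOfOrthogonalEqBot ho hb, fun n => by
    rw [HilbertBasis.coe_mkOfOrthogonalEqBot]⟩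

/-- Parseval's identity for the eigenfunctions. -/
theorem hasSum_integral_mul_integral (hq : MemLp q 2 piMeasure) (hc : ∀ ρ, IsCauchySolution q h ρ (c ρ))
    (hl : IsEigenvalueSequence q h H lam) (hu : ContinuousOn u (Icc 0 π))
    (hv : ContinuousOn v (Icc 0 π)) :
    HasSum (fun n => (∫ x in (0 : ℝ)..π, c (rho lam n) x * u x) *
      (∫ x in (0 : ℝ)..π, c (rho lam n) x * v x) / weight c lam n)
      (∫ x in (0 : ℝ)..π, u x * v x) := by
  obtain ⟨b, hb⟩ := exists_hilbertBasis hq hc hl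
  -- Conjugating u turns the sesquilinear Parseval identity into a bilinear one; the eigenfunctions
  -- are real.
  have hu' : ContinuousOn (fun x => starRingEnd ℂ (u x)) (Icc 0 π) :=
    Complex.continuous_conj.comp_continuousOn hu
  have h1 := b.hasSum_inner_mul_inner (toL2 fun x => starRingEnd ℂ (u x)) (toL2 v)
  rw [inner_toL2_toL2 hu' hv] at h1
  simp only [Complex.conj_conj] at h1
  refine h1.congr_fun ?_
  intro n
  have hpos := norm_eigenfunction_pos hq hc (lam := lam) n
  rw [hb, inner_smul_left, inner_smul_right, inner_eigenfunction hq hc n hv,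
    inner_toL2_toL2 hu' (hc _).continuousOn, weight_eq_norm_sq hq hc, Complex.conj_ofReal]
  simp only [Complex.conj_conj]
  have e : ∫ x in (0 : ℝ)..π, u x * c (rho lam n) x = ∫ x in (0 : ℝ)..π, c (rho lam n) x * u x :=
    intervalIntegral.integral_congr fun x _ => mul_comm _ _
  have hne : ((‖toL2 (c (rho lam n))‖ : ℝ) : ℂ) ≠ 0 := by exact_mod_cast hpos.ne'
  rw [e]
  push_cast
  field_simp

theorem isCauchySolution_cos (ρ : ℂ) :
    IsCauchySolution 0 0 ρ fun x : ℝ => Complex.cos (ρ * x) :=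
  ⟨_, (hasSecondDeriv_cos ρ).congr_right (Eventually.of_forall fun x => by simp), by simp, by simp⟩

/-- The free problem is an instance of the general one, with characteristic function -ρ sin ρπ.
Hence completeness, orthogonality and Parseval's identity for the cosines need no separate proof. -/
theorem isEigenvalueSequence_sq : IsEigenvalueSequence 0 0 0 fun n => (n : ℝ) ^ 2 := by
  have hq : MemLp (0 : ℝ → ℝ) 2 piMeasure := MemLp.zero
  have key : ∀ ρ : ℂ, IsEigenvalue 0 0 0 (ρ ^ 2) ↔ ρ * Complex.sin (ρ * π) = 0 := fun ρ => by
    rw [isEigenvalue_iff hq ((hasSecondDeriv_cos ρ).congr_right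
      (Eventually.of_forall fun x => by simp)) (by simp) (by simp)]
    simp
  refine ⟨fun m n hmn => by dsimp only; gcongr, fun μ => ?_⟩
  rw [← sqrt_sq μ, key]
  constructor
  · intro h0
    obtain ⟨k, hk⟩ : ∃ k : ℤ, Complex.sqrt μ = k := by
      rcases mul_eq_zero.1 h0 with h0 | h0
      · exact ⟨0, by simpa using h0⟩
      · obtain ⟨k, hk⟩ := Complex.sin_eq_zero_iff.1 h0
        exact ⟨k, mul_right_cancel₀ (by exact_mod_cast Real.pi_ne_zero) hk⟩
    refine ⟨k.natAbs, ?_⟩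
    rw [hk]
    have := congrArg (Int.cast : ℤ → ℂ) (Int.natAbs_sq k)
    rw [Int.cast_pow, Int.cast_pow, Int.cast_natCast] at this
    push_cast
    exact this
  · rintro ⟨n, hn⟩
    have h1 : Complex.sqrt μ ^ 2 = (n : ℂ) ^ 2 := by rw [← hn]; push_cast; ring
    rcases sq_eq_sq_iff_eq_or_eq_neg.1 h1 with h2 | h2
    · rw [h2, Complex.sin_nat_mul_pi, mul_zero]
    · rw [h2, neg_mul, neg_mul, Complex.sin_neg, Complex.sin_nat_mul_pi, neg_zero, mul_zero,
        neg_zero]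

theorem rho_sq_eq (n : ℕ) : rho (fun n => (n : ℝ) ^ 2) n = n := by
  rw [rho, Complex.sqrt_of_nonneg (by exact_mod_cast sq_nonneg (n : ℝ))]
  rw [Complex.ofReal_re, Real.sqrt_sq n.cast_nonneg]
  simp

theorem weight_cos (n : ℕ) :
    weight (fun ρ x => Complex.cos (ρ * x)) (fun n => (n : ℝ) ^ 2) n = weight₀ n := by
  have e : ∀ x : ℝ, Complex.cos (n * x) ^ 2 = ((Real.cos (n * x) ^ 2 : ℝ) : ℂ) := fun x => by
    push_cast; rfl
  simp only [weight, rho_sq_eq, e, intervalIntegral.integral_ofReal, weight₀]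
  split_ifs with h0
  · simp [h0]
  · have hn : (n : ℝ) ≠ 0 := by exact_mod_cast h0
    rw [intervalIntegral.integral_comp_mul_left (fun x => Real.cos x ^ 2) hn, integral_cos_sq]
    simp only [Real.sin_nat_mul_pi, mul_zero, Real.sin_zero, sub_self, zero_add, sub_zero,
      smul_eq_mul]
    push_cast
    have : (n : ℂ) ≠ 0 := by exact_mod_cast h0
    field_simp

/-- If there were only finitely many, completeness would embed L²(0, π) into a finite dimensional
space, against the infinite orthogonal system of cosines. -/
theorem infinite_isEigenvalue (hq : MemLp q 2 piMeasure) (h H : ℝ) :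
    {μ : ℝ | IsEigenvalue q h H μ}.Infinite := by
  intro hfin
  choose c hc using exists_isCauchySolution hq h
  have : Finite {μ : ℝ | IsEigenvalue q h H μ} := hfin
  have := Fintype.ofFinite {μ : ℝ | IsEigenvalue q h H μ}
  let L : L2 →ₗ[ℂ] ({μ : ℝ | IsEigenvalue q h H μ} → ℂ) :=
    LinearMap.pi fun μ => (innerSL ℂ (toL2 (c (Complex.sqrt ((μ : ℝ) : ℂ))))).toLinearMap
  have hL : Function.Injective L := by
    rw [← LinearMap.ker_eq_bot, eq_bot_iff]
    intro f hf
    rw [Submodule.mem_bot]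
    refine eq_zero_of_orthogonal (H := H) hq hc f fun μ hμ => ?_
    have hμr : ((μ.re : ℝ) : ℂ) = μ := Complex.ext rfl (by simp [hμ.im_eq_zero])
    have h1 : L f ⟨μ.re, by simpa [hμr] using hμ⟩ = 0 := by
      rw [LinearMap.mem_ker.1 hf]; rfl
    have h2 : ⟪toL2 (c (Complex.sqrt ((μ.re : ℝ) : ℂ))), f⟫_ℂ = 0 := h1
    rwa [hμr, inner_toL2 (hc _).continuousOn] at h2
  have : Module.Finite ℂ L2 := Module.Finite.of_injective L hL
  have hq0 : MemLp (0 : ℝ → ℝ) 2 piMeasure := MemLp.zero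
  have hli : LinearIndependent ℂ fun n : ℕ => toL2 (fun x : ℝ =>
      Complex.cos (rho (fun n => (n : ℝ) ^ 2) n * x)) :=
    linearIndependent_of_ne_zero_of_inner_eq_zero
      (fun n => norm_pos_iff.1 (norm_eigenfunction_pos hq0 isCauchySolution_cos n))
      fun m n hmn => inner_eigenfunction_eq_zero hq0 isCauchySolution_cos isEigenvalueSequence_sq hmn
  exact not_finite_iff_infinite.2 inferInstance hli.finite

theorem exists_isEigenvalueSequence (hq : MemLp q 2 piMeasure) (h H : ℝ) :
    ∃ lam, IsEigenvalueSequence q h H lam := by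
  obtain ⟨lam, h1, h2⟩ := exists_strictMono_range_eq (infinite_isEigenvalue hq h H) fun M =>
    (finite_isEigenvalue_le hq h H M).subset fun μ hμ => ⟨hμ.1, hμ.2⟩
  refine ⟨lam, h1, fun μ => ⟨fun hμ => ?_, ?_⟩⟩
  · have hμr : ((μ.re : ℝ) : ℂ) = μ := Complex.ext rfl (by simp [hμ.im_eq_zero])
    have : μ.re ∈ range lam := by rw [h2]; simpa [hμr] using hμ
    obtain ⟨n, hn⟩ := this
    exact ⟨n, by rw [hn, hμr]⟩
  · rintro ⟨n, rfl⟩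
    have : lam n ∈ range lam := ⟨n, rfl⟩
    rwa [h2] at this

theorem IsEigenvalueSequence.tendsto (hq : MemLp q 2 piMeasure)
    (hl : IsEigenvalueSequence q h H lam) : Tendsto lam atTop atTop := by
  refine tendsto_atTop_atTop_of_monotone hl.1.monotone fun M => ?_
  by_contra! hM
  refine Set.infinite_range_of_injective hl.1.injective
    ((finite_isEigenvalue_le hq h H M).subset ?_)
  rintro _ ⟨n, rfl⟩
  exact ⟨(hl.2 _).2 ⟨n, rfl⟩, (hM n).le⟩

end SturmLiouville

end

/-! ### Comparison of orthonormal bases, and the numbering of the eigenvalues. -/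

section

namespace SturmLiouville

theorem HilbertBasis.hasSum_norm_inner_sq {E : Type*} [NormedAddCommGroup E]
    [InnerProductSpace ℂ E] (b : HilbertBasis ℕ ℂ E) (v : E) :
    HasSum (fun i => ‖⟪b i, v⟫_ℂ‖ ^ 2) (‖v‖ ^ 2) := by
  have h1 := Complex.reCLM.hasSum (b.hasSum_inner_mul_inner v v)
  have e1 : Complex.reCLM ⟪v, v⟫_ℂ = ‖v‖ ^ 2 := by
    rw [inner_self_eq_norm_sq_to_K]
    simp [← Complex.ofReal_pow]
  rw [e1] at h1
  refine h1.congr_fun fun i => ?_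
  rw [← inner_conj_symm v (b i), Complex.conj_mul']
  simp [← Complex.ofReal_pow]

/-- If the elements of an orthonormal basis from index `p` on are close to elements of another one
with indices at least `r`, then `r ≤ p`. -/
theorem HilbertBasis.le_of_tsum_lt_one {E : Type*} [NormedAddCommGroup E]
    [InnerProductSpace ℂ E] (b b' : HilbertBasis ℕ ℂ E) (m : ℕ → ℕ) {p r : ℕ}
    (hm : ∀ k, p ≤ k → r ≤ m k) (hS : Summable fun k => ‖b (k + p) - b' (m (k + p))‖ ^ 2)
    (h1 : ∑' k, ‖b (k + p) - b' (m (k + p))‖ ^ 2 < 1) : r ≤ p := by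
  by_contra! hlt
  -- If p < r, counting dimensions yields a nonzero v in the span of the first r vectors of b' that
  -- is orthogonal to the first p vectors of b.
  let S : (Fin r → ℂ) →ₗ[ℂ] E := Fintype.linearCombination ℂ fun j : Fin r => b' j
  let L : (Fin r → ℂ) →ₗ[ℂ] (Fin p → ℂ) :=
    (LinearMap.pi fun i : Fin p => (innerSL ℂ (b i)).toLinearMap).comp S
  obtain ⟨a, ha, ha0⟩ := (Submodule.ne_bot_iff _).1
    (LinearMap.ker_ne_bot_of_finrank_lt (f := L) (by simpa using hlt))
  have hli : LinearIndependent ℂ fun j : Fin r => b' j :=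
    b'.orthonormal.linearIndependent.comp (fun j : Fin r => (j : ℕ)) Fin.val_injective
  set v := S a with hv
  have hv0 : v ≠ 0 := fun h0 => ha0 (by
    have := Fintype.linearIndependent_iff.1 hli a (by
      rw [← h0, hv]; exact (Fintype.linearCombination_apply ..).symm)
    exact funext this)
  have hlow : ∀ i, i < p → ⟪b i, v⟫_ℂ = 0 := fun i hi =>
    congrFun (LinearMap.mem_ker.1 ha) ⟨i, hi⟩
  have hhigh : ∀ j, r ≤ j → ⟪b' j, v⟫_ℂ = 0 := fun j hj => by
    rw [hv, Fintype.linearCombination_apply, inner_sum]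
    refine Finset.sum_eq_zero fun i _ => ?_
    rw [inner_smul_right, b'.orthonormal.2 (by have := i.2; omega), mul_zero]
  have hsum := HilbertBasis.hasSum_norm_inner_sq b v
  have hpos : 0 < ‖v‖ ^ 2 := by positivity
  have hsum' : HasSum (fun k => ‖⟪b (k + p), v⟫_ℂ‖ ^ 2) (‖v‖ ^ 2) := by
    have := (hasSum_nat_add_iff' p).2 hsum
    rwa [Finset.sum_eq_zero (fun i hi => by
      rw [hlow i (Finset.mem_range.1 hi)]; simp), sub_zero] at this
  -- As v is orthogonal to b' (m k) for k ≥ p, its remaining coefficients can be taken against the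
  -- differences. A factor less than 1 contradicts v ≠ 0.
  have hle : ‖v‖ ^ 2 ≤ (∑' k, ‖b (k + p) - b' (m (k + p))‖ ^ 2) * ‖v‖ ^ 2 := by
    refine hasSum_le (fun k => ?_) hsum' (hS.hasSum.mul_right (‖v‖ ^ 2))
    have e : ⟪b (k + p), v⟫_ℂ = ⟪b (k + p) - b' (m (k + p)), v⟫_ℂ := by
      rw [inner_sub_left, hhigh _ (hm _ (by omega)), sub_zero]
    rw [e, ← mul_pow]
    exact pow_le_pow_left₀ (norm_nonneg _) (norm_inner_le_norm _ _) 2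
  nlinarith

/-- If almost all elements of two orthonormal bases can be matched, in increasing order and up to a
square summable error, then the matching is eventually the identity. -/
theorem HilbertBasis.eventually_eq_of_close {E : Type*} [NormedAddCommGroup E]
    [InnerProductSpace ℂ E] (b b' : HilbertBasis ℕ ℂ E) (m : ℕ → ℕ) {k₀ : ℕ}
    (hm : ∀ k, k₀ ≤ k → m k < m (k + 1)) (hS : Summable fun k => ‖b k - b' (m k)‖ ^ 2) :
    ∃ N, ∀ k, N ≤ k → m k = k := by
  have htail := tendsto_sum_nat_add fun k => ‖b k - b' (m k)‖ ^ 2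
  obtain ⟨p₀, hp₀⟩ := eventually_atTop.1 (htail.eventually_lt_const one_pos)
  have hmono : ∀ p, k₀ ≤ p → ∀ j, m p + j ≤ m (p + j) := fun p hp j => by
    induction j with
    | zero => simp
    | succ j ih => have := hm (p + j) (by omega); rw [← add_assoc p]; omega
  set p₁ := max k₀ p₀ with hp₁
  -- So k - m k is a genuine difference in ℕ from here on. It does not increase, because m is
  -- strictly increasing, and is therefore constant from a minimum point on.
  have hle : ∀ p, p₁ ≤ p → m p ≤ p := fun p hp =>
    HilbertBasis.le_of_tsum_lt_one b b' m (p := p) (r := m p)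
      (fun k hk => by
        have := hmono p (le_trans (le_max_left _ _) hp) (k - p)
        rw [Nat.add_sub_cancel' hk] at this
        omega)
      ((summable_nat_add_iff p).2 hS) (hp₀ p (le_trans (le_max_right _ _) hp))
  obtain ⟨k₁, hk₁, hmin⟩ : ∃ k₁, p₁ ≤ k₁ ∧ ∀ k, p₁ ≤ k → k₁ - m k₁ ≤ k - m k := by
    have hne : ∃ s k, p₁ ≤ k ∧ k - m k = s := ⟨_, p₁, le_rfl, rfl⟩
    classical
    obtain ⟨k₁, h1, h2⟩ := Nat.find_spec hne
    exact ⟨k₁, h1, fun k hk => h2 ▸ Nat.find_min' hne ⟨k, hk, rfl⟩⟩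
  set s := k₁ - m k₁ with hs
  have hconst : ∀ k, k₁ ≤ k → m k + s = k := fun k hk => by
    have h1 := hmin k (hk₁.trans hk)
    have h2 := hle k (hk₁.trans hk)
    have h3 := hle k₁ hk₁
    have h4 := hmono k₁ (le_trans (le_max_left _ _) hk₁) (k - k₁)
    rw [Nat.add_sub_cancel' hk] at h4
    omega
  -- With the bases exchanged, the matching j ↦ j + s has small error from k₁ on, and the dimension
  -- count gives k₁ + s ≤ k₁.
  have hs0 : s = 0 := by
    have e : ∀ k, ‖b' (k + k₁) - b (k + k₁ + s)‖ ^ 2 =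
        ‖b (k + (k₁ + s)) - b' (m (k + (k₁ + s)))‖ ^ 2 := fun k => by
      have h1 := hconst (k + (k₁ + s)) (by omega)
      have h2 : m (k + (k₁ + s)) = k + k₁ := by omega
      rw [h2, norm_sub_rev, add_assoc]
    have := HilbertBasis.le_of_tsum_lt_one b' b (fun j => j + s) (p := k₁) (r := k₁ + s)
      (fun k hk => by omega)
      (by simp only [e]
          exact (summable_nat_add_iff (f := fun k => ‖b k - b' (m k)‖ ^ 2) (k₁ + s)).2 hS)
      (by simp only [e]
          exact hp₀ (k₁ + s) (le_trans (le_max_right _ _) (hk₁.trans (Nat.le_add_right _ _))))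
    omega
  exact ⟨k₁, fun k hk => by have := hconst k hk; omega⟩

/-- The scaling factors and the vectors each contribute at most ‖a - b‖/‖b‖, which gives the factor
2. -/
theorem norm_normalize_sub_le {E : Type*} [NormedAddCommGroup E] [NormedSpace ℂ E] {a b : E}
    (ha : a ≠ 0) (hb : b ≠ 0) :
    ‖((‖a‖⁻¹ : ℝ) : ℂ) • a - ((‖b‖⁻¹ : ℝ) : ℂ) • b‖ ≤ 2 * ‖a - b‖ / ‖b‖ := by
  have ha' : 0 < ‖a‖ := norm_pos_iff.2 ha
  have hb' : 0 < ‖b‖ := norm_pos_iff.2 hb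
  have e : ((‖a‖⁻¹ : ℝ) : ℂ) • a - ((‖b‖⁻¹ : ℝ) : ℂ) • b =
      ((‖a‖⁻¹ - ‖b‖⁻¹ : ℝ) : ℂ) • a + ((‖b‖⁻¹ : ℝ) : ℂ) • (a - b) := by
    rw [Complex.ofReal_sub, sub_smul, smul_sub]; abel
  have h1 : |‖a‖⁻¹ - ‖b‖⁻¹| * ‖a‖ = |‖b‖ - ‖a‖| / ‖b‖ := by
    rw [inv_sub_inv ha'.ne' hb'.ne', abs_div, abs_mul, abs_of_pos ha', abs_of_pos hb']
    field_simp
  rw [e]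
  refine (norm_add_le _ _).trans ?_
  rw [norm_smul, norm_smul, Complex.norm_real, Complex.norm_real, Real.norm_eq_abs,
    Real.norm_eq_abs, h1, abs_of_pos (inv_pos.2 hb'), inv_mul_eq_div, ← add_div]
  have h2 : |‖b‖ - ‖a‖| ≤ ‖a - b‖ := by
    rw [norm_sub_rev]; exact abs_norm_sub_norm_le b a
  gcongr
  linarith

variable {q : ℝ → ℝ} {h H : ℝ} {c : ℂ → ℝ → ℂ} {lam : ℕ → ℝ}

theorem abs_sub_floor_le {r : ℝ} (hr : 0 ≤ r) : |r - ⌊r + 1 / 2⌋₊| ≤ 1 / 2 := by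
  have h1 := Nat.floor_le (show (0 : ℝ) ≤ r + 1 / 2 by linarith)
  have h2 := Nat.lt_floor_add_one (r + 1 / 2)
  rw [abs_le]; constructor <;> linarith

/-- Square roots of large eigenvalues are close to integers. -/
theorem exists_abs_sub_floor_le (hq : MemLp q 2 piMeasure) (h H : ℝ) :
    ∃ C : ℝ, 0 < C ∧ ∀ r : ℝ, 0 < r → IsEigenvalue q h H ((r : ℂ) ^ 2) →
      |r - ⌊r + 1 / 2⌋₊| ≤ C / r := by
  obtain ⟨C, hC, hb⟩ := exists_norm_mul_sin_le hq h H
  refine ⟨C, hC, fun r hr hμ => ?_⟩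
  have h1 := hb r hμ
  rw [norm_mul, ← Complex.ofReal_mul, ← Complex.ofReal_sin, Complex.norm_real, Complex.norm_real,
    Real.norm_of_nonneg hr.le, Complex.ofReal_im, abs_zero, zero_mul, Real.exp_zero, mul_one,
    Real.norm_eq_abs] at h1
  set n := ⌊r + 1 / 2⌋₊ with hn
  have h2 := abs_sub_floor_le hr.le
  have h3 : |Real.sin (r * π)| = |Real.sin ((r - n) * π)| := by
    rw [sub_mul, Real.sin_sub_nat_mul_pi, abs_mul, abs_pow, abs_neg, abs_one, one_pow, one_mul]
  -- Jordan's inequality; it applies because r lies within 1/2 of its nearest integer.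
  have h4 := Real.mul_abs_le_abs_sin (x := (r - n) * π) (by
    rw [abs_mul, abs_of_pos Real.pi_pos]; nlinarith [Real.pi_pos])
  rw [abs_mul, abs_of_pos Real.pi_pos, ← h3] at h4
  have h5 : 2 / π * (|r - n| * π) = 2 * |r - n| := by field_simp
  rw [h5] at h4
  rw [le_div_iff₀ hr]
  nlinarith [abs_nonneg (r - n)]

theorem rho_of_nonneg {n : ℕ} (hn : 0 ≤ lam n) : rho lam n = (Real.sqrt (lam n) : ℝ) := by
  rw [rho, Complex.sqrt_of_nonneg (by exact_mod_cast hn), Complex.ofReal_re]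

theorem norm_cos_ofReal_sub_le (a b : ℝ) {x : ℝ} (hx : x ∈ Icc 0 π) :
    ‖Complex.cos (a * x) - Complex.cos (b * x)‖ ≤ π * |a - b| := by
  have h1 := norm_cos_sub_cos_le (R := 0) (z := a * x) (w := b * x) (by simp) (by simp)
  rw [Real.exp_zero, one_mul, ← sub_mul, norm_mul, Complex.norm_real, Real.norm_of_nonneg hx.1,
    ← Complex.ofReal_sub, Complex.norm_real, Real.norm_eq_abs] at h1
  rw [mul_comm π]
  exact h1.trans (mul_le_mul_of_nonneg_left hx.2 (abs_nonneg _))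

/-- The asymptotics of the square roots of the eigenvalues. -/
theorem exists_eigenvalue_asymptotics (hq : MemLp q 2 piMeasure)
    (hl : IsEigenvalueSequence q h H lam) :
    ∃ C : ℝ, 0 < C ∧ ∃ N : ℕ, ∀ n, N ≤ n → 1 ≤ n ∧ 1 ≤ lam n ∧
      |Real.sqrt (lam n) - n| ≤ 1 / 2 ∧ |Real.sqrt (lam n) - n| ≤ C / n := by
  choose c hc using exists_isCauchySolution hq h
  obtain ⟨C₁, hC₁, hb₁⟩ := exists_abs_sub_floor_le hq h H
  obtain ⟨C₂, hC₂, hb₂⟩ := exists_norm_cauchySolution_sub_cos_le hq h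
  set r : ℕ → ℝ := fun n => Real.sqrt (lam n) with hr
  set m : ℕ → ℕ := fun n => ⌊r n + 1 / 2⌋₊ with hm
  have hlt := hl.tendsto hq
  have hrt : Tendsto r atTop atTop := Real.tendsto_sqrt_atTop.comp hlt
  have hmt : Tendsto (fun n => (m n : ℝ)) atTop atTop := by
    refine tendsto_natCast_atTop_atTop.comp (tendsto_nat_floor_atTop.comp ?_)
    exact tendsto_atTop_add_const_right _ _ hrt
  have hρ : ∀ n, 1 ≤ lam n → rho lam n = r n := fun n hn =>
    rho_of_nonneg (zero_le_one.trans hn)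
  have hr1 : ∀ n, 1 ≤ lam n → 1 ≤ r n := fun n hn => Real.one_le_sqrt.2 hn
  have hE : ∀ n, 1 ≤ lam n → IsEigenvalue q h H ((r n : ℂ) ^ 2) := fun n hn => by
    rw [← hρ n hn]; exact hl.isEigenvalue n
  have hm1 : ∀ n, 1 ≤ lam n → 1 ≤ m n := fun n hn => Nat.le_floor (by
    have := hr1 n hn; push_cast; linarith)
  have hmr : ∀ n, 1 ≤ lam n → (m n : ℝ) / 2 ≤ r n := fun n hn => by
    have h1 := (abs_le.1 (abs_sub_floor_le (zero_le_one.trans (hr1 n hn)))).1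
    have h2 : (1 : ℝ) ≤ m n := by exact_mod_cast hm1 n hn
    linarith
  obtain ⟨b, hb⟩ := exists_hilbertBasis hq hc hl
  have hq0 : MemLp (0 : ℝ → ℝ) 2 piMeasure := MemLp.zero
  obtain ⟨b', hb'⟩ := exists_hilbertBasis hq0 isCauchySolution_cos isEigenvalueSequence_sq
  simp only [rho_sq_eq] at hb'
  set C₃ := 4 * (C₂ + π * C₁) * 2 with hC₃
  have hC₃0 : 0 < C₃ := by positivity
  -- The error has two sources: c(r, ·) against cos rx, and r against the nearest integer; both are
  -- O(1/r), and r ≥ m/2.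
  have hclose : ∀ n, 1 ≤ lam n → ‖b n - b' (m n)‖ ≤ C₃ / m n := fun n hn => by
    have hrpos : 0 < r n := zero_lt_one.trans_le (hr1 n hn)
    have hmpos : (0 : ℝ) < m n := by exact_mod_cast hm1 n hn
    have h1 : ∀ x ∈ Icc 0 π, ‖c (rho lam n) x - Complex.cos ((m n : ℂ) * x)‖ ≤
        (C₂ + π * C₁) / r n := fun x hx => by
      have e1 := hb₂ (r n) (c (r n)) hrpos (hc _) x hx
      have e2 := norm_cos_ofReal_sub_le (r n) (m n) hx
      have e3 := hb₁ (r n) hrpos (hE n hn)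
      rw [hρ n hn]
      have e4 := norm_sub_le_norm_sub_add_norm_sub (c (r n) x) (Complex.cos (r n * x))
        (Complex.cos ((m n : ℂ) * x))
      have e5 : π * |r n - m n| ≤ π * (C₁ / r n) := mul_le_mul_of_nonneg_left e3 Real.pi_nonneg
      rw [add_div, mul_div_assoc]
      rw [Complex.ofReal_natCast] at e2
      linarith
    have hpos := norm_eigenfunction_pos hq hc (lam := lam) n
    have hpos' := norm_eigenfunction_pos hq0 isCauchySolution_cos
      (lam := fun n => (n : ℝ) ^ 2) (m n)
    have hw := weight_eq_norm_sq hq0 isCauchySolution_cos (lam := fun n => (n : ℝ) ^ 2) (m n)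
    rw [weight_cos, weight₀, if_neg (by have := hm1 n hn; omega)] at hw
    simp only [rho_sq_eq] at hpos' hw
    have hw' : π / 2 = ‖toL2 fun x : ℝ => Complex.cos ((m n : ℂ) * x)‖ ^ 2 := by exact_mod_cast hw
    have hge : 1 ≤ ‖toL2 fun x : ℝ => Complex.cos ((m n : ℂ) * x)‖ := by
      nlinarith [Real.pi_gt_three]
    rw [hb, hb']
    refine (norm_normalize_sub_le (norm_pos_iff.1 hpos) (norm_pos_iff.1 hpos')).trans ?_
    have h2 := norm_toL2_sub_le (hc _).continuousOn (by fun_prop) h1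
    refine (div_le_self (by positivity) hge).trans ?_
    have h3 : (C₂ + π * C₁) / r n ≤ (C₂ + π * C₁) / (m n / 2) := by
      gcongr; exact hmr n hn
    calc _ ≤ 2 * (2 * ((C₂ + π * C₁) / (m n / 2))) := by linarith
      _ = C₃ / m n := by rw [hC₃]; field_simp; ring
  obtain ⟨k₀, hk₀⟩ := eventually_atTop.1
    ((hlt.eventually_ge_atTop 1).and (hmt.eventually_gt_atTop (2 * C₃)))
  -- Two orthonormal vectors are at distance √2, so they cannot both lie within 1/2 of the same
  -- normalized cosine; hence neighbouring eigenvalues have different nearest integers.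
  have hstrict : ∀ k, k₀ ≤ k → m k < m (k + 1) := fun k hk => by
    have hk' := hk₀ k hk
    have hk'' := hk₀ (k + 1) (by omega)
    have hle : m k ≤ m (k + 1) := Nat.floor_le_floor (by
      have := Real.sqrt_le_sqrt (hl.1 (Nat.lt_succ_self k)).le
      simp only [hr]; linarith)
    refine lt_of_le_of_ne hle fun heq => ?_
    have h1 := hclose k hk'.1
    have h2 := hclose (k + 1) hk''.1
    rw [← heq] at h2
    have h3 : ‖b k - b (k + 1)‖ ^ 2 = 2 := by
      rw [@norm_sub_sq ℂ, b.orthonormal.1, b.orthonormal.1, b.orthonormal.2 (by omega)]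
      norm_num
    have h4 := norm_sub_le_norm_sub_add_norm_sub (b k) (b' (m k)) (b (k + 1))
    rw [norm_sub_rev (b' (m k))] at h4
    have h5 : C₃ / m k < 1 / 2 := by
      rw [div_lt_iff₀ (by linarith)]; linarith
    nlinarith [norm_nonneg (b k - b (k + 1))]
  have hsum : Summable fun k => ‖b k - b' (m k)‖ ^ 2 := by
    rw [← summable_nat_add_iff k₀]
    have hs : Summable fun j : ℕ => C₃ ^ 2 * (1 / ((j + 1 : ℕ) : ℝ) ^ 2) :=
      ((summable_nat_add_iff 1).2 (Real.summable_one_div_nat_pow.2 one_lt_two)).mul_left _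
    refine hs.of_nonneg_of_le (fun _ => by positivity) fun j => ?_
    have hge : ∀ j, j + 1 ≤ m (j + k₀) := fun j => by
      induction j with
      | zero => have := hm1 k₀ (hk₀ k₀ le_rfl).1; simpa using this
      | succ j ih =>
        have := hstrict (j + k₀) (by omega)
        rw [show j + 1 + k₀ = j + k₀ + 1 by omega]; omega
    have h1 := hclose (j + k₀) (hk₀ _ (by omega)).1
    have h2 : ((j + 1 : ℕ) : ℝ) ≤ m (j + k₀) := by exact_mod_cast hge j
    have h3 : C₃ / m (j + k₀) ≤ C₃ / ((j + 1 : ℕ) : ℝ) := by gcongr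
    calc _ ≤ (C₃ / ((j + 1 : ℕ) : ℝ)) ^ 2 :=
          pow_le_pow_left₀ (norm_nonneg _) (h1.trans h3) 2
      _ = _ := by rw [div_pow]; ring
  obtain ⟨N, hN⟩ := HilbertBasis.eventually_eq_of_close b b' m hstrict hsum
  refine ⟨C₁ * 2, by positivity, max N k₀, fun n hn => ?_⟩
  have hmn : m n = n := hN n (le_trans (le_max_left _ _) hn)
  have h1 := (hk₀ n (le_trans (le_max_right _ _) hn)).1
  have h2 := hm1 n h1
  have hrpos : 0 < r n := zero_lt_one.trans_le (hr1 n h1)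
  have h3 := hb₁ (r n) hrpos (hE n h1)
  have h4 := abs_sub_floor_le hrpos.le
  have h5 := hmr n h1
  change |r n - m n| ≤ _ at h3 h4
  rw [hmn] at h2 h3 h4 h5
  refine ⟨h2, h1, h4, h3.trans ?_⟩
  have hnpos : (0 : ℝ) < n := by exact_mod_cast h2
  rw [div_le_div_iff₀ hrpos hnpos]
  nlinarith

end SturmLiouville

end

/-! ### Fourier coefficients of q and the first correction to ρₙ. -/

section

namespace SturmLiouville

theorem norm_integral_mul_le {p f : ℝ → ℂ} (hp : IntervalIntegrable p volume 0 π) {x B : ℝ}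
    (hx : x ∈ Icc 0 π) (hf : ∀ t ∈ Icc 0 π, ‖f t‖ ≤ B) :
    ‖∫ t in (0 : ℝ)..x, f t * p t‖ ≤ B * ∫ t in (0 : ℝ)..π, ‖p t‖ := by
  have hB : 0 ≤ B := (norm_nonneg _).trans (hf 0 zero_mem_Icc_pi)
  have h1 : ‖∫ t in (0 : ℝ)..x, f t * p t‖ ≤ ∫ t in (0 : ℝ)..x, B * ‖p t‖ := by
    refine intervalIntegral.norm_integral_le_of_norm_le hx.1 (ae_of_all _ fun t ht => ?_)
      ((intervalIntegrable_mono_pi hp hx).norm.const_mul _)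
    rw [norm_mul]
    exact mul_le_mul_of_nonneg_right (hf t ⟨ht.1.le, ht.2.trans hx.2⟩) (norm_nonneg _)
  refine h1.trans ?_
  rw [intervalIntegral.integral_const_mul]
  exact mul_le_mul_of_nonneg_left (intervalIntegral.integral_mono_interval le_rfl hx.1 hx.2
    (ae_of_all _ fun t => norm_nonneg _) hp.norm) hB

theorem integral_exp_two_mul_I {k : ℤ} (hk : k ≠ 0) :
    ∫ t in (0 : ℝ)..π, Complex.exp (2 * k * Complex.I * t) = 0 := by
  have h0 : (2 * k * Complex.I : ℂ) ≠ 0 :=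
    mul_ne_zero (mul_ne_zero two_ne_zero (by exact_mod_cast hk)) Complex.I_ne_zero
  rw [integral_exp_mul_complex h0]
  have e : (2 * k * Complex.I * π : ℂ) = k * (2 * π * Complex.I) := by ring
  rw [e, Complex.exp_int_mul_two_pi_mul_I]
  simp

theorem conj_exp_mul (k : ℤ) (t : ℝ) : starRingEnd ℂ (Complex.exp (2 * k * Complex.I * t)) =
    Complex.exp (2 * (-k : ℤ) * Complex.I * t) := by
  rw [← Complex.exp_conj]
  congr 1
  simp only [map_mul, Complex.conj_ofNat, map_intCast, Complex.conj_I, Complex.conj_ofReal]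
  push_cast
  ring

/-- Bessel's inequality for the orthonormal system exp(-2ikt)/√π. -/
theorem summable_norm_sq_integral_exp {p : ℝ → ℂ} (hp : MemLp p 2 piMeasure) :
    Summable fun k : ℤ => ‖∫ t in (0 : ℝ)..π, Complex.exp (2 * k * Complex.I * t) * p t‖ ^ 2 := by
  have hcont : ∀ k : ℤ, ContinuousOn (fun t : ℝ => Complex.exp (2 * k * Complex.I * t)) (Icc 0 π) :=
    fun k => by fun_prop
  set v : ℤ → L2 := fun k => ((√π)⁻¹ : ℂ) •
    toL2 fun t : ℝ => Complex.exp (2 * (-k : ℤ) * Complex.I * t) with hv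
  have hπ : ((√π : ℝ) : ℂ) ^ 2 = π := by
    rw [← Complex.ofReal_pow, Real.sq_sqrt Real.pi_nonneg]
  have hπ0 : ((√π : ℝ) : ℂ) ≠ 0 := by
    exact_mod_cast (Real.sqrt_pos.2 Real.pi_pos).ne'
  have hin : ∀ j k, ⟪v j, v k⟫_ℂ = if j = k then 1 else 0 := fun j k => by
    simp only [hv]
    rw [inner_smul_left, inner_smul_right, inner_toL2_toL2 (hcont _) (hcont _)]
    have e : ∀ t : ℝ, starRingEnd ℂ (Complex.exp (2 * (-j : ℤ) * Complex.I * t)) *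
        Complex.exp (2 * (-k : ℤ) * Complex.I * t) =
        Complex.exp (2 * (j - k : ℤ) * Complex.I * t) := fun t => by
      rw [conj_exp_mul, ← Complex.exp_add]
      congr 1
      push_cast
      ring
    simp only [e]
    split_ifs with hjk
    · subst hjk
      simp only [sub_self, Int.cast_zero, mul_zero, zero_mul, Complex.exp_zero,
        intervalIntegral.integral_const, sub_zero, map_inv₀, Complex.conj_ofReal,
        Complex.real_smul, mul_one]
      rw [← hπ]
      field_simp
    · rw [integral_exp_two_mul_I (sub_ne_zero.2 hjk), mul_zero, mul_zero]
  have ho : Orthonormal ℂ v := by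
    rw [orthonormal_iff_ite]; exact hin
  have h1 := ho.inner_products_summable (x := hp.toLp p)
  refine (h1.mul_left π).congr fun k => ?_
  have e : ⟪v k, hp.toLp p⟫_ℂ = ((√π)⁻¹ : ℂ) *
      ∫ t in (0 : ℝ)..π, Complex.exp (2 * k * Complex.I * t) * p t := by
    simp only [hv]
    rw [inner_smul_left, inner_toL2 (hcont _), map_inv₀, Complex.conj_ofReal]
    congr 1
    refine integral_congr_piMeasure ?_
    filter_upwards [MemLp.coeFn_toLp hp] with t ht
    rw [conj_exp_mul, ht, neg_neg]
  rw [e, norm_mul, mul_pow, norm_inv, Complex.norm_real, inv_pow, Real.norm_eq_abs, sq_abs,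
    Real.sq_sqrt Real.pi_nonneg, mul_inv_cancel_left₀ Real.pi_ne_zero]

/-- From a · (1/n) ≤ a² + 1/n². This is where square integrability, rather than mere integrability,
of q enters the error terms. -/
theorem summable_norm_integral_exp_div {p : ℝ → ℂ} (hp : MemLp p 2 piMeasure) {g : ℕ → ℤ}
    (hg : Function.Injective g) : Summable fun n : ℕ =>
      ‖∫ t in (0 : ℝ)..π, Complex.exp (2 * g n * Complex.I * t) * p t‖ / n := by
  have h1 := (summable_norm_sq_integral_exp hp).comp_injective hg
  have h2 : Summable fun n : ℕ => 1 / (n : ℝ) ^ 2 := Real.summable_one_div_nat_pow.2 one_lt_two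
  refine (h1.add h2).of_nonneg_of_le (fun n => by positivity) fun n => ?_
  simp only [Function.comp_apply]
  set a := ‖∫ t in (0 : ℝ)..π, Complex.exp (2 * g n * Complex.I * t) * p t‖
  have e : a / n = a * (1 / n) := by ring
  have e' : 1 / (n : ℝ) ^ 2 = (1 / (n : ℝ)) ^ 2 := by ring
  rw [e, e']
  nlinarith [sq_nonneg (a - 1 / (n : ℝ)), sq_nonneg a, sq_nonneg (1 / (n : ℝ))]

theorem continuousOn_mul_of_memLp {p f : ℝ → ℂ} (hp : MemLp p 2 piMeasure)
    (hf : ContinuousOn f (Icc 0 π)) : IntervalIntegrable (fun t => f t * p t) volume 0 π :=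
  continuousOn_mul_intervalIntegrable hf (intervalIntegrable_of_memLp hp)

theorem norm_integral_cos_mul_le {p : ℝ → ℂ} (hp : MemLp p 2 piMeasure) (n : ℕ) :
    ‖∫ t in (0 : ℝ)..π, Complex.cos (2 * n * t) * p t‖ ≤
      ‖∫ t in (0 : ℝ)..π, Complex.exp (2 * (n : ℤ) * Complex.I * t) * p t‖ +
      ‖∫ t in (0 : ℝ)..π, Complex.exp (2 * (-n : ℤ) * Complex.I * t) * p t‖ := by
  have e : ∫ t in (0 : ℝ)..π, Complex.cos (2 * n * t) * p t =
      (1 / 2) * ((∫ t in (0 : ℝ)..π, Complex.exp (2 * (n : ℤ) * Complex.I * t) * p t) +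
      ∫ t in (0 : ℝ)..π, Complex.exp (2 * (-n : ℤ) * Complex.I * t) * p t) := by
    rw [← intervalIntegral.integral_add (continuousOn_mul_of_memLp hp (by fun_prop))
      (continuousOn_mul_of_memLp hp (by fun_prop)), ← intervalIntegral.integral_const_mul]
    refine intervalIntegral.integral_congr fun t _ => ?_
    rw [Complex.cos]
    push_cast
    rw [show (2 : ℂ) * n * t * Complex.I = 2 * n * Complex.I * t by ring,
      show -((2 : ℂ) * n * t) * Complex.I = 2 * -n * Complex.I * t by ring]
    ring
  rw [e, norm_mul]
  refine (mul_le_of_le_one_left (norm_nonneg _) (by norm_num)).trans (norm_add_le _ _)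

theorem norm_integral_sin_mul_le {p : ℝ → ℂ} (hp : MemLp p 2 piMeasure) (n : ℕ) :
    ‖∫ t in (0 : ℝ)..π, Complex.sin (2 * n * t) * p t‖ ≤
      ‖∫ t in (0 : ℝ)..π, Complex.exp (2 * (n : ℤ) * Complex.I * t) * p t‖ +
      ‖∫ t in (0 : ℝ)..π, Complex.exp (2 * (-n : ℤ) * Complex.I * t) * p t‖ := by
  have e : ∫ t in (0 : ℝ)..π, Complex.sin (2 * n * t) * p t =
      (Complex.I / 2) * ((∫ t in (0 : ℝ)..π, Complex.exp (2 * (-n : ℤ) * Complex.I * t) * p t) -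
      ∫ t in (0 : ℝ)..π, Complex.exp (2 * (n : ℤ) * Complex.I * t) * p t) := by
    rw [← intervalIntegral.integral_sub (continuousOn_mul_of_memLp hp (by fun_prop))
      (continuousOn_mul_of_memLp hp (by fun_prop)), ← intervalIntegral.integral_const_mul]
    refine intervalIntegral.integral_congr fun t _ => ?_
    rw [Complex.sin]
    push_cast
    rw [show (2 : ℂ) * n * t * Complex.I = 2 * n * Complex.I * t by ring,
      show -((2 : ℂ) * n * t) * Complex.I = 2 * -n * Complex.I * t by ring]
    ring
  rw [e, norm_mul, add_comm]
  refine (mul_le_of_le_one_left (norm_nonneg _) (by norm_num)).trans (norm_sub_le _ _)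

theorem summable_norm_integral_cos_div {p : ℝ → ℂ} (hp : MemLp p 2 piMeasure) :
    Summable fun n : ℕ => ‖∫ t in (0 : ℝ)..π, Complex.cos (2 * n * t) * p t‖ / n := by
  have h1 := summable_norm_integral_exp_div hp (g := fun n => (n : ℤ)) Nat.cast_injective
  have h2 := summable_norm_integral_exp_div hp (g := fun n => -(n : ℤ))
    (neg_injective.comp Nat.cast_injective)
  refine (h1.add h2).of_nonneg_of_le (fun n => by positivity) fun n => ?_
  rw [← add_div]
  exact div_le_div_of_nonneg_right (norm_integral_cos_mul_le hp n) n.cast_nonneg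

theorem summable_norm_integral_sin_div {p : ℝ → ℂ} (hp : MemLp p 2 piMeasure) :
    Summable fun n : ℕ => ‖∫ t in (0 : ℝ)..π, Complex.sin (2 * n * t) * p t‖ / n := by
  have h1 := summable_norm_integral_exp_div hp (g := fun n => (n : ℤ)) Nat.cast_injective
  have h2 := summable_norm_integral_exp_div hp (g := fun n => -(n : ℤ))
    (neg_injective.comp Nat.cast_injective)
  refine (h1.add h2).of_nonneg_of_le (fun n => by positivity) fun n => ?_
  rw [← add_div]
  exact div_le_div_of_nonneg_right (norm_integral_sin_mul_le hp n) n.cast_nonneg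

theorem memLp_ofReal {q : ℝ → ℝ} (hq : MemLp q 2 piMeasure) :
    MemLp (fun t => (q t : ℂ)) 2 piMeasure := hq.ofReal

theorem abs_sin_sub_self_le_sq (x : ℝ) : |Real.sin x - x| ≤ x ^ 2 := by
  have h1 := (convex_Icc (-|x|) |x|).norm_image_sub_le_of_norm_hasDerivWithin_le (C := |x|)
    (f := fun t => Real.sin t - t) (f' := fun t => Real.cos t - 1)
    (fun t _ => ((Real.hasDerivAt_sin t).sub (hasDerivAt_id t)).hasDerivWithinAt)
    (fun t ht => by
      have := Real.abs_cos_sub_cos_le t 0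
      rw [Real.cos_zero, sub_zero] at this
      exact this.trans (abs_le.2 ht))
    (x := 0) (y := x) ⟨by simp, by simp⟩ ⟨neg_abs_le x, le_abs_self x⟩
  simpa [← sq] using h1

variable {q : ℝ → ℝ} {h H : ℝ} {c : ℂ → ℝ → ℂ} {lam : ℕ → ℝ} {y : ℝ → ℂ} {ρ : ℂ}

theorem IsCauchySolution.mul_sin_eq (hq : MemLp q 2 piMeasure) (hy : IsCauchySolution q h ρ y)
    (hρ : IsEigenvalue q h H (ρ ^ 2)) :
    ρ * Complex.sin (ρ * π) = h * Complex.cos (ρ * π) +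
      (∫ t in (0 : ℝ)..π, Complex.cos (ρ * (π - t)) * ((q t : ℂ) * y t)) + H * y π := by
  obtain ⟨y', h1, h2, h3⟩ := hy
  have h4 := (isEigenvalue_iff hq h1 h2 h3).1 hρ
  have h5 := h1.deriv_eq_integral h2 h3 pi_mem_Icc_pi
  linear_combination h5 - h4

theorem norm_cos_ofReal_le (a : ℝ) : ‖Complex.cos a‖ ≤ 1 := by
  simpa using norm_cos_le a

theorem norm_sin_ofReal_le (a : ℝ) : ‖Complex.sin a‖ ≤ 1 := by
  simpa using norm_sin_le a

/-- The first correction to the square roots of the eigenvalues. -/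
theorem exists_norm_mul_sub_le (hq : MemLp q 2 piMeasure) (hl : IsEigenvalueSequence q h H lam) :
    ∃ C : ℝ, 0 < C ∧ ∃ N : ℕ, 1 ≤ N ∧ ∀ n, N ≤ n →
      ‖((π * n * (Real.sqrt (lam n) - n) : ℝ) : ℂ) - (h + H + 1 / 2 * ∫ t in (0 : ℝ)..π, (q t : ℂ)) -
        1 / 2 * ∫ t in (0 : ℝ)..π, Complex.cos (2 * n * t) * (q t : ℂ)‖ ≤ C / n := by
  choose c hc using exists_isCauchySolution hq h
  obtain ⟨C₁, hC₁, N, hN⟩ := exists_eigenvalue_asymptotics hq hl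
  obtain ⟨C₂, hC₂, hb₂⟩ := exists_norm_cauchySolution_sub_cos_le hq h
  have hqi := intervalIntegrable_of_memLp (memLp_ofReal hq)
  set Q := ∫ t in (0 : ℝ)..π, ‖(q t : ℂ)‖ with hQ
  have hQ0 : 0 ≤ Q := intervalIntegral.integral_nonneg Real.pi_nonneg fun _ _ => norm_nonneg _
  set ω : ℂ := h + H + 1 / 2 * ∫ t in (0 : ℝ)..π, (q t : ℂ) with hω
  set K := 2 * C₂ * Q + π * C₁ * Q + |H| * (2 * C₂) + (π * C₁ ^ 2 + 2 * (π * C₁) ^ 2) +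
    ‖ω‖ * (π * C₁) + 1 with hK
  refine ⟨K, by positivity, max N 1, le_max_right _ _, fun n hn => ?_⟩
  obtain ⟨hn1, hl1, hd1, hd2⟩ := hN n (le_trans (le_max_left _ _) hn)
  set r := Real.sqrt (lam n) with hr
  set δ := r - n with hδ
  have hn0 : (0 : ℝ) < n := by exact_mod_cast hn1
  have hn1' : (1 : ℝ) ≤ n := by exact_mod_cast hn1
  have hd1' := abs_le.1 hd1
  have hr0 : (n : ℝ) / 2 ≤ r := by linarith
  have hrpos : 0 < r := by linarith
  have hr2 : r ≤ 2 * n := by linarith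
  have hρ : rho lam n = r := rho_of_nonneg (zero_le_one.trans hl1)
  have hE : IsEigenvalue q h H ((r : ℂ) ^ 2) := by rw [← hρ]; exact hl.isEigenvalue n
  have hy := hc r
  set y := c r with hyd
  have hyc : ContinuousOn y (Icc 0 π) := hy.continuousOn
  have key := hy.mul_sin_eq hq hE
  have he : ∀ x ∈ Icc 0 π, ‖y x - Complex.cos (r * x)‖ ≤ 2 * C₂ / n := fun x hx => by
    refine (hb₂ r y hrpos hy x hx).trans ?_
    rw [div_le_div_iff₀ hrpos hn0]; nlinarith
  set s : ℂ := (-1) ^ n with hs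
  have hs2 : s * s = 1 := by rw [hs, ← mul_pow]; simp
  have hsn : ‖s‖ = 1 := by simp [hs]
  have hrδ : (r : ℂ) * π = ((δ * π : ℝ) : ℂ) + n * π := by rw [hδ]; push_cast; ring
  have hsin : Complex.sin (r * π) = s * Complex.sin ((δ * π : ℝ) : ℂ) := by
    rw [hrδ, Complex.sin_antiperiodic.add_nat_mul_eq]
  have hcos : Complex.cos (r * π) = s * Complex.cos ((δ * π : ℝ) : ℂ) := by
    rw [hrδ, Complex.cos_antiperiodic.add_nat_mul_eq]
  have hcosn : ∀ t : ℝ, Complex.cos (n * (π - 2 * t)) = s * Complex.cos (2 * n * t) := fun t => by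
    rw [show (n : ℂ) * (π - 2 * t) = -(2 * n * t) + n * π by ring, Complex.cos_antiperiodic.add_nat_mul_eq,
      Complex.cos_neg]
  set E₁ := ∫ t in (0 : ℝ)..π, (Complex.cos (r * (π - t)) * (y t - Complex.cos (r * t))) * (q t : ℂ)
    with hE₁
  set E₂ := ∫ t in (0 : ℝ)..π, (1 / 2 * (Complex.cos (r * (π - 2 * t)) -
    Complex.cos (n * (π - 2 * t)))) * (q t : ℂ) with hE₂
  set p := ∫ t in (0 : ℝ)..π, Complex.cos (2 * n * t) * (q t : ℂ) with hp
  -- Replacing y by cos rt and using the product formula splits off the mean of q and the integral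
  -- of q against cos r(π - 2t)/2; in the latter r is then replaced by n, which leaves the Fourier
  -- coefficient p. The replacements cost E₁ and E₂.
  have hint : ∫ t in (0 : ℝ)..π, Complex.cos (r * (π - t)) * ((q t : ℂ) * y t) =
      E₁ + E₂ + 1 / 2 * Complex.cos (r * π) * (∫ t in (0 : ℝ)..π, (q t : ℂ)) + 1 / 2 * s * p := by
    have i1 : IntervalIntegrable (fun t : ℝ => (Complex.cos (r * (π - t)) *
        (y t - Complex.cos (r * t))) * (q t : ℂ)) volume 0 π :=
      continuousOn_mul_of_memLp (memLp_ofReal hq) (by fun_prop)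
    have i2 : IntervalIntegrable (fun t : ℝ => (1 / 2 * (Complex.cos (r * (π - 2 * t)) -
        Complex.cos (n * (π - 2 * t)))) * (q t : ℂ)) volume 0 π :=
      continuousOn_mul_of_memLp (memLp_ofReal hq) (by fun_prop)
    have i3 : IntervalIntegrable (fun t : ℝ => Complex.cos (2 * n * t) * (q t : ℂ)) volume 0 π :=
      continuousOn_mul_of_memLp (memLp_ofReal hq) (by fun_prop)
    rw [hE₁, hE₂, hp, ← intervalIntegral.integral_const_mul, ← intervalIntegral.integral_const_mul,
      ← intervalIntegral.integral_add i1 i2,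
      ← intervalIntegral.integral_add (i1.add i2) (hqi.const_mul _),
      ← intervalIntegral.integral_add ((i1.add i2).add (hqi.const_mul _)) (i3.const_mul _)]
    refine intervalIntegral.integral_congr fun t _ => ?_
    rw [hcosn t]
    have e1 : Complex.cos (r * (π - t)) * Complex.cos (r * t) =
        1 / 2 * Complex.cos (r * π) + 1 / 2 * Complex.cos (r * (π - 2 * t)) := by
      rw [show (r : ℂ) * π = r * (π - t) + r * t by ring,
        show (r : ℂ) * (π - 2 * t) = r * (π - t) - r * t by ring, Complex.cos_add, Complex.cos_sub]
      ring
    linear_combination (q t : ℂ) * e1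
  have bE₁ : ‖E₁‖ ≤ 2 * C₂ / n * Q := by
    refine norm_integral_mul_le hqi pi_mem_Icc_pi fun t ht => ?_
    rw [norm_mul]
    have := norm_cos_ofReal_le (r * (π - t))
    push_cast at this
    exact (mul_le_of_le_one_left (norm_nonneg _) this).trans (he t ht)
  have bE₂ : ‖E₂‖ ≤ π * |δ| * Q := by
    refine norm_integral_mul_le hqi pi_mem_Icc_pi fun t ht => ?_
    have e1 := norm_cos_sub_cos_le (R := 0) (z := r * (π - 2 * t)) (w := n * (π - 2 * t))
      (by simp [Complex.mul_im]) (by simp [Complex.mul_im])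
    rw [Real.exp_zero, one_mul, ← sub_mul, norm_mul] at e1
    have e2 : ‖(r : ℂ) - n‖ = |δ| := by
      rw [hδ, ← Complex.ofReal_natCast, ← Complex.ofReal_sub, Complex.norm_real, Real.norm_eq_abs]
    have e3 : ‖(π : ℂ) - 2 * t‖ ≤ π := by
      rw [show (π : ℂ) - 2 * t = ((π - 2 * t : ℝ) : ℂ) by push_cast; ring, Complex.norm_real,
        Real.norm_eq_abs, abs_le]
      constructor <;> linarith [ht.1, ht.2]
    rw [e2] at e1
    rw [norm_mul]
    refine (mul_le_of_le_one_left (norm_nonneg _) (by norm_num)).trans (e1.trans ?_)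
    rw [mul_comm π]
    exact mul_le_mul_of_nonneg_left e3 (abs_nonneg _)
  set E₃ := (H : ℂ) * (y π - Complex.cos (r * π)) with hE₃
  have bE₃ : ‖E₃‖ ≤ |H| * (2 * C₂ / n) := by
    rw [hE₃, norm_mul, Complex.norm_real, Real.norm_eq_abs]
    exact mul_le_mul_of_nonneg_left (he π pi_mem_Icc_pi) (abs_nonneg _)
  set E₄ : ℝ := π * n * δ - r * Real.sin (δ * π) with hE₄
  have bE₄ : |E₄| ≤ (π * C₁ ^ 2 + 2 * (π * C₁) ^ 2) / n := by
    have e1 := abs_sin_sub_self_le_sq (δ * π)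
    have e2 : E₄ = -(δ ^ 2 * π) - r * (Real.sin (δ * π) - δ * π) := by
      rw [hE₄]; simp only [hδ]; ring
    have e3 : δ ^ 2 ≤ (C₁ / n) ^ 2 := by
      rw [← sq_abs δ]; exact pow_le_pow_left₀ (abs_nonneg _) hd2 2
    have e4 : |E₄| ≤ δ ^ 2 * π + r * (δ * π) ^ 2 := by
      rw [e2]
      refine (abs_sub _ _).trans ?_
      rw [abs_neg, abs_mul, abs_mul, abs_of_pos hrpos, abs_of_pos Real.pi_pos, abs_of_nonneg
        (sq_nonneg δ)]
      gcongr
    have e5 : (C₁ / n) ^ 2 ≤ C₁ ^ 2 / n := by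
      rw [div_pow, div_le_div_iff₀ (by positivity) hn0]
      nlinarith [sq_nonneg C₁, mul_nonneg (sq_nonneg C₁) hn0.le]
    have e6 : r * (δ * π) ^ 2 ≤ 2 * (π * C₁) ^ 2 / n := by
      calc r * (δ * π) ^ 2 = r * (δ ^ 2 * π ^ 2) := by ring
        _ ≤ (2 * n) * ((C₁ / n) ^ 2 * π ^ 2) := by gcongr
        _ = _ := by field_simp
    have e7 : δ ^ 2 * π ≤ C₁ ^ 2 / n * π := by gcongr; exact e3.trans e5
    rw [add_div]
    calc _ ≤ _ := e4
      _ ≤ C₁ ^ 2 / n * π + 2 * (π * C₁) ^ 2 / n := add_le_add e7 e6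
      _ = _ := by ring
  have bE₅ : ‖ω * (Complex.cos ((δ * π : ℝ) : ℂ) - 1)‖ ≤ ‖ω‖ * (π * C₁ / n) := by
    rw [norm_mul]
    refine mul_le_mul_of_nonneg_left ?_ (norm_nonneg _)
    have := Real.abs_cos_sub_cos_le (δ * π) 0
    rw [Real.cos_zero, sub_zero] at this
    rw [← Complex.ofReal_cos, ← Complex.ofReal_one, ← Complex.ofReal_sub, Complex.norm_real,
      Real.norm_eq_abs]
    refine this.trans ?_
    rw [abs_mul, abs_of_pos Real.pi_pos, mul_comm, mul_div_assoc]
    gcongr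
  -- The eigenvalue equation is multiplied by s = (-1)ⁿ, whose square is 1. All terms on the right
  -- are O(1/n): E₃ is the error in y(π), E₄ linearizes the sine, and the last term replaces cos δπ
  -- by 1.
  have hfinal : ((π * n * δ : ℝ) : ℂ) - ω - 1 / 2 * p =
      s * (E₁ + E₂ + E₃) + (E₄ : ℂ) + ω * (Complex.cos ((δ * π : ℝ) : ℂ) - 1) := by
    rw [hint, hsin, hcos] at key
    have e4 : (E₄ : ℂ) = ((π * n * δ : ℝ) : ℂ) - r * Complex.sin ((δ * π : ℝ) : ℂ) := by
      rw [hE₄, Complex.ofReal_sub, Complex.ofReal_mul r, Complex.ofReal_sin]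
    rw [e4, hE₃, hcos]
    have key' := congrArg (fun z => s * z) key
    simp only [hω]
    linear_combination key' + (-(r : ℂ) * Complex.sin ((δ * π : ℝ) : ℂ) +
      (h + H + 1 / 2 * ∫ t in (0 : ℝ)..π, (q t : ℂ)) * Complex.cos ((δ * π : ℝ) : ℂ) +
        1 / 2 * p - H * Complex.cos ((δ * π : ℝ) : ℂ) +
        H * Complex.cos ((δ * π : ℝ) : ℂ)) * hs2
  rw [hfinal]
  refine (norm_add₃_le).trans ?_
  rw [norm_mul, hsn, one_mul, Complex.norm_real, Real.norm_eq_abs]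
  have b1 := norm_add₃_le (a := E₁) (b := E₂) (c := E₃)
  have b2 : π * |δ| * Q ≤ π * (C₁ / n) * Q := by gcongr
  have b3 : K / n = 2 * C₂ / n * Q + π * (C₁ / n) * Q + |H| * (2 * C₂ / n) +
      (π * C₁ ^ 2 + 2 * (π * C₁) ^ 2) / n + ‖ω‖ * (π * C₁ / n) + 1 / n := by
    rw [hK]; ring
  have b4 : (0 : ℝ) ≤ 1 / n := by positivity
  rw [b3]
  linarith

/-- Dividing the previous expansion by πn leaves errors O(1/n²) and a Fourier coefficient of q over
n, both summable. -/
theorem exists_summable_rho_sub (hq : MemLp q 2 piMeasure) (hl : IsEigenvalueSequence q h H lam) :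
    ∃ ω : ℝ, Summable fun n : ℕ => |Real.sqrt (lam n) - n - ω / n| := by
  obtain ⟨C, hC, N, hN1, hN⟩ := exists_norm_mul_sub_le hq hl
  set ω : ℝ := h + H + 1 / 2 * ∫ t in (0 : ℝ)..π, q t with hω
  have hω' : ((h : ℂ) + H + 1 / 2 * ∫ t in (0 : ℝ)..π, (q t : ℂ)) = (ω : ℂ) := by
    rw [hω, intervalIntegral.integral_ofReal]; push_cast; ring
  refine ⟨ω / π, ?_⟩
  rw [← summable_nat_add_iff N]
  have s1 := summable_norm_integral_cos_div (memLp_ofReal hq)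
  have s2 : Summable fun n : ℕ => 1 / (n : ℝ) ^ 2 := Real.summable_one_div_nat_pow.2 one_lt_two
  refine ((summable_nat_add_iff N).2 (s1.add (s2.mul_left C))).of_nonneg_of_le
    (fun _ => abs_nonneg _) fun k => ?_
  set n := k + N with hn
  have h1 := hN n (by omega)
  have hn0 : (0 : ℝ) < n := by exact_mod_cast (show 0 < n by omega)
  rw [hω'] at h1
  set p := ∫ t in (0 : ℝ)..π, Complex.cos (2 * n * t) * (q t : ℂ) with hp
  have h2 : |π * n * (Real.sqrt (lam n) - n) - ω| ≤ C / n + ‖p‖ := by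
    have e : ((π * n * (Real.sqrt (lam n) - n) - ω : ℝ) : ℂ) =
        (((π * n * (Real.sqrt (lam n) - n) : ℝ) : ℂ) - ω - 1 / 2 * p) + 1 / 2 * p := by
      push_cast; ring
    rw [← Real.norm_eq_abs, ← Complex.norm_real, e]
    refine (norm_add_le _ _).trans (add_le_add h1 ?_)
    rw [norm_mul]
    exact mul_le_of_le_one_left (norm_nonneg _) (by norm_num)
  have e : Real.sqrt (lam n) - n - ω / π / n =
      (π * n * (Real.sqrt (lam n) - n) - ω) / (π * n) := by
    field_simp
  rw [e, abs_div, abs_of_pos (by positivity : 0 < π * (n : ℝ))]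
  have h3 : 1 ≤ π := by linarith [Real.pi_gt_three]
  calc _ ≤ (C / n + ‖p‖) / (π * n) := by gcongr
    _ ≤ (C / n + ‖p‖) / (1 * n) := by gcongr
    _ = _ := by rw [hp]; field_simp; ring

end SturmLiouville

end

/-! ### Oscillatory integrals. -/

section

namespace SturmLiouville

variable {f g : ℝ → ℂ}

/-- Integration by parts, with the frequency kept as a factor so that it may be zero. -/
theorem mul_integral_mul_cos (hf : AbsolutelyContinuousOnInterval f 0 π)
    (hd : ∀ᵐ x, x ∈ uIcc 0 π → HasDerivAt f (g x) x) (a : ℂ) :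
    a * ∫ x in (0 : ℝ)..π, f x * Complex.cos (a * x) =
      f π * Complex.sin (a * π) - ∫ x in (0 : ℝ)..π, Complex.sin (a * x) * g x := by
  have hg := hf.intervalIntegrable_of_ae_hasDerivAt hd
  have hfc : ContinuousOn f (Icc 0 π) := by simpa [uIcc_zero_pi] using hf.continuousOn
  have h1 := (hf.cmul (absCont_sin_mul a)).integral_eq_sub_of_ae_hasDerivAt
    (g := fun x => Complex.sin (a * x) * g x + a * (f x * Complex.cos (a * x))) (by
      filter_upwards [hd] with x hx hm
      exact ((hx hm).mul (hasDerivAt_sin_mul a x)).congr_deriv (by ring))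
  have i1 : IntervalIntegrable (fun x : ℝ => Complex.sin (a * x) * g x) volume 0 π :=
    continuousOn_mul_intervalIntegrable (by fun_prop) hg
  have i2 : IntervalIntegrable (fun x : ℝ => a * (f x * Complex.cos (a * x))) volume 0 π :=
    (intervalIntegrable_mul hfc (by fun_prop)).const_mul a
  rw [intervalIntegral.integral_add i1 i2, intervalIntegral.integral_const_mul] at h1
  simp only [Complex.ofReal_zero, mul_zero, Complex.sin_zero, sub_zero] at h1
  linear_combination h1

theorem mul_integral_mul_sin (hf : AbsolutelyContinuousOnInterval f 0 π)
    (hd : ∀ᵐ x, x ∈ uIcc 0 π → HasDerivAt f (g x) x) (a : ℂ) :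
    a * ∫ x in (0 : ℝ)..π, f x * Complex.sin (a * x) =
      f 0 - f π * Complex.cos (a * π) + ∫ x in (0 : ℝ)..π, Complex.cos (a * x) * g x := by
  have hg := hf.intervalIntegrable_of_ae_hasDerivAt hd
  have hfc : ContinuousOn f (Icc 0 π) := by simpa [uIcc_zero_pi] using hf.continuousOn
  have h1 := (hf.cmul (absCont_cos_mul a)).integral_eq_sub_of_ae_hasDerivAt
    (g := fun x => Complex.cos (a * x) * g x - a * (f x * Complex.sin (a * x))) (by
      filter_upwards [hd] with x hx hm
      exact ((hx hm).mul (hasDerivAt_cos_mul a x)).congr_deriv (by ring))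
  have i1 : IntervalIntegrable (fun x : ℝ => Complex.cos (a * x) * g x) volume 0 π :=
    continuousOn_mul_intervalIntegrable (by fun_prop) hg
  have i2 : IntervalIntegrable (fun x : ℝ => a * (f x * Complex.sin (a * x))) volume 0 π :=
    (intervalIntegrable_mul hfc (by fun_prop)).const_mul a
  rw [intervalIntegral.integral_sub i1 i2, intervalIntegral.integral_const_mul] at h1
  simp only [Complex.ofReal_zero, mul_zero, Complex.cos_zero, mul_one] at h1
  linear_combination -h1

theorem norm_cos_ofReal_mul_le (a x : ℝ) : ‖Complex.cos (a * x)‖ ≤ 1 := by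
  rw [← Complex.ofReal_mul]; exact norm_cos_ofReal_le _

theorem norm_sin_ofReal_mul_le (a x : ℝ) : ‖Complex.sin (a * x)‖ ≤ 1 := by
  rw [← Complex.ofReal_mul]; exact norm_sin_ofReal_le _

theorem norm_integral_mul_cos_le (hf : AbsolutelyContinuousOnInterval f 0 π)
    (hd : ∀ᵐ x, x ∈ uIcc 0 π → HasDerivAt f (g x) x) {a : ℝ} (ha : 0 < a) :
    ‖∫ x in (0 : ℝ)..π, f x * Complex.cos (a * x)‖ ≤
      (‖f π‖ + ∫ x in (0 : ℝ)..π, ‖g x‖) / a := by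
  have hg := hf.intervalIntegrable_of_ae_hasDerivAt hd
  rw [le_div_iff₀ ha]
  have h1 := congrArg norm (mul_integral_mul_cos hf hd a)
  rw [norm_mul, Complex.norm_real, Real.norm_of_nonneg ha.le, mul_comm] at h1
  rw [h1]
  refine (norm_sub_le _ _).trans (add_le_add ?_ ?_)
  · rw [norm_mul]
    exact mul_le_of_le_one_right (norm_nonneg _) (norm_sin_ofReal_mul_le _ _)
  · have := norm_integral_mul_le hg pi_mem_Icc_pi (fun t _ => norm_sin_ofReal_mul_le a t)
    rwa [one_mul] at this

theorem norm_integral_mul_sin_le (hf : AbsolutelyContinuousOnInterval f 0 π)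
    (hd : ∀ᵐ x, x ∈ uIcc 0 π → HasDerivAt f (g x) x) {a : ℝ} (ha : 0 < a) :
    ‖∫ x in (0 : ℝ)..π, f x * Complex.sin (a * x)‖ ≤
      (‖f 0‖ + ‖f π‖ + ∫ x in (0 : ℝ)..π, ‖g x‖) / a := by
  have hg := hf.intervalIntegrable_of_ae_hasDerivAt hd
  rw [le_div_iff₀ ha]
  have h1 := congrArg norm (mul_integral_mul_sin hf hd a)
  rw [norm_mul, Complex.norm_real, Real.norm_of_nonneg ha.le, mul_comm] at h1
  rw [h1]
  refine (norm_add_le _ _).trans (add_le_add ((norm_sub_le _ _).trans (add_le_add le_rfl ?_)) ?_)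
  · rw [norm_mul]
    exact mul_le_of_le_one_right (norm_nonneg _) (norm_cos_ofReal_mul_le _ _)
  · have := norm_integral_mul_le hg pi_mem_Icc_pi (fun t _ => norm_cos_ofReal_mul_le a t)
    rwa [one_mul] at this

theorem absCont_const (k : ℂ) : AbsolutelyContinuousOnInterval (fun _ : ℝ => k) 0 π :=
  (contDiff_const (n := 1)).contDiffOn.absolutelyContinuousOnInterval

variable {q : ℝ → ℝ} {h H : ℝ} {c : ℂ → ℝ → ℂ} {lam : ℕ → ℝ}

theorem integral_norm_mul_le {p f : ℝ → ℂ} (hp : IntervalIntegrable p volume 0 π)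
    (hfc : ContinuousOn f (Icc 0 π)) (hf : ∀ t ∈ Icc 0 π, ‖f t‖ ≤ 1) :
    ∫ t in (0 : ℝ)..π, ‖f t * p t‖ ≤ ∫ t in (0 : ℝ)..π, ‖p t‖ := by
  refine intervalIntegral.integral_mono_on Real.pi_nonneg
    (continuousOn_mul_intervalIntegrable hfc hp).norm hp.norm fun t ht => ?_
  rw [norm_mul]
  exact mul_le_of_le_one_left (norm_nonneg _) (hf t ht)

/-- The sine transform of `q` against `cos`, in separated form. -/
theorem integral_sin_sub_eq {p : ℝ → ℂ} (hp : IntervalIntegrable p volume 0 π) (r : ℝ) {x : ℝ}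
    (hx : x ∈ Icc 0 π) :
    ∫ t in (0 : ℝ)..x, Complex.sin (r * (x - t)) * (p t * Complex.cos (r * t)) =
      Complex.sin (r * x) * (∫ t in (0 : ℝ)..x, Complex.cos (r * t) ^ 2 * p t) -
      Complex.cos (r * x) * ∫ t in (0 : ℝ)..x, (Complex.sin (r * t) * Complex.cos (r * t)) * p t := by
  have i1 : IntervalIntegrable (fun t : ℝ => Complex.cos (r * t) ^ 2 * p t) volume 0 x :=
    intervalIntegrable_mono_pi (continuousOn_mul_intervalIntegrable (by fun_prop) hp) hx
  have i2 : IntervalIntegrable (fun t : ℝ => (Complex.sin (r * t) * Complex.cos (r * t)) * p t)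
      volume 0 x :=
    intervalIntegrable_mono_pi (continuousOn_mul_intervalIntegrable (by fun_prop) hp) hx
  rw [← intervalIntegral.integral_const_mul, ← intervalIntegral.integral_const_mul,
    ← intervalIntegral.integral_sub (i1.const_mul _) (i2.const_mul _)]
  refine intervalIntegral.integral_congr fun t _ => ?_
  rw [mul_sub, Complex.sin_sub]
  ring

/-- In separated form the integrand is cos · (sin · A - cos · B). The double angle formulas produce
½ A sin 2rx - ½ B cos 2rx, which integration by parts shows to be O(1/r), and the non-oscillating -½
B. Another integration by parts, against π - x, evaluates the integral of B and yields the
correction with factor 1/4. -/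
theorem norm_integral_cos_mul_integral_sin_le {p : ℝ → ℂ}
    (hp : IntervalIntegrable p volume 0 π) {r : ℝ} (hr : 0 < r) :
    ‖(∫ x in (0 : ℝ)..π, Complex.cos (r * x) *
        ∫ t in (0 : ℝ)..x, Complex.sin (r * (x - t)) * (p t * Complex.cos (r * t))) +
      1 / 4 * ∫ x in (0 : ℝ)..π, Complex.sin (2 * r * x) * ((π - x) * p x)‖ ≤
      2 * (∫ t in (0 : ℝ)..π, ‖p t‖) / r := by
  set Q := ∫ t in (0 : ℝ)..π, ‖p t‖ with hQ
  set A : ℝ → ℂ := fun x => ∫ t in (0 : ℝ)..x, Complex.cos (r * t) ^ 2 * p t with hA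
  set B : ℝ → ℂ := fun x => ∫ t in (0 : ℝ)..x, (Complex.sin (r * t) * Complex.cos (r * t)) * p t
    with hB
  have iA : IntervalIntegrable (fun t : ℝ => Complex.cos (r * t) ^ 2 * p t) volume 0 π :=
    continuousOn_mul_intervalIntegrable (by fun_prop) hp
  have iB : IntervalIntegrable (fun t : ℝ => (Complex.sin (r * t) * Complex.cos (r * t)) * p t)
      volume 0 π := continuousOn_mul_intervalIntegrable (by fun_prop) hp
  have acA : AbsolutelyContinuousOnInterval A 0 π := iA.absolutelyContinuousOnInterval_complex
  have acB : AbsolutelyContinuousOnInterval B 0 π := iB.absolutelyContinuousOnInterval_complex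
  have dA : ∀ᵐ x, x ∈ uIcc 0 π → HasDerivAt A (Complex.cos (r * x) ^ 2 * p x) x := by
    filter_upwards [iA.ae_hasDerivAt_integral] with x hx hm using hx hm 0 left_mem_uIcc
  have dB : ∀ᵐ x, x ∈ uIcc 0 π →
      HasDerivAt B ((Complex.sin (r * x) * Complex.cos (r * x)) * p x) x := by
    filter_upwards [iB.ae_hasDerivAt_integral] with x hx hm using hx hm 0 left_mem_uIcc
  have b1 : ∀ t ∈ Icc 0 π, ‖Complex.cos (r * t) ^ 2‖ ≤ 1 := fun t _ => by
    rw [norm_pow]; exact pow_le_one₀ (norm_nonneg _) (norm_cos_ofReal_mul_le r t)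
  have b2 : ∀ t ∈ Icc 0 π, ‖Complex.sin (r * t) * Complex.cos (r * t)‖ ≤ 1 := fun t _ => by
    rw [norm_mul]
    exact mul_le_one₀ (norm_sin_ofReal_mul_le r t) (norm_nonneg _) (norm_cos_ofReal_mul_le r t)
  have cA : ContinuousOn A (Icc 0 π) := by simpa [uIcc_zero_pi] using acA.continuousOn
  have cB : ContinuousOn B (Icc 0 π) := by simpa [uIcc_zero_pi] using acB.continuousOn
  have hA0 : A 0 = 0 := by simp [hA]
  have hB0 : B 0 = 0 := by simp [hB]
  have hAπ : ‖A π‖ ≤ Q := by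
    have := norm_integral_mul_le hp pi_mem_Icc_pi b1; rwa [one_mul] at this
  have hBπ : ‖B π‖ ≤ Q := by
    have := norm_integral_mul_le hp pi_mem_Icc_pi b2; rwa [one_mul] at this
  have e1 := norm_integral_mul_sin_le acA dA (a := 2 * r) (by positivity)
  have e2 := norm_integral_mul_cos_le acB dB (a := 2 * r) (by positivity)
  have e3 : ∫ x in (0 : ℝ)..π, ‖Complex.cos (r * x) ^ 2 * p x‖ ≤ Q :=
    integral_norm_mul_le hp (by fun_prop) b1
  have e4 : ∫ x in (0 : ℝ)..π, ‖(Complex.sin (r * x) * Complex.cos (r * x)) * p x‖ ≤ Q :=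
    integral_norm_mul_le hp (by fun_prop) b2
  have hBint : ∫ x in (0 : ℝ)..π, B x =
      1 / 2 * ∫ x in (0 : ℝ)..π, Complex.sin (2 * r * x) * ((π - x) * p x) := by
    have acid : AbsolutelyContinuousOnInterval (fun x : ℝ => (π : ℂ) - x) 0 π := by
      have h0 : ContDiff ℝ 1 fun x : ℝ => (π : ℂ) - x :=
        contDiff_const.sub Complex.ofRealCLM.contDiff
      exact h0.contDiffOn.absolutelyContinuousOnInterval
    have h1 := (acid.cmul acB).integral_eq_sub_of_ae_hasDerivAt
      (g := fun x : ℝ => ((π : ℂ) - x) * ((Complex.sin (r * x) * Complex.cos (r * x)) * p x) - B x)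
      (by
        filter_upwards [dB] with x hx hm
        have hd : HasDerivAt (fun x : ℝ => (π : ℂ) - x) (-1) x :=
          Complex.ofRealCLM.hasDerivAt.const_sub (π : ℂ)
        exact (hd.mul (hx hm)).congr_deriv (by ring))
    have i3 : IntervalIntegrable (fun x : ℝ => ((π : ℂ) - x) *
        ((Complex.sin (r * x) * Complex.cos (r * x)) * p x)) volume 0 π :=
      continuousOn_mul_intervalIntegrable (by fun_prop) iB
    rw [intervalIntegral.integral_sub i3 (intervalIntegrable_of_continuousOn cB), hB0, sub_self,
      zero_mul, mul_zero, sub_zero, sub_eq_zero] at h1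
    rw [← h1, ← intervalIntegral.integral_const_mul]
    refine intervalIntegral.integral_congr fun x _ => ?_
    rw [mul_assoc 2, Complex.sin_two_mul]
    ring
  have hmain : (∫ x in (0 : ℝ)..π, Complex.cos (r * x) *
      ∫ t in (0 : ℝ)..x, Complex.sin (r * (x - t)) * (p t * Complex.cos (r * t))) =
      1 / 2 * (∫ x in (0 : ℝ)..π, A x * Complex.sin ((2 * r : ℝ) * x)) -
      1 / 2 * (∫ x in (0 : ℝ)..π, B x * Complex.cos ((2 * r : ℝ) * x)) -
      1 / 2 * ∫ x in (0 : ℝ)..π, B x := by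
    have j1 : IntervalIntegrable (fun x : ℝ => A x * Complex.sin ((2 * r : ℝ) * x)) volume 0 π :=
      intervalIntegrable_mul cA (by fun_prop)
    have j2 : IntervalIntegrable (fun x : ℝ => B x * Complex.cos ((2 * r : ℝ) * x)) volume 0 π :=
      intervalIntegrable_mul cB (by fun_prop)
    have j3 := intervalIntegrable_of_continuousOn cB
    rw [← intervalIntegral.integral_const_mul, ← intervalIntegral.integral_const_mul,
      ← intervalIntegral.integral_const_mul,
      ← intervalIntegral.integral_sub (j1.const_mul _) (j2.const_mul _),
      ← intervalIntegral.integral_sub ((j1.const_mul _).sub (j2.const_mul _)) (j3.const_mul _)]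
    refine intervalIntegral.integral_congr fun x hx => ?_
    rw [uIcc_zero_pi] at hx
    rw [integral_sin_sub_eq hp r hx]
    change Complex.cos (r * x) * (Complex.sin (r * x) * A x - Complex.cos (r * x) * B x) = _
    push_cast
    rw [mul_assoc 2, Complex.sin_two_mul, Complex.cos_two_mul]
    ring
  rw [hmain, hBint]
  have e5 : ‖∫ x in (0 : ℝ)..π, A x * Complex.sin ((2 * r : ℝ) * x)‖ ≤ 2 * Q / (2 * r) := by
    refine e1.trans ?_
    rw [hA0, norm_zero]
    gcongr
    linarith
  have e6 : ‖∫ x in (0 : ℝ)..π, B x * Complex.cos ((2 * r : ℝ) * x)‖ ≤ 2 * Q / (2 * r) := by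
    refine e2.trans ?_
    gcongr
    linarith
  rw [show ∀ a b d : ℂ, 1 / 2 * a - 1 / 2 * b - 1 / 2 * (1 / 2 * d) + 1 / 4 * d =
    1 / 2 * (a - b) from fun a b d => by ring, norm_mul]
  refine (mul_le_of_le_one_left (norm_nonneg _) (by norm_num)).trans ((norm_sub_le _ _).trans ?_)
  refine (add_le_add e5 e6).trans (le_of_eq ?_)
  field_simp
  ring

end SturmLiouville

end

/-! ### Asymptotics of the weight numbers. -/

section

namespace SturmLiouville

variable {q : ℝ → ℝ} {h H : ℝ} {c : ℂ → ℝ → ℂ} {lam : ℕ → ℝ} {y : ℝ → ℂ}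

/-- The norm of the Cauchy solution, up to terms of second order. -/
theorem exists_norm_integral_sq_sub_le (hq : MemLp q 2 piMeasure) (h : ℝ) :
    ∃ C : ℝ, 0 < C ∧ ∀ (r : ℝ) y, 0 < r → IsCauchySolution q h r y →
      ‖(∫ x in (0 : ℝ)..π, y x ^ 2) - (∫ x in (0 : ℝ)..π, Complex.cos (r * x) ^ 2) +
        1 / (2 * r) * ∫ x in (0 : ℝ)..π, Complex.sin (2 * r * x) * ((π - x) * (q x : ℂ))‖ ≤
      C / r ^ 2 := by
  obtain ⟨C₂, hC₂, hb₂⟩ := exists_norm_cauchySolution_sub_cos_le hq h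
  have hqi := intervalIntegrable_of_memLp (memLp_ofReal hq)
  set Q := ∫ t in (0 : ℝ)..π, ‖(q t : ℂ)‖ with hQ
  have hQ0 : 0 ≤ Q := intervalIntegral.integral_nonneg Real.pi_nonneg fun _ _ => norm_nonneg _
  refine ⟨2 * |h| + 4 * Q + 2 * π * (C₂ * Q) + π * C₂ ^ 2 + 1, by positivity,
    fun r y hr hy => ?_⟩
  have hyc : ContinuousOn y (Icc 0 π) := hy.continuousOn
  have he := hb₂ r y hr hy
  have hrC : (r : ℂ) ≠ 0 := by exact_mod_cast hr.ne'
  set S : ℝ → ℂ := fun x => ∫ t in (0 : ℝ)..x,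
    Complex.sin (r * (x - t)) * ((q t : ℂ) * Complex.cos (r * t)) with hS
  have hSc : ContinuousOn S (Icc 0 π) := by
    have iA : IntervalIntegrable (fun t : ℝ => Complex.cos (r * t) ^ 2 * (q t : ℂ)) volume 0 π :=
      continuousOn_mul_intervalIntegrable (by fun_prop) hqi
    have iB : IntervalIntegrable (fun t : ℝ =>
        (Complex.sin (r * t) * Complex.cos (r * t)) * (q t : ℂ)) volume 0 π :=
      continuousOn_mul_intervalIntegrable (by fun_prop) hqi
    have cA := iA.absolutelyContinuousOnInterval_complex.continuousOn
    have cB := iB.absolutelyContinuousOnInterval_complex.continuousOn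
    rw [uIcc_zero_pi] at cA cB
    have s1 : ContinuousOn (fun x : ℝ => Complex.sin (r * x)) (Icc 0 π) := by fun_prop
    have s2 : ContinuousOn (fun x : ℝ => Complex.cos (r * x)) (Icc 0 π) := by fun_prop
    refine ((s1.mul cA).sub (s2.mul cB)).congr fun x hx => ?_
    exact integral_sin_sub_eq hqi r hx
  set e : ℝ → ℂ := fun x => y x - Complex.cos (r * x) with hedef
  have hec : ContinuousOn e (Icc 0 π) := by fun_prop
  -- D is the second order remainder in r(y - cos rx) = h sin rx + S + D; being the Duhamel integral
  -- of the first order error, it is O(1/r).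
  set D : ℝ → ℂ := fun x => r * e x - h * Complex.sin (r * x) - S x with hD
  have hDc : ContinuousOn D (Icc 0 π) := by fun_prop
  have hDb : ∀ x ∈ Icc 0 π, ‖D x‖ ≤ C₂ / r * Q := fun x hx => by
    obtain ⟨y', hy1, hy2, hy3⟩ := hy
    have h2 := hy1.mul_eq_integral hy2 hy3 hx
    have e1 : D x = ∫ t in (0 : ℝ)..x, (Complex.sin (r * (x - t)) *
        (y t - Complex.cos (r * t))) * (q t : ℂ) := by
      have i1 : IntervalIntegrable (fun t : ℝ => (Complex.sin (r * (x - t)) * y t) * (q t : ℂ))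
          volume 0 x :=
        intervalIntegrable_mono_pi (continuousOn_mul_intervalIntegrable (by fun_prop) hqi) hx
      have i2 : IntervalIntegrable (fun t : ℝ => (Complex.sin (r * (x - t)) *
          Complex.cos (r * t)) * (q t : ℂ)) volume 0 x :=
        intervalIntegrable_mono_pi (continuousOn_mul_intervalIntegrable (by fun_prop) hqi) hx
      have e2 : D x = (∫ t in (0 : ℝ)..x, Complex.sin (r * (x - t)) * ((q t : ℂ) * y t)) - S x := by
        simp only [hD, hedef]; linear_combination h2
      rw [e2, hS]
      beta_reduce
      rw [← intervalIntegral.integral_sub (i1.congr fun t _ => by ring)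
        (i2.congr fun t _ => by ring)]
      exact intervalIntegral.integral_congr fun t _ => by ring
    rw [e1]
    refine norm_integral_mul_le hqi hx fun t ht => ?_
    rw [norm_mul]
    have := norm_sin_ofReal_le (r * (x - t))
    push_cast at this
    exact (mul_le_of_le_one_left (norm_nonneg _) this).trans (he t ht)
  have hcc : ContinuousOn (fun x : ℝ => Complex.cos (r * x)) (Icc 0 π) := by fun_prop
  have hsc : ContinuousOn (fun x : ℝ => Complex.sin (r * x)) (Icc 0 π) := by fun_prop
  set I₁ := ∫ x in (0 : ℝ)..π, 1 * Complex.sin ((2 * r : ℝ) * x) with hI₁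
  set I₂ := ∫ x in (0 : ℝ)..π, Complex.cos (r * x) * S x with hI₂
  set I₃ := ∫ x in (0 : ℝ)..π, Complex.cos (r * x) * D x with hI₃
  set I₄ := ∫ x in (0 : ℝ)..π, e x * e x with hI₄
  -- From y² = cos² + 2e cos + e², with e expanded through D. Only the term with S fails to be
  -- O(1/r²), and its leading part is the sine integral in the statement.
  have hsplit : (∫ x in (0 : ℝ)..π, y x ^ 2) = (∫ x in (0 : ℝ)..π, Complex.cos (r * x) ^ 2) +
      (h / r) * I₁ + (2 / r) * I₂ + (2 / r) * I₃ + I₄ := by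
    have j0 : IntervalIntegrable (fun x : ℝ => Complex.cos (r * x) ^ 2) volume 0 π :=
      intervalIntegrable_of_continuousOn (hcc.pow 2)
    have j1 : IntervalIntegrable (fun x : ℝ => 1 * Complex.sin ((2 * r : ℝ) * x)) volume 0 π :=
      intervalIntegrable_of_continuousOn (by fun_prop)
    have j2 := intervalIntegrable_mul hcc hSc
    have j3 := intervalIntegrable_mul hcc hDc
    have j4 := intervalIntegrable_mul hec hec
    rw [hI₁, hI₂, hI₃, hI₄, ← intervalIntegral.integral_const_mul,
      ← intervalIntegral.integral_const_mul, ← intervalIntegral.integral_const_mul,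
      ← intervalIntegral.integral_add j0 (j1.const_mul _),
      ← intervalIntegral.integral_add (j0.add (j1.const_mul _)) (j2.const_mul _),
      ← intervalIntegral.integral_add ((j0.add (j1.const_mul _)).add (j2.const_mul _))
        (j3.const_mul _),
      ← intervalIntegral.integral_add (((j0.add (j1.const_mul _)).add (j2.const_mul _)).add
        (j3.const_mul _)) j4]
    refine intervalIntegral.integral_congr fun x hx => ?_
    have e1 : y x = Complex.cos (r * x) + e x := by simp only [hedef]; ring
    have e2 : (2 / r : ℂ) * (Complex.cos (r * x) * D x) = 2 * Complex.cos (r * x) * e x -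
        (2 * h / r) * Complex.cos (r * x) * Complex.sin (r * x) -
        (2 / r) * (Complex.cos (r * x) * S x) := by
      simp only [hD]; field_simp
    have e3 : Complex.sin ((2 * r : ℝ) * x) = 2 * Complex.sin (r * x) * Complex.cos (r * x) := by
      push_cast; rw [mul_assoc 2, Complex.sin_two_mul]
    rw [e2, e3, e1]
    ring
  have b1 : ‖I₁‖ ≤ 2 / (2 * r) := by
    have := norm_integral_mul_sin_le (absCont_const 1) (g := fun _ => 0)
      (ae_of_all _ fun x _ => hasDerivAt_const x (1 : ℂ)) (a := 2 * r) (by positivity)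
    refine this.trans (le_of_eq ?_)
    norm_num
  have b2 := norm_integral_cos_mul_integral_sin_le hqi hr
  have b3 : ‖I₃‖ ≤ C₂ / r * Q * |π - 0| := by
    refine intervalIntegral.norm_integral_le_of_norm_le_const fun x hx => ?_
    rw [uIoc_of_le Real.pi_nonneg] at hx
    rw [norm_mul]
    exact (mul_le_of_le_one_left (norm_nonneg _) (norm_cos_ofReal_mul_le r x)).trans
      (hDb x ⟨hx.1.le, hx.2⟩)
  have b4 : ‖I₄‖ ≤ C₂ / r * (C₂ / r) * |π - 0| := by
    refine intervalIntegral.norm_integral_le_of_norm_le_const fun x hx => ?_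
    rw [uIoc_of_le Real.pi_nonneg] at hx
    have := he x ⟨hx.1.le, hx.2⟩
    rw [norm_mul]
    exact mul_le_mul this this (norm_nonneg _) ((norm_nonneg _).trans this)
  rw [sub_zero, abs_of_pos Real.pi_pos] at b3 b4
  set J := ∫ x in (0 : ℝ)..π, Complex.sin (2 * r * x) * ((π - x) * (q x : ℂ)) with hJ
  have hfin : (∫ x in (0 : ℝ)..π, y x ^ 2) - (∫ x in (0 : ℝ)..π, Complex.cos (r * x) ^ 2) +
      1 / (2 * r) * J = ((h : ℂ) / r) * I₁ + (2 / r) * (I₂ + 1 / 4 * J) + ((2 / r) * I₃ + I₄) := by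
    rw [hsplit]; field_simp; ring
  rw [hfin]
  have n1 : ‖((h : ℂ) / r) * I₁‖ ≤ |h| / r * (2 / (2 * r)) := by
    rw [norm_mul, norm_div, Complex.norm_real, Complex.norm_real, Real.norm_eq_abs,
      Real.norm_of_nonneg hr.le]
    exact mul_le_mul_of_nonneg_left b1 (by positivity)
  have n2r : ‖(2 / r : ℂ)‖ = 2 / r := by
    rw [norm_div, Complex.norm_real, Real.norm_of_nonneg hr.le, Complex.norm_ofNat]
  have n2 : ‖(2 / r : ℂ) * (I₂ + 1 / 4 * J)‖ ≤ 2 / r * (2 * Q / r) := by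
    rw [norm_mul, n2r]
    exact mul_le_mul_of_nonneg_left b2 (by positivity)
  have n3 : ‖(2 / r : ℂ) * I₃‖ ≤ 2 / r * (C₂ / r * Q * π) := by
    rw [norm_mul, n2r]
    exact mul_le_mul_of_nonneg_left b3 (by positivity)
  refine (norm_add₃_le).trans ?_
  have n4 := norm_add_le ((2 / r : ℂ) * I₃) I₄
  have n5 : (2 * |h| + 4 * Q + 2 * π * (C₂ * Q) + π * C₂ ^ 2 + 1) / r ^ 2 =
      |h| / r * (2 / (2 * r)) + |h| / r ^ 2 + 2 / r * (2 * Q / r) + 2 / r * (C₂ / r * Q * π) +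
      C₂ / r * (C₂ / r) * π + 1 / r ^ 2 := by field_simp; ring
  have n6 : 0 ≤ |h| / r ^ 2 := by positivity
  have n7 : 0 ≤ 1 / r ^ 2 := by positivity
  rw [n5]
  linarith

/-- The weight numbers approach those of the free problem. -/
theorem summable_norm_weight_sub (hq : MemLp q 2 piMeasure)
    (hc : ∀ ρ, IsCauchySolution q h ρ (c ρ)) (hl : IsEigenvalueSequence q h H lam) :
    Summable fun n => ‖weight c lam n - weight₀ n‖ := by
  obtain ⟨C₁, hC₁, N, hN⟩ := exists_eigenvalue_asymptotics hq hl
  obtain ⟨C₂, hC₂, hb₂⟩ := exists_norm_integral_sq_sub_le hq h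
  have hpm : MemLp (fun x : ℝ => ((π : ℂ) - x) * (q x : ℂ)) 2 piMeasure := by
    have hb : ∀ᵐ x : ℝ ∂piMeasure, ‖((π : ℂ) - x) * (q x : ℂ)‖ ≤ π * ‖(q x : ℂ)‖ := by
      filter_upwards [ae_restrict_mem measurableSet_Ioc] with x hx
      rw [norm_mul, ← Complex.ofReal_sub, Complex.norm_real, Real.norm_eq_abs,
        abs_of_nonneg (sub_nonneg.2 hx.2)]
      exact mul_le_mul_of_nonneg_right (by linarith [hx.1]) (norm_nonneg _)
    exact (memLp_ofReal hq).of_le_mul ((by fun_prop : Continuous fun x : ℝ =>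
      ((π : ℂ) - x)).aestronglyMeasurable.mul (memLp_ofReal hq).1) hb
  have hpi := intervalIntegrable_of_memLp hpm
  set P := ∫ t in (0 : ℝ)..π, ‖((π : ℂ) - t) * (q t : ℂ)‖ with hP
  have hP0 : 0 ≤ P := intervalIntegral.integral_nonneg Real.pi_nonneg fun _ _ => norm_nonneg _
  have s1 := summable_norm_integral_sin_div hpm
  have s2 : Summable fun n : ℕ => 1 / (n : ℝ) ^ 2 := Real.summable_one_div_nat_pow.2 one_lt_two
  set K := 4 * C₂ + 2 * π * C₁ * P + π * C₁ with hK
  rw [← summable_nat_add_iff N]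
  refine ((summable_nat_add_iff N).2 (s1.add (s2.mul_left K))).of_nonneg_of_le
    (fun _ => norm_nonneg _) fun k => ?_
  set n := k + N with hn
  obtain ⟨hn1, hl1, hd1, hd2⟩ := hN n (by omega)
  set r := Real.sqrt (lam n) with hr
  set δ := r - n with hδ
  have hn0 : (0 : ℝ) < n := by exact_mod_cast hn1
  have hn1' : (1 : ℝ) ≤ n := by exact_mod_cast hn1
  have hd1' := abs_le.1 hd1
  have hr0 : (n : ℝ) / 2 ≤ r := by linarith
  have hrpos : 0 < r := by linarith
  have hρ : rho lam n = r := rho_of_nonneg (zero_le_one.trans hl1)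
  have h1 := hb₂ r (c r) hrpos (hc r)
  rw [weight, weight₀, if_neg (by omega), hρ]
  set J := ∫ x in (0 : ℝ)..π, Complex.sin (2 * r * x) * ((π - x) * (q x : ℂ)) with hJ
  set J' := ∫ x in (0 : ℝ)..π, Complex.sin (2 * n * x) * ((π - x) * (q x : ℂ)) with hJ'
  have h2 : ‖J - J'‖ ≤ 2 * π * |δ| * P := by
    have i1 : IntervalIntegrable (fun x : ℝ => Complex.sin (2 * r * x) * ((π - x) * (q x : ℂ)))
      volume 0 π := continuousOn_mul_intervalIntegrable (by fun_prop) hpi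
    have i2 : IntervalIntegrable (fun x : ℝ => Complex.sin (2 * n * x) * ((π - x) * (q x : ℂ)))
      volume 0 π := continuousOn_mul_intervalIntegrable (by fun_prop) hpi
    rw [hJ, hJ', ← intervalIntegral.integral_sub i1 i2]
    simp only [← sub_mul]
    refine norm_integral_mul_le hpi pi_mem_Icc_pi fun t ht => ?_
    have e1 := norm_sin_sub_sin_le (R := 0) (z := 2 * r * t) (w := 2 * n * t)
      (by simp [Complex.mul_im]) (by simp [Complex.mul_im])
    have e2 : (2 * r * t - 2 * n * t : ℂ) = ((2 * t * δ : ℝ) : ℂ) := by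
      rw [hδ]; push_cast; ring
    rw [Real.exp_zero, one_mul, e2, Complex.norm_real, Real.norm_eq_abs, abs_mul,
      abs_of_nonneg (by linarith [ht.1] : 0 ≤ 2 * t)] at e1
    refine e1.trans (mul_le_mul_of_nonneg_right ?_ (abs_nonneg _))
    linarith [ht.2]
  -- The deviation from π/2 is sin(2πr)/(4r). Since 2πr is within 2π|δ| of a multiple of 2π, this is
  -- O(1/n²).
  have h3 : (∫ x in (0 : ℝ)..π, Complex.cos (r * x) ^ 2) =
      π / 2 + 1 / 2 * ∫ x in (0 : ℝ)..π, 1 * Complex.cos ((2 * r : ℝ) * x) := by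
    have e1 : ∀ x : ℝ, Complex.cos (r * x) ^ 2 =
        1 / 2 + 1 / 2 * (1 * Complex.cos ((2 * r : ℝ) * x)) := fun x => by
      push_cast
      rw [mul_assoc 2, Complex.cos_two_mul]
      ring
    simp only [e1]
    rw [intervalIntegral.integral_add intervalIntegrable_const
      ((by fun_prop : Continuous fun x : ℝ => 1 / 2 * (1 * Complex.cos ((2 * r : ℝ) *
        x))).intervalIntegrable _ _), intervalIntegral.integral_const_mul,
      intervalIntegral.integral_const]
    rw [sub_zero, Complex.real_smul]
    ring
  set L := ∫ x in (0 : ℝ)..π, 1 * Complex.cos ((2 * r : ℝ) * x) with hL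
  have h4 : ‖L‖ ≤ 2 * π * |δ| / (2 * r) := by
    have e1 := mul_integral_mul_cos (absCont_const 1) (g := fun _ => 0)
      (ae_of_all _ fun x _ => hasDerivAt_const x (1 : ℂ)) ((2 * r : ℝ) : ℂ)
    simp only [mul_zero, intervalIntegral.integral_zero, sub_zero] at e1
    have e2 := congrArg norm e1
    rw [norm_mul, Complex.norm_real, Real.norm_of_nonneg (by positivity : 0 ≤ 2 * r), one_mul] at e2
    have e3 : ((2 * r : ℝ) : ℂ) * π = ((2 * π * δ : ℝ) : ℂ) + n * (2 * π) := by
      rw [hδ]; push_cast; ring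
    rw [e3, Complex.sin_periodic.nat_mul n _, ← Complex.ofReal_sin, Complex.norm_real,
      Real.norm_eq_abs] at e2
    have e4 : |Real.sin (2 * π * δ)| ≤ 2 * π * |δ| := by
      refine (Real.abs_sin_le_abs).trans (le_of_eq ?_)
      rw [abs_mul, abs_of_pos (by positivity : 0 < 2 * π)]
    rw [le_div_iff₀ (by positivity), mul_comm, e2]
    exact e4
  -- All that is not O(1/n²) is J' over 2r, a Fourier sine coefficient of (π - x)q at the integer n,
  -- so Bessel's inequality makes it summable too.
  have hid : (∫ x in (0 : ℝ)..π, c r x ^ 2) - (π : ℂ) / 2 =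
      ((∫ x in (0 : ℝ)..π, c r x ^ 2) - (∫ x in (0 : ℝ)..π, Complex.cos (r * x) ^ 2) +
        1 / (2 * r) * J) + (1 / 2 * L - 1 / (2 * r) * (J - J')) - 1 / (2 * r) * J' := by
    rw [h3]; ring
  rw [hid]
  have m0 : ‖(1 / (2 * r) : ℂ)‖ = 1 / (2 * r) := by
    rw [norm_div, norm_one, norm_mul, Complex.norm_ofNat, Complex.norm_real,
      Real.norm_of_nonneg hrpos.le]
  have mr : 1 / (2 * r) ≤ 1 / n := by
    apply one_div_le_one_div_of_le hn0; linarith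
  have mδ : π * |δ| ≤ π * (C₁ / n) := by gcongr
  have m1 : ‖(1 / (2 * r) : ℂ) * J'‖ ≤ ‖J'‖ / n := by
    rw [norm_mul, m0]
    calc _ ≤ 1 / (n : ℝ) * ‖J'‖ := by gcongr
      _ = _ := by ring
  have m2 : ‖(1 / (2 * r) : ℂ) * (J - J')‖ ≤ 2 * π * C₁ * P * (1 / n ^ 2) := by
    rw [norm_mul, m0]
    calc _ ≤ 1 / (n : ℝ) * (2 * π * (C₁ / n) * P) := by
          refine mul_le_mul mr (h2.trans ?_) (norm_nonneg _) (by positivity)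
          gcongr
      _ = _ := by field_simp
  have m3 : ‖1 / 2 * L‖ ≤ π * C₁ * (1 / n ^ 2) := by
    rw [norm_mul]
    have : ‖(1 / 2 : ℂ)‖ = 1 / 2 := by norm_num
    rw [this]
    calc _ ≤ 1 / 2 * (2 * π * |δ| / (2 * r)) := by gcongr
      _ = π * |δ| * (1 / (2 * r)) := by ring
      _ ≤ π * (C₁ / n) * (1 / n) := by gcongr
      _ = _ := by field_simp
  have m4 : C₂ / r ^ 2 ≤ 4 * C₂ * (1 / n ^ 2) := by
    calc C₂ / r ^ 2 ≤ C₂ / (n / 2) ^ 2 := by gcongr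
      _ = _ := by field_simp; norm_num
  refine (norm_sub_le _ _).trans ?_
  have m5 := norm_add_le ((∫ x in (0 : ℝ)..π, c r x ^ 2) -
    (∫ x in (0 : ℝ)..π, Complex.cos (r * x) ^ 2) + 1 / (2 * r) * J)
    (1 / 2 * L - 1 / (2 * r) * (J - J'))
  have m6 := norm_sub_le (1 / 2 * L) (1 / (2 * r) * (J - J'))
  have m7 : K * (1 / n ^ 2) = 4 * C₂ * (1 / n ^ 2) + 2 * π * C₁ * P * (1 / n ^ 2) +
      π * C₁ * (1 / n ^ 2) := by rw [hK]; ring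
  rw [m7]
  linarith

theorem norm_weight₀_ge (n : ℕ) : 1 ≤ ‖weight₀ n‖ := by
  rw [weight₀]
  split_ifs
  · rw [Complex.norm_real, Real.norm_of_nonneg Real.pi_nonneg]; linarith [Real.pi_gt_three]
  · rw [norm_div, Complex.norm_real, Real.norm_of_nonneg Real.pi_nonneg, Complex.norm_ofNat]
    linarith [Real.pi_gt_three]

theorem weight₀_ne_zero (n : ℕ) : weight₀ n ≠ 0 := fun h0 => by
  have := norm_weight₀_ge n
  rw [h0, norm_zero] at this
  linarith

theorem exists_norm_inv_weight_le (hq : MemLp q 2 piMeasure)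
    (hc : ∀ ρ, IsCauchySolution q h ρ (c ρ)) (hl : IsEigenvalueSequence q h H lam) :
    ∃ N, ∀ n, N ≤ n → ‖(weight c lam n)⁻¹‖ ≤ 2 := by
  have h1 := (summable_norm_weight_sub hq hc hl).tendsto_atTop_zero
  obtain ⟨N, hN⟩ := eventually_atTop.1 (h1.eventually_lt_const (show (0 : ℝ) < 1 / 2 by norm_num))
  refine ⟨N, fun n hn => ?_⟩
  have h2 := hN n hn
  have h3 := norm_weight₀_ge n
  have h4 := norm_sub_norm_le (weight₀ n) (weight c lam n)
  rw [norm_sub_rev] at h4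
  have h5 : 1 / 2 ≤ ‖weight c lam n‖ := by linarith
  rw [norm_inv, inv_le_comm₀ (by linarith) two_pos]
  linarith

/-- Both families are bounded away from zero for large n, so the reciprocals inherit the
summability. -/
theorem summable_norm_inv_weight_sub (hq : MemLp q 2 piMeasure)
    (hc : ∀ ρ, IsCauchySolution q h ρ (c ρ)) (hl : IsEigenvalueSequence q h H lam) :
    Summable fun n => ‖(weight c lam n)⁻¹ - (weight₀ n)⁻¹‖ := by
  have h1 := summable_norm_weight_sub hq hc hl
  obtain ⟨N, hN⟩ := exists_norm_inv_weight_le hq hc hl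
  rw [← summable_nat_add_iff N]
  refine ((summable_nat_add_iff N).2 (h1.mul_left 2)).of_nonneg_of_le (fun _ => norm_nonneg _)
    fun k => ?_
  have h2 := hN (k + N) (by omega)
  have h3 := norm_weight₀_ge (k + N)
  rw [inv_sub_inv (weight_ne_zero hq hc _) (weight₀_ne_zero _), norm_div, norm_mul, norm_sub_rev]
  rw [norm_inv] at h2
  have h4 := norm_pos_iff.2 (weight_ne_zero hq hc (lam := lam) (k + N))
  rw [div_le_iff₀ (by positivity)]
  have h5 : 1 ≤ 2 * ‖weight c lam (k + N)‖ := by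
    rw [inv_le_comm₀ h4 two_pos] at h2
    linarith
  have h6 : 1 ≤ 2 * ‖weight c lam (k + N)‖ * ‖weight₀ (k + N)‖ := by nlinarith
  nlinarith [norm_nonneg (weight c lam (k + N) - weight₀ (k + N))]

end SturmLiouville

end

/-! ### Transposed Volterra operators and the cosine transform. -/

section

namespace SturmLiouville

/-- The transpose of the operator `volterra k`. -/
def volterraAdj (k : ℝ → ℝ → ℝ) (u : ℝ → ℂ) (t : ℝ) : ℂ :=
  u t + ∫ s in t..π, (k s t : ℂ) * u s

variable {k : ℝ → ℝ → ℝ} {u w : ℝ → ℂ}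

theorem continuousOn_volterraAdj (hk : ContinuousOn (Function.uncurry k) triangle)
    (hu : ContinuousOn u (Icc 0 π)) : ContinuousOn (volterraAdj k u) (Icc 0 π) := by
  obtain ⟨g, hg⟩ := exists_extension_of_continuousOn_triangle hk
  have hc : Continuous fun s => u (clamp s) := hu.comp_continuous continuous_clamp clamp_mem
  have h1 : Continuous fun t => u (clamp t) - ∫ s in π..t, (g (s, t) : ℂ) * u (clamp s) :=
    hc.sub (intervalIntegral.continuous_parametric_intervalIntegral_of_continuous
      ((Complex.continuous_ofReal.comp (g.continuous.comp continuous_swap)).mul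
        (hc.comp continuous_snd)) continuous_id)
  refine h1.continuousOn.congr fun t ht => ?_
  beta_reduce
  rw [volterraAdj, clamp_of_mem ht, sub_eq_add_neg,
    ← intervalIntegral.integral_symm]
  congr 1
  refine intervalIntegral.integral_congr fun s hs => ?_
  rw [uIcc_of_le ht.2] at hs
  have hs' : s ∈ Icc 0 π := ⟨ht.1.trans hs.1, hs.2⟩
  rw [hg s hs' t ⟨ht.1, hs.1⟩, clamp_of_mem hs']

/-- Fubini on the triangle; this is the duality by which both series are summed. -/
theorem integral_mul_volterra (hk : ContinuousOn (Function.uncurry k) triangle)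
    (hu : ContinuousOn u (Icc 0 π)) (hw : ContinuousOn w (Icc 0 π)) :
    ∫ x in (0 : ℝ)..π, w x * volterra k u x = ∫ t in (0 : ℝ)..π, u t * volterraAdj k w t := by
  obtain ⟨g, hg⟩ := exists_extension_of_continuousOn_triangle hk
  have hcu : Continuous fun s => u (clamp s) := hu.comp_continuous continuous_clamp clamp_mem
  have hcw : Continuous fun s => w (clamp s) := hw.comp_continuous continuous_clamp clamp_mem
  set F : ℝ → ℝ → ℂ := fun s t => w (clamp s) * ((g (s, t) : ℂ) * u (clamp t)) with hF
  have hFc : Continuous (Function.uncurry F) :=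
    (hcw.comp continuous_fst).mul ((Complex.continuous_ofReal.comp g.continuous).mul
      (hcu.comp continuous_snd))
  have hsw := integral_triangle_swap Real.pi_nonneg (integrable_of_continuous_prod hFc 0 π 0 π)
  have c1 := continuousOn_volterra hk hu
  have c2 := continuousOn_volterraAdj hk hw
  have e1 : ∀ x ∈ Icc 0 π, w x * volterra k u x = w x * u x + ∫ t in (0 : ℝ)..x, F x t :=
    fun x hx => by
      rw [volterra, mul_add, ← intervalIntegral.integral_const_mul]
      congr 1
      refine intervalIntegral.integral_congr fun t ht => ?_
      rw [uIcc_of_le hx.1] at ht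
      simp only [hF]
      rw [hg x hx t ht, clamp_of_mem hx, clamp_of_mem ⟨ht.1, ht.2.trans hx.2⟩]
  have e2 : ∀ t ∈ Icc 0 π, u t * volterraAdj k w t = w t * u t + ∫ s in t..π, F s t :=
    fun t ht => by
      rw [volterraAdj, mul_add, ← intervalIntegral.integral_const_mul, mul_comm]
      congr 1
      refine intervalIntegral.integral_congr fun s hs => ?_
      rw [uIcc_of_le ht.2] at hs
      have hs' : s ∈ Icc 0 π := ⟨ht.1.trans hs.1, hs.2⟩
      simp only [hF]
      rw [hg s hs' t ⟨ht.1, hs.1⟩, clamp_of_mem hs', clamp_of_mem ht]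
      ring
  have iu := intervalIntegrable_mul hw hu
  have i1 : IntervalIntegrable (fun x => ∫ t in (0 : ℝ)..x, F x t) volume 0 π := by
    refine ((intervalIntegrable_mul hw c1).sub iu).congr fun x hx => ?_
    rw [uIoc_of_le Real.pi_nonneg] at hx
    rw [e1 x ⟨hx.1.le, hx.2⟩]; ring
  have i2 : IntervalIntegrable (fun t => ∫ s in t..π, F s t) volume 0 π := by
    refine ((intervalIntegrable_mul hu c2).sub iu).congr fun x hx => ?_
    rw [uIoc_of_le Real.pi_nonneg] at hx
    rw [e2 x ⟨hx.1.le, hx.2⟩]; ring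
  rw [intervalIntegral.integral_congr (fun x hx => e1 x (uIcc_zero_pi ▸ hx)),
    intervalIntegral.integral_congr (fun x hx => e2 x (uIcc_zero_pi ▸ hx)),
    intervalIntegral.integral_add iu i1, intervalIntegral.integral_add iu i2, hsw]

/-- Integration against the difference of the kernels extended by zero. -/
theorem integral_extendZero_sub {G K : ℝ → ℝ → ℝ}
    (hG : ContinuousOn (Function.uncurry G) triangle)
    (hK : ContinuousOn (Function.uncurry K) triangle) (hu : ContinuousOn u (Icc 0 π)) {x : ℝ}
    (hx : x ∈ Icc 0 π) :
    ∫ t in (0 : ℝ)..π, u t * ((extendZero G x t : ℂ) - (extendZero K t x : ℂ)) =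
      volterra G u x - volterraAdj K u x := by
  -- Left of x only G contributes and right of x only K; the diagonal is null. The terms u(x)
  -- contained in both operators cancel in their difference.
  have e1 : (fun t => (G x t : ℂ) * u t) =ᵐ[volume.restrict (uIoc 0 x)]
      fun t => u t * ((extendZero G x t : ℂ) - (extendZero K t x : ℂ)) := by
    filter_upwards [ae_restrict_mem measurableSet_uIoc, ae_restrict_of_ae (volume.ae_ne x)]
      with t ht hne
    rw [uIoc_of_le hx.1] at ht
    rw [extendZero, extendZero, if_pos ht.2, if_neg (not_le.2 (lt_of_le_of_ne ht.2 hne))]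
    push_cast; ring
  have e2 : (fun t => -((K t x : ℂ) * u t)) =ᵐ[volume.restrict (uIoc x π)]
      fun t => u t * ((extendZero G x t : ℂ) - (extendZero K t x : ℂ)) := by
    filter_upwards [ae_restrict_mem measurableSet_uIoc] with t ht
    rw [uIoc_of_le hx.2] at ht
    rw [extendZero, extendZero, if_pos ht.1.le, if_neg (not_le.2 ht.1)]
    push_cast; ring
  have i1 := intervalIntegrable_kernel_mul hG hu hx
  have i2 : IntervalIntegrable (fun t => -((K t x : ℂ) * u t)) volume x π := by
    refine (ContinuousOn.intervalIntegrable ?_).neg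
    rw [uIcc_of_le hx.2]
    obtain ⟨g, hg⟩ := exists_extension_of_continuousOn_triangle hK
    have h1 : ContinuousOn (fun t => (g (t, x) : ℂ)) (Icc x π) := by
      have : Continuous fun t => (g (t, x) : ℂ) := by fun_prop
      exact this.continuousOn
    refine (h1.mul (hu.mono (Icc_subset_Icc_left hx.1))).congr fun t ht => ?_
    rw [Pi.mul_apply, hg t ⟨hx.1.trans ht.1, ht.2⟩ x ⟨hx.1, ht.1⟩]
  rw [← intervalIntegral.integral_add_adjacent_intervals (i1.congr_ae e1) (i2.congr_ae e2),
    ← intervalIntegral.integral_congr_ae_restrict e1,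
    ← intervalIntegral.integral_congr_ae_restrict e2, intervalIntegral.integral_neg, volterra,
    volterraAdj]
  ring

theorem ae_hasDerivAt_deriv {f : ℝ → ℂ}
    (hf : AbsolutelyContinuousOnInterval f 0 π) :
    ∀ᵐ x, x ∈ uIcc 0 π → HasDerivAt f (deriv f x) x := by
  filter_upwards [hf.boundedVariationOn.ae_differentiableAt_of_mem_uIcc] with x hx hm
  exact (hx hm).hasDerivAt

/-- The cosine transform of an absolutely continuous function. -/
theorem exists_norm_cosTransform_le {f : ℝ → ℂ} (hf : AbsolutelyContinuousOnInterval f 0 π) :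
    ∃ M : ℝ, 0 ≤ M ∧ (∀ a : ℝ, 0 < a → ‖∫ t in (0 : ℝ)..π, f t * Complex.cos (a * t)‖ ≤ M / a) ∧
      ∀ (a : ℝ) (n : ℕ), 0 < a → 0 < n →
        ‖(∫ t in (0 : ℝ)..π, f t * Complex.cos (a * t)) -
          ∫ t in (0 : ℝ)..π, f t * Complex.cos (n * t)‖ ≤ M * |a - n| * (π + 1 / a) / n := by
  have hd := ae_hasDerivAt_deriv hf
  have hgi := hf.intervalIntegrable_of_ae_hasDerivAt hd
  set M := ‖f π‖ + ∫ x in (0 : ℝ)..π, ‖deriv f x‖ with hM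
  have hM0 : 0 ≤ M := add_nonneg (norm_nonneg _)
    (intervalIntegral.integral_nonneg Real.pi_nonneg fun _ _ => norm_nonneg _)
  have h1 : ∀ a : ℝ, 0 < a → ‖∫ t in (0 : ℝ)..π, f t * Complex.cos (a * t)‖ ≤ M / a :=
    fun a ha => norm_integral_mul_cos_le hf hd ha
  refine ⟨M, hM0, h1, fun a n ha hn => ?_⟩
  have hn' : (0 : ℝ) < n := by exact_mod_cast hn
  have e1 := mul_integral_mul_cos hf hd a
  have e2 := mul_integral_mul_cos hf hd n
  set A := ∫ t in (0 : ℝ)..π, f t * Complex.cos (a * t)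
  set B := ∫ t in (0 : ℝ)..π, f t * Complex.cos (n * t)
  have hs : ∀ t ∈ Icc 0 π, ‖Complex.sin (a * t) - Complex.sin (n * t)‖ ≤ π * |a - n| :=
    fun t ht => by
      have := norm_sin_sub_sin_le (R := 0) (z := a * t) (w := n * t) (by simp) (by simp)
      rw [Real.exp_zero, one_mul, ← sub_mul, norm_mul, Complex.norm_real,
        Real.norm_of_nonneg ht.1, ← Complex.ofReal_natCast, ← Complex.ofReal_sub,
        Complex.norm_real, Real.norm_eq_abs] at this
      rw [mul_comm π]
      exact this.trans (mul_le_mul_of_nonneg_left ht.2 (abs_nonneg _))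
  have i1 : IntervalIntegrable (fun t : ℝ => Complex.sin (a * t) * deriv f t) volume 0 π :=
    continuousOn_mul_intervalIntegrable (by fun_prop) hgi
  have i2 : IntervalIntegrable (fun t : ℝ => Complex.sin (n * t) * deriv f t) volume 0 π :=
    continuousOn_mul_intervalIntegrable (by fun_prop) hgi
  -- This is n(A - B) = (aA - nB) - (a - n)A after integration by parts in aA and nB. Each part
  -- carries a factor |a - n|, which is the gain over bounding A and B separately.
  have e3 : (n : ℂ) * (A - B) = f π * (Complex.sin (a * π) - Complex.sin (n * π)) -
      (∫ t in (0 : ℝ)..π, (Complex.sin (a * t) - Complex.sin (n * t)) * deriv f t) -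
      ((a - n : ℝ) : ℂ) * A := by
    simp only [sub_mul]
    rw [intervalIntegral.integral_sub i1 i2]
    push_cast
    linear_combination e1 - e2
  have e4 : (n : ℝ) * ‖A - B‖ ≤ M * |a - n| * (π + 1 / a) := by
    have e5 := congrArg norm e3
    rw [norm_mul, Complex.norm_natCast] at e5
    rw [e5]
    have n1 := norm_sub_le (f π * (Complex.sin (a * π) - Complex.sin (n * π)) -
      (∫ t in (0 : ℝ)..π, (Complex.sin (a * t) - Complex.sin (n * t)) * deriv f t))
      (((a - n : ℝ) : ℂ) * A)
    have n2 := norm_sub_le (f π * (Complex.sin (a * π) - Complex.sin (n * π)))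
      (∫ t in (0 : ℝ)..π, (Complex.sin (a * t) - Complex.sin (n * t)) * deriv f t)
    have n3 : ‖f π * (Complex.sin (a * π) - Complex.sin (n * π))‖ ≤ ‖f π‖ * (π * |a - n|) := by
      rw [norm_mul]
      exact mul_le_mul_of_nonneg_left (hs π pi_mem_Icc_pi) (norm_nonneg _)
    have n4 := norm_integral_mul_le hgi pi_mem_Icc_pi hs
    have n5 : ‖((a - n : ℝ) : ℂ) * A‖ ≤ |a - n| * (M / a) := by
      rw [norm_mul, Complex.norm_real, Real.norm_eq_abs]
      exact mul_le_mul_of_nonneg_left (h1 a ha) (abs_nonneg _)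
    have n6 : M * |a - n| * (π + 1 / a) = ‖f π‖ * (π * |a - n|) +
        π * |a - n| * (∫ x in (0 : ℝ)..π, ‖deriv f x‖) + |a - n| * (M / a) := by
      rw [hM]; ring
    rw [n6]
    linarith
  rw [le_div_iff₀ hn', mul_comm]
  exact e4

end SturmLiouville

end

/-! ### Uniform convergence of the integrated series and its sum. -/

section

namespace SturmLiouville

/-- This permits testing the sum of the series against w term by term. -/
theorem tendsto_integral_mul_of_tendstoUniformlyOn {S : ℕ → ℝ → ℂ} {U w : ℝ → ℂ}
    (hS : ∀ N, ContinuousOn (S N) (Icc 0 π)) (hU : TendstoUniformlyOn S U atTop (Icc 0 π))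
    (hw : ContinuousOn w (Icc 0 π)) :
    Tendsto (fun N => ∫ x in (0 : ℝ)..π, w x * S N x) atTop
      (𝓝 (∫ x in (0 : ℝ)..π, w x * U x)) := by
  have hUc : ContinuousOn U (Icc 0 π) := hU.continuousOn (Frequently.of_forall hS)
  obtain ⟨B, hB⟩ := isCompact_Icc.exists_bound_of_continuousOn hUc
  obtain ⟨W, hW⟩ := isCompact_Icc.exists_bound_of_continuousOn hw
  refine intervalIntegral.tendsto_integral_filter_of_dominated_convergence
    (fun _ => W * (B + 1)) ?_ ?_ intervalIntegrable_const ?_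
  · refine Eventually.of_forall fun N => ?_
    rw [uIoc_of_le Real.pi_nonneg]
    exact ((hw.mul (hS N)).mono Ioc_subset_Icc_self).aestronglyMeasurable measurableSet_Ioc
  · filter_upwards [Metric.tendstoUniformlyOn_iff.1 hU 1 one_pos] with N hN
    refine ae_of_all _ fun x hx => ?_
    rw [uIoc_of_le Real.pi_nonneg] at hx
    have hx' : x ∈ Icc 0 π := ⟨hx.1.le, hx.2⟩
    rw [norm_mul]
    have h1 := hN x hx'
    rw [dist_comm, dist_eq_norm] at h1
    have h2 := norm_le_norm_add_norm_sub' (S N x) (U x)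
    have h3 := hB x hx'
    exact mul_le_mul (hW x hx') (by linarith) (norm_nonneg _)
      ((norm_nonneg _).trans (hW x hx'))
  · refine ae_of_all _ fun x hx => ?_
    rw [uIoc_of_le Real.pi_nonneg] at hx
    exact (hU.tendsto_at ⟨hx.1.le, hx.2⟩).const_mul _

/-- A continuous function orthogonal to all continuous functions vanishes. -/
theorem eqOn_of_forall_integral_mul_eq {U V : ℝ → ℂ} (hU : ContinuousOn U (Icc 0 π))
    (hV : ContinuousOn V (Icc 0 π))
    (h : ∀ w : ℝ → ℂ, ContinuousOn w (Icc 0 π) →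
      ∫ x in (0 : ℝ)..π, w x * U x = ∫ x in (0 : ℝ)..π, w x * V x) :
    ∀ x ∈ Icc 0 π, U x = V x := by
  have hd : ContinuousOn (fun x => U x - V x) (Icc 0 π) := hU.sub hV
  have hcd : ContinuousOn (fun x => starRingEnd ℂ (U x - V x)) (Icc 0 π) :=
    Complex.continuous_conj.comp_continuousOn hd
  by_contra! hne
  obtain ⟨x, hx, hxne⟩ := hne
  refine integral_mul_conj_ne_zero hd ⟨x, hx, sub_ne_zero.2 hxne⟩ ?_
  have h1 := h _ hcd
  rw [← sub_eq_zero, ← intervalIntegral.integral_sub (intervalIntegrable_mul hcd hU)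
    (intervalIntegrable_mul hcd hV)] at h1
  rw [← h1]
  exact intervalIntegral.integral_congr fun x _ => by ring

/-- The terms of the series for `∫ f(t) (G(x, t) - K(t, x)) dt`. -/
def seriesTerm (c : ℂ → ℝ → ℂ) (lam : ℕ → ℝ) (f : ℝ → ℂ) (n : ℕ) (x : ℝ) : ℂ :=
  c n x * (∫ t in (0 : ℝ)..π, f t * Complex.cos (n * t)) / weight₀ n -
    c (rho lam n) x * (∫ t in (0 : ℝ)..π, f t * Complex.cos (rho lam n * t)) / weight c lam n

variable {q : ℝ → ℝ} {h H : ℝ} {c : ℂ → ℝ → ℂ} {lam : ℕ → ℝ} {f : ℝ → ℂ} {G K : ℝ → ℝ → ℝ}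

theorem integral_mul_partialSumG (hf : ContinuousOn f (Icc 0 π)) (N : ℕ) (x : ℝ) :
    ∫ t in (0 : ℝ)..π, f t * partialSumG c lam N x t =
      ∑ n ∈ Finset.range (N + 1), seriesTerm c lam f n x := by
  have i1 : ∀ ρ : ℂ, IntervalIntegrable (fun t : ℝ => f t * Complex.cos (ρ * t)) volume 0 π :=
    fun ρ => intervalIntegrable_mul hf (by fun_prop)
  have e : ∀ n : ℕ, (fun t : ℝ => f t * (c n x * Complex.cos (n * t) / weight₀ n -
      c (rho lam n) x * Complex.cos (rho lam n * t) / weight c lam n)) = fun t : ℝ =>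
      c n x / weight₀ n * (f t * Complex.cos (n * t)) -
      c (rho lam n) x / weight c lam n * (f t * Complex.cos (rho lam n * t)) := fun n => by
    funext t; ring
  simp only [partialSumG, Finset.mul_sum]
  rw [intervalIntegral.integral_finsetSum fun n _ => by
    rw [e]; exact ((i1 _).const_mul _).sub ((i1 _).const_mul _)]
  refine Finset.sum_congr rfl fun n _ => ?_
  rw [e, intervalIntegral.integral_sub ((i1 _).const_mul _) ((i1 _).const_mul _),
    intervalIntegral.integral_const_mul, intervalIntegral.integral_const_mul, seriesTerm]
  ring

theorem continuousOn_seriesTerm (hc : ∀ ρ, IsCauchySolution q h ρ (c ρ)) (n : ℕ) :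
    ContinuousOn (seriesTerm c lam f n) (Icc 0 π) :=
  (((hc _).continuousOn.mul continuousOn_const).div_const _).sub
    (((hc _).continuousOn.mul continuousOn_const).div_const _)

/-- The difference of the two halves of a term telescopes into a change of c, a change of the
transform of f, and a change of the weight. The first is O(1/n) · O(1/n), the second O(1/n²), and
the third is bounded by the summable differences of reciprocal weights. -/
theorem exists_summable_bound_seriesTerm (hq : MemLp q 2 piMeasure)
    (hc : ∀ ρ, IsCauchySolution q h ρ (c ρ)) (hl : IsEigenvalueSequence q h H lam)
    (hf : AbsolutelyContinuousOnInterval f 0 π) :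
    ∃ u : ℕ → ℝ, Summable u ∧ ∀ᶠ n in atTop, ∀ x ∈ Icc 0 π, ‖seriesTerm c lam f n x‖ ≤ u n := by
  obtain ⟨C₁, hC₁, N, hN⟩ := exists_eigenvalue_asymptotics hq hl
  obtain ⟨B, hB, hb⟩ := exists_norm_cauchySolution_le hq h
  obtain ⟨C, hC, hL⟩ := exists_norm_cauchySolution_sub_le hq h 0
  obtain ⟨M, hM, hM1, hM2⟩ := exists_norm_cosTransform_le hf
  have s2 : Summable fun n : ℕ => 1 / (n : ℝ) ^ 2 := Real.summable_one_div_nat_pow.2 one_lt_two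
  refine ⟨fun n => (C * C₁ * M + B * (M * C₁ * (π + 2))) * (1 / (n : ℝ) ^ 2) +
    B * (2 * M) * ‖(weight c lam n)⁻¹ - (weight₀ n)⁻¹‖,
    (s2.mul_left _).add ((summable_norm_inv_weight_sub hq hc hl).mul_left _), ?_⟩
  -- The bound is required only eventually, so the finitely many n outside the asymptotic regime,
  -- including those with λₙ < 0, play no role.
  filter_upwards [eventually_ge_atTop N] with n hn x hx
  obtain ⟨hn1, hl1, hd1, hd2⟩ := hN n hn
  set r := Real.sqrt (lam n) with hr
  have hn0 : (0 : ℝ) < n := by exact_mod_cast hn1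
  have hn1' : (1 : ℝ) ≤ n := by exact_mod_cast hn1
  have hd1' := abs_le.1 hd1
  have hr0 : (n : ℝ) / 2 ≤ r := by linarith
  have hr12 : 1 / 2 ≤ r := by linarith
  have hrpos : 0 < r := by linarith
  have hρ : rho lam n = r := rho_of_nonneg (zero_le_one.trans hl1)
  rw [seriesTerm, hρ]
  set A := ∫ t in (0 : ℝ)..π, f t * Complex.cos (r * t) with hA
  set A' := ∫ t in (0 : ℝ)..π, f t * Complex.cos (n * t) with hA'
  have a1 : ‖A‖ ≤ 2 * M := by
    refine (hM1 r hrpos).trans ?_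
    rw [div_le_iff₀ hrpos]; nlinarith
  have a2 : ‖A'‖ ≤ M / n := by
    have := hM1 n hn0
    rwa [Complex.ofReal_natCast] at this
  have a3 : ‖A' - A‖ ≤ M * (C₁ / n) * (π + 2) / n := by
    rw [norm_sub_rev]
    refine (hM2 r n hrpos (by omega)).trans ?_
    have : 1 / r ≤ 2 := by rw [div_le_iff₀ hrpos]; linarith
    gcongr
  have c1 : ‖c r x‖ ≤ B := by simpa using hb r (c r) (hc r) x hx
  have c2 : ‖c n x - c r x‖ ≤ C * (C₁ / n) := by
    have := hL n r (c n) (c r) (by simp) (by simp) (hc _) (hc _) x hx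
    refine this.trans (mul_le_mul_of_nonneg_left ?_ hC.le)
    rw [← Complex.ofReal_natCast, ← Complex.ofReal_sub, Complex.norm_real, norm_sub_rev]
    exact hd2
  have w1 : ‖(weight₀ n)⁻¹‖ ≤ 1 := by
    rw [norm_inv]; exact inv_le_one_of_one_le₀ (norm_weight₀_ge n)
  have e : c n x * A' / weight₀ n - c r x * A / weight c lam n =
      (c n x - c r x) * A' * (weight₀ n)⁻¹ + c r x * (A' - A) * (weight₀ n)⁻¹ -
      c r x * A * ((weight c lam n)⁻¹ - (weight₀ n)⁻¹) := by
    rw [div_eq_mul_inv, div_eq_mul_inv]; ring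
  rw [e]
  refine (norm_sub_le _ _).trans (add_le_add ((norm_add_le _ _).trans ?_) ?_)
  · rw [add_mul]
    refine add_le_add ?_ ?_
    · rw [norm_mul, norm_mul]
      calc _ ≤ C * (C₁ / n) * (M / n) * 1 := by gcongr
        _ = _ := by field_simp
    · rw [norm_mul, norm_mul]
      calc _ ≤ B * (M * (C₁ / n) * (π + 2) / n) * 1 := by gcongr
        _ = _ := by field_simp
  · rw [norm_mul, norm_mul]
    gcongr

theorem hasSum_cos (hu : ContinuousOn f (Icc 0 π)) {v : ℝ → ℂ} (hv : ContinuousOn v (Icc 0 π)) :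
    HasSum (fun n : ℕ => (∫ x in (0 : ℝ)..π, Complex.cos (n * x) * f x) *
      (∫ x in (0 : ℝ)..π, Complex.cos (n * x) * v x) / weight₀ n)
      (∫ x in (0 : ℝ)..π, f x * v x) := by
  have hq0 : MemLp (0 : ℝ → ℝ) 2 piMeasure := MemLp.zero
  have := hasSum_integral_mul_integral hq0 isCauchySolution_cos isEigenvalueSequence_sq hu hv
  simpa only [rho_sq_eq, weight_cos] using this

/-- Both sides are continuous, so it suffices to pair them with continuous w. Transposition turns
the two halves of the series into Parseval sums, one for the cosines with T*w and f, the other for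
the eigenfunctions with w and (T⁻¹)*f. The order of summation is the natural one on both sides, so
uniqueness of limits concludes. -/
theorem tsum_seriesTerm (hq : MemLp q 2 piMeasure)
    (hc : ∀ ρ, IsCauchySolution q h ρ (c ρ)) (hl : IsEigenvalueSequence q h H lam)
    (hG : IsTransmutationKernel q h G) (hK : IsInverseKernel G K)
    (hf : AbsolutelyContinuousOnInterval f 0 π) :
    ∀ x ∈ Icc 0 π, ∑' n, seriesTerm c lam f n x = volterra G f x - volterraAdj K f x := by
  have hfc : ContinuousOn f (Icc 0 π) := by simpa [uIcc_zero_pi] using hf.continuousOn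
  obtain ⟨u, hu, hbd⟩ := exists_summable_bound_seriesTerm hq hc hl hf
  have hunif := tendstoUniformlyOn_tsum_nat_eventually hu hbd
  have hSc : ∀ N, ContinuousOn (fun x => ∑ n ∈ Finset.range N, seriesTerm c lam f n x) (Icc 0 π) :=
    fun N => continuousOn_finsetSum _ fun n _ => continuousOn_seriesTerm hc n
  have cG := continuousOn_volterra hG.1 hfc
  have cK := continuousOn_volterraAdj hK.1 hfc
  refine eqOn_of_forall_integral_mul_eq (hunif.continuousOn (Frequently.of_forall hSc))
    (cG.sub cK) fun w hw => ?_
  have t1 := tendsto_integral_mul_of_tendstoUniformlyOn hSc hunif hw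
  have cw := continuousOn_volterraAdj hG.1 hw
  have p1 := hasSum_cos cw hfc
  have p2 := hasSum_integral_mul_integral hq hc hl hw cK
  have e1 : ∀ ρ : ℂ, ∫ x in (0 : ℝ)..π, Complex.cos (ρ * x) * volterraAdj G w x =
      ∫ x in (0 : ℝ)..π, w x * c ρ x := fun ρ => by
    rw [← integral_mul_volterra hG.1 (by fun_prop) hw]
    refine intervalIntegral.integral_congr fun x hx => ?_
    rw [uIcc_zero_pi] at hx
    rw [(hc ρ).eq_volterra hq hG x hx]
  -- Here the inverse kernel is used: T⁻¹[c(ρ, ·)] = cos ρ·.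
  have e2 : ∀ ρ : ℂ, ∫ x in (0 : ℝ)..π, c ρ x * volterraAdj K f x =
      ∫ x in (0 : ℝ)..π, f x * Complex.cos (ρ * x) := fun ρ => by
    rw [← integral_mul_volterra hK.1 (hc ρ).continuousOn hfc]
    refine intervalIntegral.integral_congr fun x hx => ?_
    rw [uIcc_zero_pi] at hx
    rw [volterra_congr ((hc ρ).eq_volterra hq hG) hx,
      (hK.2 (fun x : ℝ => Complex.cos (ρ * x)) (by fun_prop) x hx).1]
  have t2 := (p1.sub p2).tendsto_sum_nat
  have e3 : ∫ x in (0 : ℝ)..π, volterraAdj G w x * f x = ∫ x in (0 : ℝ)..π, w x * volterra G f x := by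
    rw [integral_mul_volterra hG.1 hfc hw]
    exact intervalIntegral.integral_congr fun x _ => mul_comm _ _
  rw [e3, ← intervalIntegral.integral_sub (intervalIntegrable_mul hw cG)
    (intervalIntegrable_mul hw cK)] at t2
  refine tendsto_nhds_unique t1 ((t2.congr fun N => ?_).trans (le_of_eq ?_))
  · have i1 : ∀ n, IntervalIntegrable (fun x => w x * seriesTerm c lam f n x) volume 0 π :=
      fun n => intervalIntegrable_mul hw (continuousOn_seriesTerm hc n)
    simp only [Finset.mul_sum]
    rw [intervalIntegral.integral_finsetSum fun n _ => i1 n]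
    refine Finset.sum_congr rfl fun n _ => ?_
    have e4 : (fun x => w x * seriesTerm c lam f n x) = fun x =>
        ((∫ t in (0 : ℝ)..π, f t * Complex.cos (n * t)) / weight₀ n) * (w x * c n x) -
        ((∫ t in (0 : ℝ)..π, f t * Complex.cos (rho lam n * t)) / weight c lam n) *
          (w x * c (rho lam n) x) := by
      funext x; rw [seriesTerm]; ring
    have i2 : ∀ ρ, IntervalIntegrable (fun x => w x * c ρ x) volume 0 π := fun ρ =>
      intervalIntegrable_mul hw (hc ρ).continuousOn
    have e5 : ∀ ρ : ℂ, ∀ v : ℝ → ℂ, ∫ x in (0 : ℝ)..π, c ρ x * v x = ∫ x in (0 : ℝ)..π, v x * c ρ x :=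
      fun ρ v => intervalIntegral.integral_congr fun x _ => mul_comm _ _
    have e6 : ∫ x in (0 : ℝ)..π, Complex.cos (n * x) * f x =
        ∫ x in (0 : ℝ)..π, f x * Complex.cos (n * x) :=
      intervalIntegral.integral_congr fun x _ => mul_comm _ _
    rw [e4, intervalIntegral.integral_sub ((i2 _).const_mul _) ((i2 _).const_mul _),
      intervalIntegral.integral_const_mul, intervalIntegral.integral_const_mul, e1, e2, e5, e6]
    ring
  · congr 1
    exact intervalIntegral.integral_congr fun x _ => by ring

theorem tendstoUniformlyOn_integral_partialSumG (hq : MemLp q 2 piMeasure)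
    (hc : ∀ ρ, IsCauchySolution q h ρ (c ρ)) (hl : IsEigenvalueSequence q h H lam)
    (hG : IsTransmutationKernel q h G) (hK : IsInverseKernel G K)
    (hf : AbsolutelyContinuousOnInterval f 0 π) :
    TendstoUniformlyOn (fun N x => ∫ t in (0 : ℝ)..π, f t * partialSumG c lam N x t)
      (fun x => ∫ t in (0 : ℝ)..π, f t * ((extendZero G x t : ℂ) - (extendZero K t x : ℂ)))
      atTop (Icc 0 π) := by
  have hfc : ContinuousOn f (Icc 0 π) := by simpa [uIcc_zero_pi] using hf.continuousOn
  obtain ⟨u, hu, hbd⟩ := exists_summable_bound_seriesTerm hq hc hl hf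
  have hunif := tendstoUniformlyOn_tsum_nat_eventually hu hbd
  have h1 : TendstoUniformlyOn (fun N x => ∫ t in (0 : ℝ)..π, f t * partialSumG c lam N x t)
      (fun x => ∑' n, seriesTerm c lam f n x) atTop (Icc 0 π) := by
    simp only [integral_mul_partialSumG hfc]
    intro v hv
    -- The partial sums with index N contain N + 1 terms, hence the shift.
    exact (tendsto_add_atTop_nat 1).eventually (hunif v hv)
  refine h1.congr_right fun x hx => ?_
  beta_reduce
  rw [tsum_seriesTerm hq hc hl hG hK hf x hx, integral_extendZero_sub hG.1 hK.1 hfc hx]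

theorem partialSumH_eq_neg (N : ℕ) (x t : ℝ) :
    partialSumH c lam N t x = -partialSumG c lam N x t := by
  rw [partialSumH, partialSumG, ← Finset.sum_neg_distrib]
  exact Finset.sum_congr rfl fun n _ => by ring

theorem tendstoUniformlyOn_integral_partialSumH (hq : MemLp q 2 piMeasure)
    (hc : ∀ ρ, IsCauchySolution q h ρ (c ρ)) (hl : IsEigenvalueSequence q h H lam)
    (hG : IsTransmutationKernel q h G) (hK : IsInverseKernel G K)
    (hf : AbsolutelyContinuousOnInterval f 0 π) :
    TendstoUniformlyOn (fun N x => ∫ t in (0 : ℝ)..π, f t * partialSumH c lam N t x)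
      (fun x => ∫ t in (0 : ℝ)..π, f t * ((extendZero K t x : ℂ) - (extendZero G x t : ℂ)))
      atTop (Icc 0 π) := by
  have h1 := (tendstoUniformlyOn_integral_partialSumG hq hc hl hG hK hf).neg
  refine (h1.congr (Eventually.of_forall fun N x _ => ?_)).congr_right fun x _ => ?_
  · simp only [Pi.neg_apply, partialSumH_eq_neg, mul_neg, intervalIntegral.integral_neg]
  · simp only [Pi.neg_apply, ← intervalIntegral.integral_neg, ← mul_neg, neg_sub]

end SturmLiouville

end

/-! ### Bounded convergence of the series for F. -/

section

namespace SturmLiouville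

/-- Abel's inequality. -/
theorem abs_sum_mul_le_of_antitone {a b : ℕ → ℝ} {A : ℝ} (hb : Antitone b) (hb0 : ∀ i, 0 ≤ b i)
    (hA : ∀ k, |∑ i ∈ Finset.range k, a i| ≤ A) (N : ℕ) :
    |∑ i ∈ Finset.range N, b i * a i| ≤ A * b 0 := by
  have key : |∑ i ∈ Finset.range N, b i * a i - b N * ∑ i ∈ Finset.range N, a i| ≤
      A * (b 0 - b N) := by
    induction N with
    | zero => simp
    | succ N ih =>
      have e : ∑ i ∈ Finset.range (N + 1), b i * a i -
          b (N + 1) * ∑ i ∈ Finset.range (N + 1), a i =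
          (∑ i ∈ Finset.range N, b i * a i - b N * ∑ i ∈ Finset.range N, a i) +
          (b N - b (N + 1)) * ∑ i ∈ Finset.range (N + 1), a i := by
        simp only [Finset.sum_range_succ]; ring
      rw [e]
      refine (abs_add_le _ _).trans ?_
      rw [abs_mul, abs_of_nonneg (sub_nonneg.2 (hb N.le_succ))]
      have := mul_le_mul_of_nonneg_left (hA (N + 1)) (sub_nonneg.2 (hb N.le_succ))
      rw [Nat.succ_eq_add_one] at this
      linarith
  have h1 : |b N * ∑ i ∈ Finset.range N, a i| ≤ b N * A := by
    rw [abs_mul, abs_of_nonneg (hb0 N)]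
    exact mul_le_mul_of_nonneg_left (hA N) (hb0 N)
  have := abs_add_le (∑ i ∈ Finset.range N, b i * a i - b N * ∑ i ∈ Finset.range N, a i)
    (b N * ∑ i ∈ Finset.range N, a i)
  rw [sub_add_cancel] at this
  linarith

/-- Multiplication by 2 sin(z/2) makes the sum telescope to a difference of two cosines. -/
theorem abs_sum_sin_le (m k : ℕ) {z : ℝ} (hz : Real.sin (z / 2) ≠ 0) :
    |∑ i ∈ Finset.range k, Real.sin ((m + i : ℕ) * z)| ≤ 1 / |Real.sin (z / 2)| := by
  have key : 2 * Real.sin (z / 2) * ∑ i ∈ Finset.range k, Real.sin ((m + i : ℕ) * z) =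
      Real.cos ((m - 1 / 2) * z) - Real.cos ((m + k - 1 / 2) * z) := by
    induction k with
    | zero => simp
    | succ k ih =>
      rw [Finset.sum_range_succ, mul_add, ih]
      have e1 : ((m : ℝ) + k - 1 / 2) * z = (m + k : ℕ) * z - z / 2 := by push_cast; ring
      have e2 : ((m : ℝ) + (k + 1 : ℕ) - 1 / 2) * z = (m + k : ℕ) * z + z / 2 := by
        push_cast; ring
      rw [e1, e2, Real.cos_sub, Real.cos_add]
      ring
  rw [le_div_iff₀ (abs_pos.2 hz)]
  have h1 := congrArg abs key
  rw [abs_mul, abs_mul, abs_two] at h1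
  have h2 := abs_sub (Real.cos ((m - 1 / 2) * z)) (Real.cos ((m + k - 1 / 2) * z))
  have h3 := Real.abs_cos_le_one ((m - 1 / 2) * z)
  have h4 := Real.abs_cos_le_one ((m + k - 1 / 2) * z)
  nlinarith

theorem abs_sum_sin_div_le {m : ℕ} (hm : 1 ≤ m) (k : ℕ) {z : ℝ} (hz : Real.sin (z / 2) ≠ 0) :
    |∑ i ∈ Finset.range k, Real.sin ((m + i : ℕ) * z) / (m + i : ℕ)| ≤
      1 / |Real.sin (z / 2)| * (1 / m) := by
  have hm0 : (0 : ℝ) < m := by exact_mod_cast hm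
  have := abs_sum_mul_le_of_antitone (a := fun i => Real.sin ((m + i : ℕ) * z))
    (b := fun i => 1 / ((m + i : ℕ) : ℝ)) (fun i j hij => ?_) (fun i => by positivity)
    (fun k => abs_sum_sin_le m k hz) k
  · simpa only [one_div_mul_eq_div, add_zero] using this
  · refine one_div_le_one_div_of_le (by push_cast; positivity) ?_
    exact_mod_cast Nat.add_le_add_left hij m

/-- The partial sums of `∑ sin(n z) / n`. -/
def sineSum (N : ℕ) (z : ℝ) : ℝ := ∑ n ∈ Finset.range N, Real.sin (n * z) / n

theorem sineSum_add (m k : ℕ) (z : ℝ) : sineSum (m + k) z =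
    sineSum m z + ∑ i ∈ Finset.range k, Real.sin ((m + i : ℕ) * z) / (m + i : ℕ) := by
  rw [sineSum, Finset.sum_range_add, sineSum]

theorem sineSum_eq_zero {z : ℝ} (hz : Real.sin (z / 2) = 0) (N : ℕ) : sineSum N z = 0 := by
  obtain ⟨k, hk⟩ := Real.sin_eq_zero_iff.1 hz
  refine Finset.sum_eq_zero fun n _ => ?_
  have : (n : ℝ) * z = (2 * n * k : ℤ) * π := by push_cast; linear_combination -2 * (n : ℝ) * hk
  rw [this, Real.sin_int_mul_pi, zero_div]

theorem exists_tendsto_sineSum (z : ℝ) : ∃ l, Tendsto (fun N => sineSum N z) atTop (𝓝 l) := by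
  by_cases hz : Real.sin (z / 2) = 0
  · exact ⟨0, by simp [sineSum_eq_zero hz]⟩
  refine cauchySeq_tendsto_of_complete (Metric.cauchySeq_iff'.2 fun ε hε => ?_)
  have ht : Tendsto (fun m : ℕ => 1 / |Real.sin (z / 2)| * (1 / (m : ℝ))) atTop (𝓝 0) := by
    simpa using (tendsto_one_div_atTop_nhds_zero_nat (𝕜 := ℝ)).const_mul (1 / |Real.sin (z / 2)|)
  obtain ⟨m, hm, hm1⟩ := ((ht.eventually_lt_const hε).and (eventually_ge_atTop 1)).exists
  refine ⟨m, fun N hN => ?_⟩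
  obtain ⟨k, rfl⟩ := Nat.exists_eq_add_of_le hN
  rw [sineSum_add, Real.dist_eq, add_sub_cancel_left]
  exact (abs_sum_sin_div_le hm1 k hz).trans_lt hm

theorem abs_sineSum_le_mul (N : ℕ) (z : ℝ) : |sineSum N z| ≤ N * |z| := by
  refine (Finset.abs_sum_le_sum_abs _ _).trans ?_
  have : ∀ n ∈ Finset.range N, |Real.sin (n * z) / n| ≤ |z| := fun n _ => by
    rcases Nat.eq_zero_or_pos n with rfl | hn
    · simp
    have hn' : (0 : ℝ) < n := by exact_mod_cast hn
    rw [abs_div, abs_of_pos hn', div_le_iff₀ hn']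
    have := Real.abs_sin_le_abs (x := n * z)
    rwa [abs_mul, abs_of_pos hn', mul_comm (n : ℝ) |z|] at this
  simpa using Finset.sum_le_sum this

/-- The sum is cut at m ≈ 1/|z|. The first m terms are at most |z| each and add up to at most 1 + π;
the tail is at most 1/(m |sin(z/2)|) ≤ π by Abel's inequality and |sin(z/2)| ≥ |z|/π. -/
theorem abs_sineSum_le_of_abs_le_pi (N : ℕ) {z : ℝ} (hz : |z| ≤ π) : |sineSum N z| ≤ 1 + 2 * π := by
  have hπ := Real.pi_pos
  rcases eq_or_ne z 0 with rfl | hz0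
  · rw [sineSum_eq_zero (by simp), abs_zero]; positivity
  have hzp : 0 < |z| := abs_pos.2 hz0
  set m : ℕ := ⌊1 / |z|⌋₊ + 1 with hm
  have hm1 : (m : ℝ) * |z| ≤ 1 + π := by
    have := Nat.floor_le (a := 1 / |z|) (by positivity)
    rw [le_div_iff₀ hzp] at this
    rw [hm]; push_cast; linarith
  have hm2 : 1 ≤ (m : ℝ) * |z| := by
    have := (Nat.lt_floor_add_one (1 / |z|)).le
    rw [div_le_iff₀ hzp] at this
    rw [hm]; push_cast; linarith
  rcases le_total N m with hN | hN
  · refine (abs_sineSum_le_mul N z).trans ?_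
    have : (N : ℝ) * |z| ≤ m * |z| := by gcongr
    linarith
  · obtain ⟨k, rfl⟩ := Nat.exists_eq_add_of_le hN
    have hs : |z| / π ≤ |Real.sin (z / 2)| := by
      have := Real.mul_abs_le_abs_sin (x := z / 2) (by rw [abs_div, abs_two]; linarith)
      rw [abs_div, abs_two] at this
      calc _ = 2 / π * (|z| / 2) := by ring
        _ ≤ _ := this
    have hs0 : 0 < |Real.sin (z / 2)| := (div_pos hzp hπ).trans_le hs
    rw [sineSum_add]
    refine (abs_add_le _ _).trans ?_
    have h1 := (abs_sineSum_le_mul m z).trans hm1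
    have h2 := abs_sum_sin_div_le (m := m) (by omega) k (abs_pos.1 hs0)
    have hmp : (0 : ℝ) < m := by rw [hm]; positivity
    have h3 : 1 / |Real.sin (z / 2)| * (1 / m) ≤ π := by
      rw [div_mul_div_comm, one_mul, div_le_iff₀ (by positivity)]
      rw [div_le_iff₀ hπ] at hs
      nlinarith
    linarith

/-- Periodicity extends the bound to the range needed for z = x + t. -/
theorem abs_sineSum_le (N : ℕ) {z : ℝ} (hz : |z| ≤ 2 * π) : |sineSum N z| ≤ 1 + 2 * π := by
  have hz' := abs_le.1 hz
  have hπ := Real.pi_pos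
  rcases lt_or_ge π z with h1 | h1
  · have e : sineSum N z = sineSum N (z - 2 * π) := Finset.sum_congr rfl fun n _ => by
      rw [mul_sub, Real.sin_sub_nat_mul_two_pi]
    rw [e]
    exact abs_sineSum_le_of_abs_le_pi N (abs_le.2 ⟨by linarith, by linarith⟩)
  rcases lt_or_ge z (-π) with h2 | h2
  · have e : sineSum N z = sineSum N (z + 2 * π) := Finset.sum_congr rfl fun n _ => by
      rw [mul_add, Real.sin_add_nat_mul_two_pi]
    rw [e]
    exact abs_sineSum_le_of_abs_le_pi N (abs_le.2 ⟨by linarith, by linarith⟩)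
  · exact abs_sineSum_le_of_abs_le_pi N (abs_le.2 ⟨h2, h1⟩)

theorem abs_cos_add_sub_le (a b : ℝ) :
    |Real.cos (a + b) - Real.cos a + b * Real.sin a| ≤ 2 * b ^ 2 := by
  have e : Real.cos (a + b) - Real.cos a + b * Real.sin a =
      Real.cos a * (Real.cos b - 1) - Real.sin a * (Real.sin b - b) := by
    rw [Real.cos_add]; ring
  have h1 : |Real.cos b - 1| ≤ b ^ 2 := by
    rw [abs_le]; constructor
    · nlinarith [Real.one_sub_sq_div_two_le_cos (x := b), sq_nonneg b]
    · nlinarith [Real.cos_le_one b, sq_nonneg b]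
  have h2 := abs_sin_sub_self_le_sq b
  rw [e]
  refine (abs_sub _ _).trans ?_
  rw [abs_mul, abs_mul]
  have h3 := mul_le_mul (Real.abs_cos_le_one a) h1 (abs_nonneg _) zero_le_one
  have h4 := mul_le_mul (Real.abs_sin_le_one a) h2 (abs_nonneg _) zero_le_one
  linarith

/-- The terms of the one-variable series `a(z)` with `F(x, t) = (a(x + t) + a(x - t)) / 2`. -/
def cosTerm (c : ℂ → ℝ → ℂ) (lam : ℕ → ℝ) (n : ℕ) (z : ℝ) : ℂ :=
  Complex.cos (rho lam n * z) / weight c lam n - Complex.cos (n * z) / weight₀ n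

variable {q : ℝ → ℝ} {h H : ℝ} {c : ℂ → ℝ → ℂ} {lam : ℕ → ℝ} {f : ℝ → ℂ} {G K : ℝ → ℝ → ℝ}

theorem continuous_cosTerm (n : ℕ) : Continuous (cosTerm c lam n) := by
  unfold cosTerm
  fun_prop

/-- To first order cos ρₙz - cos nz = -z(ρₙ - n) sin nz, and ρₙ - n equals a constant over n up to a
summable error. The second order remainder is O(1/n²) and the change of weight is summable. -/
theorem exists_summable_bound_cosTerm (hq : MemLp q 2 piMeasure)
    (hc : ∀ ρ, IsCauchySolution q h ρ (c ρ)) (hl : IsEigenvalueSequence q h H lam) :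
    ∃ (ω : ℝ) (u : ℕ → ℝ), Summable u ∧ ∀ n, ∀ z : ℝ, |z| ≤ 2 * π →
      ‖cosTerm c lam n z + ((ω * z * (Real.sin (n * z) / n) : ℝ) : ℂ)‖ ≤ u n := by
  obtain ⟨C, hC, N, hN⟩ := exists_eigenvalue_asymptotics hq hl
  obtain ⟨ω, hω⟩ := exists_summable_rho_sub hq hl
  have hπ := Real.pi_pos
  have hB : ∀ n : ℕ, ∃ B, ∀ z ∈ Icc (-(2 * π)) (2 * π),
      ‖cosTerm c lam n z + ((2 / π * ω * z * (Real.sin (n * z) / n) : ℝ) : ℂ)‖ ≤ B := fun n =>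
    isCompact_Icc.exists_bound_of_continuousOn
      ((continuous_cosTerm n).add (by fun_prop)).continuousOn
  choose B hB using hB
  have s2 : Summable fun n : ℕ => 1 / (n : ℝ) ^ 2 := Real.summable_one_div_nat_pow.2 one_lt_two
  set v : ℕ → ℝ := fun n => ‖(weight c lam n)⁻¹ - (weight₀ n)⁻¹‖ +
    (4 * |Real.sqrt (lam n) - n - ω / n| + 16 * π * C ^ 2 * (1 / (n : ℝ) ^ 2)) with hv
  have hvs : Summable v := (summable_norm_inv_weight_sub hq hc hl).add
    ((hω.mul_left _).add (s2.mul_left _))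
  -- The factor 2/π is the reciprocal of the free weight for n ≥ 1. The initial terms, to which the
  -- asymptotics do not apply, are bounded by compactness.
  refine ⟨2 / π * ω, fun n => if n < N then B n else v n, ?_, fun n z hz => ?_⟩
  · refine Summable.of_norm_bounded_eventually_nat hvs.norm ?_
    filter_upwards [eventually_ge_atTop N] with n hn
    rw [if_neg (not_lt.2 hn)]
  beta_reduce
  split_ifs with hn
  · exact hB n z (abs_le.1 hz)
  obtain ⟨hn1, hl1, -, hd⟩ := hN n (not_lt.1 hn)
  simp only [hv]
  set r := Real.sqrt (lam n) with hr
  have hn0 : (0 : ℝ) < n := by exact_mod_cast hn1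
  have hρ : rho lam n = r := rho_of_nonneg (zero_le_one.trans hl1)
  have hw : weight₀ n = ((π / 2 : ℝ) : ℂ) := by
    rw [weight₀, if_neg (by omega)]; push_cast; rfl
  have e : cosTerm c lam n z + ((2 / π * ω * z * (Real.sin (n * z) / n) : ℝ) : ℂ) =
      ((Real.cos (r * z) : ℝ) : ℂ) * ((weight c lam n)⁻¹ - (weight₀ n)⁻¹) +
      ((2 / π * ((Real.cos (n * z + z * (r - n)) - Real.cos (n * z) +
        z * (r - n) * Real.sin (n * z)) - z * (r - n - ω / n) * Real.sin (n * z)) : ℝ) : ℂ) := by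
    have e1 : (n : ℝ) * z + z * (r - n) = r * z := by ring
    have hπ' : (π : ℂ) ≠ 0 := by exact_mod_cast hπ.ne'
    rw [cosTerm, hρ, e1, hw]
    push_cast
    field_simp
    ring
  rw [e]
  refine (norm_add_le _ _).trans (add_le_add ?_ ?_)
  · rw [norm_mul, Complex.norm_real]
    exact mul_le_of_le_one_left (norm_nonneg _) (Real.abs_cos_le_one _)
  · rw [Complex.norm_real, Real.norm_eq_abs, abs_mul, abs_of_pos (by positivity : 0 < 2 / π)]
    have h1 := abs_cos_add_sub_le (n * z) (z * (r - n))
    have h2 : |z * (r - n - ω / n) * Real.sin (n * z)| ≤ 2 * π * |r - n - ω / n| := by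
      rw [abs_mul, abs_mul]
      refine (mul_le_of_le_one_right (by positivity) (Real.abs_sin_le_one _)).trans ?_
      gcongr
    have h3 : (z * (r - n)) ^ 2 ≤ (2 * π * (C / n)) ^ 2 := by
      rw [← sq_abs, abs_mul]
      gcongr
    have h4 := (abs_sub (Real.cos (n * z + z * (r - n)) - Real.cos (n * z) +
        z * (r - n) * Real.sin (n * z)) (z * (r - n - ω / n) * Real.sin (n * z)))
    calc _ ≤ 2 / π * (2 * (2 * π * (C / n)) ^ 2 + 2 * π * |r - n - ω / n|) := by
          gcongr; linarith
      _ = _ := by field_simp; ring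

/-- The corrected terms converge absolutely and uniformly; the correction is a multiple of z
`sineSum`, bounded and pointwise convergent, in general not absolutely. -/
theorem exists_bound_tendsto_sum_cosTerm (hq : MemLp q 2 piMeasure)
    (hc : ∀ ρ, IsCauchySolution q h ρ (c ρ)) (hl : IsEigenvalueSequence q h H lam) :
    ∃ M : ℝ, ∀ z : ℝ, |z| ≤ 2 * π →
      (∀ N, ‖∑ n ∈ Finset.range N, cosTerm c lam n z‖ ≤ M) ∧
      ∃ l, Tendsto (fun N => ∑ n ∈ Finset.range N, cosTerm c lam n z) atTop (𝓝 l) := by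
  obtain ⟨ω, u, hu, hbd⟩ := exists_summable_bound_cosTerm hq hc hl
  have hu0 : ∀ n, 0 ≤ u n := fun n => (norm_nonneg _).trans (hbd n 0 (by simp [Real.pi_nonneg]))
  refine ⟨∑' n, u n + |ω| * (2 * π) * (1 + 2 * π), fun z hz => ?_⟩
  have e : ∀ N, ∑ n ∈ Finset.range N, cosTerm c lam n z =
      ∑ n ∈ Finset.range N, (cosTerm c lam n z + ((ω * z * (Real.sin (n * z) / n) : ℝ) : ℂ)) -
      ((ω * z * sineSum N z : ℝ) : ℂ) := fun N => by
    rw [Finset.sum_add_distrib, sineSum, Finset.mul_sum, Complex.ofReal_sum, add_sub_cancel_right]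
  constructor
  · intro N
    rw [e]
    refine (norm_sub_le _ _).trans (add_le_add ?_ ?_)
    · exact (norm_sum_le_of_le _ fun n _ => hbd n z hz).trans
        (hu.sum_le_tsum _ fun n _ => hu0 n)
    · rw [Complex.norm_real, Real.norm_eq_abs, abs_mul, abs_mul]
      have := abs_sineSum_le N hz
      gcongr
  · obtain ⟨l, hl'⟩ := exists_tendsto_sineSum z
    have hs := (Summable.of_norm_bounded hu fun n => hbd n z hz).hasSum.tendsto_sum_nat
    have h1 : Tendsto (fun N => ((ω * z * sineSum N z : ℝ) : ℂ)) atTop (𝓝 ((ω * z * l : ℝ) : ℂ)) :=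
      (Complex.continuous_ofReal.tendsto _).comp (hl'.const_mul (ω * z))
    exact ⟨_, Tendsto.congr (fun N => (e N).symm) (hs.sub h1)⟩

/-- The product formula for cosines reduces two variables to one, with arguments in [-π, 2π]. -/
theorem partialSumF_eq (N : ℕ) (x t : ℝ) : partialSumF c lam N x t =
    (∑ n ∈ Finset.range (N + 1), cosTerm c lam n (x + t) +
      ∑ n ∈ Finset.range (N + 1), cosTerm c lam n (x - t)) / 2 := by
  rw [partialSumF, ← Finset.sum_add_distrib, Finset.sum_div]
  refine Finset.sum_congr rfl fun n _ => ?_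
  rw [cosTerm, cosTerm]
  push_cast
  rw [mul_add, mul_sub, mul_add, mul_sub, Complex.cos_add, Complex.cos_sub, Complex.cos_add,
    Complex.cos_sub]
  ring

/-- The series for `F` converges boundedly. -/
theorem exists_bound_tendsto_partialSumF (hq : MemLp q 2 piMeasure)
    (hc : ∀ ρ, IsCauchySolution q h ρ (c ρ)) (hl : IsEigenvalueSequence q h H lam) :
    ∃ M : ℝ, ∀ x ∈ Icc 0 π, ∀ t ∈ Icc 0 π, (∀ N, ‖partialSumF c lam N x t‖ ≤ M) ∧
      ∃ l, Tendsto (fun N => partialSumF c lam N x t) atTop (𝓝 l) := by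
  obtain ⟨M, hM⟩ := exists_bound_tendsto_sum_cosTerm hq hc hl
  refine ⟨M, fun x hx t ht => ?_⟩
  obtain ⟨b1, l1, h1⟩ := hM (x + t) (abs_le.2 ⟨by linarith [hx.1, ht.1, Real.pi_pos],
    by linarith [hx.2, ht.2]⟩)
  obtain ⟨b2, l2, h2⟩ := hM (x - t) (abs_le.2 ⟨by linarith [hx.1, ht.2, Real.pi_pos],
    by linarith [hx.2, ht.1, Real.pi_pos]⟩)
  simp only [partialSumF_eq]
  refine ⟨fun N => ?_, (l1 + l2) / 2, ?_⟩
  · rw [norm_div, Complex.norm_ofNat, div_le_iff₀ two_pos]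
    refine (norm_add_le _ _).trans ?_
    linarith [b1 (N + 1), b2 (N + 1)]
  · exact ((h1.comp (tendsto_add_atTop_nat 1)).add (h2.comp (tendsto_add_atTop_nat 1))).div_const 2

end SturmLiouville

end

/-! ### The transmutation operator applied to F. -/

section

namespace SturmLiouville

variable {q : ℝ → ℝ} {h H : ℝ} {c : ℂ → ℝ → ℂ} {lam : ℕ → ℝ} {f : ℝ → ℂ} {G K : ℝ → ℝ → ℝ}

theorem continuous_partialSumF_left (N : ℕ) (t : ℝ) :
    Continuous fun s => partialSumF c lam N s t := by
  unfold partialSumF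
  fun_prop

theorem continuous_partialSumG_right (N : ℕ) (x : ℝ) : Continuous (partialSumG c lam N x) := by
  unfold partialSumG
  fun_prop

/-- The transmutation operator maps the partial sums for `F` to minus those for `G`. -/
theorem volterra_partialSumF (hq : MemLp q 2 piMeasure)
    (hc : ∀ ρ, IsCauchySolution q h ρ (c ρ)) (hG : IsTransmutationKernel q h G) (N : ℕ) {x : ℝ}
    (hx : x ∈ Icc 0 π) (t : ℝ) :
    volterra G (fun s => partialSumF c lam N s t) x = -partialSumG c lam N x t := by
  have i1 : ∀ ρ : ℂ, IntervalIntegrable (fun s : ℝ => (G x s : ℂ) * Complex.cos (ρ * s))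
      volume 0 x := fun ρ => intervalIntegrable_kernel_mul hG.1 (by fun_prop) hx
  have e : ∀ n : ℕ, (fun s : ℝ => (G x s : ℂ) *
      (Complex.cos (rho lam n * s) * Complex.cos (rho lam n * t) / weight c lam n -
        Complex.cos (n * s) * Complex.cos (n * t) / weight₀ n)) = fun s : ℝ =>
      Complex.cos (rho lam n * t) / weight c lam n * ((G x s : ℂ) * Complex.cos (rho lam n * s)) -
      Complex.cos (n * t) / weight₀ n * ((G x s : ℂ) * Complex.cos (n * s)) := fun n => by
    funext s; ring
  simp only [volterra, partialSumF, partialSumG, Finset.mul_sum]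
  rw [intervalIntegral.integral_finsetSum fun n _ => by
    rw [e]; exact ((i1 _).const_mul _).sub ((i1 _).const_mul _), ← Finset.sum_add_distrib,
    ← Finset.sum_neg_distrib]
  refine Finset.sum_congr rfl fun n _ => ?_
  rw [e, intervalIntegral.integral_sub ((i1 _).const_mul _) ((i1 _).const_mul _),
    intervalIntegral.integral_const_mul, intervalIntegral.integral_const_mul,
    (hc (rho lam n)).eq_volterra hq hG x hx, (hc n).eq_volterra hq hG x hx, volterra, volterra]
  ring

/-- The operators `volterra G` commute with bounded pointwise limits. -/
theorem tendsto_volterra_of_bounded (hG : ContinuousOn (Function.uncurry G) triangle)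
    {u : ℕ → ℝ → ℂ} {v : ℝ → ℂ} {M : ℝ} (hu : ∀ N, ContinuousOn (u N) (Icc 0 π))
    (hM : ∀ N, ∀ s ∈ Icc 0 π, ‖u N s‖ ≤ M)
    (hv : ∀ s ∈ Icc 0 π, Tendsto (fun N => u N s) atTop (𝓝 (v s))) {x : ℝ} (hx : x ∈ Icc 0 π) :
    Tendsto (fun N => volterra G (u N) x) atTop (𝓝 (volterra G v x)) := by
  obtain ⟨g, hg⟩ := exists_extension_of_continuousOn_triangle hG
  refine (hv x hx).add ?_
  refine intervalIntegral.tendsto_integral_filter_of_dominated_convergence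
    (fun _ => ‖g‖ * M) ?_ ?_ intervalIntegrable_const ?_
  · refine Eventually.of_forall fun N => ?_
    have := (intervalIntegrable_kernel_mul hG (hu N) hx).aestronglyMeasurable
    rwa [uIoc_of_le hx.1]
  · refine Eventually.of_forall fun N => ae_of_all _ fun s hs => ?_
    rw [uIoc_of_le hx.1] at hs
    rw [norm_mul, Complex.norm_real, ← hg x hx s ⟨hs.1.le, hs.2⟩]
    exact mul_le_mul (g.norm_coe_le_norm _) (hM N s ⟨hs.1.le, hs.2.trans hx.2⟩)
      (norm_nonneg _) (norm_nonneg _)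
  · refine ae_of_all _ fun s hs => ?_
    rw [uIoc_of_le hx.1] at hs
    exact (hv s ⟨hs.1.le, hs.2.trans hx.2⟩).const_mul _

/-- The integrals of f against the partial sums for G have two limits: one from the uniform
convergence above, the other by dominated convergence, since these partial sums are minus T of
boundedly convergent partial sums for F. -/
theorem integral_extendZero_sub_eq (hq : MemLp q 2 piMeasure)
    (hc : ∀ ρ, IsCauchySolution q h ρ (c ρ)) (hl : IsEigenvalueSequence q h H lam)
    (hG : IsTransmutationKernel q h G) (hK : IsInverseKernel G K)
    (hf : AbsolutelyContinuousOnInterval f 0 π) {F : ℝ → ℝ → ℂ}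
    (hF : ∀ x ∈ Icc 0 π, ∀ t ∈ Icc 0 π,
      Tendsto (fun N => partialSumF c lam N x t) atTop (𝓝 (F x t))) {x : ℝ} (hx : x ∈ Icc 0 π) :
    ∫ t in (0 : ℝ)..π, f t * ((extendZero G x t : ℂ) - (extendZero K t x : ℂ)) =
      -∫ t in (0 : ℝ)..π, f t * volterra G (fun s => F s t) x := by
  have hfc : ContinuousOn f (Icc 0 π) := by simpa [uIcc_zero_pi] using hf.continuousOn
  obtain ⟨M, hM⟩ := exists_bound_tendsto_partialSumF hq hc hl
  obtain ⟨C, hC, hCb⟩ := exists_volterra_bound hG.1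
  obtain ⟨B, hB⟩ := isCompact_Icc.exists_bound_of_continuousOn hfc
  have t1 := (tendstoUniformlyOn_integral_partialSumG hq hc hl hG hK hf).tendsto_at hx
  rw [← intervalIntegral.integral_neg]
  refine tendsto_nhds_unique t1 ?_
  refine intervalIntegral.tendsto_integral_filter_of_dominated_convergence
    (fun _ => B * (C * M)) ?_ ?_ intervalIntegrable_const ?_
  · refine Eventually.of_forall fun N => ?_
    rw [uIoc_of_le Real.pi_nonneg]
    exact ((hfc.mul (continuous_partialSumG_right N x).continuousOn).mono
      Ioc_subset_Icc_self).aestronglyMeasurable measurableSet_Ioc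
  · refine Eventually.of_forall fun N => ae_of_all _ fun t ht => ?_
    rw [uIoc_of_le Real.pi_nonneg] at ht
    have ht' : t ∈ Icc 0 π := ⟨ht.1.le, ht.2⟩
    rw [norm_mul, ← norm_neg (partialSumG c lam N x t), ← volterra_partialSumF hq hc hG N hx t]
    exact mul_le_mul (hB t ht') (hCb _ M (fun s hs => (hM s hs t ht').1 N) x hx) (norm_nonneg _)
      ((norm_nonneg _).trans (hB t ht'))
  · refine ae_of_all _ fun t ht => ?_
    rw [uIoc_of_le Real.pi_nonneg] at ht
    have ht' : t ∈ Icc 0 π := ⟨ht.1.le, ht.2⟩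
    have := tendsto_volterra_of_bounded hG.1
      (fun N => (continuous_partialSumF_left (c := c) (lam := lam) N t).continuousOn)
      (fun N s hs => (hM s hs t ht').1 N) (fun s hs => hF s hs t ht') hx
    simp only [volterra_partialSumF hq hc hG _ hx t] at this
    simpa only [neg_neg, mul_neg] using (this.neg.const_mul (f t))

end SturmLiouville

end

end

/-! ### The main theorem. -/

theorem theorem1 (q : ℝ → ℝ) (hq : MemLp q 2 (volume.restrict (Ioo 0 Real.pi))) (h H : ℝ) :
    -- the objects exist
    (∀ ρ : ℂ, ∃ y, SturmLiouville.IsCauchySolution q h ρ y) ∧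
    (∃ lam, SturmLiouville.IsEigenvalueSequence q h H lam) ∧
    (∃ G K, SturmLiouville.IsTransmutationKernel q h G ∧ SturmLiouville.IsInverseKernel G K) ∧
    -- and, whatever way they are presented, the kernels have the series representations
    ∀ (c : ℂ → ℝ → ℂ) (lam : ℕ → ℝ) (G K : ℝ → ℝ → ℝ),
      (∀ ρ, SturmLiouville.IsCauchySolution q h ρ (c ρ)) →
      SturmLiouville.IsEigenvalueSequence q h H lam →
      SturmLiouville.IsTransmutationKernel q h G →
      SturmLiouville.IsInverseKernel G K →
      (∃ F : ℝ → ℝ → ℂ,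
        (∀ x ∈ Icc 0 Real.pi, ∀ t ∈ Icc 0 Real.pi,
          Tendsto (fun N => SturmLiouville.partialSumF c lam N x t) atTop (𝓝 (F x t))) ∧
        ∀ f : ℝ → ℂ, AbsolutelyContinuousOnInterval f 0 Real.pi →
          TendstoUniformlyOn
            (fun N x => ∫ t in (0 : ℝ)..Real.pi, f t * SturmLiouville.partialSumG c lam N x t)
            (fun x => ∫ t in (0 : ℝ)..Real.pi, f t *
              ((SturmLiouville.extendZero G x t : ℂ) - (SturmLiouville.extendZero K t x : ℂ)))
            atTop (Icc 0 Real.pi) ∧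
          TendstoUniformlyOn
            (fun N x => ∫ t in (0 : ℝ)..Real.pi, f t * SturmLiouville.partialSumH c lam N t x)
            (fun x => ∫ t in (0 : ℝ)..Real.pi, f t *
              ((SturmLiouville.extendZero K t x : ℂ) - (SturmLiouville.extendZero G x t : ℂ)))
            atTop (Icc 0 Real.pi) ∧
          ∀ x ∈ Icc 0 Real.pi,
            (∫ t in (0 : ℝ)..Real.pi, f t *
              ((SturmLiouville.extendZero G x t : ℂ) - (SturmLiouville.extendZero K t x : ℂ))) =
            -∫ t in (0 : ℝ)..Real.pi, f t *
              (F x t + ∫ s in (0 : ℝ)..x, (G x s : ℂ) * F s t)) ∧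
      ∀ x t : ℝ, x ≠ t →
        SturmLiouville.extendZero G x t = 0 ∨ SturmLiouville.extendZero K t x = 0 := by
  have hq' : MemLp q 2 SturmLiouville.piMeasure := by
    rwa [SturmLiouville.piMeasure, ← Measure.restrict_congr_set Ioo_ae_eq_Ioc]
  refine ⟨SturmLiouville.exists_isCauchySolution hq' h,
    SturmLiouville.exists_isEigenvalueSequence hq' h H, ?_, fun c lam G K hc hl hG hK => ⟨?_, ?_⟩⟩
  · obtain ⟨G, hG⟩ := SturmLiouville.exists_isTransmutationKernel hq' h
    obtain ⟨K, hK⟩ := SturmLiouville.exists_isInverseKernel hG.1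
    exact ⟨G, K, hG, hK⟩
  · obtain ⟨M, hM⟩ := SturmLiouville.exists_bound_tendsto_partialSumF hq' hc hl
    have hF : ∀ x ∈ Icc 0 Real.pi, ∀ t ∈ Icc 0 Real.pi,
        Tendsto (fun N => SturmLiouville.partialSumF c lam N x t) atTop
          (𝓝 (limUnder atTop fun N => SturmLiouville.partialSumF c lam N x t)) :=
      fun x hx t ht => tendsto_nhds_limUnder (hM x hx t ht).2
    exact ⟨_, hF, fun f hf =>
      ⟨SturmLiouville.tendstoUniformlyOn_integral_partialSumG hq' hc hl hG hK hf,
        SturmLiouville.tendstoUniformlyOn_integral_partialSumH hq' hc hl hG hK hf,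
        -- The integrand F + ∫ G F of the statement is `volterra` applied to F in its first
        -- variable, by definition.
        fun x hx => SturmLiouville.integral_extendZero_sub_eq hq' hc hl hG hK hf hF hx⟩⟩
  · intro x t hxt
    rcases hxt.lt_or_gt with hlt | hlt
    · exact Or.inl (if_neg (not_le.2 hlt))
    · exact Or.inr (if_neg (not_le.2 hlt))
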